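/- \textbf{Setting.} Let $T>0$, let $\Omega\subset\mathbb R^d$ be open with $C^1$ boundary and inward unit normal $\nu(x_0)$, $x_0\in\partial\Omega$. Let $N=(N-N')+N'$ and split $u=(u^1,u^2)\in\mathbb R^{N-N'}\times\mathbb R^{N'}$; $M^{\alpha\beta}$ are the corresponding blocks of an $N\times N$ matrix $M$. Let $\mathcal O(t,x)\subset\mathbb R^N$ ($(t,x)\in[-T,T]\times\overline\Omega$) and $\mathcal O^*(t,x_0)\supset\mathcal O(t,x_0)$ ($(t,x_0)\in[-T,T]\times\partial\Omega$) be open sets, and let $\pi\mathcal U$, $\pi\mathcal U_\partial$, $\pi\mathcal U^*$ be the unions of the $\mathcal O(t,x)$ over $[-T,T]\times\overline\Omega$, of the $\mathcal O(t,x_0)$ over $[-T,T]\times\partial\Omega$, and of the $\mathcal O^*(t,x_0)$ over $[-T,T]\times\partial\Omega$. Consider $$A_0(u)u_t+\sum_{j=1}^d A_j(u)\partial_ju-\varepsilon\sum_{j,k=1}^d\partial_j(B_{jk}(u)\partial_ku)=0$$ with real $N\times N$ matrices, $C^\infty$ in $u\in\pi\mathcal U\cup\pi\mathcal U^*$, such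 that $A_0^{12}=0$ and all blocks of $B_{jk}$ other than $B_{jk}^{22}$ vanish. Put $A_\xi=\sum\xi_jA_j$, $B_\xi=\sum\xi_j\xi_kB_{jk}$, $\overline A(u,\xi)=A_0^{-1}A_\xi$, $\overline B(u,\xi)=A_0^{-1}B_\xi$. Assume: (H1) $\det A_0\ne0$ on $\pi\mathcal U\cup\pi\mathcal U^*$. (H2) There is $c>0$ such that for $u\in\pi\mathcal U\cup\pi\mathcal U^*$, $\xi\in\mathbb R^d$, the eigenvalues $\mu$ of $\overline B^{22}(u,\xi)$ satisfy $\operatorname{Re}\mu\ge c|\xi|^2$. (H3) For $u\in\pi\mathcal U\cup\pi\mathcal U^*$, $\xi\ne0$, the eigenvalues of $\overline A^{11}(u,\xi)$ are real. For $u\in\mathcal O^*(t,x_0)$ the eigenvalues of $\overline A^{11}(u,\nu(x_0))$ are all positive or all negative, and the number $N^1_+$ of positive ones is independent of $(t,x_0,u)$. (H4) For $u\in\pi\mathcal U$, $\xi\neq0$, the eigenvalues of $\overline A(u,\xi)$ are real. For $u\in\mathcal O(t,x_0)$, $x_0\in\partial\Omega$, $\det\overline A(u,\nu(x_0))\ne0$,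 and the number $N_+$ of positive eigenvalues of $\overline A(u,\nu(x_0))$ is independent of $(t,x_0,u)$. (H5) There is $c>0$ such that for $u\in\pi\mathcal U$, $\xi\in\mathbb R^d$, the eigenvalues of $i\overline A(u,\xi)+\overline B(u,\xi)$ satisfy $\operatorname{Re}\mu\ge c|\xi|^2/(1+|\xi|^2)$. (H6) $0\le N''\le N'$; the boundary operator is $\Upsilon(u,\partial_Tu^2,\partial_\nu u^2)=(\Upsilon_1(u^1),\Upsilon_2(u^2),K_\nu\partial_\nu u^2+\sum_jK_j(u)V_ju^2)$ with the $V_j$ tangential, $\Upsilon_1,\Upsilon_2,K_j$ smooth (on the states, or projections of states, of $\pi\mathcal U^*$) with values in $\mathbb R^{N^1_+}$, $\mathbb R^{N'-N''}$ and the $N''\times N'$ matrices, $K_\nu$ a constant $N''\times N'$ matrix of rank $N''$, and for $u\in\pi\mathcal U^*$ the Jacobians $\Upsilon_1'(u^1)$, $\Upsilon_2'(u^2)$ have ranks $N^1_+$, $N'-N''$. Put $N_b=N'+N^1_+$. Let $p:[-T,T]\times\partial\Omega\to\mathbb R^N$ be continuous with $p(t,x_0)\in\mathcal O(t,x_0)$,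 and $B=\{(\nu(x_0),p(t,x_0))\}\subset S^{d-1}\times\pi\mathcal U_\partial$. For $\nu\in S^{d-1}$ and states $p,q$ consider smooth $w:[0,\infty)\to\pi\mathcal U^*$ with $$(1)\quad A_\nu(w)\partial_zw-\partial_z(B_\nu(w)\partial_zw)=0\ (z\ge0),\qquad w(z)\to q\ (z\to\infty),$$ $$(2)\quad \Upsilon(w,0,\partial_zw^2)|_{z=0}=(\Upsilon_1(p^1),\Upsilon_2(p^2),0).$$ Such a $w$ is \emph{transversal} if, with $\Gamma_\nu(\dot w,\partial_z\dot w^2)=(\Upsilon_1'(w^1(0))\dot w^1,\Upsilon_2'(w^2(0))\dot w^2,K_\nu\partial_z\dot w^2)|_{z=0}$ and $\dot w$ ranging over smooth $\mathbb C^N$-valued solutions on $[0,\infty)$ of the equation linearized about $w$: (i) no nontrivial $\dot w$ with $(\dot w,\partial_z\dot w^2)\to0$ as $z\to\infty$ satisfies $\Gamma_\nu=0$; (ii) $\Gamma_\nu$ has rank $N_b$ on the space of the $\dot w$ for which $(\dot w,\partial_z\dot w^2)$ has a finite limit. Let $$G_\nu(q)=(B_\nu^{22})^{-1}\big(A_\nu^{22}-A_\nu^{21}(A_\nu^{11})^{-1}A_\nu^{12}\big)(q)$$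 and let $\mathbb E_-(G)\subset\mathbb R^{N'}$ be the generalized eigenspace of $G$ for the eigenvalues with negative real part. \textbf{Proposition.} (a) Let $(\underline\nu,\underline p)\in B$. The constant layer $w\equiv\underline p$ (with $\nu=\underline\nu$) is transversal if and only if (i) the $N_b\times N'$ matrix with block rows $-\Upsilon_1'(\underline p^1)\big((A^{11}_{\underline\nu})^{-1}A^{12}_{\underline\nu}G_{\underline\nu}^{-1}\big)(\underline p)$, $\Upsilon_2'(\underline p^2)G_{\underline\nu}^{-1}(\underline p)$, $K_{\underline\nu}$ is injective on $\mathbb E_-(G_{\underline\nu}(\underline p))$, and (ii) if $N''>0$, $K_{\underline\nu}$ has rank $N''$ on $\mathbb E_-(G_{\underline\nu}(\underline p))$. One can choose, for every $\underline b=(\underline\nu,\underline p)\in B$ satisfying (i) and (ii), a chart $(\omega,\mathcal C,w)=(\omega^{\underline b},\mathcal C^{\underline b},w^{\underline b})$ with the following properties. (b) $\omega\subset S^{d-1}\times\pi\mathcal U_\partial$ is an open neighborhood of $(\underline\nu,\underline p)$ (relative to $S^{d-1}\times\mathbb R^N$). The sets $\mathcal C_{\nu,p}\subset\mathbb R^N$,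 $(\nu,p)\in\omega$, are embedded smooth submanifolds of dimension $N-N_+$ varying smoothly with $(\nu,p)\in\omega$, and $p\in\mathcal C_{\nu,p}$. The maps $w_{\nu,p}:[0,\infty)\times\mathcal C_{\nu,p}\to\pi\mathcal U_\partial$ are smooth, also jointly with $(\nu,p)$. For $q\in\mathcal C_{\nu,p}$, $w_{\nu,p}(\cdot,q)$ satisfies (1) and (2), and for some $C,\delta>0$, uniformly in $(\nu,p)\in\omega$, $q\in\mathcal C_{\nu,p}$, $z\ge0$, $|w_{\nu,p}(z,q)-q|+|\partial_zw^2_{\nu,p}(z,q)|\le Ce^{-\delta z}$. (c) Each chart is locally unique: there is $\varepsilon>0$ such that if $(\nu,p)\in\omega$, $|q-\underline p|<\varepsilon$, and $v$ satisfies (1) and (2) with $|v(z)-q|<\varepsilon$, $|\partial_zv^2(z)|<\varepsilon$ for all $z\ge0$, then $q\in\mathcal C_{\nu,p}$ and $v=w_{\nu,p}(\cdot,q)$. Moreover, if $(\nu,p)$ lies in the charts $\omega^1,\omega^2$ of two base points, then $\mathcal C^1_{\nu,p}$ and $\mathcal C^2_{\nu,p}$ coincide in a neighborhood of $p$, and $w^1_{\nu,p}(\cdot,q)=w^2_{\nu,p}(\cdot,q)$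 for every $q\in\mathcal C^1_{\nu,p}\cap\mathcal C^2_{\nu,p}$. -/

import Mathlib

open Set Filter Topology
open scoped ContDiff Matrix

noncomputable section

namespace BoundaryLayer

/-! ### Linear algebra -/

/-- Entrywise complexification of a real matrix. -/
def cplx {m n : Type*} (M : Matrix m n ℝ) : Matrix m n ℂ := M.map Complex.ofReal

/-- The number of eigenvalues of a real matrix with positive real part, counted with
(algebraic) multiplicity. -/
def numPos {n : Type*} [Fintype n] [DecidableEq n] (M : Matrix n n ℝ) : ℕ :=
  (((cplx M).charpoly.roots).filter fun μ => 0 < μ.re).card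

/-- The real generalized eigenspace of `M` associated to the eigenvalues `μ` with `Re μ < 0`. -/
def stableSubspace {n : Type*} [Fintype n] [DecidableEq n] (M : Matrix n n ℝ) :
    Submodule ℝ (n → ℝ) :=
  ((⨆ μ ∈ {μ : ℂ | μ.re < 0},
      Module.End.maxGenEigenspace (Matrix.toLin' (cplx M)) μ).restrictScalars ℝ).comap
    (Complex.ofRealCLM.toLinearMap.compLeft n)

/-- The Jacobian matrix of `f` at `x`. -/
def jacobian {m n : ℕ} (f : (Fin m → ℝ) → (Fin n → ℝ)) (x : Fin m → ℝ) :
    Matrix (Fin n) (Fin m) ℝ :=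
  LinearMap.toMatrix' (fderiv ℝ f x).toLinearMap

/-! ### Domains -/

/-- `n` is the inward unit normal at `x₀` of a set `Ω` which near `x₀` is
`{ρ > 0}` for a `C¹` function `ρ` with nonvanishing gradient at `x₀`. -/
def IsInwardUnitNormal {d : ℕ} (Ω : Set (EuclideanSpace ℝ (Fin d)))
    (x₀ n : EuclideanSpace ℝ (Fin d)) : Prop :=
  ∃ ρ : EuclideanSpace ℝ (Fin d) → ℝ, ContDiff ℝ 1 ρ ∧ gradient ρ x₀ ≠ 0 ∧
    (∀ᶠ x in 𝓝 x₀, (x ∈ Ω ↔ 0 < ρ x)) ∧ n = ‖gradient ρ x₀‖⁻¹ • gradient ρ x₀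

/-! ### The hyperbolic-parabolic boundary value problem -/

/-- States `u = (u¹, u²)`, with `u¹` of dimension `n₁ = N - N'` and `u²` of dimension
`n₂ = N'`. -/
abbrev State (n₁ n₂ : ℕ) : Type := Fin n₁ ⊕ Fin n₂ → ℝ

/-- The component `u¹`. -/
def fstPart {n₁ n₂ : ℕ} {R : Type*} (u : Fin n₁ ⊕ Fin n₂ → R) : Fin n₁ → R := fun i => u (Sum.inl i)

/-- The component `u²`. -/
def sndPart {n₁ n₂ : ℕ} {R : Type*} (u : Fin n₁ ⊕ Fin n₂ → R) : Fin n₂ → R := fun i => u (Sum.inr i)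

/-- Data of the problem
`A₀(u) u_t + ∑ A_j(u) ∂_j u - ε ∑ ∂_j (B_jk(u) ∂_k u) = 0` on `[-T, T] × Ω`, with boundary
operators `Υ₁(u¹)`, `Υ₂(u²)`, `Υ₃ = K_ν ∂_ν u² + ∑ K_j(u) V_j u²`.
Hypotheses on the data are in `System.Hypotheses`. -/
structure System (d n₁ n₂ : ℕ) where
  /-- half-length of the time interval -/
  T : ℝ
  /-- the spatial domain -/
  Ω : Set (EuclideanSpace ℝ (Fin d))
  /-- the inward unit normal along `∂Ω` -/
  normal : EuclideanSpace ℝ (Fin d) → EuclideanSpace ℝ (Fin d)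
  /-- sets of hyperbolic states `𝒪(t,x)` -/
  O : ℝ → EuclideanSpace ℝ (Fin d) → Set (State n₁ n₂)
  /-- sets of layer states `𝒪*(t,x₀)` -/
  Ostar : ℝ → EuclideanSpace ℝ (Fin d) → Set (State n₁ n₂)
  A₀ : State n₁ n₂ → Matrix (Fin n₁ ⊕ Fin n₂) (Fin n₁ ⊕ Fin n₂) ℝ
  A : Fin d → State n₁ n₂ → Matrix (Fin n₁ ⊕ Fin n₂) (Fin n₁ ⊕ Fin n₂) ℝ
  B : Fin d → Fin d → State n₁ n₂ → Matrix (Fin n₁ ⊕ Fin n₂) (Fin n₁ ⊕ Fin n₂) ℝ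
  /-- `N₊`, the number of positive eigenvalues of the normal matrix `Ā_ν` -/
  Nplus : ℕ
  /-- `N¹₊`, the number of positive eigenvalues of `Ā¹¹_ν` -/
  N1plus : ℕ
  /-- `N''`, the number of Neumann-type boundary conditions -/
  N'' : ℕ
  Υ₁ : (Fin n₁ → ℝ) → (Fin N1plus → ℝ)
  Υ₂ : (Fin n₂ → ℝ) → (Fin (n₂ - N'') → ℝ)
  /-- the constant matrix `K_ν` -/
  K : Matrix (Fin N'') (Fin n₂) ℝ
  /-- the number of tangential vector fields `V_j` in `Υ₃` -/
  numTan : ℕ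
  /-- the coefficients `K_j(u)` of the tangential derivatives `V_j u²` -/
  Ktan : Fin numTan → State n₁ n₂ → Matrix (Fin N'') (Fin n₂) ℝ

namespace System

variable {d n₁ n₂ : ℕ} (S : System d n₁ n₂)

/-- `π𝒰`. -/
def hypStates : Set (State n₁ n₂) :=
  {u | ∃ t ∈ Icc (-S.T) S.T, ∃ x ∈ closure S.Ω, u ∈ S.O t x}

/-- `π𝒰_∂`. -/
def bdryStates : Set (State n₁ n₂) :=
  {u | ∃ t ∈ Icc (-S.T) S.T, ∃ x ∈ frontier S.Ω, u ∈ S.O t x}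

/-- `π𝒰*`. -/
def layerStates : Set (State n₁ n₂) :=
  {u | ∃ t ∈ Icc (-S.T) S.T, ∃ x ∈ frontier S.Ω, u ∈ S.Ostar t x}

/-- `A_ξ(u) = ∑ ξ_j A_j(u)`. -/
def symA (ξ : EuclideanSpace ℝ (Fin d)) (u : State n₁ n₂) :
    Matrix (Fin n₁ ⊕ Fin n₂) (Fin n₁ ⊕ Fin n₂) ℝ :=
  ∑ j, ξ j • S.A j u

/-- `B_ξ(u) = ∑ ξ_j ξ_k B_jk(u)`. -/
def symB (ξ : EuclideanSpace ℝ (Fin d)) (u : State n₁ n₂) :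
    Matrix (Fin n₁ ⊕ Fin n₂) (Fin n₁ ⊕ Fin n₂) ℝ :=
  ∑ j, ∑ k, (ξ j * ξ k) • S.B j k u

/-- `Ā(u, ξ) = A₀(u)⁻¹ A_ξ(u)`. -/
def Abar (ξ : EuclideanSpace ℝ (Fin d)) (u : State n₁ n₂) :
    Matrix (Fin n₁ ⊕ Fin n₂) (Fin n₁ ⊕ Fin n₂) ℝ :=
  (S.A₀ u)⁻¹ * S.symA ξ u

/-- `B̄(u, ξ) = A₀(u)⁻¹ B_ξ(u)`. -/
def Bbar (ξ : EuclideanSpace ℝ (Fin d)) (u : State n₁ n₂) :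
    Matrix (Fin n₁ ⊕ Fin n₂) (Fin n₁ ⊕ Fin n₂) ℝ :=
  (S.A₀ u)⁻¹ * S.symB ξ u

/-- The structural assumptions on the domain, the equations and the boundary conditions.
Nothing is required here about multiplicities or semisimplicity of the real eigenvalues of
`Ā¹¹(u, ξ)` and `Ā(u, ξ)`. -/
structure Hypotheses : Prop where
  T_pos : 0 < S.T
  isOpen_Ω : IsOpen S.Ω
  normal_spec : ∀ x₀ ∈ frontier S.Ω, IsInwardUnitNormal S.Ω x₀ (S.normal x₀)
  isOpen_O : ∀ t ∈ Icc (-S.T) S.T, ∀ x ∈ closure S.Ω, IsOpen (S.O t x)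
  isOpen_Ostar : ∀ t ∈ Icc (-S.T) S.T, ∀ x ∈ frontier S.Ω, IsOpen (S.Ostar t x)
  O_subset_Ostar : ∀ t ∈ Icc (-S.T) S.T, ∀ x ∈ frontier S.Ω, S.O t x ⊆ S.Ostar t x
  -- block structure
  A₀_block : ∀ u ∈ S.hypStates ∪ S.layerStates, (S.A₀ u).toBlocks₁₂ = 0
  B_block : ∀ j k, ∀ u ∈ S.hypStates ∪ S.layerStates,
    (S.B j k u).toBlocks₁₁ = 0 ∧ (S.B j k u).toBlocks₁₂ = 0 ∧ (S.B j k u).toBlocks₂₁ = 0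
  -- smooth coefficients, invertible `A₀`
  smooth_A₀ : ∀ i l, ContDiffOn ℝ ∞ (fun u => S.A₀ u i l) (S.hypStates ∪ S.layerStates)
  smooth_A : ∀ j i l, ContDiffOn ℝ ∞ (fun u => S.A j u i l) (S.hypStates ∪ S.layerStates)
  smooth_B : ∀ j k i l, ContDiffOn ℝ ∞ (fun u => S.B j k u i l) (S.hypStates ∪ S.layerStates)
  det_A₀ : ∀ u ∈ S.hypStates ∪ S.layerStates, (S.A₀ u).det ≠ 0
  -- parabolicity in `u²`
  parabolic : ∃ c : ℝ, 0 < c ∧ ∀ u ∈ S.hypStates ∪ S.layerStates,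
    ∀ ξ : EuclideanSpace ℝ (Fin d), ∀ μ ∈ spectrum ℂ (cplx (S.Bbar ξ u).toBlocks₂₂),
      c * ‖ξ‖ ^ 2 ≤ μ.re
  -- hyperbolicity in `u¹`, with noncharacteristic boundary (totally incoming or outgoing)
  real_A11 : ∀ u ∈ S.hypStates ∪ S.layerStates, ∀ ξ : EuclideanSpace ℝ (Fin d), ξ ≠ 0 →
    ∀ μ ∈ spectrum ℂ (cplx (S.Abar ξ u).toBlocks₁₁), μ.im = 0
  sign_A11 : ∀ t ∈ Icc (-S.T) S.T, ∀ x ∈ frontier S.Ω, ∀ u ∈ S.Ostar t x,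
    (∀ μ ∈ spectrum ℂ (cplx (S.Abar (S.normal x) u).toBlocks₁₁), 0 < μ.re) ∨
    (∀ μ ∈ spectrum ℂ (cplx (S.Abar (S.normal x) u).toBlocks₁₁), μ.re < 0)
  N1plus_spec : ∀ t ∈ Icc (-S.T) S.T, ∀ x ∈ frontier S.Ω, ∀ u ∈ S.Ostar t x,
    numPos (S.Abar (S.normal x) u).toBlocks₁₁ = S.N1plus
  -- hyperbolicity of the inviscid problem, with noncharacteristic boundary
  real_A : ∀ u ∈ S.hypStates, ∀ ξ : EuclideanSpace ℝ (Fin d), ξ ≠ 0 →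
    ∀ μ ∈ spectrum ℂ (cplx (S.Abar ξ u)), μ.im = 0
  det_A : ∀ t ∈ Icc (-S.T) S.T, ∀ x ∈ frontier S.Ω, ∀ u ∈ S.O t x,
    (S.Abar (S.normal x) u).det ≠ 0
  Nplus_spec : ∀ t ∈ Icc (-S.T) S.T, ∀ x ∈ frontier S.Ω, ∀ u ∈ S.O t x,
    numPos (S.Abar (S.normal x) u) = S.Nplus
  -- dissipativity
  dissipative : ∃ c : ℝ, 0 < c ∧ ∀ u ∈ S.hypStates, ∀ ξ : EuclideanSpace ℝ (Fin d),
    ∀ μ ∈ spectrum ℂ (Complex.I • cplx (S.Abar ξ u) + cplx (S.Bbar ξ u)),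
      c * (‖ξ‖ ^ 2 / (1 + ‖ξ‖ ^ 2)) ≤ μ.re
  -- boundary operators
  N''_le : S.N'' ≤ n₂
  smooth_Υ₁ : ContDiffOn ℝ ∞ S.Υ₁ (fstPart '' S.layerStates)
  smooth_Υ₂ : ContDiffOn ℝ ∞ S.Υ₂ (sndPart '' S.layerStates)
  smooth_Ktan : ∀ j i l, ContDiffOn ℝ ∞ (fun u => S.Ktan j u i l) S.layerStates
  rank_K : S.K.rank = S.N''
  rank_Υ₁ : ∀ u ∈ S.layerStates, (jacobian S.Υ₁ (fstPart u)).rank = S.N1plus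
  rank_Υ₂ : ∀ u ∈ S.layerStates, (jacobian S.Υ₂ (sndPart u)).rank = n₂ - S.N''

/-! ### Profiles -/

/-- Indices of the `N_b = N¹₊ + (N' - N'') + N''` scalar boundary conditions. -/
abbrev BIndex : Type := Fin S.N1plus ⊕ (Fin (n₂ - S.N'') ⊕ Fin S.N'')

/-- The boundary operator `Υ(u, ∂_T u², ∂_ν u²) = (Υ₁(u¹), Υ₂(u²), Υ₃)`, where `τ j` stands
for the tangential derivative `V_j u²` and `y` for `∂_ν u²`. -/
def Υ (u : State n₁ n₂) (τ : Fin S.numTan → Fin n₂ → ℝ) (y : Fin n₂ → ℝ) : S.BIndex → ℝ :=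
  Sum.elim (S.Υ₁ (fstPart u))
    (Sum.elim (S.Υ₂ (sndPart u)) (S.K *ᵥ y + ∑ j, S.Ktan j u *ᵥ τ j))

/-- The derivative of a function of `z ∈ [0, ∞)`, one-sided at `0`. -/
def dz {F : Type*} [NormedAddCommGroup F] [NormedSpace ℝ F] (w : ℝ → F) (z : ℝ) : F :=
  derivWithin w (Ici 0) z

/-- `w` is a smooth solution on `[0, ∞)`, with values in `π𝒰*`, of
`A_ν(w) ∂_z w - ∂_z (B_ν(w) ∂_z w) = 0`, `w(z) → q` as `z → ∞`. -/
structure IsProfile (ν : EuclideanSpace ℝ (Fin d)) (q : State n₁ n₂)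
    (w : ℝ → State n₁ n₂) : Prop where
  smooth : ContDiffOn ℝ ∞ w (Ici 0)
  mem : ∀ z, 0 ≤ z → w z ∈ S.layerStates
  eqn : ∀ z, 0 ≤ z →
    S.symA ν (w z) *ᵥ dz w z - dz (fun s => S.symB ν (w s) *ᵥ dz w s) z = 0
  limit : Tendsto w atTop (𝓝 q)

/-- `Υ(w, 0, ∂_z w²)(0) = (Υ₁(p¹), Υ₂(p²), 0)`. -/
def SatisfiesBC (p : State n₁ n₂) (w : ℝ → State n₁ n₂) : Prop :=
  S.Υ (w 0) 0 (sndPart (dz w 0)) = Sum.elim (S.Υ₁ (fstPart p)) (Sum.elim (S.Υ₂ (sndPart p)) 0)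

/-! ### Linearization and transversality -/

/-- The derivative of the matrix function `M` at `u`, applied to a complex direction `h`. -/
def dMat (M : State n₁ n₂ → Matrix (Fin n₁ ⊕ Fin n₂) (Fin n₁ ⊕ Fin n₂) ℝ) (u : State n₁ n₂)
    (h : Fin n₁ ⊕ Fin n₂ → ℂ) : Matrix (Fin n₁ ⊕ Fin n₂) (Fin n₁ ⊕ Fin n₂) ℂ :=
  Matrix.of fun i l =>
    ∑ k, h k * ((fderiv ℝ (fun v => M v i l) u (Pi.single k 1) : ℝ) : ℂ)

/-- `h` is a (smooth, complex-valued) solution on `[0, ∞)` of the profile equation linearized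
about `w`. -/
def IsLinearizedSolution (ν : EuclideanSpace ℝ (Fin d)) (w : ℝ → State n₁ n₂)
    (h : ℝ → Fin n₁ ⊕ Fin n₂ → ℂ) : Prop :=
  ContDiffOn ℝ ∞ h (Ici 0) ∧ ∀ z, 0 ≤ z →
    cplx (S.symA ν (w z)) *ᵥ dz h z
        + dMat (S.symA ν) (w z) (h z) *ᵥ (fun k => (dz w z k : ℂ))
      - dz (fun s => cplx (S.symB ν (w s)) *ᵥ dz h s
            + dMat (S.symB ν) (w s) (h s) *ᵥ (fun k => (dz w s k : ℂ))) z = 0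

/-- The linearized boundary operator
`Γ_ν(h, ∂_z h²) = (Υ₁'(w¹(0)) h¹, Υ₂'(w²(0)) h², K_ν ∂_z h²)` at `z = 0`. -/
def Γ (w : ℝ → State n₁ n₂) (h : ℝ → Fin n₁ ⊕ Fin n₂ → ℂ) : S.BIndex → ℂ :=
  Sum.elim (cplx (jacobian S.Υ₁ (fstPart (w 0))) *ᵥ fstPart (h 0))
    (Sum.elim (cplx (jacobian S.Υ₂ (sndPart (w 0))) *ᵥ sndPart (h 0))
      (cplx S.K *ᵥ sndPart (dz h 0)))

/-- The profile `w` is transversal: (i) no nontrivial linearized solution for which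
`(h, ∂_z h²)` decays to `0` satisfies the linearized boundary conditions, and (ii) `Γ_ν` maps the
space of linearized solutions for which `(h, ∂_z h²)` has a finite limit onto `ℂ^{N_b}`, i.e. has
rank `N_b` there. -/
def IsTransversal (ν : EuclideanSpace ℝ (Fin d)) (w : ℝ → State n₁ n₂) : Prop :=
  (∀ h, S.IsLinearizedSolution ν w h →
      Tendsto (fun z => (h z, sndPart (dz h z))) atTop (𝓝 0) →
      S.Γ w h = 0 → ∀ z, 0 ≤ z → h z = 0) ∧
  (∀ y : S.BIndex → ℂ, ∃ h, S.IsLinearizedSolution ν w h ∧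
      (∃ l, Tendsto (fun z => (h z, sndPart (dz h z))) atTop (𝓝 l)) ∧ S.Γ w h = y)

/-! ### The algebraic condition -/

/-- `G_ν(q) = (B²²_ν)⁻¹ (A²²_ν - A²¹_ν (A¹¹_ν)⁻¹ A¹²_ν)(q)`. -/
def G (ν : EuclideanSpace ℝ (Fin d)) (q : State n₁ n₂) : Matrix (Fin n₂) (Fin n₂) ℝ :=
  (S.symB ν q).toBlocks₂₂⁻¹ * ((S.symA ν q).toBlocks₂₂
    - (S.symA ν q).toBlocks₂₁ * (S.symA ν q).toBlocks₁₁⁻¹ * (S.symA ν q).toBlocks₁₂)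

/-- The `N_b × N'` matrix with block rows `Υ₁'(p¹) (-(A¹¹_ν)⁻¹ A¹²_ν G_ν⁻¹)(p)`,
`Υ₂'(p²) G_ν⁻¹(p)`, `K_ν`. -/
def thirdColumn (ν : EuclideanSpace ℝ (Fin d)) (p : State n₁ n₂) :
    Matrix S.BIndex (Fin n₂) ℝ :=
  Matrix.fromRows
    (jacobian S.Υ₁ (fstPart p) *
      (-((S.symA ν p).toBlocks₁₁⁻¹ * (S.symA ν p).toBlocks₁₂ * (S.G ν p)⁻¹)))
    (Matrix.fromRows (jacobian S.Υ₂ (sndPart p) * (S.G ν p)⁻¹) S.K)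

/-- (i) the third column is injective on `𝔼₋(G_ν(p))`; (ii) if `N'' > 0`, then `K_ν` has full
rank `N''` on `𝔼₋(G_ν(p))`. -/
def LayerCondition (ν : EuclideanSpace ℝ (Fin d)) (p : State n₁ n₂) : Prop :=
  Set.InjOn (fun a => S.thirdColumn ν p *ᵥ a) (stableSubspace (S.G ν p)) ∧
  (0 < S.N'' →
    Module.finrank ℝ ((stableSubspace (S.G ν p)).map (Matrix.toLin' S.K)) = S.N'')

/-- The set `{(ν(x₀), p(t, x₀)) : (t, x₀) ∈ [-T, T] × ∂Ω}` of base points. -/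
def basePoints (p : ℝ → EuclideanSpace ℝ (Fin d) → State n₁ n₂) :
    Set (EuclideanSpace ℝ (Fin d) × State n₁ n₂) :=
  {b | ∃ t ∈ Icc (-S.T) S.T, ∃ x ∈ frontier S.Ω, b = (S.normal x, p t x)}

end System

/-! ### Endstate manifolds -/

/-- The sets `C b ⊆ F`, `b ∈ Om`, are `m`-dimensional embedded `C^∞` submanifolds of `F`, varying
smoothly with `b`: they are parametrized by maps `Q b` on an open set `V ⊆ ℝᵐ`, with
`Q` smooth in `(b, y)`, each `Q b` an immersion, and `(b, y) ↦ (b, Q b y)` a topological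
embedding. -/
def IsSmoothFamily {P F : Type*} [NormedAddCommGroup P] [NormedSpace ℝ P]
    [NormedAddCommGroup F] [NormedSpace ℝ F] (m : ℕ) (Om : Set P) (C : P → Set F) : Prop :=
  ∃ (V : Set (Fin m → ℝ)) (Q : P → (Fin m → ℝ) → F), IsOpen V ∧
    ContDiffOn ℝ ∞ (fun x : P × (Fin m → ℝ) => Q x.1 x.2) (Om ×ˢ V) ∧
    (∀ b ∈ Om, ∀ y ∈ V, Function.Injective (fderiv ℝ (Q b) y)) ∧
    IsEmbedding ((Om ×ˢ V).domRestrict fun x : P × (Fin m → ℝ) => (x.1, Q x.1 x.2)) ∧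
    ∀ b ∈ Om, C b = Q b '' V

/-- `(Om, C, w)` is a family of endstate manifolds `C (ν, p)` and profiles `w (ν, p) · q`,
`q ∈ C (ν, p)`, over a neighbourhood `Om` of the base point `b₀` in `S^{d-1} × π𝒰_∂`. -/
structure IsEndstateChart {d n₁ n₂ : ℕ} (S : System d n₁ n₂)
    (b₀ : EuclideanSpace ℝ (Fin d) × State n₁ n₂)
    (Om : Set (EuclideanSpace ℝ (Fin d) × State n₁ n₂))
    (C : EuclideanSpace ℝ (Fin d) × State n₁ n₂ → Set (State n₁ n₂))
    (w : EuclideanSpace ℝ (Fin d) × State n₁ n₂ → ℝ → State n₁ n₂ → State n₁ n₂) : Prop where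
  base_mem : b₀ ∈ Om
  subset : Om ⊆ Metric.sphere 0 1 ×ˢ S.bdryStates
  relOpen : ∃ U, IsOpen U ∧ Om = U ∩ (Metric.sphere 0 1 ×ˢ univ)
  /-- the `C (ν, p)` are smoothly varying manifolds of dimension `N - N₊` -/
  manifold : IsSmoothFamily (n₁ + n₂ - S.Nplus) Om C
  /-- `p` itself is an endstate -/
  mem : ∀ b ∈ Om, b.2 ∈ C b
  /-- the profiles are smooth in `(z, q)`, and in `(ν, p)` -/
  smooth : ContDiffOn ℝ ∞
    (fun x : ℝ × (EuclideanSpace ℝ (Fin d) × State n₁ n₂) × State n₁ n₂ => w x.2.1 x.1 x.2.2)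
    {x | 0 ≤ x.1 ∧ x.2.1 ∈ Om ∧ x.2.2 ∈ C x.2.1}
  values : ∀ b ∈ Om, ∀ q ∈ C b, ∀ z, 0 ≤ z → w b z q ∈ S.bdryStates
  profile : ∀ b ∈ Om, ∀ q ∈ C b, S.IsProfile b.1 q (fun z => w b z q)
  bc : ∀ b ∈ Om, ∀ q ∈ C b, S.SatisfiesBC b.2 (fun z => w b z q)
  /-- exponential convergence, uniformly on the chart -/
  decay : ∃ c δ : ℝ, 0 < δ ∧ ∀ b ∈ Om, ∀ q ∈ C b, ∀ z, 0 ≤ z →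
    ‖w b z q - q‖ + ‖sndPart (System.dz (fun s => w b s q) z)‖ ≤ c * Real.exp (-δ * z)
  /-- local uniqueness: every small-amplitude profile with endstate near the base point
  is one of the given profiles -/
  unique : ∃ ε : ℝ, 0 < ε ∧ ∀ b ∈ Om, ∀ (q : State n₁ n₂) (v : ℝ → State n₁ n₂),
    S.IsProfile b.1 q v → S.SatisfiesBC b.2 v → ‖q - b₀.2‖ < ε →
    (∀ z, 0 ≤ z → ‖v z - q‖ < ε ∧ ‖sndPart (System.dz v z)‖ < ε) →
    q ∈ C b ∧ ∀ z, 0 ≤ z → v z = w b z q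

end BoundaryLayer

end

noncomputable section

set_option linter.unusedSectionVars false

namespace BoundaryLayer

section

/-! ### Stable subspaces of real matrices -/

section StableSubspace

variable {n : Type*} [Fintype n] [DecidableEq n]

/-! Since only the lower right block of `B_ν` is nonzero, the first block row of the profile
equation has no second derivatives, and where `A¹¹_ν` is invertible it expresses `∂_z w¹` through
`∂_z w²`. With the normalized flux `y = B₀⁻¹ B²²_ν(w) ∂_z w²` as a second unknown, profiles solve a
first order system `(w, y)' = f(ν, w) y`. Every `(q, 0)` is a rest point, so there is an
`N`-dimensional manifold of equilibria, and at the base point the linearization in the `y` direction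
is `G`.

Part (a) is linear algebra. About a constant state all linearized solutions are `l + R G⁻¹ e^{zG}
a`, where `R` denotes `slopeMat` (`IsConstLinearized.eq_constSol`), and `(h, ∂_z h²)` has a limit
precisely when `a` lies in `𝔼₋(G)`. Decaying solutions have `l = 0`, and `Γ` acts on them by the
matrix of condition (i). For surjectivity, `l` alone already fills the rows of `Υ₁` and `Υ₂`, whose
Jacobians are onto; what remains is that `K` be onto on `𝔼₋(G)`, which is (ii).

Two facts about `G` are extracted from the hypotheses in `isHyperbolicPoint`. First, `G` has no
purely imaginary eigenvalue: a nonzero one, `is`, would produce a kernel vector of `iξĀ + ξ²B̄` at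
`ξ = s`, against dissipativity, and the eigenvalue `0` would make `Ā_ν` singular. Secondly, `dim
𝔼₋(G) + N₊ = N¹₊ + N'`. This is a homotopy argument (`stableCount_reduced_add`): for `λ > 0` the
modes `e^{λt + κz}` of the viscous problem linearized about the constant state never have `Re κ =
0`, by dissipativity, so the number with `Re κ < 0` is independent of `λ`. As `λ → 0` the modes
split into fast ones, governed by `G`, and slow ones, governed by `-Ā_ν`; as `λ → ∞` they split into
`N¹₊` stable hyperbolic modes and one of each pair of the `2N'` parabolic modes. Counting both ways
gives the formula.

For (b), `exists_stableFamily` is a stable manifold theorem for the manifold of equilibria, with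
parameters. After multiplying `v - (q, 0)` by `e^{δz}` the neutral equilibrium directions become
unstable, the linear part has an exponential dichotomy, and the implicit function theorem in the
space of bounded continuous functions gives all small profiles as a smooth family in `(ν, q, a)`, `a
∈ 𝔼₋(G)`. Smoothness up to `z = 0` and jointly in `z` comes from a dilation parameter and a time
shift. An a priori estimate (`Dichotomy.norm_le_of_perturbation`) shows that small profiles
automatically decay exponentially, so the family is complete.

The boundary conditions become `N_b` equations in `(ν, p, q, a)`, solved by `(ν, p, p, 0)`. By (i)
and (ii) their derivative is injective in `a` and surjective in `(q, a)`; hence they determine `a`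
as a function of `q` on a manifold of endstates (`exists_implicit_family`) of dimension `N + dim
𝔼₋(G) - N_b = N - N₊`.

For (c), every chart carries more information than the statement requires (`IsControlledChart`): one
and the same number `r` bounds the amplitudes of its profiles and is a scale on which a profile with
a given endstate is unique. Two overlapping charts are then compared by using uniqueness in the one
with the larger `r`, which gives equality of the profiles at all common endstates and not only near
`p`. -/

/-- The number of eigenvalues of a real matrix with negative real part, counted with algebraic
multiplicity. -/
def stableCount (M : Matrix n n ℝ) : ℕ :=
  (((cplx M).charpoly.roots).filter fun μ => μ.re < 0).card

/-- The complex stable subspace. -/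
def cplxStable (M : Matrix n n ℝ) : Submodule ℂ (n → ℂ) :=
  ⨆ μ ∈ {μ : ℂ | μ.re < 0}, Module.End.maxGenEigenspace (Matrix.toLin' (cplx M)) μ

theorem mem_stableSubspace {M : Matrix n n ℝ} {v : n → ℝ} :
    v ∈ stableSubspace M ↔ (fun i => (v i : ℂ)) ∈ cplxStable M := Iff.rfl

theorem cplx_mulVec_star (M : Matrix n n ℝ) (v : n → ℂ) :
    cplx M *ᵥ star v = star (cplx M *ᵥ v) := by
  ext i
  simp [Matrix.mulVec, dotProduct, cplx]

theorem pow_sub_star (M : Matrix n n ℝ) (μ : ℂ) (k : ℕ) (v : n → ℂ) :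
    ((Matrix.toLin' (cplx M) - algebraMap ℂ _ (star μ)) ^ k) (star v) =
      star (((Matrix.toLin' (cplx M) - algebraMap ℂ _ μ) ^ k) v) := by
  induction k with
  | zero => simp
  | succ k ih =>
    rw [pow_succ', pow_succ', Module.End.mul_apply, Module.End.mul_apply, ih]
    simp [cplx_mulVec_star, Module.algebraMap_end_apply]

/-- A real matrix commutes with conjugation, so conjugation exchanges the generalized eigenspaces of
`μ` and of its conjugate, and the half plane `Re μ < 0` is symmetric. This is what makes the complex
stable space the complexification of the real one. -/
theorem star_mem_cplxStable {M : Matrix n n ℝ} {v : n → ℂ} (hv : v ∈ cplxStable M) :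
    star v ∈ cplxStable M := by
  unfold cplxStable at hv
  induction hv using Submodule.iSup_induction' with
  | mem μ x hx =>
    induction hx using Submodule.iSup_induction' with
    | mem hμ x hx =>
      rw [Module.End.mem_maxGenEigenspace] at hx
      obtain ⟨k, hk⟩ := hx
      refine Submodule.mem_iSup_of_mem (star μ) (Submodule.mem_iSup_of_mem (by simpa using hμ) ?_)
      rw [Module.End.mem_maxGenEigenspace]
      refine ⟨k, ?_⟩
      have := pow_sub_star M μ k x
      simp only [Algebra.algebraMap_eq_smul_one] at this
      rw [this, hk, star_zero]
    | zero => simp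
    | add x y _ _ hx hy => rw [star_add]; exact add_mem hx hy
  | zero => simp
  | add x y _ _ hx hy => rw [star_add]; exact add_mem hx hy

theorem re_mem_stableSubspace {M : Matrix n n ℝ} {v : n → ℂ} (hv : v ∈ cplxStable M) :
    (fun i => (v i).re) ∈ stableSubspace M := by
  rw [mem_stableSubspace]
  have h : (fun i => (((v i).re : ℝ) : ℂ)) = (2⁻¹ : ℂ) • (v + star v) := by
    ext i
    simp [Complex.add_conj]
  rw [h]
  exact Submodule.smul_mem _ _ (add_mem hv (star_mem_cplxStable hv))

theorem im_mem_stableSubspace {M : Matrix n n ℝ} {v : n → ℂ} (hv : v ∈ cplxStable M) :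
    (fun i => (v i).im) ∈ stableSubspace M := by
  have h := re_mem_stableSubspace (Submodule.smul_mem _ (-Complex.I) hv)
  simpa using h

theorem finrank_iSup_of_iSupIndep {K V ι : Type*} [Field K] [AddCommGroup V] [Module K V]
    [FiniteDimensional K V] {f : ι → Submodule K V} (hf : iSupIndep f) (s : Finset ι) :
    Module.finrank K ↥(⨆ i ∈ s, f i) = ∑ i ∈ s, Module.finrank K (f i) := by
  classical
  induction s using Finset.induction_on with
  | empty => simp
  | insert a s ha ih =>
    rw [Finset.sum_insert ha, ← ih, Finset.iSup_insert]
    have hd : Disjoint (f a) (⨆ i ∈ s, f i) := hf.disjoint_biSup (y := (s : Set ι)) (by simpa using ha)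
    have := Submodule.finrank_sup_add_finrank_inf_eq (f a) (⨆ i ∈ s, f i)
    rw [hd.eq_bot, finrank_bot] at this
    simpa using this

/-- Generalized eigenspaces are independent, and each has the algebraic multiplicity of its
eigenvalue as dimension. -/
theorem finrank_cplxStable (M : Matrix n n ℝ) :
    Module.finrank ℂ (cplxStable M) = stableCount M := by
  classical
  set φ := Matrix.toLin' (cplx M) with hφ
  set s := (cplx M).charpoly.roots.toFinset.filter fun μ => μ.re < 0 with hs
  have hch : φ.charpoly = (cplx M).charpoly := by rw [hφ, Matrix.charpoly_toLin']
  have h1 : cplxStable M = ⨆ μ ∈ s, Module.End.maxGenEigenspace φ μ := by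
    refine le_antisymm (iSup₂_le fun μ hμ => ?_) (iSup₂_le fun μ hμ => ?_)
    · by_cases h : μ ∈ s
      · exact le_iSup₂_of_le μ h le_rfl
      · have h0 : Module.finrank ℂ ↥(Module.End.maxGenEigenspace φ μ) = 0 := by
          rw [LinearMap.finrank_maxGenEigenspace_eq, hch, ← Polynomial.count_roots,
            Multiset.count_eq_zero]
          intro h'
          exact h (by simpa [hs] using ⟨by simpa using h', hμ⟩)
        rw [Submodule.finrank_eq_zero] at h0
        rw [← hφ, h0]
        exact bot_le
    · have : μ ∈ {μ : ℂ | μ.re < 0} := (Finset.mem_filter.mp hμ).2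
      exact le_iSup₂_of_le (f := fun (μ : ℂ) (_ : μ ∈ {μ : ℂ | μ.re < 0}) => Module.End.maxGenEigenspace φ μ)
        μ this le_rfl
  rw [h1, finrank_iSup_of_iSupIndep (Module.End.independent_maxGenEigenspace φ), stableCount]
  have h2 := Multiset.toFinset_sum_count_eq ((cplx M).charpoly.roots.filter fun μ => μ.re < 0)
  rw [← h2, Multiset.toFinset_filter]
  refine Finset.sum_congr rfl fun μ hμ => ?_
  rw [LinearMap.finrank_maxGenEigenspace_eq, hch, Multiset.count_filter_of_pos
    (p := fun μ : ℂ => μ.re < 0) (Finset.mem_filter.mp hμ).2, Polynomial.count_roots]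

/-- The map `(x, y) ↦ x + iy` is a real isomorphism from two copies of the real stable space onto
the complex one; real dimensions are then compared. -/
theorem finrank_stableSubspace (M : Matrix n n ℝ) :
    Module.finrank ℝ (stableSubspace M) = stableCount M := by
  let f : (stableSubspace M × stableSubspace M) →ₗ[ℝ] cplxStable M :=
    { toFun := fun x => ⟨(fun i => ((x.1 : n → ℝ) i : ℂ)) +
          Complex.I • (fun i => ((x.2 : n → ℝ) i : ℂ)),
        add_mem (mem_stableSubspace.mp x.1.2) (Submodule.smul_mem _ _ (mem_stableSubspace.mp x.2.2))⟩
      map_add' := fun x y => by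
        ext i; simp; ring
      map_smul' := fun c x => by
        ext i; simp; ring }
  have hf : Function.Bijective f := by
    constructor
    · rw [← LinearMap.ker_eq_bot, LinearMap.ker_eq_bot']
      rintro ⟨x, y⟩ h
      have h' : ∀ i, ((x : n → ℝ) i : ℂ) + Complex.I * ((y : n → ℝ) i : ℂ) = 0 := fun i => by
        have := congrFun (congrArg Subtype.val h) i
        simpa [f] using this
      have hx : x = 0 := by
        ext i; simpa using congrArg Complex.re (h' i)
      have hy : y = 0 := by
        ext i; simpa using congrArg Complex.im (h' i)
      rw [hx, hy]; rfl
    · rintro ⟨v, hv⟩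
      refine ⟨(⟨_, re_mem_stableSubspace hv⟩, ⟨_, im_mem_stableSubspace hv⟩), ?_⟩
      ext i
      simp only [f, LinearMap.coe_mk, AddHom.coe_mk, Pi.add_apply, Pi.smul_apply, smul_eq_mul]
      rw [mul_comm]; exact Complex.re_add_im _
  have h1 := (LinearEquiv.ofBijective f hf).finrank_eq
  rw [Module.finrank_prod, finrank_real_of_complex, finrank_cplxStable] at h1
  omega

/-- The generalized eigenspaces span. Those with `Re μ > 0` belong to `-M` with eigenvalue `-μ`, and
those on the imaginary axis are zero by hypothesis. -/
theorem cplxStable_sup_neg {M : Matrix n n ℝ}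
    (h : ∀ μ ∈ spectrum ℂ (cplx M), μ.re ≠ 0) : cplxStable M ⊔ cplxStable (-M) = ⊤ := by
  rw [eq_top_iff, ← Module.End.iSup_maxGenEigenspace_eq_top (Matrix.toLin' (cplx M))]
  refine iSup_le fun μ => ?_
  rcases lt_trichotomy μ.re 0 with hμ | hμ | hμ
  · exact le_sup_of_le_left (le_iSup₂_of_le
      (f := fun (μ : ℂ) (_ : μ ∈ {μ : ℂ | μ.re < 0}) =>
        Module.End.maxGenEigenspace (Matrix.toLin' (cplx M)) μ) μ hμ le_rfl)
  · have h0 : Module.finrank ℂ ↥(Module.End.maxGenEigenspace (Matrix.toLin' (cplx M)) μ) = 0 := by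
      rw [LinearMap.finrank_maxGenEigenspace_eq, Matrix.charpoly_toLin', ← Polynomial.count_roots,
        Multiset.count_eq_zero]
      intro h'
      exact h μ (Matrix.mem_spectrum_of_isRoot_charpoly (Polynomial.isRoot_of_mem_roots h')) hμ
    rw [Submodule.finrank_eq_zero] at h0
    rw [h0]
    exact bot_le
  · refine le_sup_of_le_right (le_trans ?_ (le_iSup₂_of_le
      (f := fun (μ : ℂ) (_ : μ ∈ {μ : ℂ | μ.re < 0}) =>
        Module.End.maxGenEigenspace (Matrix.toLin' (cplx (-M))) μ) (-μ) (by simpa using hμ) le_rfl))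
    intro v hv
    rw [Module.End.mem_maxGenEigenspace] at hv ⊢
    obtain ⟨k, hk⟩ := hv
    refine ⟨k, ?_⟩
    have h1 : cplx (-M) = -cplx M := by ext i j; simp [cplx]
    have h2 : ((Matrix.toLin' (cplx (-M)) : Module.End ℂ (n → ℂ)) - (-μ) • (1 : Module.End ℂ (n → ℂ)))
        = -((Matrix.toLin' (cplx M) : Module.End ℂ (n → ℂ)) - μ • (1 : Module.End ℂ (n → ℂ))) := by
      rw [h1]
      refine LinearMap.ext fun x => ?_
      simp
      abel
    rw [h2, neg_pow (R := Module.End ℂ (n → ℂ)), Module.End.mul_apply, hk, map_zero]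

theorem stableSubspace_sup_neg {M : Matrix n n ℝ}
    (h : ∀ μ ∈ spectrum ℂ (cplx M), μ.re ≠ 0) : stableSubspace M ⊔ stableSubspace (-M) = ⊤ := by
  rw [eq_top_iff]
  intro v _
  have hv : (fun i => (v i : ℂ)) ∈ cplxStable M ⊔ cplxStable (-M) := by
    rw [cplxStable_sup_neg h]; trivial
  obtain ⟨a, ha, b, hb, hab⟩ := Submodule.mem_sup.mp hv
  refine Submodule.mem_sup.mpr ⟨_, re_mem_stableSubspace ha, _, re_mem_stableSubspace hb, ?_⟩
  ext i
  have := congrArg Complex.re (congrFun hab i)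
  simpa using this

/-- The vectors which are the initial value of an exponentially decaying solution of the complex
equation `c' = M c`. -/
def decaying (M : Matrix n n ℝ) : Submodule ℂ (n → ℂ) where
  carrier := {v | ∃ c : ℝ → n → ℂ, c 0 = v ∧ (∀ t, HasDerivAt c (cplx M *ᵥ c t) t) ∧
    ∃ C β : ℝ, 0 < β ∧ ∀ t, 0 ≤ t → ‖c t‖ ≤ C * Real.exp (-β * t)}
  zero_mem' := ⟨fun _ => 0, rfl, fun t => by simpa using hasDerivAt_const t (0 : n → ℂ),
    0, 1, one_pos, fun t _ => by simp⟩
  add_mem' := by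
    rintro v w ⟨c, hc0, hc, C, β, hβ, hC⟩ ⟨d, hd0, hd, D, γ, hγ, hD⟩
    refine ⟨fun t => c t + d t, by simp [hc0, hd0], fun t => ?_, |C| + |D|, min β γ,
      lt_min hβ hγ, fun t ht => ?_⟩
    · rw [Matrix.mulVec_add]; exact (hc t).add (hd t)
    · have h1 : Real.exp (-β * t) ≤ Real.exp (-min β γ * t) :=
        Real.exp_le_exp.mpr (by nlinarith [min_le_left β γ])
      have h2 : Real.exp (-γ * t) ≤ Real.exp (-min β γ * t) :=
        Real.exp_le_exp.mpr (by nlinarith [min_le_right β γ])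
      calc ‖c t + d t‖ ≤ ‖c t‖ + ‖d t‖ := norm_add_le _ _
        _ ≤ C * Real.exp (-β * t) + D * Real.exp (-γ * t) := add_le_add (hC t ht) (hD t ht)
        _ ≤ |C| * Real.exp (-min β γ * t) + |D| * Real.exp (-min β γ * t) := by
            gcongr <;> exact le_abs_self _
        _ = _ := by ring
  smul_mem' := by
    rintro a v ⟨c, hc0, hc, C, β, hβ, hC⟩
    refine ⟨fun t => a • c t, by simp [hc0], fun t => ?_, ‖a‖ * C, β, hβ, fun t ht => ?_⟩
    · rw [Matrix.mulVec_smul]; exact (hc t).const_smul a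
    · rw [norm_smul, mul_assoc]; gcongr; exact hC t ht

/-- Once `N ^ k` annihilates `v`, the two truncations of `e^{tN} v` coincide, and the identity
becomes the differential equation. -/
theorem hasDerivAt_sum_pow (N : Matrix n n ℂ) (v : n → ℂ) (k : ℕ) (t : ℝ) :
    HasDerivAt (fun t : ℝ => ∑ j ∈ Finset.range (k + 1), ((t ^ j / j.factorial : ℝ) : ℂ) • ((N ^ j) *ᵥ v))
      (N *ᵥ ∑ j ∈ Finset.range k, ((t ^ j / j.factorial : ℝ) : ℂ) • ((N ^ j) *ᵥ v)) t := by
  simp_rw [Finset.sum_range_succ']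
  rw [Matrix.mulVec_sum]
  have h : ∀ j ∈ Finset.range k, HasDerivAt
      (fun t : ℝ => ((t ^ (j + 1) / (j + 1).factorial : ℝ) : ℂ) • ((N ^ (j + 1)) *ᵥ v))
      (N *ᵥ (((t ^ j / j.factorial : ℝ) : ℂ) • ((N ^ j) *ᵥ v))) t := by
    intro j _
    have h1 : HasDerivAt (fun t : ℝ => (t ^ (j + 1) / (j + 1).factorial : ℝ))
        (t ^ j / j.factorial : ℝ) t := by
      have := (hasDerivAt_pow (j + 1) t).div_const ((j + 1).factorial : ℝ)
      refine this.congr_deriv ?_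
      rw [Nat.factorial_succ]; push_cast; field_simp
    have h2 := (h1.ofReal_comp).smul_const ((N ^ (j + 1)) *ᵥ v)
    refine h2.congr_deriv ?_
    rw [Matrix.mulVec_smul, Matrix.mulVec_mulVec, pow_succ']
  have := (HasDerivAt.fun_sum h).add_const ((((t ^ 0 / Nat.factorial 0 : ℝ) : ℂ) • ((N ^ 0) *ᵥ v)))
  simpa using this

/-- On a generalized eigenvector the solution is `e^{μt}` times a polynomial in `t`, because the
exponential series of `M - μ` terminates. -/
theorem cplxStable_le_decaying (M : Matrix n n ℝ) : cplxStable M ≤ decaying M := by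
  refine iSup₂_le fun μ hμ v hv => ?_
  have hμ : μ.re < 0 := hμ
  rw [Module.End.mem_maxGenEigenspace] at hv
  obtain ⟨k, hk⟩ := hv
  set N : Matrix n n ℂ := cplx M - μ • 1 with hN
  have hNk : (N ^ k) *ᵥ v = 0 := by
    have h1 : Matrix.toLin' (cplx M) - μ • 1 = Matrix.toLin' N := by
      rw [hN, map_sub, map_smul, Matrix.toLin'_one]; rfl
    rw [h1, ← Matrix.toLin'_pow, Matrix.toLin'_apply] at hk
    exact hk
  set p : ℝ → n → ℂ := fun t => ∑ j ∈ Finset.range (k + 1),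
    ((t ^ j / j.factorial : ℝ) : ℂ) • ((N ^ j) *ᵥ v) with hp
  have hp' : ∀ t, HasDerivAt p (N *ᵥ p t) t := by
    intro t
    have := hasDerivAt_sum_pow N v k t
    convert this using 2
    rw [hp]; simp only
    rw [Finset.sum_range_succ, hNk, smul_zero, add_zero]
  refine ⟨fun t => Complex.exp (t * μ) • p t, ?_, fun t => ?_, ?_⟩
  · simp only [hp, Finset.sum_range_succ']
    simp
  · have h1 : HasDerivAt (fun t : ℝ => Complex.exp (t * μ)) (Complex.exp (t * μ) * μ) t := by
      have : HasDerivAt (fun t : ℝ => ((t : ℂ) * μ)) μ t := by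
        simpa using (Complex.ofRealCLM.hasDerivAt (x := t)).mul_const μ
      exact this.cexp
    have := h1.smul (hp' t)
    refine this.congr_deriv ?_
    have hM : cplx M = N + μ • 1 := by rw [hN]; abel
    rw [hM, Matrix.add_mulVec, Matrix.mulVec_smul, Matrix.smul_mulVec, Matrix.one_mulVec]
    simp only [smul_smul]
    congr 2
    ring
  -- Half of the decay rate absorbs the polynomial factor through `t^j / j! ≤ β⁻ʲ e^{βt}`; the other
  -- half remains.
  · set β := -μ.re / 2 with hβ
    have hβ0 : 0 < β := by rw [hβ]; linarith
    refine ⟨∑ j ∈ Finset.range (k + 1), β⁻¹ ^ j * ‖(N ^ j) *ᵥ v‖, β, hβ0, fun t ht => ?_⟩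
    have he : ‖Complex.exp (t * μ)‖ = Real.exp (-β * t) * Real.exp (-β * t) := by
      rw [Complex.norm_exp, ← Real.exp_add]; congr 1; simp [hβ]; ring
    have hb : ‖p t‖ ≤ ∑ j ∈ Finset.range (k + 1), Real.exp (β * t) * (β⁻¹ ^ j * ‖(N ^ j) *ᵥ v‖) := by
      refine norm_sum_le_of_le _ fun j _ => ?_
      rw [norm_smul, Complex.norm_real, ← mul_assoc]
      gcongr
      have h3 := Real.pow_div_factorial_le_exp (β * t) (by positivity) j
      rw [Real.norm_of_nonneg (by positivity)]
      calc t ^ j / j.factorial = (β * t) ^ j / j.factorial * β⁻¹ ^ j := by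
            rw [mul_pow, inv_pow]; field_simp
        _ ≤ _ := by gcongr
    rw [norm_smul, he]
    rw [← Finset.mul_sum] at hb
    calc _ ≤ Real.exp (-β * t) * Real.exp (-β * t) * (Real.exp (β * t) *
          ∑ j ∈ Finset.range (k + 1), β⁻¹ ^ j * ‖(N ^ j) *ᵥ v‖) := by gcongr
      _ = (∑ j ∈ Finset.range (k + 1), β⁻¹ ^ j * ‖(N ^ j) *ᵥ v‖) * Real.exp (-β * t) *
          (Real.exp (-β * t) * Real.exp (β * t)) := by ring
      _ = _ := by rw [← Real.exp_add]; simp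

/-- A vector of the real stable subspace is the initial value of an exponentially decaying
solution. -/
theorem exists_decaying_of_mem_stableSubspace {M : Matrix n n ℝ} {v : n → ℝ}
    (hv : v ∈ stableSubspace M) :
    ∃ c : ℝ → n → ℝ, c 0 = v ∧ (∀ t, HasDerivAt c (M *ᵥ c t) t) ∧
      ∃ C β : ℝ, 0 < β ∧ ∀ t, 0 ≤ t → ‖c t‖ ≤ C * Real.exp (-β * t) := by
  obtain ⟨c, hc0, hc, C, β, hβ, hC⟩ := cplxStable_le_decaying M (mem_stableSubspace.mp hv)
  refine ⟨fun t i => (c t i).re, ?_, fun t => ?_, C, β, hβ, fun t ht => ?_⟩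
  · ext i; simp [hc0]
  · rw [hasDerivAt_pi]
    intro i
    have h1 := (hasDerivAt_pi.mp (hc t)) i
    have h2 := Complex.reCLM.hasFDerivAt.comp_hasDerivAt t h1
    refine h2.congr_deriv ?_
    simp [Matrix.mulVec, dotProduct, cplx]
  · refine le_trans ?_ (hC t ht)
    rw [pi_norm_le_iff_of_nonneg (norm_nonneg _)]
    intro i
    exact (Complex.abs_re_le_norm _).trans (norm_le_pi_norm _ i)

end StableSubspace

end

section

/-! ### Counting eigenvalues along families of matrices -/

section Counting

variable {n : Type*} [Fintype n] [DecidableEq n]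

/-- The eigenvalues of `M`, with algebraic multiplicity, are the `e i`. -/
def IsEigenEnum (M : Matrix n n ℂ) (e : n → ℂ) : Prop :=
  M.charpoly = ∏ i, (Polynomial.X - Polynomial.C (e i))

/-- Listing the eigenvalues by the index set of the matrix makes the spectrum a point of `n → ℂ`, so
that compactness applies and the eigenvalues of two related matrices can be paired index by index.
-/
theorem exists_isEigenEnum (M : Matrix n n ℂ) : ∃ e, IsEigenEnum M e := by
  obtain ⟨l, hl⟩ : ∃ l : List ℂ, (l : Multiset ℂ) = M.charpoly.roots :=
    ⟨_, Multiset.coe_toList _⟩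
  have hcard : l.length = Fintype.card n := by
    rw [← Multiset.coe_card, hl, IsAlgClosed.card_roots_eq_natDegree, Matrix.charpoly_natDegree_eq_dim]
  let σ : n ≃ Fin l.length := (Fintype.equivFin n).trans (finCongr hcard.symm)
  refine ⟨fun i => l.get (σ i), ?_⟩
  rw [IsEigenEnum, Equiv.prod_comp σ fun j => (Polynomial.X - Polynomial.C (l.get j)),
    Finset.prod_eq_multiset_prod]
  change _ = (Multiset.map ((fun a => Polynomial.X - Polynomial.C a) ∘ l.get) _).prod
  rw [← Multiset.map_map, Fin.univ_val_map, List.ofFn_get, hl]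
  exact (IsAlgClosed.splits M.charpoly).eq_prod_roots_of_monic M.charpoly_monic

theorem IsEigenEnum.roots {M : Matrix n n ℂ} {e : n → ℂ} (h : IsEigenEnum M e) :
    M.charpoly.roots = Finset.univ.val.map e := by
  rw [h, Finset.prod_eq_multiset_prod]
  change (Multiset.map ((fun a => Polynomial.X - Polynomial.C a) ∘ e) _).prod.roots = _
  rw [← Multiset.map_map, Polynomial.roots_multiset_prod_X_sub_C]

theorem IsEigenEnum.mem_spectrum {M : Matrix n n ℂ} {e : n → ℂ} (h : IsEigenEnum M e) (i : n) :
    e i ∈ spectrum ℂ M := by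
  refine Matrix.mem_spectrum_of_isRoot_charpoly ?_
  rw [h, Polynomial.IsRoot, Polynomial.eval_prod]
  exact Finset.prod_eq_zero (Finset.mem_univ i) (by simp)

theorem IsEigenEnum.card_filter {M : Matrix n n ℂ} {e : n → ℂ} (h : IsEigenEnum M e)
    (p : ℂ → Prop) [DecidablePred p] :
    (M.charpoly.roots.filter p).card = (Finset.univ.filter fun i => p (e i)).card := by
  rw [h.roots, Multiset.filter_map, Multiset.card_map]
  rfl

/-- The number of nonzero eigenvalues of a real matrix, with algebraic multiplicity. -/
def nonzeroCount (M : Matrix n n ℝ) : ℕ :=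
  (((cplx M).charpoly.roots).filter fun μ => μ ≠ 0).card

theorem norm_le_of_mem_spectrum {M : Matrix n n ℂ} {μ : ℂ} (h : μ ∈ spectrum ℂ M) :
    ‖μ‖ ≤ ∑ i, ∑ j, ‖M i j‖ := by
  have h1 : (algebraMap ℂ (Matrix n n ℂ) μ - M).det = 0 := by
    by_contra h0
    exact h ((Matrix.isUnit_iff_isUnit_det _).mpr (isUnit_iff_ne_zero.mpr h0))
  obtain ⟨v, hv, hMv⟩ := Matrix.exists_mulVec_eq_zero_iff.mpr h1
  rw [Matrix.sub_mulVec, sub_eq_zero, Algebra.algebraMap_eq_smul_one, Matrix.smul_mulVec,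
    Matrix.one_mulVec] at hMv
  have hv0 : 0 < ‖v‖ := norm_pos_iff.mpr hv
  refine le_of_mul_le_mul_right ?_ hv0
  rw [← norm_smul, hMv, pi_norm_le_iff_of_nonneg (by positivity)]
  intro i
  rw [Finset.sum_mul]
  calc ‖(M *ᵥ v) i‖ ≤ ∑ j, ‖M i j‖ * ‖v‖ := by
        refine norm_sum_le_of_le _ fun j _ => ?_
        rw [norm_mul]; gcongr; exact norm_le_pi_norm v j
    _ = (∑ j, ‖M i j‖) * ‖v‖ := by rw [Finset.sum_mul]
    _ ≤ _ := Finset.single_le_sum (f := fun i => (∑ j, ‖M i j‖) * ‖v‖)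
        (fun i _ => by positivity) (Finset.mem_univ i)

/-- Eigenvalues of a convergent sequence of matrices converge along a subsequence. -/
theorem exists_subseq_isEigenEnum {M : ℕ → Matrix n n ℂ} {M' : Matrix n n ℂ}
    (hM : Tendsto M atTop (𝓝 M')) {e : ℕ → n → ℂ} (he : ∀ k, IsEigenEnum (M k) (e k)) :
    ∃ (e' : n → ℂ) (φ : ℕ → ℕ), StrictMono φ ∧ Tendsto (e ∘ φ) atTop (𝓝 e') ∧
      IsEigenEnum M' e' := by
  have hb : Tendsto (fun k => ∑ i, ∑ j, ‖M k i j‖) atTop (𝓝 (∑ i, ∑ j, ‖M' i j‖)) := by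
    refine tendsto_finsetSum _ fun i _ => tendsto_finsetSum _ fun j _ => ?_
    exact ((tendsto_pi_nhds.mp ((tendsto_pi_nhds.mp hM) i)) j).norm
  obtain ⟨R, hR⟩ := hb.isBoundedUnder_le.eventually_le
  rw [eventually_atTop] at hR
  obtain ⟨k₀, hk₀⟩ := hR
  have hbd : ∀ k, e (k + k₀) ∈ Metric.closedBall (0 : n → ℂ) (max R 0) := by
    intro k
    rw [mem_closedBall_zero_iff, pi_norm_le_iff_of_nonneg (le_max_right _ _)]
    intro i
    exact ((norm_le_of_mem_spectrum ((he _).mem_spectrum i)).trans (hk₀ _ (by omega))).trans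
      (le_max_left _ _)
  obtain ⟨e', -, φ, hφ, he'⟩ := (isCompact_closedBall (0 : n → ℂ) (max R 0)).tendsto_subseq hbd
  have hφ' : StrictMono fun k => φ k + k₀ := fun a b h => by simpa using hφ h
  refine ⟨e', fun k => φ k + k₀, hφ', he', ?_⟩
  -- The characteristic polynomials converge at every `x`, both to that of `M'` and to the product
  -- over the limiting eigenvalues.
  refine Polynomial.funext fun x => ?_
  have h1 : Tendsto (fun k => (M (φ k + k₀)).charpoly.eval x) atTop (𝓝 (M'.charpoly.eval x)) := by
    simp only [Matrix.eval_charpoly]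
    have hc : Continuous fun A : Matrix n n ℂ => (Matrix.scalar n x - A).det :=
      Continuous.matrix_det (continuous_const.sub continuous_id)
    exact (hc.tendsto M').comp (hM.comp hφ'.tendsto_atTop)
  have h2 : Tendsto (fun k => (M (φ k + k₀)).charpoly.eval x) atTop
      (𝓝 ((∏ i, (Polynomial.X - Polynomial.C (e' i))).eval x)) := by
    have : ∀ k, (M (φ k + k₀)).charpoly.eval x = ∏ i, (x - e (φ k + k₀) i) := fun k => by
      rw [he (φ k + k₀), Polynomial.eval_prod]; simp
    simp only [this, Polynomial.eval_prod, Polynomial.eval_sub, Polynomial.eval_X, Polynomial.eval_C]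
    exact tendsto_finsetProd _ fun i _ => tendsto_const_nhds.sub ((tendsto_pi_nhds.mp he') i)
  exact tendsto_nhds_unique h1 h2

theorem eventually_re_neg_iff {e : ℕ → ℂ} {e' : ℂ} (h : Tendsto e atTop (𝓝 e')) (h' : e'.re ≠ 0) :
    ∀ᶠ k in atTop, ((e k).re < 0 ↔ e'.re < 0) := by
  have hre : Tendsto (fun k => (e k).re) atTop (𝓝 e'.re) :=
    (Complex.continuous_re.tendsto e').comp h
  rcases lt_or_gt_of_ne h' with h0 | h0
  · filter_upwards [hre.eventually_lt_const h0] with k hk using ⟨fun _ => h0, fun _ => hk⟩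
  · filter_upwards [hre.eventually_const_lt h0] with k hk
    exact ⟨fun h => absurd h hk.not_gt, fun h => absurd h h0.not_gt⟩

/-- Along a subsequence the eigenvalues converge, and no limit lies on the imaginary axis, so no
sign of a real part changes. "Frequently" is all that a subsequence gives and all that is needed to
contradict a sequence of exceptions. -/
theorem frequently_stableCount_eq {M : ℕ → Matrix n n ℝ} {M' : Matrix n n ℝ}
    (hM : Tendsto M atTop (𝓝 M')) (h : ∀ μ ∈ spectrum ℂ (cplx M'), μ.re ≠ 0) :
    ∃ᶠ k in atTop, stableCount (M k) = stableCount M' := by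
  have hM' : Tendsto (fun k => cplx (M k)) atTop (𝓝 (cplx M')) :=
    ((continuous_id.matrix_map Complex.continuous_ofReal).tendsto M').comp hM
  choose e he using fun k => exists_isEigenEnum (cplx (M k))
  obtain ⟨e', φ, hφ, he', hE⟩ := exists_subseq_isEigenEnum hM' he
  have hev : ∀ᶠ k in atTop, ∀ i, (e (φ k) i).re < 0 ↔ (e' i).re < 0 := by
    rw [eventually_all]
    exact fun i => eventually_re_neg_iff ((tendsto_pi_nhds.mp he') i) (h _ (hE.mem_spectrum i))
  refine hφ.tendsto_atTop.frequently (Eventually.frequently ?_)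
  filter_upwards [hev] with k hk
  rw [stableCount, stableCount, (he _).card_filter, hE.card_filter]
  simp [hk]

theorem stableCount_eq_of_isPreconnected {X : Type*} [TopologicalSpace X] [FirstCountableTopology X]
    {s : Set X} (hs : IsPreconnected s) {M : X → Matrix n n ℝ} (hM : ContinuousOn M s)
    (h : ∀ x ∈ s, ∀ μ ∈ spectrum ℂ (cplx (M x)), μ.re ≠ 0) {x y : X} (hx : x ∈ s) (hy : y ∈ s) :
    stableCount (M x) = stableCount (M y) := by
  refine hs.constant (f := fun x => stableCount (M x)) (fun x hx => ?_) hx hy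
  have hev : ∀ᶠ z in 𝓝[s] x, stableCount (M z) = stableCount (M x) := by
    -- Local constancy on `s`: otherwise some sequence tending to `x` within `s` would avoid the
    -- value at `x` throughout.
    by_contra hcon
    rw [not_eventually] at hcon
    obtain ⟨z, hz, hz'⟩ := exists_seq_forall_of_frequently hcon
    obtain ⟨k, hk⟩ := (frequently_stableCount_eq ((hM x hx).tendsto.comp hz) (h x hx)).exists
    exact hz' k hk
  exact (tendsto_const_nhds).congr' (hev.mono fun z hz => hz.symm)

/-- From `M (x - L) = -x (c/x - M)` the determinants give the characteristic polynomial of `L` at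
every `x ≠ 0`. The enumeration by `c / e i` keeps track of which eigenvalue of `L` corresponds to
which eigenvalue of `M`. -/
theorem IsEigenEnum.of_mul_eq {M L : Matrix n n ℂ} {c : ℂ} (hc : c ≠ 0) (h : M * L = c • 1)
    {e : n → ℂ} (he : IsEigenEnum M e) : (∀ i, e i ≠ 0) ∧ IsEigenEnum L fun i => c / e i := by
  have hdet : M.det * L.det = c ^ Fintype.card n := by
    rw [← Matrix.det_mul, h, Matrix.det_smul, Matrix.det_one, mul_one]
  have hev : ∀ x, (Matrix.scalar n x - M).det = ∏ i, (x - e i) := fun x => by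
    rw [← Matrix.eval_charpoly, he, Polynomial.eval_prod]; simp
  have hM0 : M.det ≠ 0 := fun h0 => by
    rw [h0, zero_mul] at hdet
    exact pow_ne_zero _ hc hdet.symm
  have hne : ∀ i, e i ≠ 0 := by
    intro i hi
    have h0 := hev 0
    rw [Finset.prod_eq_zero (Finset.mem_univ i) (by simp [hi])] at h0
    rw [map_zero, zero_sub, Matrix.det_neg] at h0
    exact hM0 ((mul_eq_zero.mp h0).resolve_left (by simp))
  refine ⟨hne, ?_⟩
  refine Polynomial.eq_of_infinite_eval_eq _ _ (Set.Infinite.mono (s := {0}ᶜ) (fun x hx => ?_)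
    (Set.Finite.infinite_compl (Set.finite_singleton 0)))
  have hx : x ≠ 0 := hx
  simp only [Set.mem_ofPred_eq, Matrix.eval_charpoly, Polynomial.eval_prod, Polynomial.eval_sub,
    Polynomial.eval_X, Polynomial.eval_C]
  have h1 : M * (Matrix.scalar n x - L) = (-x) • (Matrix.scalar n (c / x) - M) := by
    rw [mul_sub, h, smul_sub]
    ext i j
    simp only [Matrix.sub_apply, Matrix.smul_apply, Matrix.scalar_apply, Matrix.mul_diagonal,
      Matrix.diagonal_apply, Matrix.one_apply, smul_eq_mul]
    split_ifs
    · field_simp; ring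
    · ring
  have h2 := congrArg Matrix.det h1
  rw [Matrix.det_mul, Matrix.det_smul, hev] at h2
  have h3 : M.det = (-1) ^ Fintype.card n * ∏ i, (-e i) := by
    have := hev 0
    rw [map_zero, zero_sub, Matrix.det_neg] at this
    simp only [zero_sub] at this
    rw [← this, ← mul_assoc, ← mul_pow]; simp
  refine mul_left_cancel₀ hM0 ?_
  rw [h2, h3, ← Finset.card_univ, ← Finset.prod_const, ← Finset.prod_const, ← Finset.prod_mul_distrib,
    ← Finset.prod_mul_distrib, ← Finset.prod_mul_distrib]
  refine Finset.prod_congr rfl fun i _ => ?_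
  have := hne i
  field_simp
  ring

theorem cplx_mul {l m k : Type*} [Fintype m] (M : Matrix l m ℝ) (N : Matrix m k ℝ) :
    cplx (M * N) = cplx M * cplx N := by
  ext i j; simp [cplx, Matrix.mul_apply]

theorem cplx_smul_one (c : ℝ) : cplx (c • (1 : Matrix n n ℝ)) = (c : ℂ) • 1 := by
  ext i j
  by_cases hij : i = j <;> simp [cplx, hij]

theorem cplx_mul_eq {M L : Matrix n n ℝ} {c : ℝ} (h : M * L = c • 1) :
    cplx M * cplx L = (c : ℂ) • 1 := by
  rw [← cplx_mul, h, cplx_smul_one]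

theorem re_ofReal_div_neg_iff {c : ℝ} (hc : 0 < c) {z : ℂ} (hz : z ≠ 0) :
    ((c : ℂ) / z).re < 0 ↔ z.re < 0 := by
  have h0 : 0 < Complex.normSq z := Complex.normSq_pos.mpr hz
  rw [Complex.div_re]
  simp only [Complex.ofReal_re, Complex.ofReal_im, zero_mul, zero_div, add_zero]
  rw [div_neg_iff]
  constructor
  · rintro (⟨h1, h2⟩ | ⟨h1, h2⟩)
    · linarith
    · exact (pos_iff_neg_of_mul_neg h1).mp hc
  · intro h
    exact Or.inr ⟨mul_neg_of_pos_of_neg hc h, h0⟩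

theorem stableCount_eq_of_mul_eq {M L : Matrix n n ℝ} {c : ℝ} (hc : 0 < c) (h : M * L = c • 1) :
    stableCount M = stableCount L := by
  obtain ⟨e, he⟩ := exists_isEigenEnum (cplx M)
  obtain ⟨hne, hL⟩ := he.of_mul_eq (by exact_mod_cast hc.ne') (cplx_mul_eq h)
  rw [stableCount, stableCount, he.card_filter, hL.card_filter]
  simp [re_ofReal_div_neg_iff hc (hne _)]

/-- Two-scale limits: if `M_k L_k = ε_k → 0` and the nonzero eigenvalues of the limits of `M_k`
and `L_k` account for all eigenvalues, then the stable counts add up. -/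
theorem frequently_stableCount_eq_add {M L : ℕ → Matrix n n ℝ} {M' L' : Matrix n n ℝ} {c : ℕ → ℝ}
    (hM : Tendsto M atTop (𝓝 M')) (hL : Tendsto L atTop (𝓝 L')) (hc : Tendsto c atTop (𝓝 0))
    (hc0 : ∀ k, 0 < c k) (h : ∀ k, M k * L k = c k • 1)
    (hM' : ∀ μ ∈ spectrum ℂ (cplx M'), μ ≠ 0 → μ.re ≠ 0)
    (hL' : ∀ μ ∈ spectrum ℂ (cplx L'), μ ≠ 0 → μ.re ≠ 0)
    (hcard : Fintype.card n ≤ nonzeroCount M' + nonzeroCount L') :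
    ∃ᶠ k in atTop, stableCount (M k) = stableCount M' + stableCount L' := by
  have hMc : Tendsto (fun k => cplx (M k)) atTop (𝓝 (cplx M')) :=
    ((continuous_id.matrix_map Complex.continuous_ofReal).tendsto M').comp hM
  have hLc : Tendsto (fun k => cplx (L k)) atTop (𝓝 (cplx L')) :=
    ((continuous_id.matrix_map Complex.continuous_ofReal).tendsto L').comp hL
  choose e he using fun k => exists_isEigenEnum (cplx (M k))
  have hτ := fun k => (he k).of_mul_eq (by exact_mod_cast (hc0 k).ne') (cplx_mul_eq (h k))
  obtain ⟨e', φ, hφ, he', hE⟩ := exists_subseq_isEigenEnum hMc he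
  obtain ⟨τ', ψ, hψ, hτ', hT⟩ := exists_subseq_isEigenEnum (hLc.comp hφ.tendsto_atTop)
    (fun k => (hτ (φ k)).2)
  have he'' := he'.comp hψ.tendsto_atTop
  -- Paired eigenvalues have product `c k → 0`, so in the limit at least one of the two vanishes.
  have hprod : ∀ i, e' i * τ' i = 0 := by
    intro i
    have h1 : Tendsto (fun k => e (φ (ψ k)) i * (c (φ (ψ k)) / e (φ (ψ k)) i)) atTop
        (𝓝 (e' i * τ' i)) := (tendsto_pi_nhds.mp he'' i).mul (tendsto_pi_nhds.mp hτ' i)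
    have h2 : Tendsto (fun k => e (φ (ψ k)) i * (c (φ (ψ k)) / e (φ (ψ k)) i)) atTop (𝓝 0) := by
      have h3 : Tendsto (fun k => ((c (φ (ψ k)) : ℝ) : ℂ)) atTop (𝓝 ((0 : ℝ) : ℂ)) :=
        (Complex.continuous_ofReal.tendsto 0).comp
          (hc.comp (hφ.tendsto_atTop.comp hψ.tendsto_atTop))
      rw [Complex.ofReal_zero] at h3
      refine h3.congr fun k => ?_
      rw [mul_div_cancel₀ _ ((hτ _).1 i)]
    exact tendsto_nhds_unique h1 h2
  -- The counting hypothesis excludes that both vanish. Each index is thus seen at exactly one of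
  -- the two scales, where the sign of its real part is stable; since `c k > 0`, paired eigenvalues
  -- have real parts of the same sign.
  have hor : ∀ i, e' i ≠ 0 ∨ τ' i ≠ 0 := by
    rw [nonzeroCount, nonzeroCount, hE.card_filter, hT.card_filter] at hcard
    rw [← Finset.card_union_of_disjoint] at hcard
    · have := (Finset.card_eq_iff_eq_univ _).mp (le_antisymm (Finset.card_le_univ _) hcard)
      intro i
      have hi := Finset.mem_univ i
      rw [← this] at hi
      simpa using hi
    · rw [Finset.disjoint_filter]
      intro i _ h1 h2
      exact (mul_ne_zero h1 h2) (hprod i)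
  have hev : ∀ᶠ k in atTop, ∀ i, (e (φ (ψ k)) i).re < 0 ↔ ((e' i).re < 0 ∨ (τ' i).re < 0) := by
    rw [eventually_all]
    intro i
    rcases hor i with h1 | h1
    · have h2 : τ' i = 0 := (mul_eq_zero.mp (hprod i)).resolve_left h1
      filter_upwards [eventually_re_neg_iff ((tendsto_pi_nhds.mp he'') i)
        (hM' _ (hE.mem_spectrum i) h1)] with k hk
      simpa [h2] using hk
    · have h2 : e' i = 0 := (mul_eq_zero.mp (hprod i)).resolve_right h1
      filter_upwards [eventually_re_neg_iff ((tendsto_pi_nhds.mp hτ') i)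
        (hL' _ (hT.mem_spectrum i) h1)] with k hk
      rw [← re_ofReal_div_neg_iff (hc0 (φ (ψ k))) ((hτ _).1 i)]
      simpa [h2] using hk
  refine (hφ.tendsto_atTop.comp hψ.tendsto_atTop).frequently (Eventually.frequently ?_)
  filter_upwards [hev] with k hk
  rw [stableCount, stableCount, stableCount, (he _).card_filter, hE.card_filter, hT.card_filter,
    ← Finset.card_union_of_disjoint]
  · congr 1
    ext i
    simpa using hk i
  · rw [Finset.disjoint_filter]
    intro i _ h1 h2
    have := hprod i
    rcases mul_eq_zero.mp this with h0 | h0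
    · simp [h0] at h1
    · simp [h0] at h2

theorem charpoly_roots_neg (M : Matrix n n ℂ) :
    (-M).charpoly.roots = M.charpoly.roots.map (fun z => -z) := by
  obtain ⟨e, he⟩ := exists_isEigenEnum M
  have : IsEigenEnum (-M) fun i => -e i := by
    refine Polynomial.funext fun x => ?_
    have h1 : Matrix.scalar n x - -M = -(Matrix.scalar n (-x) - M) := by
      rw [map_neg]; abel
    rw [Matrix.eval_charpoly, h1, Matrix.det_neg, ← Matrix.eval_charpoly, he]
    simp only [Polynomial.eval_prod, Polynomial.eval_sub, Polynomial.eval_X, Polynomial.eval_C]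
    rw [← Finset.card_univ, ← Finset.prod_const, ← Finset.prod_mul_distrib]
    exact Finset.prod_congr rfl fun i _ => by ring
  rw [this.roots, he.roots, Multiset.map_map]
  rfl

theorem stableCount_neg (M : Matrix n n ℝ) : stableCount (-M) = numPos M := by
  have h : cplx (-M) = -cplx M := by ext i j; simp [cplx]
  rw [stableCount, numPos, h, charpoly_roots_neg, Multiset.filter_map, Multiset.card_map]
  congr 1
  refine Multiset.filter_congr fun z _ => ?_
  simp

end Counting

end

section

/-! ### Viscous modes at low and high frequency, and the stable dimension of `G` -/

section Blocks

variable {m p n : Type*} [Fintype m] [DecidableEq m] [Fintype p] [DecidableEq p]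
  [Fintype n] [DecidableEq n]

theorem mem_spectrum_iff_mem_roots {M : Matrix n n ℂ} {μ : ℂ} :
    μ ∈ spectrum ℂ M ↔ μ ∈ M.charpoly.roots := by
  rw [Polynomial.mem_roots M.charpoly_monic.ne_zero, Matrix.mem_spectrum_iff_isRoot_charpoly]

theorem roots_charpoly_cplx_fromBlocks (A : Matrix m m ℝ) (B : Matrix m p ℝ) (D : Matrix p p ℝ) :
    (cplx (Matrix.fromBlocks A B 0 D)).charpoly.roots =
      (cplx A).charpoly.roots + (cplx D).charpoly.roots := by
  have h : cplx (Matrix.fromBlocks A B 0 D) = Matrix.fromBlocks (cplx A) (cplx B) 0 (cplx D) := by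
    ext (i | i) (j | j) <;> simp [cplx]
  rw [h, Matrix.charpoly_fromBlocks_zero₂₁, Polynomial.roots_mul]
  exact mul_ne_zero (Matrix.charpoly_monic _).ne_zero (Matrix.charpoly_monic _).ne_zero

theorem stableCount_fromBlocks (A : Matrix m m ℝ) (B : Matrix m p ℝ) (D : Matrix p p ℝ) :
    stableCount (Matrix.fromBlocks A B 0 D) = stableCount A + stableCount D := by
  rw [stableCount, roots_charpoly_cplx_fromBlocks, Multiset.filter_add, Multiset.card_add]; rfl

theorem nonzeroCount_fromBlocks (A : Matrix m m ℝ) (B : Matrix m p ℝ) (D : Matrix p p ℝ) :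
    nonzeroCount (Matrix.fromBlocks A B 0 D) = nonzeroCount A + nonzeroCount D := by
  rw [nonzeroCount, roots_charpoly_cplx_fromBlocks, Multiset.filter_add, Multiset.card_add]; rfl

theorem mem_spectrum_fromBlocks {A : Matrix m m ℝ} {B : Matrix m p ℝ} {D : Matrix p p ℝ} {μ : ℂ} :
    μ ∈ spectrum ℂ (cplx (Matrix.fromBlocks A B 0 D)) ↔
      μ ∈ spectrum ℂ (cplx A) ∨ μ ∈ spectrum ℂ (cplx D) := by
  simp only [mem_spectrum_iff_mem_roots, roots_charpoly_cplx_fromBlocks, Multiset.mem_add]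

theorem roots_charpoly_cplx_zero :
    (cplx (0 : Matrix n n ℝ)).charpoly.roots = Multiset.replicate (Fintype.card n) 0 := by
  have h : cplx (0 : Matrix n n ℝ) = 0 := by ext i j; simp [cplx]
  rw [h, Matrix.charpoly_zero, Polynomial.roots_X_pow, Multiset.nsmul_singleton]

theorem stableCount_zero : stableCount (0 : Matrix n n ℝ) = 0 := by
  rw [stableCount, roots_charpoly_cplx_zero, Multiset.card_eq_zero, Multiset.filter_eq_nil]
  intro a ha
  rw [Multiset.eq_of_mem_replicate ha]; simp

theorem eq_zero_of_mem_spectrum_zero {μ : ℂ} (h : μ ∈ spectrum ℂ (cplx (0 : Matrix n n ℝ))) :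
    μ = 0 := by
  rw [mem_spectrum_iff_mem_roots, roots_charpoly_cplx_zero] at h
  exact Multiset.eq_of_mem_replicate h

theorem nonzeroCount_eq_card {M : Matrix n n ℝ} (h : ∀ μ ∈ spectrum ℂ (cplx M), μ ≠ 0) :
    nonzeroCount M = Fintype.card n := by
  rw [nonzeroCount, Multiset.filter_eq_self.mpr fun μ hμ => h μ (mem_spectrum_iff_mem_roots.mpr hμ),
    IsAlgClosed.card_roots_eq_natDegree, Matrix.charpoly_natDegree_eq_dim]

theorem cplx_neg (M : Matrix n p ℝ) : cplx (-M) = -cplx M := by ext i j; simp [cplx]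

theorem re_ne_zero_neg {M : Matrix n n ℝ} (h : ∀ μ ∈ spectrum ℂ (cplx M), μ.re ≠ 0) :
    ∀ μ ∈ spectrum ℂ (cplx (-M)), μ.re ≠ 0 := by
  intro μ hμ
  rw [mem_spectrum_iff_mem_roots, cplx_neg, charpoly_roots_neg, Multiset.mem_map] at hμ
  obtain ⟨z, hz, rfl⟩ := hμ
  simpa using h z (mem_spectrum_iff_mem_roots.mpr hz)

theorem ne_zero_of_re_ne_zero {z : ℂ} (h : z.re ≠ 0) : z ≠ 0 := fun h0 => h (by simp [h0])

theorem nonzeroCount_eq_card_of_re {M : Matrix n n ℝ} (h : ∀ μ ∈ spectrum ℂ (cplx M), μ.re ≠ 0) :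
    nonzeroCount M = Fintype.card n :=
  nonzeroCount_eq_card fun μ hμ => ne_zero_of_re_ne_zero (h μ hμ)

theorem re_ne_zero_of_mul_eq {M L : Matrix n n ℝ} (h : M * L = 1)
    (hM : ∀ μ ∈ spectrum ℂ (cplx M), μ.re ≠ 0) : ∀ μ ∈ spectrum ℂ (cplx L), μ.re ≠ 0 := by
  obtain ⟨e, he⟩ := exists_isEigenEnum (cplx M)
  have h' : cplx M * cplx L = (1 : ℂ) • 1 := by
    have := cplx_mul_eq (M := M) (L := L) (c := 1) (by simpa using h)
    simpa using this
  obtain ⟨hne, hL⟩ := he.of_mul_eq one_ne_zero h'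
  intro μ hμ
  rw [mem_spectrum_iff_mem_roots, hL.roots, Multiset.mem_map] at hμ
  obtain ⟨i, -, rfl⟩ := hμ
  have h1 := hM _ (he.mem_spectrum i)
  rw [Complex.div_re]
  simpa using ⟨h1, hne i⟩

theorem exists_cplx_eigenvector {M : Matrix n n ℂ} {μ : ℂ} (h : μ ∈ spectrum ℂ M) :
    ∃ v, v ≠ 0 ∧ M *ᵥ v = μ • v := by
  have h1 : (algebraMap ℂ (Matrix n n ℂ) μ - M).det = 0 := by
    by_contra h0
    exact h ((Matrix.isUnit_iff_isUnit_det _).mpr (isUnit_iff_ne_zero.mpr h0))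
  obtain ⟨v, hv, hMv⟩ := Matrix.exists_mulVec_eq_zero_iff.mpr h1
  rw [Matrix.sub_mulVec, sub_eq_zero, Algebra.algebraMap_eq_smul_one, Matrix.smul_mulVec,
    Matrix.one_mulVec] at hMv
  exact ⟨v, hv, hMv.symm⟩

theorem mem_spectrum_of_mulVec_eq {M : Matrix n n ℂ} {μ : ℂ} {v : n → ℂ} (hv : v ≠ 0)
    (h : M *ᵥ v = μ • v) : μ ∈ spectrum ℂ M := by
  intro hu
  have hu := (Matrix.isUnit_iff_isUnit_det _).mp hu
  refine hu.ne_zero (Matrix.exists_mulVec_eq_zero_iff.mp ⟨v, hv, ?_⟩)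
  rw [Matrix.sub_mulVec, sub_eq_zero, Algebra.algebraMap_eq_smul_one, Matrix.smul_mulVec,
    Matrix.one_mulVec, h]

/-- The Schur complement of the scalar block `x` is `x - x⁻¹ J P`, with `P` the lower left block.
Since `J P = diag(0, S)`, the determinant is a power of `x` times that of `x² - S`, whose roots are
the square roots of the eigenvalues of `S`. -/
theorem isEigenEnum_fromBlocks_sqrt (S : Matrix p p ℝ) (J : Matrix (m ⊕ p) p ℝ)
    (hJ : J * Matrix.fromCols (0 : Matrix p m ℝ) (1 : Matrix p p ℝ) = Matrix.fromBlocks (0 : Matrix m m ℝ) 0 0 S) {r : p → ℂ}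
    (hr : IsEigenEnum (cplx S) fun i => r i ^ 2) :
    IsEigenEnum (cplx (Matrix.fromBlocks 0 J (Matrix.fromCols (0 : Matrix p m ℝ) 1) 0))
      (Sum.elim (Sum.elim 0 r) (-r)) := by
  refine Polynomial.eq_of_infinite_eval_eq _ _ (Set.Infinite.mono (s := {0}ᶜ) (fun x hx => ?_)
    (Set.Finite.infinite_compl (Set.finite_singleton 0)))
  have hx : x ≠ 0 := hx
  simp only [Set.mem_ofPred_eq, Matrix.eval_charpoly, Polynomial.eval_prod, Polynomial.eval_sub,
    Polynomial.eval_X, Polynomial.eval_C]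
  have hblock : Matrix.scalar ((m ⊕ p) ⊕ p) x -
      cplx (Matrix.fromBlocks 0 J (Matrix.fromCols (0 : Matrix p m ℝ) 1) 0) =
      Matrix.fromBlocks (Matrix.scalar (m ⊕ p) x) (-cplx J)
        (-cplx (Matrix.fromCols (0 : Matrix p m ℝ) 1)) (Matrix.scalar p x) := by
    ext (i | i) (j | j) <;>
      simp [cplx, Matrix.scalar_apply, Matrix.diagonal_apply]
  let _ : Invertible (Matrix.scalar p x) :=
    ⟨Matrix.scalar p x⁻¹, by rw [← map_mul, inv_mul_cancel₀ hx, map_one],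
      by rw [← map_mul, mul_inv_cancel₀ hx, map_one]⟩
  have hinv : ⅟(Matrix.scalar p x) = Matrix.scalar p x⁻¹ := rfl
  have hS : Matrix.scalar (m ⊕ p) x - -cplx J * ⅟(Matrix.scalar p x) *
      -cplx (Matrix.fromCols (0 : Matrix p m ℝ) 1) =
      Matrix.fromBlocks (Matrix.scalar m x) 0 0 (Matrix.scalar p x - x⁻¹ • cplx S) := by
    have h1 : -cplx J * ⅟(Matrix.scalar p x) * -cplx (Matrix.fromCols (0 : Matrix p m ℝ) 1) =
        x⁻¹ • cplx (Matrix.fromBlocks (0 : Matrix m m ℝ) 0 0 S) := by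
      rw [← hJ, cplx_mul, hinv]
      rw [show Matrix.scalar p x⁻¹ = x⁻¹ • (1 : Matrix p p ℂ) by
        ext i j; simp [Matrix.scalar_apply, Matrix.diagonal_apply, Matrix.one_apply]]
      simp
    rw [h1]
    ext (i | i) (j | j) <;>
      simp [cplx, Matrix.scalar_apply, Matrix.diagonal_apply]
  rw [hblock, Matrix.det_fromBlocks₂₂, hS, Matrix.det_fromBlocks_zero₂₁]
  have h2 : (Matrix.scalar p x).det * (Matrix.scalar p x - x⁻¹ • cplx S).det =
      ∏ i, (x ^ 2 - r i ^ 2) := by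
    rw [← Matrix.det_mul]
    have h3 : Matrix.scalar p x * (Matrix.scalar p x - x⁻¹ • cplx S) =
        Matrix.scalar p (x ^ 2) - cplx S := by
      rw [mul_sub, ← map_mul, ← pow_two]
      congr 1
      ext i j
      simp [Matrix.scalar_apply, Matrix.diagonal_mul, hx]
    rw [h3, ← Matrix.eval_charpoly, hr, Polynomial.eval_prod]
    simp
  rw [mul_left_comm, h2]
  simp only [Fintype.prod_sum_type, Sum.elim_inl, Sum.elim_inr, Pi.zero_apply, sub_zero,
    Pi.neg_apply, Finset.prod_const, Finset.card_univ]
  rw [mul_assoc, ← Finset.prod_mul_distrib]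
  congr 1
  · simp [Matrix.scalar_apply, Matrix.det_diagonal]
  · exact Finset.prod_congr rfl fun i _ => by ring

/-- If `Re r² > 0` then `r` is not imaginary, so exactly one of `r` and `-r` is stable. These are
the parabolic modes, which grow like the square root of the frequency. -/
theorem stableCount_fromBlocks_sqrt (S : Matrix p p ℝ) (J : Matrix (m ⊕ p) p ℝ)
    (hJ : J * Matrix.fromCols (0 : Matrix p m ℝ) (1 : Matrix p p ℝ) = Matrix.fromBlocks (0 : Matrix m m ℝ) 0 0 S)
    (hS : ∀ μ ∈ spectrum ℂ (cplx S), 0 < μ.re) :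
    let L := Matrix.fromBlocks 0 J (Matrix.fromCols (0 : Matrix p m ℝ) 1) 0
    stableCount L = Fintype.card p ∧ nonzeroCount L = Fintype.card p + Fintype.card p ∧
      ∀ μ ∈ spectrum ℂ (cplx L), μ ≠ 0 → μ.re ≠ 0 := by
  intro L
  obtain ⟨s, hs⟩ := exists_isEigenEnum (cplx S)
  choose r hr using fun i => IsAlgClosed.exists_pow_nat_eq (s i) (n := 2) two_pos
  have hr0 : ∀ i, (r i).re ≠ 0 := by
    intro i hi
    have h1 := hS _ (hs.mem_spectrum i)
    rw [← hr i, pow_two, Complex.mul_re, hi] at h1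
    nlinarith [mul_self_nonneg (r i).im]
  have hE := isEigenEnum_fromBlocks_sqrt (m := m) S J hJ (r := r) (by simpa [hr] using hs)
  refine ⟨?_, ?_, ?_⟩
  · rw [stableCount, hE.card_filter, Finset.card_filter]
    simp only [Fintype.sum_sum_type, Sum.elim_inl, Sum.elim_inr, Pi.zero_apply, Complex.zero_re,
      lt_irrefl, if_false, Finset.sum_const_zero, zero_add, Pi.neg_apply, Complex.neg_re]
    rw [← Finset.sum_add_distrib]
    have : ∀ i, ((if (r i).re < 0 then 1 else 0) + if -(r i).re < 0 then 1 else 0 : ℕ) = 1 := by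
      intro i
      rcases lt_or_gt_of_ne (hr0 i) with h | h
      · simp [h, h.le]
      · simp [h, h.le]
    refine (Finset.sum_congr rfl fun i _ => this i).trans (by simp)
  · rw [nonzeroCount, hE.card_filter, Finset.card_filter]
    have h0 : ∀ i, r i ≠ 0 := fun i => ne_zero_of_re_ne_zero (hr0 i)
    simp [Fintype.sum_sum_type, h0]
  · intro μ hμ hμ0
    rw [mem_spectrum_iff_mem_roots, hE.roots, Multiset.mem_map] at hμ
    obtain ⟨(i | i) | i, -, rfl⟩ := hμ
    · simp at hμ0
    · simpa using hr0 i
    · simpa using hr0 i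

/-- The matrix of the first order system for the modes of
`λ A₀ + κ A - κ² diag(0, B)`, in scaled form. -/
def modeMatrix (a : Matrix m m ℝ) (b : Matrix m p ℝ) (c : Matrix p m ℝ) (A₀ : Matrix (m ⊕ p) (m ⊕ p) ℝ)
    (B G : Matrix p p ℝ) (x : ℝ × ℝ) : Matrix ((m ⊕ p) ⊕ p) ((m ⊕ p) ⊕ p) ℝ :=
  Matrix.fromBlocks (-x.2 • (Matrix.fromBlocks a⁻¹ (0 : Matrix m p ℝ) (0 : Matrix p m ℝ) (0 : Matrix p p ℝ) * A₀))
    (x.1 • Matrix.fromRows (-(a⁻¹ * b)) 1)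
    ((x.1 * x.2) • (B⁻¹ * (Matrix.fromCols (-(c * a⁻¹)) (1 : Matrix p p ℝ) * A₀)))
    (x.1 ^ 2 • G)

/-- The inverse of `modeMatrix`, up to a scalar. -/
def modeMatrixInv (A₀ A : Matrix (m ⊕ p) (m ⊕ p) ℝ) (B : Matrix p p ℝ) (x : ℝ × ℝ) :
    Matrix ((m ⊕ p) ⊕ p) ((m ⊕ p) ⊕ p) ℝ :=
  Matrix.fromBlocks (-x.1 • (A₀⁻¹ * A)) (A₀⁻¹ * Matrix.fromRows (0 : Matrix m p ℝ) B) (x.2 • Matrix.fromCols (0 : Matrix p m ℝ) (1 : Matrix p p ℝ)) 0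

/-- Modes whose eigenvalue tends to zero in the first matrix at one scale are resolved at the other
scale by its partner: the product is `x.1 * x.2`, which tends to zero in both regimes used below. -/
theorem modeMatrix_mul_inv {a : Matrix m m ℝ} {b : Matrix m p ℝ} {c : Matrix p m ℝ} {d : Matrix p p ℝ}
    {A₀ : Matrix (m ⊕ p) (m ⊕ p) ℝ} {B : Matrix p p ℝ} (hA₀ : IsUnit A₀.det) (ha : IsUnit a.det)
    (hB : IsUnit B.det) (x : ℝ × ℝ) :
    modeMatrix a b c A₀ B (B⁻¹ * (d - c * a⁻¹ * b)) x *
      modeMatrixInv A₀ (Matrix.fromBlocks a b c d) B x = (x.1 * x.2) • 1 := by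
  have e1 : Matrix.fromBlocks a⁻¹ (0 : Matrix m p ℝ) (0 : Matrix p m ℝ) (0 : Matrix p p ℝ) * A₀ * (A₀⁻¹ * Matrix.fromBlocks a b c d) =
      Matrix.fromBlocks 1 (a⁻¹ * b) 0 0 := by
    rw [Matrix.mul_assoc, Matrix.mul_nonsing_inv_cancel_left _ _ hA₀, Matrix.fromBlocks_multiply]
    simp [Matrix.nonsing_inv_mul _ ha]
  have e2 : Matrix.fromBlocks a⁻¹ (0 : Matrix m p ℝ) (0 : Matrix p m ℝ) (0 : Matrix p p ℝ) * A₀ * (A₀⁻¹ * Matrix.fromRows (0 : Matrix m p ℝ) B) = 0 := by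
    rw [Matrix.mul_assoc, Matrix.mul_nonsing_inv_cancel_left _ _ hA₀, Matrix.fromBlocks_mul_fromRows]
    simp
  have e3 : B⁻¹ * (Matrix.fromCols (-(c * a⁻¹)) (1 : Matrix p p ℝ) * A₀) * (A₀⁻¹ * Matrix.fromBlocks a b c d) =
      Matrix.fromCols 0 (B⁻¹ * (d - c * a⁻¹ * b)) := by
    rw [Matrix.mul_assoc, Matrix.mul_assoc, Matrix.mul_nonsing_inv_cancel_left _ _ hA₀,
      Matrix.fromCols_mul_fromBlocks, Matrix.mul_fromCols]
    have : -(c * a⁻¹) * a + (1 : Matrix p p ℝ) * c = 0 := by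
      rw [Matrix.neg_mul, Matrix.mul_assoc, Matrix.nonsing_inv_mul _ ha]; simp
    rw [this]
    congr 1
    · simp
    · congr 1
      rw [Matrix.neg_mul, Matrix.one_mul]; abel
  have e4 : B⁻¹ * (Matrix.fromCols (-(c * a⁻¹)) (1 : Matrix p p ℝ) * A₀) * (A₀⁻¹ * Matrix.fromRows (0 : Matrix m p ℝ) B)
      = 1 := by
    rw [Matrix.mul_assoc, Matrix.mul_assoc, Matrix.mul_nonsing_inv_cancel_left _ _ hA₀,
      Matrix.fromCols_mul_fromRows]
    simp [Matrix.nonsing_inv_mul _ hB]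
  rw [modeMatrix, modeMatrixInv, Matrix.fromBlocks_multiply]
  simp only [Matrix.smul_mul, Matrix.mul_smul, e1, e2, e3, e4]
  rw [Matrix.fromRows_mul_fromCols, Matrix.mul_fromCols]
  ext ((i | i) | i) ((j | j) | j) <;>
    simp [Matrix.one_apply] <;> ring_nf

/-- With `x = (ε, l)`, an eigenvalue `κ` is a viscous mode with spatial exponent `κ / ε²` and
temporal growth rate `l / ε² > 0`. If `κ` were imaginary, this would be a growing Fourier mode,
which dissipativity forbids. -/
theorem re_ne_zero_of_mem_spectrum_modeMatrix {M : Matrix ((m ⊕ p) ⊕ p) ((m ⊕ p) ⊕ p) ℝ}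
    {A₀ A : Matrix (m ⊕ p) (m ⊕ p) ℝ} {B : Matrix p p ℝ} {x : ℝ × ℝ} (hx1 : 0 < x.1) (hx2 : 0 < x.2)
    (hM : M * modeMatrixInv A₀ A B x = (x.1 * x.2) • 1)
    (hdiss : ∀ ξ : ℝ, ∀ μ ∈ spectrum ℂ ((ξ * Complex.I) • cplx (A₀⁻¹ * A) +
      (ξ : ℂ) ^ 2 • cplx (A₀⁻¹ * Matrix.fromBlocks (0 : Matrix m m ℝ) 0 0 B)), 0 ≤ μ.re) :
    ∀ μ ∈ spectrum ℂ (cplx M), μ.re ≠ 0 := by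
  intro κ hκ hre
  obtain ⟨v, hv, hMv⟩ := exists_cplx_eigenvector hκ
  set ε := x.1
  set l := x.2
  have hεl : (ε * l : ℝ) ≠ 0 := (mul_pos hx1 hx2).ne'
  have hLM : modeMatrixInv A₀ A B x * M = (ε * l) • 1 := by
    have h1 : M * ((ε * l)⁻¹ • modeMatrixInv A₀ A B x) = 1 := by
      rw [Matrix.mul_smul, hM, smul_smul, inv_mul_cancel₀ hεl, one_smul]
    have h2 := mul_eq_one_comm.mp h1
    rw [Matrix.smul_mul] at h2
    rw [← h2, smul_smul, mul_inv_cancel₀ hεl, one_smul]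
  have hLv : κ • (cplx (modeMatrixInv A₀ A B x) *ᵥ v) = ((ε * l : ℝ) : ℂ) • v := by
    rw [← Matrix.mulVec_smul, ← hMv, Matrix.mulVec_mulVec, cplx_mul_eq hLM, Matrix.smul_mulVec,
      Matrix.one_mulVec]
  have hL : cplx (modeMatrixInv A₀ A B x) = Matrix.fromBlocks (-(ε : ℂ) • cplx (A₀⁻¹ * A))
      (cplx (A₀⁻¹ * Matrix.fromRows (0 : Matrix m p ℝ) B))
      ((l : ℂ) • cplx (Matrix.fromCols (0 : Matrix p m ℝ) (1 : Matrix p p ℝ))) 0 := by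
    ext (i | i) (j | j) <;> simp [cplx, modeMatrixInv, ε, l]
  rw [hL, Matrix.fromBlocks_mulVec] at hLv
  set w := v ∘ Sum.inl with hw
  set y := v ∘ Sum.inr with hy
  set P := cplx (Matrix.fromCols (0 : Matrix p m ℝ) (1 : Matrix p p ℝ)) with hP
  set J := cplx (A₀⁻¹ * Matrix.fromRows (0 : Matrix m p ℝ) B) with hJ
  have hJP : J * P = cplx (A₀⁻¹ * Matrix.fromBlocks (0 : Matrix m m ℝ) 0 0 B) := by
    rw [hJ, hP, ← cplx_mul, Matrix.mul_assoc, Matrix.fromRows_mul_fromCols]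
    simp
  have e1 : κ • (-(ε : ℂ) • (cplx (A₀⁻¹ * A) *ᵥ w) + J *ᵥ y) = ((ε * l : ℝ) : ℂ) • w := by
    ext i
    have := congrFun hLv (Sum.inl i)
    simp [Matrix.smul_mulVec, Matrix.neg_mulVec] at this ⊢
    exact this
  have e2 : κ • ((l : ℂ) • (P *ᵥ w)) = ((ε * l : ℝ) : ℂ) • y := by
    ext i
    have := congrFun hLv (Sum.inr i)
    simp [Matrix.smul_mulVec] at this ⊢
    exact this
  have hlC : (l : ℂ) ≠ 0 := by exact_mod_cast hx2.ne'
  have hεC : (ε : ℂ) ≠ 0 := by exact_mod_cast hx1.ne'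
  have e3 : (ε : ℂ) • y = κ • (P *ᵥ w) := by
    have h1 : (l : ℂ) • ((ε : ℂ) • y) = (l : ℂ) • (κ • (P *ᵥ w)) := by
      rw [smul_comm (l : ℂ) κ, e2, smul_smul]
      push_cast
      rw [mul_comm]
    exact (smul_right_injective _ hlC) h1
  have hw0 : w ≠ 0 := by
    intro h0
    apply hv
    have hy0 : y = 0 := by
      rw [h0, Matrix.mulVec_zero, smul_zero] at e3
      exact (smul_eq_zero.mp e3).resolve_left hεC
    ext (i | i)
    · exact congrFun h0 i
    · exact congrFun hy0 i
  obtain ⟨s, hs⟩ : ∃ s : ℝ, κ = s * Complex.I := ⟨κ.im, by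
    apply Complex.ext <;> simp [hre]⟩
  have e4 : ((ε : ℂ) ^ 2 * s * Complex.I) • (cplx (A₀⁻¹ * A) *ᵥ w) +
      ((s : ℂ) ^ 2) • ((J * P) *ᵥ w) = -((ε : ℂ) ^ 2 * l) • w := by
    have h1 := congrArg (fun z => (ε : ℂ) • z) e1
    rw [smul_comm, smul_add, ← Matrix.mulVec_smul J, e3, Matrix.mulVec_smul, Matrix.mulVec_mulVec,
      smul_add, smul_smul, smul_smul, smul_smul, smul_smul] at h1
    have hI : κ * κ = -(s : ℂ) ^ 2 := by
      rw [hs]; ring_nf; simp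
    rw [hI] at h1
    rw [neg_smul]
    rw [show (ε : ℂ) ^ 2 * l = ε * ((ε * l : ℝ) : ℂ) by push_cast; ring, ← h1, hs, neg_add,
      ← neg_smul, ← neg_smul]
    congr 2 <;> ring
  -- Division of the mode equation by `ε⁴` brings it to the form of the dissipativity condition at
  -- the real frequency `s / ε²`.
  have h5 : (-((l / ε ^ 2 : ℝ) : ℂ)) ∈ spectrum ℂ ((((s / ε ^ 2 : ℝ) : ℂ) * Complex.I) • cplx (A₀⁻¹ * A) +
      ((s / ε ^ 2 : ℝ) : ℂ) ^ 2 • cplx (A₀⁻¹ * Matrix.fromBlocks (0 : Matrix m m ℝ) 0 0 B)) := by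
    refine mem_spectrum_of_mulVec_eq hw0 ?_
    have h6 := congrArg (fun z => ((ε : ℂ) ^ 4)⁻¹ • z) e4
    simp only [smul_add, smul_smul] at h6
    rw [Matrix.add_mulVec, Matrix.smul_mulVec, Matrix.smul_mulVec, ← hJP]
    convert h6 using 2
    · congr 1; push_cast; field_simp
    · congr 1; push_cast; field_simp
    · push_cast; field_simp
  have h7 := hdiss (s / ε ^ 2) _ h5
  have h8 : 0 < l / ε ^ 2 := by positivity
  simp only [Complex.neg_re, Complex.ofReal_re] at h7
  linarith

theorem continuous_modeMatrix (a : Matrix m m ℝ) (b : Matrix m p ℝ) (c : Matrix p m ℝ)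
    (A₀ : Matrix (m ⊕ p) (m ⊕ p) ℝ) (B G : Matrix p p ℝ) : Continuous (modeMatrix a b c A₀ B G) := by
  unfold modeMatrix
  refine Continuous.matrix_fromBlocks ?_ ?_ ?_ ?_ <;> fun_prop

theorem continuous_modeMatrixInv (A₀ A : Matrix (m ⊕ p) (m ⊕ p) ℝ) (B : Matrix p p ℝ) :
    Continuous (modeMatrixInv A₀ A B) := by
  unfold modeMatrixInv
  refine Continuous.matrix_fromBlocks ?_ ?_ ?_ ?_ <;> fun_prop

/-- The stable dimension of the reduced matrix `G`, from dissipativity. -/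
theorem stableCount_reduced_add {a : Matrix m m ℝ} {b : Matrix m p ℝ} {c : Matrix p m ℝ}
    {d : Matrix p p ℝ} {E₁₁ : Matrix m m ℝ} {E₂₁ : Matrix p m ℝ} {E₂₂ B : Matrix p p ℝ}
    (hE₁₁ : IsUnit E₁₁.det) (hE₂₂ : IsUnit E₂₂.det) (ha : IsUnit a.det) (hB : IsUnit B.det)
    (hA : ∀ μ ∈ spectrum ℂ (cplx ((Matrix.fromBlocks E₁₁ 0 E₂₁ E₂₂)⁻¹ * Matrix.fromBlocks a b c d)),
      μ.re ≠ 0)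
    (hA11 : ∀ μ ∈ spectrum ℂ (cplx (E₁₁⁻¹ * a)), μ.re ≠ 0)
    (hG : ∀ μ ∈ spectrum ℂ (cplx (B⁻¹ * (d - c * a⁻¹ * b))), μ.re ≠ 0)
    (hS : ∀ μ ∈ spectrum ℂ (cplx (E₂₂⁻¹ * B)), 0 < μ.re)
    (hdiss : ∀ ξ : ℝ, ∀ μ ∈ spectrum ℂ ((ξ * Complex.I) •
      cplx ((Matrix.fromBlocks E₁₁ 0 E₂₁ E₂₂)⁻¹ * Matrix.fromBlocks a b c d) +
      (ξ : ℂ) ^ 2 • cplx ((Matrix.fromBlocks E₁₁ 0 E₂₁ E₂₂)⁻¹ *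
        Matrix.fromBlocks (0 : Matrix m m ℝ) 0 0 B)), 0 ≤ μ.re) :
    stableCount (B⁻¹ * (d - c * a⁻¹ * b)) +
      numPos ((Matrix.fromBlocks E₁₁ 0 E₂₁ E₂₂)⁻¹ * Matrix.fromBlocks a b c d) =
      numPos (E₁₁⁻¹ * a) + Fintype.card p := by
  set A₀ := Matrix.fromBlocks E₁₁ 0 E₂₁ E₂₂ with hA₀def
  set A := Matrix.fromBlocks a b c d with hAdef
  set G := B⁻¹ * (d - c * a⁻¹ * b) with hGdef
  have hA₀ : IsUnit A₀.det := by
    rw [hA₀def, Matrix.det_fromBlocks_zero₁₂]; exact hE₁₁.mul hE₂₂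
  have hA₀inv : A₀⁻¹ = Matrix.fromBlocks E₁₁⁻¹ 0 (-(E₂₂⁻¹ * E₂₁ * E₁₁⁻¹)) E₂₂⁻¹ := by
    refine Matrix.inv_eq_right_inv ?_
    rw [hA₀def, Matrix.fromBlocks_multiply]
    simp [Matrix.mul_nonsing_inv _ hE₁₁, Matrix.mul_nonsing_inv _ hE₂₂, Matrix.mul_assoc,
      Matrix.mul_nonsing_inv_cancel_left _ _ hE₂₂, Matrix.fromBlocks_one]
  set M := modeMatrix a b c A₀ B G with hMdef
  set L := modeMatrixInv A₀ A B with hLdef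
  have hML : ∀ x, M x * L x = (x.1 * x.2) • 1 := fun x => modeMatrix_mul_inv hA₀ ha hB x
  -- The open quadrant is connected and on it no eigenvalue reaches the imaginary axis. The limits
  -- along its two edges can therefore be compared.
  have hconst : ∀ x ∈ Ioi (0 : ℝ) ×ˢ Ioi (0 : ℝ), stableCount (M x) = stableCount (M (1, 1)) := by
    intro x hx
    refine stableCount_eq_of_isPreconnected (s := Ioi (0 : ℝ) ×ˢ Ioi (0 : ℝ))
      (isPreconnected_Ioi.prod isPreconnected_Ioi)
      (continuous_modeMatrix a b c A₀ B G).continuousOn (fun y hy => ?_) hx (by simp)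
    exact re_ne_zero_of_mem_spectrum_modeMatrix hy.1 hy.2 (hML y) hdiss
  have hseq : Tendsto (fun k : ℕ => 1 / ((k : ℝ) + 1)) atTop (𝓝 0) :=
    tendsto_one_div_add_atTop_nhds_zero_nat
  have hpos : ∀ k : ℕ, 0 < 1 / ((k : ℝ) + 1) := fun k => by positivity
  -- Low frequency, `l → 0`: fast modes converge to the eigenvalues of `G`; slow modes are of order
  -- `l`, and `l / κ` converges to the eigenvalues of `-A₀⁻¹ A`.
  have low : stableCount (M (1, 1)) = stableCount G + numPos (A₀⁻¹ * A) := by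
    have hM0 : M (1, 0) = Matrix.fromBlocks 0 (Matrix.fromRows (-(a⁻¹ * b)) 1) 0 G := by
      rw [hMdef, modeMatrix]; simp
    have hL0 : L (1, 0) = Matrix.fromBlocks (-(A₀⁻¹ * A)) (A₀⁻¹ * Matrix.fromRows (0 : Matrix m p ℝ) B) 0 0 := by
      rw [hLdef, modeMatrixInv]; simp
    have hlim : Tendsto (fun k : ℕ => ((1 : ℝ), 1 / ((k : ℝ) + 1))) atTop (𝓝 (1, 0)) :=
      tendsto_const_nhds.prodMk_nhds hseq
    have hM1 : ∀ μ ∈ spectrum ℂ (cplx (M (1, 0))), μ ≠ 0 → μ.re ≠ 0 := by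
      rw [hM0]
      intro μ hμ h0
      rcases mem_spectrum_fromBlocks.mp hμ with h | h
      · exact absurd (eq_zero_of_mem_spectrum_zero h) h0
      · exact hG μ h
    have hL1 : ∀ μ ∈ spectrum ℂ (cplx (L (1, 0))), μ ≠ 0 → μ.re ≠ 0 := by
      rw [hL0]
      intro μ hμ h0
      rcases mem_spectrum_fromBlocks.mp hμ with h | h
      · exact re_ne_zero_neg hA μ h
      · exact absurd (eq_zero_of_mem_spectrum_zero h) h0
    have hn1 : Fintype.card ((m ⊕ p) ⊕ p) ≤ nonzeroCount (M (1, 0)) + nonzeroCount (L (1, 0)) := by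
      rw [hM0, hL0, nonzeroCount_fromBlocks, nonzeroCount_fromBlocks, nonzeroCount_eq_card_of_re hG,
        nonzeroCount_eq_card_of_re (re_ne_zero_neg hA)]
      simp only [Fintype.card_sum]
      omega
    obtain ⟨k, hk⟩ := (frequently_stableCount_eq_add
      (((continuous_modeMatrix a b c A₀ B G).tendsto _).comp hlim)
      (((continuous_modeMatrixInv A₀ A B).tendsto _).comp hlim) hseq hpos
      (fun k => by simpa using hML (1, 1 / ((k : ℝ) + 1))) hM1 hL1 hn1).exists
    · rw [← hconst (1, 1 / ((k : ℝ) + 1)) ⟨zero_lt_one' ℝ, hpos k⟩]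
      refine hk.trans ?_
      change stableCount (M (1, 0)) + stableCount (L (1, 0)) = _
      rw [hM0, hL0, stableCount_fromBlocks, stableCount_fromBlocks, stableCount_zero,
        stableCount_zero, stableCount_neg, zero_add, add_zero]
  -- High frequency, `ε → 0`: hyperbolic modes converge to the eigenvalues of `-a⁻¹ E₁₁`; parabolic
  -- modes are of order `ε`, and `ε / κ` converges to the square roots of the eigenvalues of `E₂₂⁻¹
  -- B`, half of which are stable.
  have high : stableCount (M (1, 1)) = numPos (E₁₁⁻¹ * a) + Fintype.card p := by
    have hM0 : M (0, 1) = Matrix.fromBlocks (Matrix.fromBlocks (-(a⁻¹ * E₁₁)) 0 0 0) 0 0 0 := by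
      rw [hMdef, modeMatrix, hA₀def, Matrix.fromBlocks_multiply]; simp [Matrix.fromBlocks_neg]
    have hL0 : L (0, 1) = Matrix.fromBlocks 0 (A₀⁻¹ * Matrix.fromRows (0 : Matrix m p ℝ) B)
        (Matrix.fromCols (0 : Matrix p m ℝ) (1 : Matrix p p ℝ)) 0 := by
      rw [hLdef, modeMatrixInv]; simp
    have hJ : A₀⁻¹ * Matrix.fromRows (0 : Matrix m p ℝ) B *
        Matrix.fromCols (0 : Matrix p m ℝ) (1 : Matrix p p ℝ) =
        Matrix.fromBlocks (0 : Matrix m m ℝ) 0 0 (E₂₂⁻¹ * B) := by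
      rw [Matrix.mul_assoc, Matrix.fromRows_mul_fromCols, hA₀inv, Matrix.fromBlocks_multiply]
      simp
    obtain ⟨hst, hnz, hsp⟩ := stableCount_fromBlocks_sqrt _ _ hJ hS
    have hinv : -(E₁₁⁻¹ * a) * -(a⁻¹ * E₁₁) = 1 := by
      rw [neg_mul_neg, Matrix.mul_assoc, Matrix.mul_nonsing_inv_cancel_left _ _ ha,
        Matrix.nonsing_inv_mul _ hE₁₁]
    have hre := re_ne_zero_of_mul_eq hinv (re_ne_zero_neg hA11)
    have hst' : stableCount (-(a⁻¹ * E₁₁)) = numPos (E₁₁⁻¹ * a) := by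
      rw [← stableCount_neg, stableCount_eq_of_mul_eq (M := -(E₁₁⁻¹ * a)) (L := -(a⁻¹ * E₁₁)) one_pos
        (by rw [hinv, one_smul])]
    have hlim : Tendsto (fun k : ℕ => (1 / ((k : ℝ) + 1), (1 : ℝ))) atTop (𝓝 (0, 1)) :=
      hseq.prodMk_nhds tendsto_const_nhds
    have hM1 : ∀ μ ∈ spectrum ℂ (cplx (M (0, 1))), μ ≠ 0 → μ.re ≠ 0 := by
      rw [hM0]
      intro μ hμ h0
      rcases mem_spectrum_fromBlocks.mp hμ with h | h
      · rcases mem_spectrum_fromBlocks.mp h with h | h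
        · exact hre μ h
        · exact absurd (eq_zero_of_mem_spectrum_zero h) h0
      · exact absurd (eq_zero_of_mem_spectrum_zero h) h0
    have hL1 : ∀ μ ∈ spectrum ℂ (cplx (L (0, 1))), μ ≠ 0 → μ.re ≠ 0 := by
      rw [hL0]
      exact hsp
    have hn1 : Fintype.card ((m ⊕ p) ⊕ p) ≤ nonzeroCount (M (0, 1)) + nonzeroCount (L (0, 1)) := by
      rw [hM0, hL0, nonzeroCount_fromBlocks, nonzeroCount_fromBlocks, nonzeroCount_eq_card_of_re hre, hnz]
      simp only [Fintype.card_sum]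
      omega
    obtain ⟨k, hk⟩ := (frequently_stableCount_eq_add
      (((continuous_modeMatrix a b c A₀ B G).tendsto _).comp hlim)
      (((continuous_modeMatrixInv A₀ A B).tendsto _).comp hlim) hseq hpos
      (fun k => by simpa using hML (1 / ((k : ℝ) + 1), 1)) hM1 hL1 hn1).exists
    · rw [← hconst (1 / ((k : ℝ) + 1), 1) ⟨hpos k, zero_lt_one' ℝ⟩]
      refine hk.trans ?_
      change stableCount (M (0, 1)) + stableCount (L (0, 1)) = _
      rw [hM0, hL0, stableCount_fromBlocks, stableCount_fromBlocks, stableCount_zero,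
        hst, hst', add_zero, add_zero]
  rw [← low, high]

end Blocks

end

section

/-! ### Exponential dichotomies -/

section Dichotomy

variable {Z : Type*} [NormedAddCommGroup Z] [NormedSpace ℝ Z] [CompleteSpace Z]

/-- The linear flow `e^{tA}`. -/
def expFlow (A : Z →L[ℝ] Z) (t : ℝ) : Z →L[ℝ] Z := NormedSpace.exp (t • A)

theorem hasDerivAt_expFlow (A : Z →L[ℝ] Z) (t : ℝ) :
    HasDerivAt (expFlow A) (A * expFlow A t) t :=
  hasDerivAt_exp_smul_const' A t

theorem hasDerivAt_expFlow' (A : Z →L[ℝ] Z) (t : ℝ) :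
    HasDerivAt (expFlow A) (expFlow A t * A) t :=
  hasDerivAt_exp_smul_const A t

@[simp] theorem expFlow_zero (A : Z →L[ℝ] Z) : expFlow A 0 = 1 := by
  simp [expFlow, NormedSpace.exp_zero]

theorem expFlow_add (A : Z →L[ℝ] Z) (s t : ℝ) : expFlow A (s + t) = expFlow A s * expFlow A t := by
  have : NormedAlgebra ℚ (Z →L[ℝ] Z) := NormedAlgebra.restrictScalars ℚ ℝ _
  rw [expFlow, add_smul, NormedSpace.exp_add_of_commute]
  · rfl
  · exact ((Commute.refl A).smul_left s).smul_right t

theorem expFlow_neg_apply (A : Z →L[ℝ] Z) (t : ℝ) (v : Z) :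
    expFlow A (-t) (expFlow A t v) = v := by
  rw [← mul_apply_eq_comp, ← expFlow_add]; simp

theorem expFlow_apply_neg (A : Z →L[ℝ] Z) (t : ℝ) (v : Z) :
    expFlow A t (expFlow A (-t) v) = v := by
  rw [← mul_apply_eq_comp, ← expFlow_add]; simp

theorem expFlow_neg_left (A : Z →L[ℝ] Z) (t : ℝ) : expFlow (-A) t = expFlow A (-t) := by
  simp [expFlow]

theorem continuous_expFlow (A : Z →L[ℝ] Z) : Continuous (expFlow A) :=
  continuous_iff_continuousAt.mpr fun t => (hasDerivAt_expFlow A t).continuousAt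

theorem hasDerivAt_expFlow_apply (A : Z →L[ℝ] Z) (v : Z) (t : ℝ) :
    HasDerivAt (fun t => expFlow A t v) (A (expFlow A t v)) t :=
  (hasDerivAt_expFlow A t).clm_apply (hasDerivAt_const t v) |>.congr_deriv (by simp)

/-- Solutions of `c' = A c` on `[0, ∞)`. -/
theorem eq_expFlow_of_hasDerivWithinAt {A : Z →L[ℝ] Z} {c : ℝ → Z}
    (hc : ∀ t, 0 ≤ t → HasDerivWithinAt c (A (c t)) (Ici 0) t) {t : ℝ} (ht : 0 ≤ t) :
    c t = expFlow A t (c 0) := by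
  have h1 : ∀ s, 0 ≤ s → HasDerivWithinAt (fun s => expFlow A (-s) (c s)) 0 (Ici 0) s := by
    intro s hs
    have h2 : HasDerivAt (fun s => expFlow A (-s)) (-(expFlow A (-s) * A)) s := by
      have := (hasDerivAt_expFlow' A (-s)).scomp s (hasDerivAt_neg s)
      exact this.congr_deriv (by simp)
    exact (h2.hasDerivWithinAt.clm_apply (hc s hs)).congr_deriv (by simp)
  have h3 : expFlow A (-t) (c t) = expFlow A (-0) (c 0) := by
    refine (convex_Ici (0 : ℝ)).is_const_of_fderivWithin_eq_zero (𝕜 := ℝ)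
      (f := fun s => expFlow A (-s) (c s))
      (fun s hs => (h1 s hs).differentiableWithinAt) (fun s hs => ?_) ht (le_refl (0 : ℝ))
    have h4 := (h1 s hs).hasFDerivWithinAt.fderivWithin (uniqueDiffOn_Ici 0 s hs)
    rw [h4]; ext; simp
  rw [neg_zero, expFlow_zero] at h3
  rw [← expFlow_apply_neg A t (c t), h3]; rfl

/-- Exponential dichotomy: `P` projects onto the stable subspace along the unstable subspace. -/
structure Dichotomy (A P : Z →L[ℝ] Z) (C β : ℝ) : Prop where
  pos : 0 < β
  nonneg : 0 ≤ C
  idem : ∀ v, P (P v) = P v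
  comm : ∀ t v, P (expFlow A t v) = expFlow A t (P v)
  stable : ∀ t, 0 ≤ t → ∀ v, ‖expFlow A t (P v)‖ ≤ C * Real.exp (-β * t) * ‖v‖
  unstable : ∀ t, 0 ≤ t → ∀ v, ‖expFlow A (-t) (v - P v)‖ ≤ C * Real.exp (-β * t) * ‖v‖

/-- The vectors whose orbits decay exponentially. -/
def decaySubspace (A : Z →L[ℝ] Z) : Submodule ℝ Z where
  carrier := {v | ∃ C β : ℝ, 0 < β ∧ ∀ t, 0 ≤ t → ‖expFlow A t v‖ ≤ C * Real.exp (-β * t)}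
  zero_mem' := ⟨0, 1, one_pos, fun t _ => by simp⟩
  add_mem' := by
    rintro v w ⟨C, β, hβ, hC⟩ ⟨D, γ, hγ, hD⟩
    refine ⟨|C| + |D|, min β γ, lt_min hβ hγ, fun t ht => ?_⟩
    have h1 : Real.exp (-β * t) ≤ Real.exp (-min β γ * t) :=
      Real.exp_le_exp.mpr (by nlinarith [min_le_left β γ])
    have h2 : Real.exp (-γ * t) ≤ Real.exp (-min β γ * t) :=
      Real.exp_le_exp.mpr (by nlinarith [min_le_right β γ])
    rw [map_add]
    calc _ ≤ ‖expFlow A t v‖ + ‖expFlow A t w‖ := norm_add_le _ _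
      _ ≤ C * Real.exp (-β * t) + D * Real.exp (-γ * t) := add_le_add (hC t ht) (hD t ht)
      _ ≤ |C| * Real.exp (-min β γ * t) + |D| * Real.exp (-min β γ * t) := by
          gcongr <;> exact le_abs_self _
      _ = _ := by ring
  smul_mem' := by
    rintro a v ⟨C, β, hβ, hC⟩
    refine ⟨‖a‖ * C, β, hβ, fun t ht => ?_⟩
    rw [map_smul, norm_smul, mul_assoc]; gcongr; exact hC t ht

theorem expFlow_mem_decaySubspace {A : Z →L[ℝ] Z} {v : Z} (hv : v ∈ decaySubspace A) (s : ℝ) :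
    expFlow A s v ∈ decaySubspace A := by
  obtain ⟨C, β, hβ, hC⟩ := hv
  refine ⟨‖expFlow A s‖ * C, β, hβ, fun t ht => ?_⟩
  rw [← mul_apply_eq_comp, ← expFlow_add, add_comm, expFlow_add,
    mul_apply_eq_comp, mul_assoc]
  exact ((expFlow A s).le_opNorm _).trans (by gcongr; exact hC t ht)

/-- Each decaying vector has its own constants; expansion in a finite basis of the subspace makes
them common. -/
theorem exists_uniform_decay [FiniteDimensional ℝ Z] (A : Z →L[ℝ] Z) :
    ∃ C β : ℝ, 0 < β ∧ 0 ≤ C ∧ ∀ v ∈ decaySubspace A, ∀ t, 0 ≤ t →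
      ‖expFlow A t v‖ ≤ C * Real.exp (-β * t) * ‖v‖ := by
  set b := Module.finBasis ℝ (decaySubspace A)
  choose C β hβ hC using fun i => (b i).2
  obtain ⟨β₀, hβ₀, hle⟩ : ∃ β₀ > 0, ∀ i, β₀ ≤ β i := by
    rcases isEmpty_or_nonempty (Fin (Module.finrank ℝ (decaySubspace A))) with h | h
    · exact ⟨1, one_pos, fun i => isEmptyElim i⟩
    · obtain ⟨i, hi⟩ := Finite.exists_min β
      exact ⟨β i, hβ i, hi⟩
  set e := b.equivFunL.toContinuousLinearMap
  refine ⟨∑ i, |C i| * ‖e‖, β₀, hβ₀, by positivity, fun v hv t ht => ?_⟩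
  have hsum : v = ∑ i, (e ⟨v, hv⟩ i) • (b i : Z) := by
    have := b.sum_equivFun ⟨v, hv⟩
    calc v = ((∑ i, b.equivFun ⟨v, hv⟩ i • b i : decaySubspace A) : Z) := by rw [this]
      _ = _ := by rw [Submodule.coe_sum]; rfl
  have hnorm : ∀ i, ‖e ⟨v, hv⟩ i‖ ≤ ‖e‖ * ‖v‖ := fun i =>
    (norm_le_pi_norm _ i).trans (e.le_opNorm ⟨v, hv⟩)
  rw [Finset.sum_mul, Finset.sum_mul]
  calc ‖expFlow A t v‖ = ‖∑ i, (e ⟨v, hv⟩ i) • expFlow A t (b i : Z)‖ := by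
        conv_lhs => rw [hsum]
        rw [map_sum]; simp only [map_smul]
    _ ≤ _ := norm_sum_le_of_le _ fun i _ => by
        rw [norm_smul]
        have h1 : ‖expFlow A t (b i : Z)‖ ≤ |C i| * Real.exp (-β₀ * t) :=
          (hC i t ht).trans (by
            gcongr
            · exact le_abs_self _
            · exact hle i)
        calc _ ≤ (‖e‖ * ‖v‖) * (|C i| * Real.exp (-β₀ * t)) := by
              gcongr; exact hnorm i
          _ = _ := by ring

/-- The projection along the backward decaying vectors onto the forward decaying ones commutes with
the flow because both subspaces are invariant. Only their spanning has to be assumed. -/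
theorem exists_dichotomy [FiniteDimensional ℝ Z] {A : Z →L[ℝ] Z}
    (h : decaySubspace A ⊔ decaySubspace (-A) = ⊤) :
    ∃ P C β, Dichotomy A P C β ∧ (∀ v ∈ decaySubspace A, P v = v) ∧
      (∀ v ∈ decaySubspace (-A), P v = 0) ∧ ∀ v, P v ∈ decaySubspace A := by
  obtain ⟨C₁, β₁, hβ₁, hC₁, h₁⟩ := exists_uniform_decay A
  obtain ⟨C₂, β₂, hβ₂, hC₂, h₂⟩ := exists_uniform_decay (-A)
  -- If `v` decays in both directions, going forward to time `t` and back bounds `v` by a multiple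
  -- of `e^{-β₁ t}`.
  have hdisj : Disjoint (decaySubspace A) (decaySubspace (-A)) := by
    rw [Submodule.disjoint_def]
    intro v hv hv'
    have hb : ∀ t, 0 ≤ t → ‖v‖ ≤ C₂ * C₁ * ‖v‖ * Real.exp (-β₁ * t) := by
      intro t ht
      have h3 := h₂ (expFlow A t v) (by
        rw [show t = -(-t) by ring, ← expFlow_neg_left]
        exact expFlow_mem_decaySubspace hv' _) t ht
      rw [expFlow_neg_left, expFlow_neg_apply] at h3
      have h4 : Real.exp (-β₂ * t) ≤ 1 := Real.exp_le_one_iff.mpr (by nlinarith)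
      calc ‖v‖ ≤ C₂ * Real.exp (-β₂ * t) * ‖expFlow A t v‖ := h3
        _ ≤ C₂ * 1 * (C₁ * Real.exp (-β₁ * t) * ‖v‖) := by
            gcongr; exact h₁ v hv t ht
        _ = _ := by ring
    have hlim : Tendsto (fun t : ℝ => C₂ * C₁ * ‖v‖ * Real.exp (-β₁ * t)) atTop
        (𝓝 (C₂ * C₁ * ‖v‖ * 0)) := by
      refine Tendsto.const_mul _ (Real.tendsto_exp_atBot.comp ?_)
      exact tendsto_id.const_mul_atTop_of_neg (by linarith)
    have := ge_of_tendsto hlim ((eventually_ge_atTop 0).mono hb)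
    rw [mul_zero] at this
    exact norm_le_zero_iff.mp this
  have hc : IsCompl (decaySubspace A) (decaySubspace (-A)) := ⟨hdisj, codisjoint_iff.mpr h⟩
  set P₀ := (decaySubspace A).projection (decaySubspace (-A)) hc with hP₀
  set P : Z →L[ℝ] Z := LinearMap.toContinuousLinearMap P₀ with hP
  have hPv : ∀ v, P v = P₀ v := fun v => rfl
  have hmem : ∀ v, P v ∈ decaySubspace A := fun v => Submodule.projection_apply_mem hc v
  have hfix : ∀ v ∈ decaySubspace A, P v = v := fun v hv =>
    Submodule.projection_apply_of_mem_left hc hv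
  have hmem' : ∀ v, v - P v ∈ decaySubspace (-A) := by
    intro v
    rw [← Submodule.projection_apply_eq_zero_iff hc, map_sub, ← hP₀, ← hPv, ← hPv,
      hfix _ (hmem v), sub_self]
  refine ⟨P, max (C₁ * ‖P‖) (C₂ * (1 + ‖P‖)), min β₁ β₂, ⟨lt_min hβ₁ hβ₂, by positivity,
    fun v => hfix _ (hmem v), fun t v => ?_, fun t ht v => ?_, fun t ht v => ?_⟩, hfix,
    fun v hv => Submodule.projection_apply_of_mem_right hc hv, hmem⟩
  · have e1 : P (expFlow A t (P v)) = expFlow A t (P v) :=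
      hfix _ (expFlow_mem_decaySubspace (hmem v) t)
    have e2 : P (expFlow A t (v - P v)) = 0 := by
      rw [hPv, hP₀, Submodule.projection_apply_eq_zero_iff hc, show t = -(-t) by ring,
        ← expFlow_neg_left]
      exact expFlow_mem_decaySubspace (hmem' v) _
    rw [map_sub, map_sub, e1] at e2
    exact sub_eq_zero.mp e2
  · calc _ ≤ C₁ * Real.exp (-β₁ * t) * ‖P v‖ := h₁ _ (hmem v) t ht
      _ ≤ C₁ * Real.exp (-min β₁ β₂ * t) * (‖P‖ * ‖v‖) := by
          gcongr
          · exact min_le_left _ _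
          · exact P.le_opNorm v
      _ = (C₁ * ‖P‖) * Real.exp (-min β₁ β₂ * t) * ‖v‖ := by ring
      _ ≤ _ := by gcongr; exact le_max_left _ _
  · rw [← expFlow_neg_left]
    calc _ ≤ C₂ * Real.exp (-β₂ * t) * ‖v - P v‖ := h₂ _ (hmem' v) t ht
      _ ≤ C₂ * Real.exp (-min β₁ β₂ * t) * (‖v‖ + ‖P‖ * ‖v‖) := by
          gcongr
          · exact min_le_right _ _
          · exact (norm_sub_le _ _).trans (by gcongr; exact P.le_opNorm v)
      _ = (C₂ * (1 + ‖P‖)) * Real.exp (-min β₁ β₂ * t) * ‖v‖ := by ring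
      _ ≤ _ := by gcongr; exact le_max_right _ _

/-- The bounded solution of `u' = A u + n` on `[0, ∞)` with `P (u 0) = 0`. -/
def greenSol (A P : Z →L[ℝ] Z) (n : ℝ → Z) (z : ℝ) : Z :=
  expFlow A z ((∫ s in (0 : ℝ)..z, expFlow A (-s) (n s)) -
    ∫ s in Ioi (0 : ℝ), expFlow A (-s) (n s - P (n s)))

variable {A P : Z →L[ℝ] Z} {C β : ℝ} {n : ℝ → Z} {N : ℝ}

theorem continuous_expFlow_neg_apply (hn : Continuous n) :
    Continuous fun s => expFlow A (-s) (n s) :=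
  ((continuous_expFlow A).comp continuous_neg).clm_apply hn

theorem Dichotomy.integrableOn (h : Dichotomy A P C β) (hn : Continuous n)
    (hN : ∀ s, ‖n s‖ ≤ N) (z : ℝ) (hz : 0 ≤ z) :
    MeasureTheory.IntegrableOn (fun s => expFlow A (-s) (n s - P (n s))) (Ioi z) := by
  have hc : Continuous fun s => expFlow A (-s) (n s - P (n s)) :=
    continuous_expFlow_neg_apply (hn.sub (P.continuous.comp hn))
  refine MeasureTheory.Integrable.mono' (g := fun s => C * Real.exp (-β * s) * N)
    (((exp_neg_integrableOn_Ioi z h.pos).const_mul C).mul_const N) hc.aestronglyMeasurable ?_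
  refine (MeasureTheory.ae_restrict_iff' measurableSet_Ioi).mpr (Eventually.of_forall fun s hs => ?_)
  have hs : z < s := hs
  have := h.nonneg
  exact (h.unstable s (by linarith) _).trans (by gcongr; exact hN s)

theorem hasDerivAt_greenSol (hn : Continuous n) (z : ℝ) :
    HasDerivAt (greenSol A P n) (A (greenSol A P n z) + n z) z := by
  have h1 : HasDerivAt (fun z => (∫ s in (0 : ℝ)..z, expFlow A (-s) (n s)) -
      ∫ s in Ioi (0 : ℝ), expFlow A (-s) (n s - P (n s))) (expFlow A (-z) (n z)) z := by
    refine HasDerivAt.sub_const _ ?_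
    have hc := continuous_expFlow_neg_apply (A := A) hn
    exact intervalIntegral.integral_hasDerivAt_right (hc.intervalIntegrable _ _)
      (hc.stronglyMeasurableAtFilter _ _) hc.continuousAt
  refine ((hasDerivAt_expFlow A z).clm_apply h1).congr_deriv ?_
  rw [expFlow_apply_neg]
  rfl

theorem Dichotomy.proj_greenSol_zero (h : Dichotomy A P C β) (hn : Continuous n)
    (hN : ∀ s, ‖n s‖ ≤ N) : P (greenSol A P n 0) = 0 := by
  rw [greenSol, intervalIntegral.integral_same, zero_sub, expFlow_zero]
  change P (-_) = 0
  rw [map_neg, ← ContinuousLinearMap.integral_comp_comm _ (h.integrableOn hn hN 0 le_rfl)]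
  simp [h.comm, h.idem]

/-- The integral over `(0, ∞)` cancels the unstable contribution of `(0, z)`. There remain the
stable part integrated over the past and the unstable part over the future, each bounded by `C / β *
N`. -/
theorem Dichotomy.norm_greenSol_le (h : Dichotomy A P C β) (hn : Continuous n)
    (hN : ∀ s, ‖n s‖ ≤ N) {z : ℝ} (hz : 0 ≤ z) : ‖greenSol A P n z‖ ≤ 2 * C / β * N := by
  have hN0 : 0 ≤ N := (norm_nonneg _).trans (hN 0)
  have hC := h.nonneg
  have hβ := h.pos
  have hcP : Continuous fun s => expFlow A (-s) (P (n s)) :=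
    continuous_expFlow_neg_apply (P.continuous.comp hn)
  have hcQ : Continuous fun s => expFlow A (-s) (n s - P (n s)) :=
    continuous_expFlow_neg_apply (hn.sub (P.continuous.comp hn))
  have hshift : ∀ s v, expFlow A z (expFlow A (-s) v) = expFlow A (z - s) v := fun s v => by
    rw [← mul_apply_eq_comp, ← expFlow_add, sub_eq_add_neg]
  have hsplit : greenSol A P n z = (∫ s in (0 : ℝ)..z, expFlow A (z - s) (P (n s))) -
      ∫ s in Ioi z, expFlow A (z - s) (n s - P (n s)) := by
    have e1 : ∫ s in (0 : ℝ)..z, expFlow A (-s) (n s) =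
        (∫ s in (0 : ℝ)..z, expFlow A (-s) (P (n s))) +
          ∫ s in (0 : ℝ)..z, expFlow A (-s) (n s - P (n s)) := by
      rw [← intervalIntegral.integral_add (hcP.intervalIntegrable _ _) (hcQ.intervalIntegrable _ _)]
      simp
    have e2 := intervalIntegral.integral_interval_add_Ioi (h.integrableOn hn hN 0 le_rfl)
      (h.integrableOn hn hN z hz)
    rw [greenSol, e1, ← e2, sub_add_eq_sub_sub, add_sub_cancel_right, map_sub,
      ← ContinuousLinearMap.intervalIntegral_comp_comm _ (hcP.intervalIntegrable _ _),
      ← ContinuousLinearMap.integral_comp_comm _ (h.integrableOn hn hN z hz)]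
    simp only [hshift]
  have b1 : ‖∫ s in (0 : ℝ)..z, expFlow A (z - s) (P (n s))‖ ≤ C / β * N := by
    have hle : ∀ s ∈ Ioc 0 z, ‖expFlow A (z - s) (P (n s))‖ ≤ C * Real.exp (-β * (z - s)) * N := by
      intro s hs
      exact (h.stable (z - s) (by linarith [hs.2]) _).trans (by gcongr; exact hN s)
    have hint : Continuous fun s => C * Real.exp (-β * (z - s)) * N := by fun_prop
    refine (intervalIntegral.norm_integral_le_of_norm_le hz
      (Eventually.of_forall hle) (hint.intervalIntegrable _ _)).trans ?_
    have hder : ∀ s ∈ uIcc 0 z, HasDerivAt (fun s => C / β * Real.exp (-β * (z - s)) * N)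
        (C * Real.exp (-β * (z - s)) * N) s := by
      intro s _
      have h1 : HasDerivAt (fun s => -β * (z - s)) β s := by
        have := ((hasDerivAt_id s).const_sub z).const_mul (-β)
        simpa using this
      refine ((h1.exp.const_mul (C / β)).mul_const N).congr_deriv ?_
      field_simp
    rw [intervalIntegral.integral_eq_sub_of_hasDerivAt hder (hint.intervalIntegrable _ _)]
    have : 0 ≤ C / β * Real.exp (-β * (z - 0)) * N := by positivity
    simp only [sub_self, mul_zero, Real.exp_zero, mul_one]
    linarith
  have b2 : ‖∫ s in Ioi z, expFlow A (z - s) (n s - P (n s))‖ ≤ C / β * N := by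
    have hle : ∀ s ∈ Ioi z, ‖expFlow A (z - s) (n s - P (n s))‖ ≤
        (C * Real.exp (β * z) * N) * Real.exp (-β * s) := by
      intro s hs
      have hs : z < s := hs
      have := h.unstable (s - z) (by linarith) (n s)
      rw [neg_sub] at this
      refine this.trans ?_
      have he : Real.exp (-β * (s - z)) = Real.exp (β * z) * Real.exp (-β * s) := by
        rw [← Real.exp_add]; congr 1; ring
      rw [he]
      calc _ ≤ C * (Real.exp (β * z) * Real.exp (-β * s)) * N := by gcongr; exact hN s
        _ = _ := by ring
    refine (MeasureTheory.norm_integral_le_of_norm_le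
      ((exp_neg_integrableOn_Ioi z hβ).const_mul _)
      ((MeasureTheory.ae_restrict_iff' measurableSet_Ioi).mpr (Eventually.of_forall hle))).trans ?_
    rw [MeasureTheory.integral_const_mul, integral_exp_mul_Ioi (by linarith)]
    have he : Real.exp (β * z) * Real.exp (-β * z) = 1 := by rw [← Real.exp_add]; simp
    apply le_of_eq
    calc _ = C * N / β * (Real.exp (β * z) * Real.exp (-β * z)) := by ring
      _ = _ := by rw [he]; ring
  rw [hsplit]
  calc _ ≤ _ := norm_sub_le _ _
    _ ≤ C / β * N + C / β * N := add_le_add b1 b2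
    _ = _ := by ring

/-- A bounded solution of `u' = A u + n` is determined by `P (u 0)`. -/
theorem Dichotomy.eq_of_bounded (h : Dichotomy A P C β) (hn : Continuous n)
    (hN : ∀ s, ‖n s‖ ≤ N) {u : ℝ → Z}
    (hu : ∀ z, 0 ≤ z → HasDerivWithinAt u (A (u z) + n z) (Ici 0) z) {D : ℝ}
    (hD : ∀ z, 0 ≤ z → ‖u z‖ ≤ D) {z : ℝ} (hz : 0 ≤ z) :
    u z = expFlow A z (P (u 0)) + greenSol A P n z := by
  set d : ℝ → Z := fun z => u z - expFlow A z (P (u 0)) - greenSol A P n z with hd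
  have hd' : ∀ z, 0 ≤ z → HasDerivWithinAt d (A (d z)) (Ici 0) z := by
    intro z hz
    refine (((hu z hz).sub (hasDerivAt_expFlow_apply A _ z).hasDerivWithinAt).sub
      (hasDerivAt_greenSol hn z).hasDerivWithinAt).congr_deriv ?_
    simp only [hd, map_sub]; abel
  have hP0 : P (d 0) = 0 := by
    simp only [hd, map_sub, h.proj_greenSol_zero hn hN, expFlow_zero]
    simp [h.idem]
  have hC := h.nonneg
  have hβ := h.pos
  have hdb : ∀ z, 0 ≤ z → ‖d z‖ ≤ D + C * ‖u 0‖ + 2 * C / β * N := by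
    intro z hz
    have h1 : ‖expFlow A z (P (u 0))‖ ≤ C * ‖u 0‖ := by
      refine (h.stable z hz _).trans ?_
      have : Real.exp (-β * z) ≤ 1 := Real.exp_le_one_iff.mpr (by nlinarith)
      calc _ ≤ C * 1 * ‖u 0‖ := by gcongr
        _ = _ := by ring
    calc ‖d z‖ ≤ ‖u z‖ + ‖expFlow A z (P (u 0))‖ + ‖greenSol A P n z‖ :=
          (norm_sub_le _ _).trans (by gcongr; exact norm_sub_le _ _)
      _ ≤ _ := by gcongr; exacts [hD z hz, h.norm_greenSol_le hn hN hz]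
  -- The difference is a bounded homogeneous solution without stable component; pulled back from
  -- time `t` it is `O(e^{-βt})`.
  have h0 : d 0 = 0 := by
    set M := D + C * ‖u 0‖ + 2 * C / β * N
    have hb : ∀ t, 0 ≤ t → ‖d 0‖ ≤ C * M * Real.exp (-β * t) := by
      intro t ht
      have h1 := eq_expFlow_of_hasDerivWithinAt hd' ht
      have h2 := h.unstable t ht (d t)
      have h3 : P (d t) = 0 := by rw [h1, h.comm, hP0, map_zero]
      rw [h3, sub_zero] at h2
      rw [h1, expFlow_neg_apply, ← h1] at h2
      refine h2.trans ?_
      calc _ ≤ C * Real.exp (-β * t) * M := by gcongr; exact hdb t ht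
        _ = _ := by ring
    have hlim : Tendsto (fun t : ℝ => C * M * Real.exp (-β * t)) atTop (𝓝 (C * M * 0)) := by
      refine Tendsto.const_mul _ (Real.tendsto_exp_atBot.comp ?_)
      exact tendsto_id.const_mul_atTop_of_neg (by linarith)
    have := ge_of_tendsto hlim ((eventually_ge_atTop 0).mono hb)
    rw [mul_zero] at this
    exact norm_le_zero_iff.mp this
  have h1 := eq_expFlow_of_hasDerivWithinAt hd' hz
  rw [h0, map_zero] at h1
  have h2 : u z - expFlow A z (P (u 0)) - greenSol A P n z = 0 := h1
  rw [sub_sub, sub_eq_zero] at h2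
  exact h2

end Dichotomy

end

section

/-! ### Superposition operators on bounded continuous functions -/

section Superposition

universe u

open scoped BoundedContinuousFunction

variable {T : Type*} [TopologicalSpace T]

theorem norm_bilin_apply_le {E F G : Type*} [NormedAddCommGroup E] [NormedSpace ℝ E]
    [NormedAddCommGroup F] [NormedSpace ℝ F] [NormedAddCommGroup G] [NormedSpace ℝ G]
    (B : E →L[ℝ] F →L[ℝ] G) (u : T →ᵇ E) (v : T →ᵇ F) (t : T) :
    ‖B (u t) (v t)‖ ≤ ‖B‖ * ‖u‖ * ‖v‖ :=
  (B.le_opNorm₂ _ _).trans (by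
    gcongr
    · exact u.norm_coe_le_norm t
    · exact v.norm_coe_le_norm t)

/-- Pointwise application of a bounded bilinear map. -/
def bcfBilin {E F G : Type*} [NormedAddCommGroup E] [NormedSpace ℝ E] [NormedAddCommGroup F]
    [NormedSpace ℝ F] [NormedAddCommGroup G] [NormedSpace ℝ G] (B : E →L[ℝ] F →L[ℝ] G) :
    (T →ᵇ E) →L[ℝ] (T →ᵇ F) →L[ℝ] (T →ᵇ G) :=
  LinearMap.mkContinuous₂
    (LinearMap.mk₂ ℝ (fun (u : T →ᵇ E) (v : T →ᵇ F) =>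
        BoundedContinuousFunction.ofNormedAddCommGroup (fun t => B (u t) (v t))
          ((B.continuous.comp u.continuous).clm_apply v.continuous) (‖B‖ * ‖u‖ * ‖v‖)
          (norm_bilin_apply_le B u v))
      (fun u u' v => by ext t; simp) (fun c u v => by ext t; simp)
      (fun u v v' => by ext t; simp) (fun c u v => by ext t; simp))
    ‖B‖ (fun u v => BoundedContinuousFunction.norm_ofNormedAddCommGroup_le _ (by positivity)
      (norm_bilin_apply_le B u v))

@[simp] theorem bcfBilin_apply {E F G : Type*} [NormedAddCommGroup E] [NormedSpace ℝ E]
    [NormedAddCommGroup F] [NormedSpace ℝ F] [NormedAddCommGroup G] [NormedSpace ℝ G]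
    (B : E →L[ℝ] F →L[ℝ] G) (u : T →ᵇ E) (v : T →ᵇ F) (t : T) :
    bcfBilin B u v t = B (u t) (v t) := rfl

/-- The constant functions, as a continuous linear map. -/
def bcfConst (T : Type*) [TopologicalSpace T] (E : Type*) [NormedAddCommGroup E] [NormedSpace ℝ E] :
    E →L[ℝ] (T →ᵇ E) :=
  LinearMap.mkContinuous
    { toFun := fun e => BoundedContinuousFunction.const T e
      map_add' := fun x y => by ext; simp
      map_smul' := fun c x => by ext; simp } 1
    (fun e => by simpa using BoundedContinuousFunction.norm_const_le e)

@[simp] theorem bcfConst_apply {E : Type*} [NormedAddCommGroup E] [NormedSpace ℝ E] (e : E) (t : T) :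
    bcfConst T E e t = e := rfl

variable {E F : Type*} [NormedAddCommGroup E] [NormedSpace ℝ E] [FiniteDimensional ℝ E]
  [NormedAddCommGroup F] [NormedSpace ℝ F]

/-- The superposition operator `u ↦ f ∘ u`. -/
def superpose (f : E → F) (hf : Continuous f) (u : T →ᵇ E) : T →ᵇ F where
  toFun := fun t => f (u t)
  continuous_toFun := hf.comp u.continuous
  map_bounded' := by
    have : ProperSpace E := FiniteDimensional.proper_real E
    have hK := ((isCompact_closedBall (0 : E) ‖u‖).image hf).isBounded
    obtain ⟨C, hC⟩ := Metric.isBounded_iff.mp hK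
    refine ⟨C, fun s t => hC (mem_image_of_mem _ ?_) (mem_image_of_mem _ ?_)⟩ <;>
    · rw [mem_closedBall_zero_iff]; exact u.norm_coe_le_norm _

@[simp] theorem superpose_apply (f : E → F) (hf : Continuous f) (u : T →ᵇ E) (t : T) :
    superpose f hf u t = f (u t) := rfl

theorem continuous_superpose (f : E → F) (hf : Continuous f) :
    Continuous (superpose f hf : (T →ᵇ E) → (T →ᵇ F)) := by
  have : ProperSpace E := FiniteDimensional.proper_real E
  rw [Metric.continuous_iff]
  intro u ε hε
  have hK := (isCompact_closedBall (0 : E) (‖u‖ + 1)).uniformContinuousOn_of_continuous hf.continuousOn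
  obtain ⟨δ, hδ, h⟩ := Metric.uniformContinuousOn_iff.mp hK (ε / 2) (half_pos hε)
  refine ⟨min δ 1, lt_min hδ one_pos, fun v hv => ?_⟩
  refine lt_of_le_of_lt ((BoundedContinuousFunction.dist_le (half_pos hε).le).mpr fun t => ?_)
    (half_lt_self hε)
  have hd : dist (v t) (u t) < min δ 1 := (BoundedContinuousFunction.dist_coe_le_dist t).trans_lt hv
  refine (h (v t) ?_ (u t) ?_ (hd.trans_le (min_le_left _ _))).le
  · rw [mem_closedBall_zero_iff]
    have h1 := hd.trans_le (min_le_right _ _)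
    rw [dist_eq_norm] at h1
    calc ‖v t‖ = ‖u t + (v t - u t)‖ := by simp
      _ ≤ ‖u t‖ + ‖v t - u t‖ := norm_add_le _ _
      _ ≤ _ := add_le_add (u.norm_coe_le_norm t) h1.le
  · rw [mem_closedBall_zero_iff]
    linarith [u.norm_coe_le_norm t]

/-- The derivative is pointwise multiplication by `f' ∘ u`. The remainder is uniformly small because
`f'` is uniformly continuous on a ball containing the values of `u` and of its perturbations. -/
theorem hasFDerivAt_superpose {f : E → F} (hf : ContDiff ℝ 1 f) (u : T →ᵇ E) :
    HasFDerivAt (superpose f hf.continuous : (T →ᵇ E) → (T →ᵇ F))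
      (bcfBilin (ContinuousLinearMap.id ℝ (E →L[ℝ] F))
        (superpose (fderiv ℝ f) (hf.continuous_fderiv one_ne_zero) u)) u := by
  have : ProperSpace E := FiniteDimensional.proper_real E
  rw [hasFDerivAt_iff_isLittleO_nhds_zero, Asymptotics.isLittleO_iff]
  intro ε hε
  have hK := (isCompact_closedBall (0 : E) (‖u‖ + 1)).uniformContinuousOn_of_continuous
    (hf.continuous_fderiv one_ne_zero).continuousOn
  obtain ⟨δ, hδ, h⟩ := Metric.uniformContinuousOn_iff.mp hK ε hε
  filter_upwards [Metric.ball_mem_nhds (0 : T →ᵇ E) (lt_min hδ one_pos)] with v hv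
  rw [mem_ball_zero_iff] at hv
  refine (BoundedContinuousFunction.norm_le (by positivity)).mpr fun t => ?_
  have hvt := (v.norm_coe_le_norm t).trans_lt hv
  have hb : ∀ x ∈ Metric.ball (u t) (min δ 1), ‖fderiv ℝ f x - fderiv ℝ f (u t)‖ ≤ ε := by
    intro x hx
    have hx1 := (Metric.mem_ball.mp hx).trans_le (min_le_right _ _)
    rw [← dist_eq_norm]
    refine (h x ?_ (u t) ?_ ((Metric.mem_ball.mp hx).trans_le (min_le_left _ _))).le
    · rw [mem_closedBall_zero_iff]
      rw [dist_eq_norm] at hx1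
      calc ‖x‖ = ‖u t + (x - u t)‖ := by simp
        _ ≤ ‖u t‖ + ‖x - u t‖ := norm_add_le _ _
        _ ≤ _ := add_le_add (u.norm_coe_le_norm t) hx1.le
    · rw [mem_closedBall_zero_iff]
      linarith [u.norm_coe_le_norm t]
  have hmv := (convex_ball (u t) (min δ 1)).norm_image_sub_le_of_norm_fderiv_le' (𝕜 := ℝ)
    (fun x _ => (hf.differentiable one_ne_zero) x) hb
    (Metric.mem_ball_self (lt_min hδ one_pos)) (y := u t + v t) (by simpa using hvt)
  rw [add_sub_cancel_left] at hmv
  have hle : ε * ‖v t‖ ≤ ε * ‖v‖ := by gcongr; exact v.norm_coe_le_norm t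
  exact le_trans hmv hle

/-- The derivative is again a superposition operator, that of `fderiv ℝ f`, which gives an induction
on the order. The target changes from `F` to `E →L[ℝ] F` at each step, hence the quantification over
`F` and the common universe. -/
theorem contDiff_superpose_nat {E : Type u} [NormedAddCommGroup E] [NormedSpace ℝ E]
    [FiniteDimensional ℝ E] (n : ℕ) : ∀ {F : Type u} [NormedAddCommGroup F] [NormedSpace ℝ F]
    {f : E → F} (hf : ContDiff ℝ n f),
    ContDiff ℝ n (superpose f hf.continuous : (T →ᵇ E) → (T →ᵇ F)) := by
  induction n with
  | zero =>
    intro F _ _ f hf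
    exact contDiff_zero.mpr (continuous_superpose f hf.continuous)
  | succ n ih =>
    intro F _ _ f hf
    have hf1 : ContDiff ℝ 1 f := hf.of_le (by norm_cast; omega)
    have hf' : ContDiff ℝ n (fderiv ℝ f) := hf.fderiv_right (by norm_cast)
    have hfc := hf.continuous
    change ContDiff ℝ _ (superpose f hfc)
    rw [Nat.cast_add, Nat.cast_one, contDiff_succ_iff_hasFDerivAt]
    exact ⟨_, (bcfBilin (ContinuousLinearMap.id ℝ (E →L[ℝ] F))).contDiff.comp (ih hf'),
      hasFDerivAt_superpose hf1⟩

theorem contDiff_superpose {E F : Type u} [NormedAddCommGroup E] [NormedSpace ℝ E]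
    [FiniteDimensional ℝ E] [NormedAddCommGroup F] [NormedSpace ℝ F]
    {f : E → F} (hf : ContDiff ℝ ∞ f) :
    ContDiff ℝ ∞ (superpose f hf.continuous : (T →ᵇ E) → (T →ᵇ F)) :=
  contDiff_infty.mpr fun n => contDiff_superpose_nat n (contDiff_infty.mp hf n)

end Superposition

/-! ### The Green operator -/

section Green

open scoped BoundedContinuousFunction NNReal

variable {Z : Type*} [NormedAddCommGroup Z] [NormedSpace ℝ Z] [CompleteSpace Z]
  {A P : Z →L[ℝ] Z} {C β : ℝ}

/-- Extension of a function on `[0, ∞)` to `ℝ`, constant on `(-∞, 0]`. -/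
def extendReal (n : ℝ≥0 →ᵇ Z) (s : ℝ) : Z := n s.toNNReal

theorem continuous_extendReal (n : ℝ≥0 →ᵇ Z) : Continuous (extendReal n) :=
  n.continuous.comp continuous_real_toNNReal

theorem norm_extendReal_le (n : ℝ≥0 →ᵇ Z) (s : ℝ) : ‖extendReal n s‖ ≤ ‖n‖ := n.norm_coe_le_norm _

theorem Dichotomy.greenSol_add (h : Dichotomy A P C β) (n n' : ℝ≥0 →ᵇ Z) (z : ℝ) :
    greenSol A P (extendReal (n + n')) z =
      greenSol A P (extendReal n) z + greenSol A P (extendReal n') z := by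
  have e : extendReal (n + n') = fun s => extendReal n s + extendReal n' s := rfl
  rw [greenSol, greenSol, greenSol, ← map_add, e]
  congr 1
  have i1 := (continuous_expFlow_neg_apply (A := A) (continuous_extendReal n)).intervalIntegrable
    (μ := MeasureTheory.volume) 0 z
  have i2 := (continuous_expFlow_neg_apply (A := A) (continuous_extendReal n')).intervalIntegrable
    (μ := MeasureTheory.volume) 0 z
  have j1 := h.integrableOn (continuous_extendReal n) (norm_extendReal_le n) 0 le_rfl
  have j2 := h.integrableOn (continuous_extendReal n') (norm_extendReal_le n') 0 le_rfl
  rw [sub_add_sub_comm, ← intervalIntegral.integral_add i1 i2, ← MeasureTheory.integral_add j1 j2]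
  simp only [map_add, map_sub]
  congr 2
  ext s
  abel

theorem greenSol_smul (c : ℝ) (n : ℝ≥0 →ᵇ Z) (z : ℝ) :
    greenSol A P (extendReal (c • n)) z = c • greenSol A P (extendReal n) z := by
  have e : extendReal (c • n) = fun s => c • extendReal n s := rfl
  rw [greenSol, greenSol, ← map_smul, e, smul_sub, ← intervalIntegral.integral_smul,
    ← MeasureTheory.integral_smul]
  simp only [map_smul, ← smul_sub]

/-- The operator `n ↦ greenSol A P n` on bounded continuous functions. -/
def greenOp (h : Dichotomy A P C β) : (ℝ≥0 →ᵇ Z) →L[ℝ] (ℝ≥0 →ᵇ Z) :=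
  LinearMap.mkContinuous
    { toFun := fun n => BoundedContinuousFunction.ofNormedAddCommGroup
        (fun z : ℝ≥0 => greenSol A P (extendReal n) z)
        ((continuous_iff_continuousAt.mpr fun z =>
          (hasDerivAt_greenSol (continuous_extendReal n) z).continuousAt).comp NNReal.continuous_coe)
        (2 * C / β * ‖n‖)
        (fun z => h.norm_greenSol_le (continuous_extendReal n) (norm_extendReal_le n) z.2)
      map_add' := fun n n' => by ext z; exact h.greenSol_add n n' z
      map_smul' := fun c n => by ext z; exact greenSol_smul c n z }
    (2 * C / β) (fun n => BoundedContinuousFunction.norm_ofNormedAddCommGroup_le _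
      (by have := h.nonneg; have := h.pos; positivity)
      (fun z => h.norm_greenSol_le (continuous_extendReal n) (norm_extendReal_le n) z.2))

theorem greenOp_apply (h : Dichotomy A P C β) (n : ℝ≥0 →ᵇ Z) (z : ℝ≥0) :
    greenOp h n z = greenSol A P (extendReal n) z := rfl

theorem Dichotomy.norm_stable_le (h : Dichotomy A P C β) (v : Z) {z : ℝ} (hz : 0 ≤ z) :
    ‖expFlow A z (P v)‖ ≤ C * ‖v‖ := by
  refine (h.stable z hz v).trans ?_
  have h1 : Real.exp (-β * z) ≤ 1 := Real.exp_le_one_iff.mpr (by nlinarith [h.pos])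
  have := h.nonneg
  calc _ ≤ C * 1 * ‖v‖ := by gcongr
    _ = _ := by ring

/-- The operator sending `v` to the free solution `e^{zA} P v`. -/
def freeOp (h : Dichotomy A P C β) : Z →L[ℝ] (ℝ≥0 →ᵇ Z) :=
  LinearMap.mkContinuous
    { toFun := fun v => BoundedContinuousFunction.ofNormedAddCommGroup
        (fun z : ℝ≥0 => expFlow A z (P v))
        (((continuous_expFlow A).comp NNReal.continuous_coe).clm_apply continuous_const)
        (C * ‖v‖) (fun z => h.norm_stable_le v z.2)
      map_add' := fun v v' => by ext z; simp
      map_smul' := fun c v => by ext z; simp }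
    C (fun v => BoundedContinuousFunction.norm_ofNormedAddCommGroup_le _
      (by have := h.nonneg; positivity) (fun z => h.norm_stable_le v z.2))

theorem freeOp_apply (h : Dichotomy A P C β) (v : Z) (z : ℝ≥0) :
    freeOp h v z = expFlow A z (P v) := rfl

/-- The bounded functions `u = e^{zA} P v + greenOp n` solve `u' = A u + n`. -/
theorem hasDerivWithinAt_of_eq_freeOp_add_greenOp {h : Dichotomy A P C β} {u n : ℝ≥0 →ᵇ Z} {v : Z}
    (hu : u = freeOp h v + greenOp h n) {z : ℝ} (hz : 0 ≤ z) :
    HasDerivWithinAt (extendReal u) (A (extendReal u z) + extendReal n z) (Ici 0) z := by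
  have e : ∀ z, 0 ≤ z → extendReal u z = expFlow A z (P v) + greenSol A P (extendReal n) z := by
    intro z hz
    rw [extendReal, hu, BoundedContinuousFunction.add_apply, freeOp_apply, greenOp_apply,
      Real.coe_toNNReal z hz]
  have h1 := (hasDerivAt_expFlow_apply A (P v) z).add
    (hasDerivAt_greenSol (A := A) (P := P) (continuous_extendReal n) z)
  refine (h1.hasDerivWithinAt.congr (fun s hs => e s hs) (e z hz)).congr_deriv ?_
  rw [e z hz, map_add]; abel

theorem proj_of_eq_freeOp_add_greenOp {h : Dichotomy A P C β} {u n : ℝ≥0 →ᵇ Z} {v : Z}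
    (hu : u = freeOp h v + greenOp h n) : P (u 0) = P v := by
  rw [hu, BoundedContinuousFunction.add_apply, freeOp_apply, greenOp_apply, NNReal.coe_zero, map_add,
    h.proj_greenSol_zero (continuous_extendReal n) (norm_extendReal_le n), expFlow_zero]
  simp [h.idem]

/-- The bounded solutions are exactly the solutions of this integral equation, in which the initial
value enters only through its stable component. The differential equation thereby becomes an
equation in a Banach space. -/
theorem eq_freeOp_add_greenOp (h : Dichotomy A P C β) {u n : ℝ≥0 →ᵇ Z} 
    (hu : ∀ z, 0 ≤ z → HasDerivWithinAt (extendReal u) (A (extendReal u z) + extendReal n z) (Ici 0) z) :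
    u = freeOp h (u 0) + greenOp h n := by
  ext z
  have := h.eq_of_bounded (continuous_extendReal n) (norm_extendReal_le n) hu
    (fun z _ => norm_extendReal_le u z) z.2
  simpa [extendReal, freeOp_apply, greenOp_apply] using this

end Green

end

section

/-! ### Smooth inverse functions -/

/-- The source is shrunk to the points where `F` is smooth with invertible derivative; this makes
the inverse smooth on its whole domain and not only at the image of `x₀`. -/
theorem exists_smooth_inverse {X W : Type*} [NormedAddCommGroup X] [NormedSpace ℝ X]
    [CompleteSpace X] [NormedAddCommGroup W] [NormedSpace ℝ W] {F : X → W} {x₀ : X}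
    {F' : X ≃L[ℝ] W} (hF : ∀ᶠ x in 𝓝 x₀, ContDiffAt ℝ ∞ F x)
    (hF' : HasFDerivAt F (F' : X →L[ℝ] W) x₀) :
    ∃ e : OpenPartialHomeomorph X W, x₀ ∈ e.source ∧ (∀ x, e x = F x) ∧
      ContDiffOn ℝ ∞ e.symm e.target := by
  have h0 : ContDiffAt ℝ ∞ F x₀ := hF.self_of_nhds
  set e₀ := h0.toOpenPartialHomeomorph F hF' (by simp) with he₀
  have hcont : ContinuousAt (fderiv ℝ F) x₀ :=
    (h0.fderiv_right (m := ∞) (by simp)).continuousAt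
  have hinv : ∀ᶠ x in 𝓝 x₀, fderiv ℝ F x ∈ range ((↑) : (X ≃L[ℝ] W) → (X →L[ℝ] W)) := by
    apply hcont
    rw [hF'.fderiv]
    exact ContinuousLinearEquiv.nhds F'
  obtain ⟨s, hs, hso, hxs⟩ := eventually_nhds_iff.mp (hF.and hinv)
  refine ⟨e₀.restrOpen s hso, ⟨h0.mem_toOpenPartialHomeomorph_source hF' (by simp), hxs⟩, fun x => rfl, ?_⟩
  intro y hy
  set e := e₀.restrOpen s hso
  have hx : e.symm y ∈ e.source := e.map_target hy
  obtain ⟨hd, F'', hF''⟩ := hs _ hx.2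
  refine (e.contDiffAt_symm (f₀' := F'') hy ?_ hd).contDiffWithinAt
  rw [hF'']
  exact (hd.differentiableAt (by simp)).hasFDerivAt

/-- Implicit functions, smooth on a neighbourhood. -/
theorem exists_smooth_implicit {Θ X : Type*} [NormedAddCommGroup Θ] [NormedSpace ℝ Θ]
    [CompleteSpace Θ] [NormedAddCommGroup X] [NormedSpace ℝ X] [CompleteSpace X]
    {Φ : Θ × X → X} {θ₀ : Θ} {x₀ : X} (hΦ : ContDiff ℝ ∞ Φ) (h0 : Φ (θ₀, x₀) = 0)
    {D : Θ →L[ℝ] X}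
    (hD : HasFDerivAt Φ (ContinuousLinearMap.snd ℝ Θ X - D.comp (ContinuousLinearMap.fst ℝ Θ X))
      (θ₀, x₀)) :
    ∃ (s : Set Θ) (ψ : Θ → X), IsOpen s ∧ θ₀ ∈ s ∧ ContDiffOn ℝ ∞ ψ s ∧ ψ θ₀ = x₀ ∧
      HasFDerivAt ψ D θ₀ ∧ (∀ θ ∈ s, Φ (θ, ψ θ) = 0) ∧
      ∀ᶠ v in 𝓝 (θ₀, x₀), Φ v = 0 → v.2 = ψ v.1 := by
  -- The partial derivative of `Φ` in `x` is the identity, so `(θ, x) ↦ (θ, Φ)` has an explicitly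
  -- invertible derivative.
  let L : (Θ × X) ≃L[ℝ] (Θ × X) := ContinuousLinearEquiv.equivOfInverse
    ((ContinuousLinearMap.fst ℝ Θ X).prod
      (ContinuousLinearMap.snd ℝ Θ X - D.comp (ContinuousLinearMap.fst ℝ Θ X)))
    ((ContinuousLinearMap.fst ℝ Θ X).prod
      (ContinuousLinearMap.snd ℝ Θ X + D.comp (ContinuousLinearMap.fst ℝ Θ X)))
    (fun x => by ext <;> simp) (fun x => by ext <;> simp)
  have hF : ContDiff ℝ ∞ fun v : Θ × X => (v.1, Φ v) := contDiff_fst.prodMk hΦ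
  have hF' : HasFDerivAt (fun v : Θ × X => (v.1, Φ v)) (L : (Θ × X) →L[ℝ] (Θ × X)) (θ₀, x₀) :=
    hasFDerivAt_fst.prodMk hD
  obtain ⟨e, hx, he, hsm⟩ := exists_smooth_inverse (Eventually.of_forall fun x => hF.contDiffAt) hF'
  have hbase : e (θ₀, x₀) = (θ₀, 0) := by rw [he, h0]
  have hcont : Continuous fun θ : Θ => (θ, (0 : X)) := by fun_prop
  have hy : ((θ₀, 0) : Θ × X) ∈ e.target := hbase ▸ e.map_source hx
  have hsol : ∀ θ, (θ, (0 : X)) ∈ e.target → (e.symm (θ, 0)).1 = θ ∧ Φ (e.symm (θ, 0)) = 0 := by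
    intro θ hθ
    have := e.right_inv hθ
    rw [he] at this
    exact ⟨congrArg Prod.fst this, congrArg Prod.snd this⟩
  have hψ0 : e.symm (θ₀, 0) = (θ₀, x₀) := by rw [← hbase, e.left_inv hx]
  refine ⟨(fun θ : Θ => (θ, (0 : X))) ⁻¹' e.target, fun θ => (e.symm (θ, 0)).2,
    e.open_target.preimage hcont, hy, ?_, congrArg Prod.snd hψ0, ?_, ?_, ?_⟩
  · exact contDiff_snd.comp_contDiffOn (hsm.comp
      (contDiff_id.prodMk contDiff_const).contDiffOn fun θ hθ => hθ)
  · have h1 : HasFDerivAt e.symm (L.symm : (Θ × X) →L[ℝ] (Θ × X)) (θ₀, 0) := by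
      refine e.hasFDerivAt_symm hy ?_
      rw [hψ0]
      exact hF'.congr_of_eventuallyEq (Eventually.of_forall he)
    have h2 : HasFDerivAt (fun θ : Θ => (θ, (0 : X)))
        ((ContinuousLinearMap.id ℝ Θ).prod 0) θ₀ :=
      (hasFDerivAt_id θ₀).prodMk (hasFDerivAt_const (0 : X) θ₀)
    have h3 := hasFDerivAt_snd.comp θ₀ (h1.comp θ₀ h2)
    refine h3.congr_fderiv ?_
    ext θ
    change ((ContinuousLinearMap.snd ℝ Θ X + D.comp (ContinuousLinearMap.fst ℝ Θ X)) (θ, 0)) = D θ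
    simp
  · intro θ hθ
    obtain ⟨h1, h2⟩ := hsol θ hθ
    rw [show (θ, (e.symm (θ, 0)).2) = e.symm (θ, 0) from Prod.ext h1.symm rfl]
    exact h2
  · filter_upwards [e.open_source.mem_nhds hx] with v hv hv0
    have := e.left_inv hv
    rw [he, hv0] at this
    rw [this]

/-! ### Decay of small bounded solutions -/

section Apriori

variable {Y : Type*} [NormedAddCommGroup Y] [NormedSpace ℝ Y] [CompleteSpace Y]

/-- Multiplication by `e^{δt}` would give decay, but the result is not known to be bounded. The
weight `ρ(t) = e^{δt} / (1 + s e^{δt})` is bounded, its logarithmic derivative lies in `[0, δ]`, and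
the estimate for `ρ y` does not depend on `s`. The choice `s = e^{-δz}` is made for the point `z`
where the estimate is wanted. -/
theorem Dichotomy.norm_le_of_perturbation {G P : Y →L[ℝ] Y} {C β : ℝ} (h : Dichotomy G P C β)
    {δ η : ℝ} (hδ : 0 < δ) (hsmall : 2 * C / β * (η + δ) ≤ 1 / 2) {B : ℝ → Y →L[ℝ] Y}
    (hB : ContinuousOn B (Ici 0)) (hBG : ∀ z, 0 ≤ z → ‖B z - G‖ ≤ η) {y : ℝ → Y}
    (hy : ∀ z, 0 ≤ z → HasDerivWithinAt y (B z (y z)) (Ici 0) z) {M : ℝ}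
    (hM : ∀ z, 0 ≤ z → ‖y z‖ ≤ M) {z : ℝ} (hz : 0 ≤ z) :
    ‖y z‖ ≤ 4 * C * M * Real.exp (-δ * z) := by
  have hM0 : 0 ≤ M := (norm_nonneg _).trans (hM 0 le_rfl)
  have hη0 : 0 ≤ η := (norm_nonneg _).trans (hBG 0 le_rfl)
  have hC := h.nonneg
  have hβ := h.pos
  set s := Real.exp (-δ * z) with hs
  have hs0 : 0 < s := Real.exp_pos _
  have hden : ∀ t, 0 < 1 + s * Real.exp (δ * t) := fun t => by positivity
  set ρ : ℝ → ℝ := fun t => Real.exp (δ * t) / (1 + s * Real.exp (δ * t)) with hρ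
  have hρpos : ∀ t, 0 < ρ t := fun t => div_pos (Real.exp_pos _) (hden t)
  have hρle : ∀ t, ρ t ≤ 1 / s := fun t => by
    rw [hρ, div_le_div_iff₀ (hden t) hs0]
    linarith
  set κ : ℝ → ℝ := fun t => δ / (1 + s * Real.exp (δ * t)) with hκ
  have hκ0 : ∀ t, 0 ≤ κ t := fun t => (div_pos hδ (hden t)).le
  have hκle : ∀ t, κ t ≤ δ := fun t => by
    rw [hκ]
    refine div_le_self hδ.le ?_
    have := mul_pos hs0 (Real.exp_pos (δ * t))
    linarith
  have hρ' : ∀ t, HasDerivAt ρ (κ t * ρ t) t := by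
    intro t
    have h1 : HasDerivAt (fun t => Real.exp (δ * t)) (Real.exp (δ * t) * δ) t := by
      have : HasDerivAt (fun t => δ * t) δ t := by simpa using (hasDerivAt_id t).const_mul δ
      exact this.exp
    have h2 := h1.div ((h1.const_mul s).const_add 1) (hden t).ne'
    refine h2.congr_deriv ?_
    have := (hden t).ne'
    simp only [hκ, hρ]
    field_simp
    ring
  have hyc : ContinuousOn y (Ici 0) := fun t ht => (hy t ht).continuousWithinAt
  set u : ℝ → Y := fun t => ρ t • y t with hu
  set m : ℝ → Y := fun t => (B t - G) (u t) + κ t • u t with hm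
  have hu' : ∀ t, 0 ≤ t → HasDerivWithinAt u (G (u t) + m t) (Ici 0) t := by
    intro t ht
    refine ((hρ' t).hasDerivWithinAt.smul (hy t ht)).congr_deriv ?_
    simp only [hm, hu, sub_apply, map_smul, smul_smul]
    module
  have hρc : Continuous ρ := continuous_iff_continuousAt.mpr fun t => (hρ' t).continuousAt
  have hκc : Continuous κ := by
    refine continuous_const.div (by fun_prop) fun t => (hden t).ne'
  have huc : ContinuousOn u (Ici 0) := hρc.continuousOn.smul hyc
  have hmc : ContinuousOn m (Ici 0) :=
    ((hB.sub continuousOn_const).clm_apply huc).add (hκc.continuousOn.smul huc)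
  have hub : ∀ t, 0 ≤ t → ‖u t‖ ≤ 1 / s * M := by
    intro t ht
    rw [hu]
    simp only [norm_smul, Real.norm_of_nonneg (hρpos t).le]
    exact mul_le_mul (hρle t) (hM t ht) (norm_nonneg _) (by positivity)
  have hbdd : BddAbove (range fun t : Ici (0 : ℝ) => ‖u t‖) :=
    ⟨1 / s * M, by rintro _ ⟨t, rfl⟩; exact hub t t.2⟩
  set K := ⨆ t : Ici (0 : ℝ), ‖u t‖ with hK
  have huK : ∀ t, 0 ≤ t → ‖u t‖ ≤ K := fun t ht => le_ciSup hbdd ⟨t, ht⟩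
  have hK0 : 0 ≤ K := (norm_nonneg _).trans (huK 0 le_rfl)
  set n : ℝ → Y := fun t => m (max t 0) with hn
  have hnc : Continuous n :=
    hmc.comp_continuous (by fun_prop) fun t => Set.mem_Ici.mpr (le_max_right _ _)
  have hnb : ∀ t, ‖n t‖ ≤ (η + δ) * K := by
    intro t
    have h0 : 0 ≤ max t 0 := le_max_right _ _
    calc ‖n t‖ ≤ ‖(B (max t 0) - G) (u (max t 0))‖ + ‖κ (max t 0) • u (max t 0)‖ := norm_add_le _ _
      _ ≤ η * K + δ * K := by
          gcongr
          · exact ((B (max t 0) - G).le_opNorm _).trans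
              (mul_le_mul (hBG _ h0) (huK _ h0) (norm_nonneg _) hη0)
          · rw [norm_smul, Real.norm_of_nonneg (hκ0 _)]
            exact mul_le_mul (hκle _) (huK _ h0) (norm_nonneg _) hδ.le
      _ = _ := by ring
  have hu0 : ‖u 0‖ ≤ M := by
    rw [hu]
    simp only [norm_smul, Real.norm_of_nonneg (hρpos 0).le]
    have : ρ 0 ≤ 1 := by
      rw [hρ]; simp only [mul_zero, Real.exp_zero, mul_one]
      rw [div_le_one (by linarith)]; linarith
    calc _ ≤ 1 * M := mul_le_mul this (hM 0 le_rfl) (norm_nonneg _) zero_le_one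
      _ = M := one_mul _
  have hest : ∀ t, 0 ≤ t → ‖u t‖ ≤ C * M + K / 2 := by
    intro t ht
    have h1 := h.eq_of_bounded hnc hnb (u := u) (fun r hr => by
      have : n r = m r := by rw [hn]; simp only [max_eq_left hr]
      rw [this]; exact hu' r hr) huK ht
    rw [h1]
    have h2 : ‖expFlow G t (P (u 0))‖ ≤ C * M :=
      (h.norm_stable_le _ ht).trans (by gcongr)
    have h3 := h.norm_greenSol_le hnc hnb ht
    calc _ ≤ _ := norm_add_le _ _
      _ ≤ C * M + 2 * C / β * ((η + δ) * K) := add_le_add h2 h3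
      _ = C * M + (2 * C / β * (η + δ)) * K := by ring
      _ ≤ C * M + 1 / 2 * K := by gcongr
      _ = _ := by ring
  -- The supremum `K` is finite because `ρ` is bounded, so half of it can be absorbed.
  have hKle : K ≤ C * M + K / 2 := ciSup_le fun t => hest t t.2
  have h1 := huK z hz
  have hse : s * Real.exp (δ * z) = 1 := by rw [hs, ← Real.exp_add]; simp
  have hρz : ρ z = 1 / (2 * s) := by
    have : Real.exp (δ * z) = 1 / s := by field_simp; linarith
    rw [hρ]; simp only [this]; field_simp; norm_num
  rw [hu] at h1
  simp only [norm_smul, Real.norm_of_nonneg (hρpos z).le] at h1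
  rw [hρz] at h1
  have h2 : ‖y z‖ ≤ K * (2 * s) := by
    rw [div_mul_eq_mul_div, one_mul, div_le_iff₀ (by positivity)] at h1
    exact h1
  calc ‖y z‖ ≤ K * (2 * s) := h2
    _ ≤ (2 * (C * M)) * (2 * s) := by gcongr; linarith
    _ = _ := by ring

/-- The derivative bound is integrated from `z` to `t`, and then `t → ∞`. -/
theorem norm_sub_le_of_deriv_decay {E : Type*} [NormedAddCommGroup E] [NormedSpace ℝ E]
    {w w' : ℝ → E} {q : E} {K δ : ℝ} (hδ : 0 < δ)
    (hw : ∀ z, 0 ≤ z → HasDerivWithinAt w (w' z) (Ici 0) z)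
    (hK : ∀ z, 0 ≤ z → ‖w' z‖ ≤ K * Real.exp (-δ * z)) (hlim : Tendsto w atTop (𝓝 q)) {z : ℝ}
    (hz : 0 ≤ z) : ‖w z - q‖ ≤ K / δ * Real.exp (-δ * z) := by
  have hK0 : 0 ≤ K := by
    have := (norm_nonneg _).trans (hK 0 le_rfl)
    simpa using this
  have hb : ∀ t, z ≤ t → ‖w t - w z‖ ≤ K / δ * Real.exp (-δ * z) := by
    intro t ht
    have h1 : ‖w t - w z‖ ≤ K / δ * (Real.exp (-δ * z) - Real.exp (-δ * t)) := by
      refine image_norm_le_of_norm_deriv_right_le_deriv_boundary (f := fun t => w t - w z)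
        (f' := w') (a := z) (b := t) (B := fun t => K / δ * (Real.exp (-δ * z) - Real.exp (-δ * t)))
        (B' := fun t => K * Real.exp (-δ * t)) ?_ ?_ ?_ ?_ ?_ ⟨ht, le_rfl⟩
      · intro r hr
        exact ((hw r (hz.trans hr.1)).continuousWithinAt.mono
          (fun x hx => hz.trans hx.1)).sub continuousWithinAt_const
      · intro r hr
        have hr0 : 0 ≤ r := hz.trans hr.1
        exact ((hw r hr0).mono fun x hx => hr0.trans hx).sub_const _
      · simp
      · intro r
        have h2 : HasDerivAt (fun t => -δ * t) (-δ) r := by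
          simpa using (hasDerivAt_id r).const_mul (-δ)
        refine ((h2.exp.const_sub _).const_mul (K / δ)).congr_deriv ?_
        field_simp
      · intro r hr
        exact hK r (hz.trans hr.1)
    refine h1.trans ?_
    have := Real.exp_pos (-δ * t)
    gcongr
    linarith
  have hl : Tendsto (fun t => ‖w t - w z‖) atTop (𝓝 ‖q - w z‖) := (hlim.sub_const _).norm
  rw [norm_sub_rev]
  exact le_of_tendsto hl ((eventually_ge_atTop z).mono hb)

end Apriori

end

section

/-! ### The weighted linear equation -/

section Weighted

variable {E Y : Type*} [NormedAddCommGroup E] [NormedSpace ℝ E] [CompleteSpace E]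
  [NormedAddCommGroup Y] [NormedSpace ℝ Y] [CompleteSpace Y]

theorem eq_expFlow_of_hasDerivAt {Z : Type*} [NormedAddCommGroup Z] [NormedSpace ℝ Z]
    [CompleteSpace Z] {A : Z →L[ℝ] Z} {c : ℝ → Z} (hc : ∀ t, HasDerivAt c (A (c t)) t) (t : ℝ) :
    c t = expFlow A t (c 0) := by
  rcases le_total 0 t with ht | ht
  · exact eq_expFlow_of_hasDerivWithinAt (fun s _ => (hc s).hasDerivWithinAt) ht
  · have h1 : ∀ s, HasDerivAt (fun s => c (-s)) ((-A) (c (-s))) s := fun s =>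
      (HasDerivAt.scomp s (hc (-s)) (hasDerivAt_neg s)).congr_deriv (by simp)
    have := eq_expFlow_of_hasDerivWithinAt (fun s _ => (h1 s).hasDerivWithinAt) (neg_nonneg.mpr ht)
    rw [expFlow_neg_left] at this
    simpa using this

/-- The linear vector field `(w, y) ↦ δ (w, y) + f₀ y`. -/
def weightedField (δ : ℝ) (f₀ : Y →L[ℝ] E × Y) : E × Y →L[ℝ] E × Y :=
  δ • ContinuousLinearMap.id ℝ (E × Y) + f₀.comp (ContinuousLinearMap.snd ℝ E Y)

variable {δ : ℝ} {f₀ : Y →L[ℝ] E × Y} {J : Y →L[ℝ] E}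

/-- The hypothesis says that `w - J y` is conserved by `(w, y)' = f₀ y`, so the first component
follows from the second; the term `δ` only contributes the factor `e^{δt}`. -/
theorem expFlow_weightedField (hJ : ∀ y, J (f₀ y).2 = (f₀ y).1) (t : ℝ) (v : E × Y) :
    expFlow (weightedField δ f₀) t v = Real.exp (δ * t) •
      (v.1 - J v.2 + J (expFlow ((ContinuousLinearMap.snd ℝ E Y).comp f₀) t v.2),
        expFlow ((ContinuousLinearMap.snd ℝ E Y).comp f₀) t v.2) := by
  set G := (ContinuousLinearMap.snd ℝ E Y).comp f₀ with hG
  set c : ℝ → E × Y := fun t => Real.exp (δ * t) •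
      (v.1 - J v.2 + J (expFlow G t v.2), expFlow G t v.2) with hc
  have h1 : ∀ t, HasDerivAt c (weightedField δ f₀ (c t)) t := by
    intro t
    have h2 : HasDerivAt (fun t => Real.exp (δ * t)) (Real.exp (δ * t) * δ) t := by
      have : HasDerivAt (fun t => δ * t) δ t := by simpa using (hasDerivAt_id t).const_mul δ
      exact this.exp
    have h3 := hasDerivAt_expFlow_apply G v.2 t
    have h4 := (J.hasFDerivAt.comp_hasDerivAt t h3).const_add (v.1 - J v.2)
    refine (h2.smul (h4.prodMk h3)).congr_deriv ?_
    have h5 : (J (G (expFlow G t v.2)), G (expFlow G t v.2)) = f₀ (expFlow G t v.2) :=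
      Prod.ext (hJ _) rfl
    rw [h5]
    simp only [hc, weightedField, add_apply, smul_apply, ContinuousLinearMap.id_apply,
      ContinuousLinearMap.comp_apply, ContinuousLinearMap.coe_snd', Function.comp_apply,
      map_smul]
    module
  have := eq_expFlow_of_hasDerivAt h1 t
  rw [show c 0 = v by simp [hc]] at this
  exact this.symm

/-- The projection onto the decaying solutions of the weighted equation. -/
def graphProj (J : Y →L[ℝ] E) (P : Y →L[ℝ] Y) : E × Y →L[ℝ] E × Y :=
  (((J.prod (ContinuousLinearMap.id ℝ Y)).comp P).comp (ContinuousLinearMap.snd ℝ E Y))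

@[simp] theorem graphProj_apply (J : Y →L[ℝ] E) (P : Y →L[ℝ] Y) (v : E × Y) :
    graphProj J P v = (J (P v.2), P v.2) := rfl

/-- The conserved direction grows at rate `δ` and joins the unstable part, while the stable part
keeps the rate `β - δ`. This is the purpose of the weight: without it, the equilibria are a neutral
direction and there is no dichotomy. -/
theorem Dichotomy.weighted (hJ : ∀ y, J (f₀ y).2 = (f₀ y).1) {P : Y →L[ℝ] Y} {C β : ℝ}
    (h : Dichotomy ((ContinuousLinearMap.snd ℝ E Y).comp f₀) P C β) (hδ : 0 < δ) (hδβ : δ < β) :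
    Dichotomy (weightedField δ f₀) (graphProj J P) ((‖J‖ + 1) * C + (‖J‖ + 1)) (min (β - δ) δ) := by
  have hC := h.nonneg
  have hnorm : ∀ y : Y, ‖(J y, y)‖ ≤ (‖J‖ + 1) * ‖y‖ := by
    intro y
    refine norm_prod_le_iff.mpr ⟨(J.le_opNorm y).trans ?_, ?_⟩ <;>
      nlinarith [norm_nonneg J, norm_nonneg y]
  refine ⟨lt_min (by linarith) hδ, by positivity, fun v => by simp [h.idem], fun t v => ?_,
    fun t ht v => ?_, fun t ht v => ?_⟩
  · rw [expFlow_weightedField hJ, expFlow_weightedField hJ]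
    simp [h.comm]
  · rw [expFlow_weightedField hJ]
    simp only [graphProj_apply, sub_self, zero_add, norm_smul, Real.norm_of_nonneg (Real.exp_pos _).le]
    have h2 : ‖v.2‖ ≤ ‖v‖ := norm_snd_le v
    have h3 : Real.exp (δ * t) * Real.exp (-β * t) ≤ Real.exp (-min (β - δ) δ * t) := by
      rw [← Real.exp_add]
      refine Real.exp_le_exp.mpr ?_
      nlinarith [min_le_left (β - δ) δ]
    calc _ ≤ Real.exp (δ * t) * ((‖J‖ + 1) * (C * Real.exp (-β * t) * ‖v‖)) := by
          gcongr
          exact (hnorm _).trans (by gcongr; exact (h.stable t ht v.2).trans (by gcongr))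
      _ = (‖J‖ + 1) * C * (Real.exp (δ * t) * Real.exp (-β * t)) * ‖v‖ := by ring
      _ ≤ ((‖J‖ + 1) * C + (‖J‖ + 1)) * Real.exp (-min (β - δ) δ * t) * ‖v‖ := by
          gcongr
          linarith [norm_nonneg J]
  · rw [expFlow_weightedField hJ]
    have h2 : ‖v.2‖ ≤ ‖v‖ := norm_snd_le v
    have h1 : ‖v.1‖ ≤ ‖v‖ := norm_fst_le v
    have h3 : Real.exp (δ * -t) ≤ Real.exp (-min (β - δ) δ * t) := by
      refine Real.exp_le_exp.mpr ?_
      nlinarith [min_le_right (β - δ) δ]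
    have h4 : Real.exp (-β * t) ≤ 1 := Real.exp_le_one_iff.mpr (by nlinarith [h.pos])
    set e := expFlow ((ContinuousLinearMap.snd ℝ E Y).comp f₀) (-t) (v.2 - P v.2) with he
    have h5 : ‖e‖ ≤ C * ‖v‖ := (h.unstable t ht v.2).trans (by
      calc _ ≤ C * 1 * ‖v‖ := by gcongr
        _ = _ := by ring)
    have h6 : ‖((v - graphProj J P v).1 - J (v - graphProj J P v).2 +
        J (expFlow ((ContinuousLinearMap.snd ℝ E Y).comp f₀) (-t) (v - graphProj J P v).2),
        expFlow ((ContinuousLinearMap.snd ℝ E Y).comp f₀) (-t) (v - graphProj J P v).2)‖ ≤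
        ((‖J‖ + 1) * C + (‖J‖ + 1)) * ‖v‖ := by
      have e1 : ((v - graphProj J P v).1 - J (v - graphProj J P v).2 + J e, e) =
          (J e, e) + (v.1 - J v.2, (0 : Y)) := by
        ext <;> simp; abel
      change ‖((v - graphProj J P v).1 - J (v - graphProj J P v).2 + J e, e)‖ ≤ _
      rw [e1, add_mul]
      refine (norm_add_le _ _).trans (add_le_add ?_ ?_)
      · exact (hnorm e).trans (by rw [mul_assoc]; gcongr)
      · refine norm_prod_le_iff.mpr ⟨?_, by simp; positivity⟩
        calc ‖v.1 - J v.2‖ ≤ ‖v.1‖ + ‖J v.2‖ := norm_sub_le _ _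
          _ ≤ ‖v‖ + ‖J‖ * ‖v‖ := add_le_add h1 ((J.le_opNorm _).trans (by gcongr))
          _ = _ := by ring
    rw [norm_smul, Real.norm_of_nonneg (Real.exp_pos _).le]
    calc _ ≤ Real.exp (-min (β - δ) δ * t) * (((‖J‖ + 1) * C + (‖J‖ + 1)) * ‖v‖) := by
          gcongr
      _ = _ := by ring

end Weighted

end

section

/-! ### Decaying solutions of the nonlinear equation -/

section Perturbation

universe u

open scoped BoundedContinuousFunction NNReal

/-- The function `τ ↦ e^{-δτ}` on `[0, ∞)`. -/
def expWeight {δ : ℝ} (hδ : 0 < δ) : ℝ≥0 →ᵇ ℝ :=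
  BoundedContinuousFunction.ofNormedAddCommGroup (fun τ : ℝ≥0 => Real.exp (-δ * τ))
    (by fun_prop) 1 (fun τ => by
      rw [Real.norm_of_nonneg (Real.exp_pos _).le]
      exact Real.exp_le_one_iff.mpr (by nlinarith [τ.2, τ.coe_nonneg]))

variable {V E Y : Type u} [NormedAddCommGroup V] [NormedSpace ℝ V] [FiniteDimensional ℝ V]
  [NormedAddCommGroup E] [NormedSpace ℝ E] [FiniteDimensional ℝ E] [CompleteSpace E]
  [NormedAddCommGroup Y] [NormedSpace ℝ Y] [FiniteDimensional ℝ Y] [CompleteSpace Y]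

/-- The nonlinear term of the equation satisfied by `e^{δτ} (v(τ) - (q, 0))` when
`v' = σ f(ν, v) v.2`. -/
def perturbation {f : V × E × Y → Y →L[ℝ] E × Y} (hf : Continuous f) (w : ℝ≥0 →ᵇ ℝ)
    (f₀ : Y →L[ℝ] E × Y) (θ : ℝ × V × E) (u : ℝ≥0 →ᵇ E × Y) : ℝ≥0 →ᵇ E × Y :=
  bcfBilin (ContinuousLinearMap.id ℝ (Y →L[ℝ] E × Y))
    (θ.1 • superpose f hf (bcfConst ℝ≥0 (V × E × Y) (θ.2.1, (θ.2.2, 0)) +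
      (ContinuousLinearMap.inr ℝ V (E × Y)).compLeftContinuousBounded ℝ≥0
        (bcfBilin (ContinuousLinearMap.lsmul ℝ ℝ) w u)) - bcfConst ℝ≥0 _ f₀)
    ((ContinuousLinearMap.snd ℝ E Y).compLeftContinuousBounded ℝ≥0 u)

variable {f : V × E × Y → Y →L[ℝ] E × Y}

theorem perturbation_apply (hf : Continuous f) (w : ℝ≥0 →ᵇ ℝ) (f₀ : Y →L[ℝ] E × Y)
    (θ : ℝ × V × E) (u : ℝ≥0 →ᵇ E × Y) (τ : ℝ≥0) :
    perturbation hf w f₀ θ u τ =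
      (θ.1 • f (θ.2.1, (θ.2.2, 0) + w τ • u τ) - f₀) (u τ).2 := by
  simp [perturbation]

theorem contDiff_coefficient (hf : ContDiff ℝ ∞ f) (w : ℝ≥0 →ᵇ ℝ) (f₀ : Y →L[ℝ] E × Y) :
    ContDiff ℝ ∞ fun x : (ℝ × V × E) × (ℝ≥0 →ᵇ E × Y) =>
      x.1.1 • superpose f hf.continuous (bcfConst ℝ≥0 (V × E × Y) (x.1.2.1, (x.1.2.2, 0)) +
      (ContinuousLinearMap.inr ℝ V (E × Y)).compLeftContinuousBounded ℝ≥0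
        (bcfBilin (ContinuousLinearMap.lsmul ℝ ℝ) w x.2)) - bcfConst ℝ≥0 _ f₀ :=
  ((contDiff_fst.comp contDiff_fst).smul
      ((contDiff_superpose (T := ℝ≥0) hf).comp (by fun_prop))).sub contDiff_const

theorem contDiff_perturbation (hf : ContDiff ℝ ∞ f) (w : ℝ≥0 →ᵇ ℝ) (f₀ : Y →L[ℝ] E × Y) :
    ContDiff ℝ ∞ fun x : (ℝ × V × E) × (ℝ≥0 →ᵇ E × Y) =>
      perturbation hf.continuous w f₀ x.1 x.2 :=
  ((bcfBilin (T := ℝ≥0) (ContinuousLinearMap.id ℝ (Y →L[ℝ] E × Y))).contDiff.comp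
    (contDiff_coefficient hf w f₀)).clm_apply (by fun_prop)

theorem hasFDerivAt_bilin_zero {X E F G : Type*} [NormedAddCommGroup X] [NormedSpace ℝ X]
    [NormedAddCommGroup E] [NormedSpace ℝ E] [NormedAddCommGroup F] [NormedSpace ℝ F]
    [NormedAddCommGroup G] [NormedSpace ℝ G] (B : E →L[ℝ] F →L[ℝ] G) {g : X → E} {h : X → F}
    {x : X} (hg : DifferentiableAt ℝ g x) (hh : DifferentiableAt ℝ h x) (hg0 : g x = 0)
    (hh0 : h x = 0) : HasFDerivAt (fun y => B (g y) (h y)) (0 : X →L[ℝ] G) x := by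
  refine (B.hasFDerivAt_of_bilinear hg.hasFDerivAt hh.hasFDerivAt).congr_fderiv ?_
  refine ContinuousLinearMap.ext fun y => ?_
  simp [hg0, hh0]

/-- The nonlinear term is a product of two factors which both vanish at the base point, so its
derivative there is zero. -/
theorem hasFDerivAt_perturbation (hf : ContDiff ℝ ∞ f) (w : ℝ≥0 →ᵇ ℝ) (ν : V) (q : E) :
    HasFDerivAt (fun x : (ℝ × V × E) × (ℝ≥0 →ᵇ E × Y) =>
      perturbation hf.continuous w (f (ν, q, 0)) x.1 x.2)
      (0 : (ℝ × V × E) × (ℝ≥0 →ᵇ E × Y) →L[ℝ] (ℝ≥0 →ᵇ E × Y)) ((1, ν, q), 0) := by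
  have h1 := contDiff_coefficient hf w (f (ν, q, 0))
  have h2 : ContDiff ℝ ∞ fun x : (ℝ × V × E) × (ℝ≥0 →ᵇ E × Y) =>
      (ContinuousLinearMap.snd ℝ E Y).compLeftContinuousBounded ℝ≥0 x.2 := by fun_prop
  have e1 : (1 : ℝ) • superpose f hf.continuous (bcfConst ℝ≥0 (V × E × Y) (ν, (q, 0)) +
      (ContinuousLinearMap.inr ℝ V (E × Y)).compLeftContinuousBounded ℝ≥0
        (bcfBilin (ContinuousLinearMap.lsmul ℝ ℝ) w 0)) - bcfConst ℝ≥0 _ (f (ν, q, 0)) = 0 := by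
    ext τ : 1
    simp
  exact hasFDerivAt_bilin_zero _ (h1.differentiable (by simp) _) (h2.differentiable (by simp) _)
    e1 (map_zero _)

variable {ν₀ : V} {q₀ : E} {P : Y →L[ℝ] Y} {C β δ : ℝ} {J : Y →L[ℝ] E} {C' β' : ℝ}

/-- The equation satisfied by the decaying solutions in weighted form. -/
def weightedEq (hf : Continuous f) (hδ : 0 < δ)
    (h : Dichotomy (weightedField δ (f (ν₀, q₀, 0))) (graphProj J P) C' β') (F : Submodule ℝ Y)
    (x : (ℝ × V × E × F) × (ℝ≥0 →ᵇ E × Y)) : ℝ≥0 →ᵇ E × Y :=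
  x.2 - freeOp h (J x.1.2.2.2, x.1.2.2.2) -
    greenOp h (perturbation hf (expWeight hδ) (f (ν₀, q₀, 0)) (x.1.1, x.1.2.1, x.1.2.2.1) x.2)

variable {hδ : 0 < δ} {h : Dichotomy (weightedField δ (f (ν₀, q₀, 0))) (graphProj J P) C' β'}
  {F : Submodule ℝ Y}

theorem contDiff_weightedEq (hf : ContDiff ℝ ∞ f) :
    ContDiff ℝ ∞ (weightedEq hf.continuous hδ h F) := by
  have h1 := (contDiff_perturbation hf (expWeight hδ) (f (ν₀, q₀, 0))).comp
    (f := fun x : (ℝ × V × E × F) × (ℝ≥0 →ᵇ E × Y) => ((x.1.1, x.1.2.1, x.1.2.2.1), x.2))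
    (by fun_prop)
  have h2 : ContDiff ℝ ∞ fun x : (ℝ × V × E × F) × (ℝ≥0 →ᵇ E × Y) =>
      ((x.1.2.2.2 : F) : Y) :=
    F.subtypeL.contDiff.comp (f := fun x : (ℝ × V × E × F) × (ℝ≥0 →ᵇ E × Y) => x.1.2.2.2)
      (by fun_prop)
  exact (contDiff_snd.sub ((freeOp h).contDiff.comp ((J.contDiff.comp h2).prodMk h2))).sub
    ((greenOp h).contDiff.comp h1)

/-- The partial derivative in `u` is the identity, as `exists_smooth_implicit` requires, and to
first order the solution is the free one, `freeOp h (J a, a)`. -/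
theorem hasFDerivAt_weightedEq (hf : ContDiff ℝ ∞ f) :
    HasFDerivAt (weightedEq hf.continuous hδ h F)
      (ContinuousLinearMap.snd ℝ (ℝ × V × E × F) (ℝ≥0 →ᵇ E × Y) -
        ((freeOp h).comp (((J.prod (ContinuousLinearMap.id ℝ Y)).comp F.subtypeL).comp
          ((ContinuousLinearMap.snd ℝ E F).comp ((ContinuousLinearMap.snd ℝ V (E × F)).comp
            (ContinuousLinearMap.snd ℝ ℝ (V × E × F)))))).comp (ContinuousLinearMap.fst ℝ _ _))
      ((1, ν₀, q₀, 0), 0) := by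
  have h1 : HasFDerivAt (fun x : (ℝ × V × E × F) × (ℝ≥0 →ᵇ E × Y) =>
      ((x.1.1, x.1.2.1, x.1.2.2.1), x.2)) (fderiv ℝ (fun x : (ℝ × V × E × F) × (ℝ≥0 →ᵇ E × Y) =>
      ((x.1.1, x.1.2.1, x.1.2.2.1), x.2)) ((1, ν₀, q₀, 0), 0)) ((1, ν₀, q₀, 0), 0) := by
    refine DifferentiableAt.hasFDerivAt ?_
    fun_prop
  have h2 := (hasFDerivAt_perturbation hf (expWeight hδ) ν₀ q₀).comp
    (((1, ν₀, q₀, 0), 0) : (ℝ × V × E × F) × (ℝ≥0 →ᵇ E × Y)) h1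
  have h3 := (greenOp h).hasFDerivAt.comp _ h2
  have h4 := (((freeOp h).comp (((J.prod (ContinuousLinearMap.id ℝ Y)).comp F.subtypeL).comp
          ((ContinuousLinearMap.snd ℝ E F).comp ((ContinuousLinearMap.snd ℝ V (E × F)).comp
            (ContinuousLinearMap.snd ℝ ℝ (V × E × F)))))).comp
    (ContinuousLinearMap.fst ℝ (ℝ × V × E × F) (ℝ≥0 →ᵇ E × Y))).hasFDerivAt
    (x := ((1, ν₀, q₀, 0), 0))
  refine ((hasFDerivAt_snd.sub h4).sub h3).congr_fderiv ?_
  refine ContinuousLinearMap.ext fun x => ?_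
  simp

/-- A zero of `weightedEq` yields a decaying solution. -/
theorem solution_of_weightedEq (hf : Continuous f) {σ : ℝ} {ν : V} {q : E} {a : F}
    (hF : ∀ v ∈ F, P v = v) {u : ℝ≥0 →ᵇ E × Y}
    (hu : weightedEq hf hδ h F ((σ, ν, q, a), u) = 0) {v : ℝ → E × Y}
    (hv : ∀ τ, 0 ≤ τ → v τ = (q, 0) + Real.exp (-δ * τ) • extendReal u τ) :
    (∀ τ, 0 ≤ τ → HasDerivWithinAt v (σ • f (ν, v τ) (v τ).2) (Ici 0) τ) ∧ P (v 0).2 = a := by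
  have hu' : u = freeOp h (J a, a) +
      greenOp h (perturbation hf (expWeight hδ) (f (ν₀, q₀, 0)) (σ, ν, q) u) := by
    rw [weightedEq, sub_sub, sub_eq_zero] at hu
    exact hu
  refine ⟨fun τ hτ => ?_, ?_⟩
  · have h1 := hasDerivWithinAt_of_eq_freeOp_add_greenOp hu' hτ
    have h2 : HasDerivAt (fun t => Real.exp (-δ * t)) (Real.exp (-δ * τ) * -δ) τ := by
      have : HasDerivAt (fun t => -δ * t) (-δ) τ := by simpa using (hasDerivAt_id τ).const_mul (-δ)
      exact this.exp
    refine (((h2.hasDerivWithinAt.smul h1).const_add ((q, 0) : E × Y)).congr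
      (fun t ht => hv t ht) (hv τ hτ)).congr_deriv ?_
    have h3 : extendReal (perturbation hf (expWeight hδ) (f (ν₀, q₀, 0)) (σ, ν, q) u) τ =
        (σ • f (ν, v τ) - f (ν₀, q₀, 0)) (extendReal u τ).2 := by
      rw [extendReal, perturbation_apply, hv τ hτ]
      simp [expWeight, extendReal, hτ]
    have h4 : (v τ).2 = Real.exp (-δ * τ) • (extendReal u τ).2 := by rw [hv τ hτ]; simp
    rw [h3, h4]
    simp only [weightedField, add_apply, smul_apply, sub_apply, ContinuousLinearMap.id_apply,
      ContinuousLinearMap.comp_apply, ContinuousLinearMap.coe_snd', map_smul]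
    module
  · have h1 := congrArg Prod.snd (proj_of_eq_freeOp_add_greenOp hu')
    simp only [graphProj_apply] at h1
    rw [hF a a.2] at h1
    rw [hv 0 le_rfl]
    simpa [extendReal] using h1

/-- A decaying solution yields a zero of `weightedEq`. -/
theorem weightedEq_of_solution (hf : Continuous f) {σ : ℝ} {ν : V} {q : E} {a : F}
    {v : ℝ → E × Y} {K : ℝ}
    (hv : ∀ τ, 0 ≤ τ → HasDerivWithinAt v (σ • f (ν, v τ) (v τ).2) (Ici 0) τ)
    (hK : ∀ τ, 0 ≤ τ → ‖v τ - (q, 0)‖ ≤ K * Real.exp (-δ * τ)) (ha : P (v 0).2 = a) :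
    ∃ u : ℝ≥0 →ᵇ E × Y, ‖u‖ ≤ K ∧
      (∀ τ, 0 ≤ τ → v τ = (q, 0) + Real.exp (-δ * τ) • extendReal u τ) ∧
      weightedEq hf hδ h F ((σ, ν, q, a), u) = 0 := by
  have hK0 : 0 ≤ K := by simpa using (norm_nonneg _).trans (hK 0 le_rfl)
  have hvc : ContinuousOn v (Ici 0) := fun τ hτ => (hv τ hτ).continuousWithinAt
  have hb : ∀ τ : ℝ≥0, ‖Real.exp (δ * τ) • (v τ - (q, 0))‖ ≤ K := by
    intro τ
    rw [norm_smul, Real.norm_of_nonneg (Real.exp_pos _).le]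
    calc _ ≤ Real.exp (δ * τ) * (K * Real.exp (-δ * τ)) := by gcongr; exact hK τ τ.2
      _ = K * (Real.exp (δ * τ) * Real.exp (-δ * τ)) := by ring
      _ = K := by rw [← Real.exp_add]; simp
  set u : ℝ≥0 →ᵇ E × Y := BoundedContinuousFunction.ofNormedAddCommGroup
    (fun τ : ℝ≥0 => Real.exp (δ * τ) • (v τ - (q, 0)))
    (by
      have he : Continuous fun τ : ℝ≥0 => Real.exp (δ * τ) := by fun_prop
      have : Continuous fun τ : ℝ≥0 => v τ :=
        hvc.comp_continuous NNReal.continuous_coe fun τ => τ.2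
      exact he.smul (this.sub continuous_const)) K hb with hu
  have hue : ∀ τ, 0 ≤ τ → extendReal u τ = Real.exp (δ * τ) • (v τ - (q, 0)) := by
    intro τ hτ
    simp [extendReal, hu, hτ]
  have hve : ∀ τ, 0 ≤ τ → v τ = (q, 0) + Real.exp (-δ * τ) • extendReal u τ := by
    intro τ hτ
    rw [hue τ hτ, smul_smul, ← Real.exp_add]
    simp
  refine ⟨u, BoundedContinuousFunction.norm_ofNormedAddCommGroup_le _ hK0 hb, hve, ?_⟩
  have key := eq_freeOp_add_greenOp h (u := u)
    (n := perturbation hf (expWeight hδ) (f (ν₀, q₀, 0)) (σ, ν, q) u) (fun τ hτ => ?_)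
  -- Only the second component of the initial value matters, because `graphProj` ignores the first;
  -- it need not be known that `u 0` lies on the graph of `J`.
  · have h5 : freeOp h (u 0) = freeOp h (J a, a) := by
      ext1 τ
      rw [freeOp_apply, freeOp_apply]
      have h6 : (u 0).2 = (v 0).2 := by simp [hu]
      have h7 : P a = a := by
        have := congrArg Prod.snd (h.idem (v 0))
        simp only [graphProj_apply] at this
        rwa [ha] at this
      rw [graphProj_apply, graphProj_apply, h6, ha, h7]
    rw [weightedEq, sub_sub, sub_eq_zero, ← h5]
    exact key
  · have h2 : HasDerivAt (fun t => Real.exp (δ * t)) (Real.exp (δ * τ) * δ) τ := by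
      have : HasDerivAt (fun t => δ * t) δ τ := by simpa using (hasDerivAt_id τ).const_mul δ
      exact this.exp
    refine ((h2.hasDerivWithinAt.smul ((hv τ hτ).sub_const (q, 0))).congr
      (fun t ht => hue t ht) (hue τ hτ)).congr_deriv ?_
    have h3 : extendReal (perturbation hf (expWeight hδ) (f (ν₀, q₀, 0)) (σ, ν, q) u) τ =
        (σ • f (ν, v τ) - f (ν₀, q₀, 0)) (extendReal u τ).2 := by
      rw [extendReal, perturbation_apply, hve τ hτ]
      simp [expWeight, extendReal, hτ]
    have h4 : (extendReal u τ).2 = Real.exp (δ * τ) • (v τ).2 := by rw [hue τ hτ]; simp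
    rw [h3]
    simp only [weightedField, add_apply, smul_apply, sub_apply, ContinuousLinearMap.id_apply,
      ContinuousLinearMap.comp_apply, ContinuousLinearMap.coe_snd', h4, map_smul]
    rw [hue τ hτ]
    module

end Perturbation

end

section

/-! ### The stable manifold theorem -/

section StableManifold

universe u

open scoped BoundedContinuousFunction NNReal

variable {V E Y : Type u} [NormedAddCommGroup V] [NormedSpace ℝ V] [FiniteDimensional ℝ V]
  [NormedAddCommGroup E] [NormedSpace ℝ E] [FiniteDimensional ℝ E] [CompleteSpace E]
  [NormedAddCommGroup Y] [NormedSpace ℝ Y] [FiniteDimensional ℝ Y] [CompleteSpace Y]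

/-- The linearization at the base point of the initial values of the decaying solutions. -/
def stableTangent (V : Type u) [NormedAddCommGroup V] [NormedSpace ℝ V] (J : Y →L[ℝ] E)
    (G : Y →L[ℝ] Y) (F : Submodule ℝ Y) : V × E × F →L[ℝ] E × Y :=
  ((ContinuousLinearMap.inl ℝ E Y).comp (ContinuousLinearMap.fst ℝ E F) +
    (((J.prod (ContinuousLinearMap.id ℝ Y)).comp (expFlow G 1)).comp F.subtypeL).comp
      (ContinuousLinearMap.snd ℝ E F)).comp (ContinuousLinearMap.snd ℝ V (E × F))

@[simp] theorem stableTangent_apply (J : Y →L[ℝ] E) (G : Y →L[ℝ] Y) (F : Submodule ℝ Y)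
    (x : V × E × F) :
    stableTangent V J G F x = (x.2.1 + J (expFlow G 1 x.2.2), expFlow G 1 x.2.2) := by
  simp [stableTangent]

/-- `u z (ν, q, a)`, `z > -1`, is the smooth family of the small solutions of `u' = f(ν, u) u.2`
which converge to `(q, 0)`. -/
structure IsStableFamily (f : V × E × Y → Y →L[ℝ] E × Y) (ν₀ : V) (q₀ : E) (J : Y →L[ℝ] E)
    (F : Submodule ℝ Y) (O : Set (V × E × F)) (u : ℝ → V × E × F → E × Y) (δ : ℝ)
    (m : V × E × F → ℝ) : Prop where
  pos : 0 < δ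
  isOpen : IsOpen O
  base_mem : (ν₀, q₀, 0) ∈ O
  smooth : ContDiffOn ℝ ∞ (fun x : ℝ × V × E × F => u x.1 x.2) (Ioi (-1) ×ˢ O)
  ode : ∀ o ∈ O, ∀ z, -1 < z → HasDerivAt (fun z => u z o) (f (o.1, u z o) (u z o).2) z
  continuousOn_bound : ContinuousOn m O
  bound_zero : ∀ ν q, (ν, q, 0) ∈ O → m (ν, q, 0) = 0
  decay : ∀ o ∈ O, ∀ z, 0 ≤ z → ‖u z o - (o.2.1, 0)‖ ≤ m o * Real.exp (-δ * z)
  hasFDerivAt : HasFDerivAt (u 0)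
    (stableTangent V J ((ContinuousLinearMap.snd ℝ E Y).comp (f (ν₀, q₀, 0))) F) (ν₀, q₀, 0)
  unique : ∀ N ∈ 𝓝 ((ν₀, q₀, 0) : V × E × F), ∃ ε > 0, ∀ ν q (v : ℝ → E × Y), ‖ν - ν₀‖ < ε →
    ‖q - q₀‖ < ε →
    (∀ z, 0 ≤ z → HasDerivWithinAt v (f (ν, v z) (v z).2) (Ici 0) z) →
    (∀ z, 0 ≤ z → ‖v z - (q, 0)‖ < ε) → Tendsto (fun z => (v z).1) atTop (𝓝 q) →
    ∃ a : F, (ν, q, a) ∈ N ∧ (ν, q, a) ∈ O ∧ ∀ z, 0 ≤ z → v z = u z (ν, q, a)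

variable {f : V × E × Y → Y →L[ℝ] E × Y} {ν₀ : V} {q₀ : E} {P : Y →L[ℝ] Y} {C β δ : ℝ}
  {J : Y →L[ℝ] E} {F : Submodule ℝ Y}

theorem weightedEq_zero (hf : Continuous f) {C' β' : ℝ} {hδ : 0 < δ}
    {h : Dichotomy (weightedField δ (f (ν₀, q₀, 0))) (graphProj J P) C' β'}
    (σ : ℝ) (ν : V) (q : E) : weightedEq hf hδ h F ((σ, ν, q, 0), 0) = 0 := by
  have h1 : perturbation hf (expWeight hδ) (f (ν₀, q₀, 0)) (σ, ν, q) 0 = 0 := by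
    ext1 τ
    simp [perturbation_apply]
  have h2 : freeOp h ((0 : E), (0 : Y)) = 0 := map_zero _
  simp only [weightedEq, h1]
  simpa using h2

/-- Small solutions which converge to `(q, 0)` converge exponentially. -/
theorem exists_decay_of_small (hf : Continuous f)
    (hG : Dichotomy ((ContinuousLinearMap.snd ℝ E Y).comp (f (ν₀, q₀, 0))) P C β)
    (hδ : 0 < δ) (hsmall : 2 * C / β * (δ + δ) ≤ 1 / 2) :
    ∃ K ≥ 0, ∃ ε₀ > 0, ∀ ε ≤ ε₀, ∀ ν q (v : ℝ → E × Y), ‖ν - ν₀‖ < ε → ‖q - q₀‖ < ε →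
      (∀ z, 0 ≤ z → HasDerivWithinAt v (f (ν, v z) (v z).2) (Ici 0) z) →
      (∀ z, 0 ≤ z → ‖v z - (q, 0)‖ < ε) → Tendsto (fun z => (v z).1) atTop (𝓝 q) →
      ∀ z, 0 ≤ z → ‖v z - (q, 0)‖ ≤ K * ε * Real.exp (-δ * z) := by
  obtain ⟨ε₁, hε₁, hc⟩ := Metric.continuousAt_iff.mp (hf.continuousAt (x := (ν₀, q₀, 0))) δ hδ
  have hC := hG.nonneg
  set f₀ := f (ν₀, q₀, 0) with hf₀
  refine ⟨max (4 * C) ((‖f₀‖ + δ) * (4 * C) / δ), by positivity, ε₁ / 2, by positivity, ?_⟩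
  intro ε hε ν q v hν hq hv hvs hlim
  have hε0 : 0 < ε := (norm_nonneg _).trans_lt hν
  have hvc : ContinuousOn v (Ici 0) := fun z hz => (hv z hz).continuousWithinAt
  have hfz : ∀ z, 0 ≤ z → ‖f (ν, v z) - f₀‖ ≤ δ := by
    intro z hz
    rw [← dist_eq_norm]
    refine (hc ?_).le
    rw [dist_eq_norm]
    have h1 : ‖v z - (q₀, 0)‖ < ε₁ := by
      calc ‖v z - (q₀, 0)‖ = ‖(v z - (q, 0)) + ((q - q₀, 0) : E × Y)‖ := by
            congr 1; ext <;> simp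
        _ ≤ ‖v z - (q, 0)‖ + ‖((q - q₀, 0) : E × Y)‖ := norm_add_le _ _
        _ < ε + ε := add_lt_add (hvs z hz) (by rw [Prod.norm_mk, norm_zero, max_lt_iff]; exact ⟨hq, hε0⟩)
        _ ≤ ε₁ := by linarith
    change ‖((ν - ν₀, v z - (q₀, 0)) : V × E × Y)‖ < ε₁
    rw [Prod.norm_mk, max_lt_iff]
    exact ⟨by linarith, h1⟩
  -- The second component solves a linear equation whose coefficient, evaluated along `v`, stays
  -- within `δ` of `G`; boundedness therefore implies decay.
  have hy : ∀ z, 0 ≤ z → ‖(v z).2‖ ≤ 4 * C * ε * Real.exp (-δ * z) := by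
    intro z hz
    refine hG.norm_le_of_perturbation (η := δ) hδ hsmall
      (B := fun z => (ContinuousLinearMap.snd ℝ E Y).comp (f (ν, v z))) ?_ ?_
      (y := fun z => (v z).2) ?_ ?_ hz
    · have : ContinuousOn (fun z => f (ν, v z)) (Ici 0) :=
        hf.comp_continuousOn (continuousOn_const.prodMk hvc)
      exact continuousOn_const.clm_comp this
    · intro z hz
      rw [← ContinuousLinearMap.comp_sub]
      refine (ContinuousLinearMap.opNorm_comp_le _ _).trans ?_
      calc _ ≤ 1 * δ := by
            gcongr
            · exact ContinuousLinearMap.norm_snd_le ℝ E Y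
            · exact hfz z hz
        _ = δ := one_mul _
    · intro z hz
      exact (ContinuousLinearMap.snd ℝ E Y).hasFDerivAt.comp_hasDerivWithinAt z (hv z hz)
    · intro z hz
      have := (norm_snd_le (v z - (q, 0))).trans (hvs z hz).le
      simpa using this
  intro z hz
  have hw : ‖(v z).1 - q‖ ≤ (‖f₀‖ + δ) * (4 * C * ε) / δ * Real.exp (-δ * z) := by
    refine norm_sub_le_of_deriv_decay hδ (w := fun z => (v z).1)
      (w' := fun z => (f (ν, v z) (v z).2).1) ?_ ?_ hlim hz
    · intro z hz
      exact (ContinuousLinearMap.fst ℝ E Y).hasFDerivAt.comp_hasDerivWithinAt z (hv z hz)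
    · intro z hz
      refine (norm_fst_le _).trans ((ContinuousLinearMap.le_opNorm _ _).trans ?_)
      have h1 : ‖f (ν, v z)‖ ≤ ‖f₀‖ + δ := by
        calc ‖f (ν, v z)‖ = ‖f₀ + (f (ν, v z) - f₀)‖ := by congr 1; abel
          _ ≤ _ := (norm_add_le _ _).trans (by gcongr; exact hfz z hz)
      calc _ ≤ (‖f₀‖ + δ) * (4 * C * ε * Real.exp (-δ * z)) := by
            gcongr
            exact hy z hz
        _ = _ := by ring
  have he := Real.exp_pos (-δ * z)
  refine norm_prod_le_iff.mpr ⟨?_, ?_⟩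
  · simp only [Prod.fst_sub]
    calc _ ≤ _ := hw
      _ = (‖f₀‖ + δ) * (4 * C) / δ * ε * Real.exp (-δ * z) := by ring
      _ ≤ _ := by gcongr; exact le_max_right _ _
  · simp only [Prod.snd_sub, sub_zero]
    calc _ ≤ _ := hy z hz
      _ ≤ _ := by gcongr; exact le_max_left _ _

-- The implicit function theorem solves the weighted equation by `ψ(σ, ν, q, a)`, where `σ`
-- multiplies the vector field, and `v₁` is the solution for `σ = 1`. Smoothness of `ψ` with values
-- in bounded functions gives smoothness in the parameters only, at fixed time; smoothness in time
-- is obtained by trading time for `σ`. The family is `v₁` shifted by one unit of time, so that `z =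
-- 0` is an interior point; this shift is the origin of `expFlow G 1` in the tangent map.
set_option maxHeartbeats 1000000 in
theorem exists_stableFamily (hf : ContDiff ℝ ∞ f)
    (hG : Dichotomy ((ContinuousLinearMap.snd ℝ E Y).comp (f (ν₀, q₀, 0))) P C β)
    (hJ : ∀ y, J (f (ν₀, q₀, 0) y).2 = (f (ν₀, q₀, 0) y).1) (hPF : ∀ v ∈ F, P v = v)
    (hFP : ∀ v, P v ∈ F) : ∃ O u δ m, IsStableFamily f ν₀ q₀ J F O u δ m := by
  have hfc := hf.continuous
  have hC := hG.nonneg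
  have hβ := hG.pos
  set G := (ContinuousLinearMap.snd ℝ E Y).comp (f (ν₀, q₀, 0)) with hGdef
  -- One `δ` serves as weight, for which `δ < β` is needed, and as size of the perturbation in the a
  -- priori estimate.
  obtain ⟨δ, hδ, hδβ, hsmall⟩ : ∃ δ, 0 < δ ∧ δ < β ∧ 2 * C / β * (δ + δ) ≤ 1 / 2 := by
    refine ⟨β / (8 * C + 8), by positivity, div_lt_self hβ (by linarith), ?_⟩
    rw [div_mul_eq_mul_div, ← add_div, div_le_div_iff₀ hβ two_pos, mul_div_assoc', div_mul_eq_mul_div,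
      div_le_iff₀ (by positivity)]
    nlinarith
  have h := hG.weighted hJ hδ hδβ
  obtain ⟨s, ψ, hso, hs0, hψs, hψ0, hψ', hψsol, hψuniq⟩ :=
    exists_smooth_implicit (contDiff_weightedEq (hδ := hδ) (h := h) (F := F) hf)
      (weightedEq_zero hfc 1 ν₀ q₀) (hasFDerivAt_weightedEq hf)
  obtain ⟨ρ, hρ, hρu⟩ := Metric.eventually_nhds_iff_ball.mp hψuniq
  have hψc : ContinuousAt ψ (1, ν₀, q₀, 0) := hψ'.continuousAt
  have hev : ∀ᶠ θ in 𝓝 ((1, ν₀, q₀, 0) : ℝ × V × E × F), θ ∈ s ∧ ‖ψ θ‖ < ρ ∧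
      dist θ (1, ν₀, q₀, 0) < ρ := by
    have hs : ∀ᶠ θ in 𝓝 ((1, ν₀, q₀, 0) : ℝ × V × E × F), θ ∈ s := hso.mem_nhds hs0
    refine hs.and (Eventually.and ?_ (Metric.ball_mem_nhds _ hρ))
    have := hψc.norm
    rw [ContinuousAt, hψ0, norm_zero] at this
    exact this.eventually_lt_const hρ
  obtain ⟨r, hr, hball⟩ := Metric.eventually_nhds_iff_ball.mp hev
  set O : Set (V × E × F) := Metric.ball (ν₀, q₀, 0) r with hO
  have hmem : ∀ σ o, |σ - 1| < r → o ∈ O → (σ, o) ∈ s ∧ ‖ψ (σ, o)‖ < ρ ∧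
      dist (σ, o) ((1, ν₀, q₀, 0) : ℝ × V × E × F) < ρ := by
    intro σ o hσ ho
    refine hball _ ?_
    rw [Metric.mem_ball, Prod.dist_eq, max_lt_iff]
    exact ⟨by rwa [Real.dist_eq], ho⟩
  have huniq : ∀ σ o (u : ℝ≥0 →ᵇ E × Y), |σ - 1| < r → o ∈ O → ‖u‖ < ρ →
      weightedEq hfc hδ h F ((σ, o), u) = 0 → u = ψ (σ, o) := by
    intro σ o u hσ ho hu h0
    refine hρu ((σ, o), u) ?_ h0
    rw [Metric.mem_ball, Prod.dist_eq, max_lt_iff]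
    exact ⟨(hmem σ o hσ ho).2.2, by simpa using hu⟩
  have h11 : |(1 : ℝ) - 1| < r := by simpa using hr
  set v₁ : V × E × F → ℝ → E × Y := fun o τ =>
    (o.2.1, 0) + Real.exp (-δ * τ) • extendReal (ψ (1, o)) τ with hv₁
  have hv₁sol : ∀ o ∈ O, (∀ τ, 0 ≤ τ →
      HasDerivWithinAt (v₁ o) (f (o.1, v₁ o τ) (v₁ o τ).2) (Ici 0) τ) ∧ P (v₁ o 0).2 = o.2.2 := by
    intro o ho
    have := solution_of_weightedEq hfc hPF (hψsol _ (hmem 1 o h11 ho).1) (v := v₁ o)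
      (fun τ _ => rfl)
    simpa only [one_smul] using this
  have hv₁b : ∀ o τ, ‖v₁ o τ - (o.2.1, 0)‖ ≤ ‖ψ (1, o)‖ * Real.exp (-δ * τ) := by
    intro o τ
    rw [hv₁]
    simp only [add_sub_cancel_left, norm_smul, Real.norm_of_nonneg (Real.exp_pos _).le]
    rw [mul_comm]
    gcongr
    exact norm_extendReal_le _ _
  -- Dilating time by `σ` multiplies the field by `σ`, so uniqueness identifies the dilated solution
  -- with `ψ(σ, o)`. With `σ ≥ 1` the decay rate is not lost.
  have hdil : ∀ σ o, 1 ≤ σ → |σ - 1| < r → o ∈ O → ∀ τ, 0 ≤ τ →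
      v₁ o (σ * τ) = (o.2.1, 0) + Real.exp (-δ * τ) • extendReal (ψ (σ, o)) τ := by
    intro σ o hσ1 hσ ho
    have hode : ∀ τ, 0 ≤ τ → HasDerivWithinAt (fun τ => v₁ o (σ * τ))
        (σ • f (o.1, v₁ o (σ * τ)) (v₁ o (σ * τ)).2) (Ici 0) τ := by
      intro τ hτ
      have hστ : 0 ≤ σ * τ := by positivity
      have h1 : HasDerivWithinAt (fun τ => σ * τ) σ (Ici 0) τ := by
        simpa using (hasDerivWithinAt_id τ (Ici 0)).const_mul σ
      exact HasDerivWithinAt.scomp τ ((hv₁sol o ho).1 _ hστ) h1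
        (fun t (ht : 0 ≤ t) => mul_nonneg (by linarith) ht)
    have hdecay : ∀ τ, 0 ≤ τ →
        ‖v₁ o (σ * τ) - (o.2.1, 0)‖ ≤ ‖ψ (1, o)‖ * Real.exp (-δ * τ) := by
      intro τ hτ
      refine (hv₁b o _).trans ?_
      gcongr ?_ * ?_
      refine Real.exp_le_exp.mpr ?_
      nlinarith [mul_nonneg hδ.le hτ]
    obtain ⟨u, hu, hu', hu0⟩ := weightedEq_of_solution (hδ := hδ) (h := h) (F := F) hfc (σ := σ)
      (a := o.2.2) hode hdecay (by simpa using (hv₁sol o ho).2)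
    have := huniq σ o u hσ ho (hu.trans_lt (hmem 1 o h11 ho).2.1) hu0
    rwa [this] at hu'
  have hpos : ∀ o ∈ O, ∀ z, -1 < z → HasDerivAt (fun z => v₁ o (z + 1))
      (f (o.1, v₁ o (z + 1)) (v₁ o (z + 1)).2) z := by
    intro o ho z hz
    have h1 := ((hv₁sol o ho).1 (z + 1) (by linarith)).hasDerivAt (Ici_mem_nhds (by linarith))
    exact h1.comp_add_const z 1
  have hu0' : HasFDerivAt (fun o => v₁ o (0 + 1)) (stableTangent V J G F) (ν₀, q₀, 0) := by
    have h1 : HasFDerivAt (fun o : V × E × F => ((1 : ℝ), o))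
        (ContinuousLinearMap.inr ℝ ℝ (V × E × F)) (ν₀, q₀, 0) :=
      hasFDerivAt_prodMk_right _ _
    have h2 := hψ'.comp (ν₀, q₀, (0 : F)) h1
    have h3 := ((BoundedContinuousFunction.evalCLM ℝ (1 : ℝ≥0) (β := E × Y)).hasFDerivAt.comp _
      h2).const_smul (Real.exp (-δ * 1))
    have h4 := ((ContinuousLinearMap.inl ℝ E Y).comp ((ContinuousLinearMap.fst ℝ E F).comp
      (ContinuousLinearMap.snd ℝ V (E × F)))).hasFDerivAt (x := (ν₀, q₀, 0))
    refine ((h4.add h3).congr_of_eventuallyEq (Eventually.of_forall fun o => ?_)).congr_fderiv ?_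
    · simp [hv₁, extendReal, BoundedContinuousFunction.evalCLM]
    · refine ContinuousLinearMap.ext fun x => ?_
      have h5 : freeOp h (J x.2.2, x.2.2) 1 =
          Real.exp δ • (J (expFlow G 1 x.2.2), expFlow G 1 x.2.2) := by
        rw [freeOp_apply, graphProj_apply, hPF _ x.2.2.2, expFlow_weightedField hJ]
        simp [hGdef]
      have h6 : Real.exp (-δ) * Real.exp δ = 1 := by rw [← Real.exp_add]; simp
      rw [stableTangent_apply]
      change ((x.2.1, 0) : E × Y) + Real.exp (-δ * 1) • freeOp h (J x.2.2, x.2.2) 1 = _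
      rw [h5, smul_smul, mul_one, h6, one_smul]
      simp
  have hsm : ContDiffOn ℝ ∞ (fun x : ℝ × V × E × F => v₁ x.2 (x.1 + 1)) (Ioi (-1) ×ˢ O) := by
    rintro ⟨z₁, o₁⟩ ⟨hz₁, ho₁⟩
    have hz₁ : -1 < z₁ := hz₁
    -- Near `z₁` one writes `z + 1 = σ τ₁` with `τ₁` fixed and `σ` near `σ₁`; evaluation at the
    -- fixed time `τ₁` is linear, so `ψ` gives joint smoothness. `σ₁` is the centre of the interval
    -- `(1, 1 + r)` of admissible dilations, and `τ₁ > 0` because `z₁ > -1`.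
    set σ₁ := 1 + r / 2 with hσ₁
    set τ₁ := (z₁ + 1) / σ₁ with hτ₁
    have hσpos : 0 < σ₁ := by positivity
    have hτpos : 0 < τ₁ := div_pos (by linarith) hσpos
    have hbase : (z₁ + 1) / τ₁ = σ₁ := by
      rw [hτ₁, div_div_cancel₀ (by linarith)]
    have hev : ∀ᶠ x : ℝ × V × E × F in 𝓝 (z₁, o₁), v₁ x.2 (x.1 + 1) =
        (x.2.2.1, 0) + Real.exp (-δ * τ₁) • ψ ((x.1 + 1) / τ₁, x.2) τ₁.toNNReal := by
      have hcont : ContinuousAt (fun x : ℝ × V × E × F => (x.1 + 1) / τ₁) (z₁, o₁) := by fun_prop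
      have hc1 : ∀ᶠ x : ℝ × V × E × F in 𝓝 (z₁, o₁), (x.1 + 1) / τ₁ ∈ Ioo 1 (1 + r) := by
        apply hcont
        change _ ∈ 𝓝 ((z₁ + 1) / τ₁)
        rw [hbase]
        exact Ioo_mem_nhds (by linarith) (by linarith)
      filter_upwards [hc1, continuousAt_snd.preimage_mem_nhds (Metric.isOpen_ball.mem_nhds ho₁)]
        with x hx hxo
      have h2 := hdil _ x.2 hx.1.le (by rw [abs_of_pos] <;> linarith [hx.1, hx.2]) hxo τ₁ hτpos.le
      rwa [div_mul_cancel₀ _ hτpos.ne'] at h2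
    refine ContDiffAt.contDiffWithinAt (ContDiffAt.congr_of_eventuallyEq ?_ hev)
    have h3 : ContDiffAt ℝ ∞ ψ (σ₁, o₁) := by
      refine hψs.contDiffAt (hso.mem_nhds (hmem σ₁ o₁ ?_ ho₁).1)
      rw [hσ₁, add_sub_cancel_left, abs_of_pos] <;> linarith
    have h4 : ContDiffAt ℝ ∞ (fun x : ℝ × V × E × F => ψ ((x.1 + 1) / τ₁, x.2)) (z₁, o₁) := by
      refine ContDiffAt.comp (g := ψ) (z₁, o₁) ?_ ?_
      · simpa only [hbase] using h3
      · fun_prop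
    have h5 := (BoundedContinuousFunction.evalCLM ℝ τ₁.toNNReal (β := E × Y)).contDiff.contDiffAt.comp
      (z₁, o₁) h4
    have h6 : ContDiffAt ℝ ∞ (fun x : ℝ × V × E × F => ((x.2.2.1, 0) : E × Y)) (z₁, o₁) := by
      fun_prop
    exact h6.add (h5.const_smul (Real.exp (-δ * τ₁)))
  have hbm : ((ν₀, q₀, 0) : V × E × F) ∈ O := Metric.mem_ball_self hr
  have hPFl : ∀ x : F, P (expFlow G 1 x) = expFlow G 1 x := fun x => by
    rw [hG.comm, hPF _ x.2]
  refine ⟨O, fun z o => v₁ o (z + 1), δ, fun o => ‖ψ (1, o)‖, hδ, Metric.isOpen_ball, hbm, hsm, hpos,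
    ?_, ?_, ?_, hu0', ?_⟩
  · refine (hψs.continuousOn.comp (by fun_prop) fun o ho => (hmem 1 o h11 ho).1).norm
  · intro ν q ho
    rw [← huniq 1 _ 0 h11 ho (by simpa using hρ) (weightedEq_zero hfc 1 ν q), norm_zero]
  · intro o ho z hz
    refine (hv₁b o _).trans ?_
    gcongr ?_ * ?_
    refine Real.exp_le_exp.mpr ?_
    nlinarith
  · intro N hN
    set PF : Y →L[ℝ] F := P.codRestrict F hFP with hPFdef
    -- `T` replaces the stable component at shifted time `-1` by the one at time `0`. It is locally
    -- onto, so `a` can be chosen such that the shifted solution starts with the stable component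
    -- `b` of `v`.
    set T : V × E × F → V × E × F := fun o => (o.1, o.2.1, PF (v₁ o (0 + 1)).2) with hT
    have hu0c : ContDiffAt ℝ ∞ (fun o => v₁ o (0 + 1)) (ν₀, q₀, (0 : F)) := by
      have h1 := hsm.contDiffAt (x := (0, ν₀, q₀, 0))
        ((isOpen_Ioi.prod Metric.isOpen_ball).mem_nhds ⟨by simp, hbm⟩)
      exact h1.comp (ν₀, q₀, (0 : F)) (f := fun o : V × E × F => ((0 : ℝ), o)) (by fun_prop)
    have hTs : HasStrictFDerivAt T ((ContinuousLinearMap.fst ℝ V (E × F)).prod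
        (((ContinuousLinearMap.fst ℝ E F).comp (ContinuousLinearMap.snd ℝ V (E × F))).prod
          (PF.comp ((ContinuousLinearMap.snd ℝ E Y).comp (stableTangent V J G F)))))
        (ν₀, q₀, 0) := by
      have h1 := hu0c.hasStrictFDerivAt' hu0' (by simp)
      refine hasStrictFDerivAt_fst.prodMk (HasStrictFDerivAt.prodMk ?_ ?_)
      · exact ((ContinuousLinearMap.fst ℝ E F).comp
          (ContinuousLinearMap.snd ℝ V (E × F))).hasStrictFDerivAt
      · exact PF.hasStrictFDerivAt.comp _ ((ContinuousLinearMap.snd ℝ E Y).hasStrictFDerivAt.comp _ h1)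
    have hTsurj : ((ContinuousLinearMap.fst ℝ V (E × F)).prod
        (((ContinuousLinearMap.fst ℝ E F).comp (ContinuousLinearMap.snd ℝ V (E × F))).prod
          (PF.comp ((ContinuousLinearMap.snd ℝ E Y).comp (stableTangent V J G F))))).range = ⊤ := by
      refine LinearMap.range_eq_top.mpr fun y => ?_
      have hb : expFlow G (-1) y.2.2 ∈ F := by
        have h1 := hG.comm (-1) (y.2.2 : Y)
        rw [hPF _ y.2.2.2] at h1
        rw [← h1]
        exact hFP _
      refine ⟨(y.1, y.2.1, ⟨expFlow G (-1) y.2.2, hb⟩), ?_⟩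
      refine Prod.ext rfl (Prod.ext rfl (Subtype.ext ?_))
      change P (stableTangent V J G F (y.1, y.2.1, ⟨expFlow G (-1) y.2.2, hb⟩)).2 = _
      rw [stableTangent_apply]
      simp only [expFlow_apply_neg]
      exact hPF _ y.2.2.2
    have hT0 : T (ν₀, q₀, 0) = (ν₀, q₀, 0) := by
      have h1 : ψ (1, ν₀, q₀, 0) = 0 := hψ0
      simp [hT, hv₁, h1, extendReal]
    have hTn : T '' (N ∩ O) ∈ 𝓝 ((ν₀, q₀, 0) : V × E × F) := by
      have h1 := hTs.map_nhds_eq_of_surj hTsurj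
      rw [hT0] at h1
      rw [← h1]
      exact image_mem_map (inter_mem hN (Metric.isOpen_ball.mem_nhds hbm))
    obtain ⟨ε₁, hε₁, hTb⟩ := Metric.mem_nhds_iff.mp (inter_mem hTn (Metric.isOpen_ball.mem_nhds hbm))
    obtain ⟨K, hK, ε₀, hε₀, hdec⟩ := exists_decay_of_small hfc hG hδ hsmall
    obtain ⟨ε, hε, hle0, hle1, hlep, hleK⟩ : ∃ ε > 0, ε ≤ ε₀ ∧ ε ≤ ε₁ ∧ ‖P‖ * ε < ε₁ ∧ K * ε < ρ := by
      have hd : 0 < ‖P‖ + K + 1 := by positivity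
      refine ⟨min ε₀ (min ε₁ (min ε₁ ρ / (‖P‖ + K + 1))), by positivity, min_le_left _ _,
        (min_le_right _ _).trans (min_le_left _ _), ?_, ?_⟩
      · have h1 : min ε₀ (min ε₁ (min ε₁ ρ / (‖P‖ + K + 1))) ≤ min ε₁ ρ / (‖P‖ + K + 1) :=
          (min_le_right _ _).trans (min_le_right _ _)
        have h2 : 0 < min ε₀ (min ε₁ (min ε₁ ρ / (‖P‖ + K + 1))) := by positivity
        rw [le_div_iff₀ hd] at h1
        nlinarith [min_le_left ε₁ ρ, norm_nonneg P]
      · have h1 : min ε₀ (min ε₁ (min ε₁ ρ / (‖P‖ + K + 1))) ≤ min ε₁ ρ / (‖P‖ + K + 1) :=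
          (min_le_right _ _).trans (min_le_right _ _)
        have h2 : 0 < min ε₀ (min ε₁ (min ε₁ ρ / (‖P‖ + K + 1))) := by positivity
        rw [le_div_iff₀ hd] at h1
        nlinarith [min_le_right ε₁ ρ, norm_nonneg P]
    refine ⟨ε, hε, fun ν q v hν hq hv hvs hlim => ?_⟩
    have hvd := hdec ε hle0 ν q v hν hq hv hvs hlim
    set b : F := PF (v 0).2 with hb
    have hvb : P (v 0).2 = b := rfl
    have hbn : ‖b‖ < ε₁ := by
      have h1 : ‖(v 0).2‖ ≤ ε := by
        have := (norm_snd_le (v 0 - (q, 0))).trans (hvs 0 le_rfl).le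
        simpa using this
      calc ‖b‖ = ‖P (v 0).2‖ := rfl
        _ ≤ ‖P‖ * ε := (P.le_opNorm _).trans (by gcongr)
        _ < ε₁ := hlep
    have hob : ((ν, q, b) : V × E × F) ∈ T '' (N ∩ O) ∩ O := by
      refine hTb ?_
      rw [Metric.mem_ball, dist_eq_norm]
      change ‖((ν - ν₀, q - q₀, b - 0) : V × E × F)‖ < ε₁
      rw [Prod.norm_mk, Prod.norm_mk, max_lt_iff, max_lt_iff, sub_zero]
      exact ⟨by linarith, by linarith, hbn⟩
    obtain ⟨⟨⟨ν', q', a⟩, ⟨hoN, hoO⟩, hTo⟩, hbO⟩ := hob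
    obtain ⟨rfl, hTo'⟩ := Prod.ext_iff.mp hTo
    obtain ⟨rfl, hTo''⟩ := Prod.ext_iff.mp hTo'
    change PF (v₁ (ν', q', a) (0 + 1)).2 = b at hTo''
    refine ⟨a, hoN, hoO, ?_⟩
    -- Small decaying solutions with the same endstate and the same stable component coincide; this
    -- applies both to `v` and to the shifted solution.
    have key : ∀ (v : ℝ → E × Y) (K : ℝ), K < ρ →
        (∀ z, 0 ≤ z → HasDerivWithinAt v (f (ν', v z) (v z).2) (Ici 0) z) →
        (∀ z, 0 ≤ z → ‖v z - (q', 0)‖ ≤ K * Real.exp (-δ * z)) → P (v 0).2 = b →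
        ∀ z, 0 ≤ z → v z = v₁ (ν', q', b) z := by
      intro v K hK hv hvd hvb
      obtain ⟨u, hu, hu', hu0⟩ := weightedEq_of_solution (hδ := hδ) (h := h) (F := F) hfc (σ := 1)
        (ν := ν') (q := q') (a := b) (v := v) (K := K) (by simpa only [one_smul] using hv) hvd hvb
      have := huniq 1 (ν', q', b) u h11 hbO (hu.trans_lt hK) hu0
      rwa [this] at hu'
    intro z hz
    rw [key v (K * ε) hleK hv hvd hvb z hz]
    refine (key (fun z => v₁ (ν', q', a) (z + 1)) ‖ψ (1, ν', q', a)‖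
      (hmem 1 _ h11 hoO).2.1 (fun z hz => (hpos _ hoO z (by linarith)).hasDerivWithinAt) ?_ ?_ z
      hz).symm
    · intro z hz
      refine (hv₁b (ν', q', a) _).trans ?_
      gcongr ?_ * ?_
      refine Real.exp_le_exp.mpr ?_
      nlinarith
    · exact congrArg Subtype.val hTo''

end StableManifold

end

section

/-! ### Smooth matrix functions -/

section SmoothMatrix

variable {X : Type*} [NormedAddCommGroup X] [NormedSpace ℝ X] {s : Set X}
  {k m n : Type*} [Fintype k] [Fintype m] [Fintype n]

/-- The entries of the matrix function `M` are smooth on `s`. -/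
def SmoothEntriesOn (M : X → Matrix m n ℝ) (s : Set X) : Prop :=
  ∀ i j, ContDiffOn ℝ ∞ (fun x => M x i j) s

theorem SmoothEntriesOn.const (M : Matrix m n ℝ) : SmoothEntriesOn (fun _ : X => M) s :=
  fun _ _ => contDiffOn_const

theorem SmoothEntriesOn.mul {M : X → Matrix k m ℝ} {N : X → Matrix m n ℝ}
    (hM : SmoothEntriesOn M s) (hN : SmoothEntriesOn N s) :
    SmoothEntriesOn (fun x => M x * N x) s := fun i j => by
  simp only [Matrix.mul_apply]
  exact ContDiffOn.sum fun l _ => (hM i l).mul (hN l j)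

theorem SmoothEntriesOn.sub {M N : X → Matrix m n ℝ} (hM : SmoothEntriesOn M s)
    (hN : SmoothEntriesOn N s) : SmoothEntriesOn (fun x => M x - N x) s :=
  fun i j => (hM i j).sub (hN i j)

theorem SmoothEntriesOn.neg {M : X → Matrix m n ℝ} (hM : SmoothEntriesOn M s) :
    SmoothEntriesOn (fun x => -M x) s := fun i j => (hM i j).neg

theorem SmoothEntriesOn.fromRows {M : X → Matrix k n ℝ} {N : X → Matrix m n ℝ}
    (hM : SmoothEntriesOn M s) (hN : SmoothEntriesOn N s) :
    SmoothEntriesOn (fun x => Matrix.fromRows (M x) (N x)) s := by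
  rintro (i | i) j
  · exact hM i j
  · exact hN i j

theorem SmoothEntriesOn.det [DecidableEq m] {M : X → Matrix m m ℝ} (hM : SmoothEntriesOn M s) :
    ContDiffOn ℝ ∞ (fun x => (M x).det) s := by
  simp only [Matrix.det_apply']
  exact ContDiffOn.sum fun σ _ => contDiffOn_const.mul (contDiffOn_prod fun i _ => hM _ _)

theorem SmoothEntriesOn.inv [DecidableEq m] {M : X → Matrix m m ℝ} (hM : SmoothEntriesOn M s)
    (h0 : ∀ x ∈ s, (M x).det ≠ 0) : SmoothEntriesOn (fun x => (M x)⁻¹) s := by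
  intro i j
  have h1 : ContDiffOn ℝ ∞ (fun x => ((M x).det)⁻¹ * (M x).adjugate i j) s := by
    refine (hM.det.inv h0).mul ?_
    simp only [Matrix.adjugate_apply]
    refine SmoothEntriesOn.det fun k l => ?_
    by_cases hk : k = j
    · subst hk; simp only [Matrix.updateRow_self]; exact contDiffOn_const
    · simp only [Matrix.updateRow_ne hk]; exact hM k l
  refine h1.congr fun x hx => ?_
  change (M x)⁻¹ i j = _
  rw [Matrix.inv_def, Matrix.smul_apply, Ring.inverse_eq_inv', smul_eq_mul]

/-- Multiplication by a real matrix, as a continuous linear map. -/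
def mulVecL (M : Matrix m n ℝ) : (n → ℝ) →L[ℝ] (m → ℝ) := LinearMap.toContinuousLinearMap M.mulVecLin

@[simp] theorem mulVecL_apply (M : Matrix m n ℝ) (v : n → ℝ) : mulVecL M v = M *ᵥ v := rfl

theorem SmoothEntriesOn.mulVecL [DecidableEq m] [DecidableEq n] {M : X → Matrix m n ℝ}
    (hM : SmoothEntriesOn M s) : ContDiffOn ℝ ∞ (fun x => mulVecL (M x)) s := by
  have h1 : ∀ N : Matrix m n ℝ, BoundaryLayer.mulVecL N =
      ∑ i, ∑ j, N i j • BoundaryLayer.mulVecL (Matrix.single i j (1 : ℝ)) := by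
    intro N
    ext v i
    conv_lhs => rw [Matrix.matrix_eq_sum_single N]
    simp only [mulVecL_apply, FunLike.coe_sum, Finset.sum_apply,
      FunLike.coe_smul, Pi.smul_apply, Matrix.sum_mulVec]
    refine Finset.sum_congr rfl fun a _ => Finset.sum_congr rfl fun b _ => ?_
    rw [← Pi.smul_apply, ← Matrix.smul_mulVec, Matrix.smul_single, smul_eq_mul, mul_one]
  rw [show (fun x => BoundaryLayer.mulVecL (M x)) = fun x => ∑ i, ∑ j, M x i j •
    BoundaryLayer.mulVecL (Matrix.single i j (1 : ℝ)) from funext fun x => h1 (M x)]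
  exact ContDiffOn.sum fun i _ => ContDiffOn.sum fun j _ => (hM i j).smul contDiffOn_const

end SmoothMatrix

/-! ### Smooth extension -/

/-- The stable manifold theorem is proved for globally defined fields, whereas the coefficients of
the system are only given on a set of states. A bump function bridges the gap. -/
theorem exists_contDiff_eventuallyEq {X W : Type*} [NormedAddCommGroup X] [NormedSpace ℝ X]
    [FiniteDimensional ℝ X] [NormedAddCommGroup W] [NormedSpace ℝ W] {g : X → W} {U : Set X} {x₀ : X}
    (hU : IsOpen U) (hx₀ : x₀ ∈ U) (hg : ContDiffOn ℝ ∞ g U) :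
    ∃ g' : X → W, ContDiff ℝ ∞ g' ∧ ∀ᶠ x in 𝓝 x₀, g' x = g x := by
  obtain ⟨r, hr, hrU⟩ := Metric.isOpen_iff.mp hU x₀ hx₀
  let χ : ContDiffBump x₀ := ⟨r / 4, r / 2, by positivity, by linarith⟩
  refine ⟨fun x => χ x • g x, ?_, ?_⟩
  · rw [contDiff_iff_contDiffAt]
    intro x
    by_cases hx : x ∈ U
    · exact χ.contDiff.contDiffAt.smul (hg.contDiffAt (hU.mem_nhds hx))
    · have hx' : x ∉ tsupport χ := by
        rw [χ.tsupport_eq]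
        intro h
        exact hx (hrU (lt_of_le_of_lt h (by change r / 2 < r; linarith)))
      have : (fun x => χ x • g x) =ᶠ[𝓝 x] fun _ => 0 := by
        filter_upwards [(isClosed_tsupport χ).isOpen_compl.mem_nhds hx'] with y hy
        rw [image_eq_zero_of_notMem_tsupport hy, zero_smul]
      exact contDiffAt_const.congr_of_eventuallyEq this
  · filter_upwards [χ.eventuallyEq_one] with x hx
    rw [hx]
    simp

/-! ### The first order system -/

namespace System

variable {d n₁ n₂ : ℕ} (S : System d n₁ n₂)

/-- The pairs `(ν, u)` with `u ∈ π𝒰_∂` for which `A¹¹_ν(u)` and `B²²_ν(u)` are invertible. -/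
def regularSet : Set (EuclideanSpace ℝ (Fin d) × State n₁ n₂) :=
  {x | x.2 ∈ S.bdryStates ∧ (S.symA x.1 x.2).toBlocks₁₁.det ≠ 0 ∧
    (S.symB x.1 x.2).toBlocks₂₂.det ≠ 0}

/-- `w' = R(w) w²'` expresses the first block row of the profile equation. -/
def slopeMat (ν : EuclideanSpace ℝ (Fin d)) (u : State n₁ n₂) :
    Matrix (Fin n₁ ⊕ Fin n₂) (Fin n₂) ℝ :=
  Matrix.fromRows (-((S.symA ν u).toBlocks₁₁⁻¹ * (S.symA ν u).toBlocks₁₂)) 1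

/-- `A²²_ν - A²¹_ν (A¹¹_ν)⁻¹ A¹²_ν`. -/
def schurMat (ν : EuclideanSpace ℝ (Fin d)) (u : State n₁ n₂) : Matrix (Fin n₂) (Fin n₂) ℝ :=
  (S.symA ν u).toBlocks₂₂ - (S.symA ν u).toBlocks₂₁ * (S.symA ν u).toBlocks₁₁⁻¹ *
    (S.symA ν u).toBlocks₁₂

/-- The profile equation for `(w, y)`, `y = B₀⁻¹ B²²_ν(w) w²'`, is `(w, y)' = layerField (ν, w) y`. -/
def layerField (B₀ : Matrix (Fin n₂) (Fin n₂) ℝ)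
    (x : EuclideanSpace ℝ (Fin d) × State n₁ n₂) :
    (Fin n₂ → ℝ) →L[ℝ] State n₁ n₂ × (Fin n₂ → ℝ) :=
  (mulVecL (S.slopeMat x.1 x.2 * ((S.symB x.1 x.2).toBlocks₂₂⁻¹ * B₀))).prod
    (mulVecL (B₀⁻¹ * S.schurMat x.1 x.2 * ((S.symB x.1 x.2).toBlocks₂₂⁻¹ * B₀)))

variable {S}

theorem bdryStates_subset_hypStates : S.bdryStates ⊆ S.hypStates := by
  rintro u ⟨t, ht, x, hx, hu⟩
  exact ⟨t, ht, x, frontier_subset_closure hx, hu⟩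

theorem bdryStates_subset_layerStates (hS : S.Hypotheses) : S.bdryStates ⊆ S.layerStates := by
  rintro u ⟨t, ht, x, hx, hu⟩
  exact ⟨t, ht, x, hx, hS.O_subset_Ostar t ht x hx hu⟩

theorem isOpen_bdryStates (hS : S.Hypotheses) : IsOpen S.bdryStates := by
  have : S.bdryStates = ⋃ t ∈ Icc (-S.T) S.T, ⋃ x ∈ frontier S.Ω, S.O t x := by
    ext u; simp [bdryStates]
  rw [this]
  exact isOpen_biUnion fun t ht => isOpen_biUnion fun x hx =>
    hS.isOpen_O t ht x (frontier_subset_closure hx)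

theorem isOpen_layerStates (hS : S.Hypotheses) : IsOpen S.layerStates := by
  have : S.layerStates = ⋃ t ∈ Icc (-S.T) S.T, ⋃ x ∈ frontier S.Ω, S.Ostar t x := by
    ext u; simp [layerStates]
  rw [this]
  exact isOpen_biUnion fun t ht => isOpen_biUnion fun x hx => hS.isOpen_Ostar t ht x hx

theorem smoothEntriesOn_symA (hS : S.Hypotheses) :
    SmoothEntriesOn (fun x : EuclideanSpace ℝ (Fin d) × State n₁ n₂ => S.symA x.1 x.2)
      (univ ×ˢ S.layerStates) := by
  intro i l
  simp only [symA, Matrix.sum_apply, Matrix.smul_apply, smul_eq_mul]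
  refine ContDiffOn.sum fun j _ => ContDiffOn.mul ?_ ?_
  · exact (EuclideanSpace.proj (𝕜 := ℝ) j).contDiff.comp_contDiffOn contDiffOn_fst
  · exact ((hS.smooth_A j i l).mono subset_union_right).comp contDiffOn_snd fun x hx => hx.2

theorem smoothEntriesOn_symB (hS : S.Hypotheses) :
    SmoothEntriesOn (fun x : EuclideanSpace ℝ (Fin d) × State n₁ n₂ => S.symB x.1 x.2)
      (univ ×ˢ S.layerStates) := by
  intro i l
  simp only [symB, Matrix.sum_apply, Matrix.smul_apply, smul_eq_mul]
  refine ContDiffOn.sum fun j _ => ContDiffOn.sum fun k _ => ContDiffOn.mul (ContDiffOn.mul ?_ ?_) ?_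
  · exact (EuclideanSpace.proj (𝕜 := ℝ) j).contDiff.comp_contDiffOn contDiffOn_fst
  · exact (EuclideanSpace.proj (𝕜 := ℝ) k).contDiff.comp_contDiffOn contDiffOn_fst
  · exact ((hS.smooth_B j k i l).mono subset_union_right).comp contDiffOn_snd fun x hx => hx.2

theorem isOpen_regularSet (hS : S.Hypotheses) : IsOpen S.regularSet := by
  have hA := smoothEntriesOn_symA hS
  have hB := smoothEntriesOn_symB hS
  have ho : IsOpen ((univ : Set (EuclideanSpace ℝ (Fin d))) ×ˢ S.bdryStates) :=
    isOpen_univ.prod (isOpen_bdryStates hS)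
  have hsub : (univ : Set (EuclideanSpace ℝ (Fin d))) ×ˢ S.bdryStates ⊆ univ ×ˢ S.layerStates :=
    prod_mono_right (bdryStates_subset_layerStates hS)
  have h1 := (SmoothEntriesOn.det (M := fun x : EuclideanSpace ℝ (Fin d) × State n₁ n₂ =>
    (S.symA x.1 x.2).toBlocks₁₁) fun i j => hA (.inl i) (.inl j)).continuousOn.mono hsub
  have h2 := (SmoothEntriesOn.det (M := fun x : EuclideanSpace ℝ (Fin d) × State n₁ n₂ =>
    (S.symB x.1 x.2).toBlocks₂₂) fun i j => hB (.inr i) (.inr j)).continuousOn.mono hsub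
  have h3 := (h1.isOpen_inter_preimage ho (t := {0}ᶜ) isOpen_compl_singleton).inter
    (h2.isOpen_inter_preimage ho (t := {0}ᶜ) isOpen_compl_singleton)
  convert! h3 using 1
  ext x
  simp [regularSet]
  tauto

theorem smoothEntriesOn_inv_symB (hS : S.Hypotheses) :
    SmoothEntriesOn (fun x : EuclideanSpace ℝ (Fin d) × State n₁ n₂ =>
      (S.symB x.1 x.2).toBlocks₂₂⁻¹) S.regularSet :=
  SmoothEntriesOn.inv (fun i j => (smoothEntriesOn_symB hS (.inr i) (.inr j)).mono
    fun _ hx => ⟨mem_univ _, bdryStates_subset_layerStates hS hx.1⟩) fun _ hx => hx.2.2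

theorem contDiffOn_layerField (hS : S.Hypotheses) (B₀ : Matrix (Fin n₂) (Fin n₂) ℝ) :
    ContDiffOn ℝ ∞ (S.layerField B₀) S.regularSet := by
  have hsub : S.regularSet ⊆ univ ×ˢ S.layerStates :=
    fun _ hx => ⟨mem_univ _, bdryStates_subset_layerStates hS hx.1⟩
  have hA : ∀ i j, ContDiffOn ℝ ∞ _ _ := fun i j => (smoothEntriesOn_symA hS i j).mono hsub
  have ha : SmoothEntriesOn (fun x : EuclideanSpace ℝ (Fin d) × State n₁ n₂ =>
      (S.symA x.1 x.2).toBlocks₁₁⁻¹) S.regularSet :=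
    SmoothEntriesOn.inv (fun i j => hA (.inl i) (.inl j)) fun x hx => hx.2.1
  have hb : SmoothEntriesOn (fun x : EuclideanSpace ℝ (Fin d) × State n₁ n₂ =>
      (S.symA x.1 x.2).toBlocks₁₂) S.regularSet := fun i j => hA (.inl i) (.inr j)
  have hc : SmoothEntriesOn (fun x : EuclideanSpace ℝ (Fin d) × State n₁ n₂ =>
      (S.symA x.1 x.2).toBlocks₂₁) S.regularSet := fun i j => hA (.inr i) (.inl j)
  have hd : SmoothEntriesOn (fun x : EuclideanSpace ℝ (Fin d) × State n₁ n₂ =>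
      (S.symA x.1 x.2).toBlocks₂₂) S.regularSet := fun i j => hA (.inr i) (.inr j)
  have hB := (smoothEntriesOn_inv_symB hS).mul (SmoothEntriesOn.const B₀)
  have hR := ((ha.mul hb).neg.fromRows (SmoothEntriesOn.const (1 : Matrix (Fin n₂) (Fin n₂) ℝ))).mul hB
  have hG := ((SmoothEntriesOn.const B₀⁻¹).mul (hd.sub ((hc.mul ha).mul hb))).mul hB
  exact (contDiffOn_const.clm_comp hR.mulVecL (g := fun _ => ContinuousLinearMap.inl ℝ _ _)).add
    (contDiffOn_const.clm_comp hG.mulVecL (g := fun _ => ContinuousLinearMap.inr ℝ _ _)) |>.congr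
    fun x _ => by
      refine ContinuousLinearMap.ext fun y => ?_
      ext <;> simp [layerField, slopeMat, schurMat]

end System

end

section

/-! ### The profile equation as a first order system -/

section Blocks

variable {n₁ n₂ : ℕ} {R : Type*} [CommRing R]

theorem fstPart_mulVec (M : Matrix (Fin n₁ ⊕ Fin n₂) (Fin n₁ ⊕ Fin n₂) R)
    (x : Fin n₁ ⊕ Fin n₂ → R) :
    fstPart (M *ᵥ x) = M.toBlocks₁₁ *ᵥ fstPart x + M.toBlocks₁₂ *ᵥ sndPart x := by
  conv_lhs => rw [← Matrix.fromBlocks_toBlocks M, Matrix.fromBlocks_mulVec]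
  rfl

theorem sndPart_mulVec (M : Matrix (Fin n₁ ⊕ Fin n₂) (Fin n₁ ⊕ Fin n₂) R)
    (x : Fin n₁ ⊕ Fin n₂ → R) :
    sndPart (M *ᵥ x) = M.toBlocks₂₁ *ᵥ fstPart x + M.toBlocks₂₂ *ᵥ sndPart x := by
  conv_lhs => rw [← Matrix.fromBlocks_toBlocks M, Matrix.fromBlocks_mulVec]
  rfl

theorem eq_elim_parts (x : Fin n₁ ⊕ Fin n₂ → R) : x = Sum.elim (fstPart x) (sndPart x) := by
  ext (i | i) <;> rfl

@[simp] theorem fstPart_elim (x : Fin n₁ → R) (y : Fin n₂ → R) : fstPart (Sum.elim x y) = x := rfl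

@[simp] theorem sndPart_elim (x : Fin n₁ → R) (y : Fin n₂ → R) : sndPart (Sum.elim x y) = y := rfl

theorem parts_ext {x y : Fin n₁ ⊕ Fin n₂ → R} (h₁ : fstPart x = fstPart y)
    (h₂ : sndPart x = sndPart y) : x = y := by
  rw [eq_elim_parts x, eq_elim_parts y, h₁, h₂]

end Blocks

/-- `fstPart` as a continuous linear map. -/
def fstPartL (𝕜 : Type*) [NontriviallyNormedField 𝕜] (n₁ n₂ : ℕ) :
    (Fin n₁ ⊕ Fin n₂ → 𝕜) →L[𝕜] (Fin n₁ → 𝕜) :=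
  ContinuousLinearMap.pi fun i => ContinuousLinearMap.proj (Sum.inl i)

/-- `sndPart` as a continuous linear map. -/
def sndPartL (𝕜 : Type*) [NontriviallyNormedField 𝕜] (n₁ n₂ : ℕ) :
    (Fin n₁ ⊕ Fin n₂ → 𝕜) →L[𝕜] (Fin n₂ → 𝕜) :=
  ContinuousLinearMap.pi fun i => ContinuousLinearMap.proj (Sum.inr i)

@[simp] theorem fstPartL_apply {𝕜 : Type*} [NontriviallyNormedField 𝕜] {n₁ n₂ : ℕ}
    (x : Fin n₁ ⊕ Fin n₂ → 𝕜) : fstPartL 𝕜 n₁ n₂ x = fstPart x := rfl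

@[simp] theorem sndPartL_apply {𝕜 : Type*} [NontriviallyNormedField 𝕜] {n₁ n₂ : ℕ}
    (x : Fin n₁ ⊕ Fin n₂ → 𝕜) : sndPartL 𝕜 n₁ n₂ x = sndPart x := rfl

namespace System

variable {d n₁ n₂ : ℕ} {S : System d n₁ n₂} {ν : EuclideanSpace ℝ (Fin d)} {u : State n₁ n₂}

theorem toBlocks_symB (hS : S.Hypotheses) (hu : u ∈ S.layerStates) :
    (S.symB ν u).toBlocks₁₁ = 0 ∧ (S.symB ν u).toBlocks₁₂ = 0 ∧ (S.symB ν u).toBlocks₂₁ = 0 := by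
  have h := fun j k => hS.B_block j k u (Or.inr hu)
  refine ⟨?_, ?_, ?_⟩ <;> ext i l <;> simp only [symB, Matrix.toBlocks₁₁, Matrix.toBlocks₁₂,
    Matrix.toBlocks₂₁, Matrix.of_apply, Matrix.sum_apply, Matrix.smul_apply, Matrix.zero_apply] <;>
    refine Finset.sum_eq_zero fun j _ => Finset.sum_eq_zero fun k _ => ?_
  · rw [show S.B j k u (Sum.inl i) (Sum.inl l) = 0 from congrFun₂ (h j k).1 i l, smul_zero]
  · rw [show S.B j k u (Sum.inl i) (Sum.inr l) = 0 from congrFun₂ (h j k).2.1 i l, smul_zero]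
  · rw [show S.B j k u (Sum.inr i) (Sum.inl l) = 0 from congrFun₂ (h j k).2.2 i l, smul_zero]

theorem symB_mulVec (hS : S.Hypotheses) (hu : u ∈ S.layerStates) (x : State n₁ n₂) :
    S.symB ν u *ᵥ x = Sum.elim (0 : Fin n₁ → ℝ) ((S.symB ν u).toBlocks₂₂ *ᵥ sndPart x) := by
  obtain ⟨h1, h2, h3⟩ := toBlocks_symB (ν := ν) hS hu
  refine parts_ext ?_ ?_
  · rw [fstPart_mulVec, h1, h2]; simp
  · rw [sndPart_mulVec, h3]; simp

@[simp] theorem sndPart_slopeMat_mulVec (y : Fin n₂ → ℝ) : sndPart (S.slopeMat ν u *ᵥ y) = y := by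
  rw [slopeMat, Matrix.fromRows_mulVec, sndPart_elim, Matrix.one_mulVec]

@[simp] theorem fstPart_slopeMat_mulVec (y : Fin n₂ → ℝ) : fstPart (S.slopeMat ν u *ᵥ y) =
    -(((S.symA ν u).toBlocks₁₁⁻¹ * (S.symA ν u).toBlocks₁₂) *ᵥ y) := by
  rw [slopeMat, Matrix.fromRows_mulVec, fstPart_elim, Matrix.neg_mulVec]

theorem symA_mulVec_slopeMat (h : (S.symA ν u).toBlocks₁₁.det ≠ 0) (y : Fin n₂ → ℝ) :
    S.symA ν u *ᵥ (S.slopeMat ν u *ᵥ y) = Sum.elim (0 : Fin n₁ → ℝ) (S.schurMat ν u *ᵥ y) := by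
  refine parts_ext ?_ ?_
  · rw [fstPart_mulVec, sndPart_slopeMat_mulVec, fstPart_slopeMat_mulVec, fstPart_elim,
      Matrix.mulVec_neg, Matrix.mulVec_mulVec, ← Matrix.mul_assoc,
      Matrix.mul_nonsing_inv _ (isUnit_iff_ne_zero.mpr h), Matrix.one_mul, neg_add_cancel]
  · rw [sndPart_mulVec, sndPart_slopeMat_mulVec, fstPart_slopeMat_mulVec, sndPart_elim,
      Matrix.mulVec_neg, Matrix.mulVec_mulVec, schurMat, Matrix.sub_mulVec, ← Matrix.mul_assoc]
    abel

theorem eq_slopeMat_mulVec (h : (S.symA ν u).toBlocks₁₁.det ≠ 0) {x : State n₁ n₂}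
    (hx : fstPart (S.symA ν u *ᵥ x) = 0) : x = S.slopeMat ν u *ᵥ sndPart x := by
  refine parts_ext ?_ (sndPart_slopeMat_mulVec _).symm
  rw [fstPart_mulVec] at hx
  have h1 := congrArg ((S.symA ν u).toBlocks₁₁⁻¹ *ᵥ ·) hx
  simp only [Matrix.mulVec_add, Matrix.mulVec_mulVec, Matrix.mulVec_zero,
    Matrix.nonsing_inv_mul _ (isUnit_iff_ne_zero.mpr h), Matrix.one_mulVec] at h1
  rw [fstPart_slopeMat_mulVec]
  exact eq_neg_of_add_eq_zero_left h1

theorem layerField_apply (B₀ : Matrix (Fin n₂) (Fin n₂) ℝ) (x : EuclideanSpace ℝ (Fin d) × State n₁ n₂)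
    (y : Fin n₂ → ℝ) : S.layerField B₀ x y =
      (S.slopeMat x.1 x.2 *ᵥ ((S.symB x.1 x.2).toBlocks₂₂⁻¹ *ᵥ (B₀ *ᵥ y)),
        B₀⁻¹ *ᵥ (S.schurMat x.1 x.2 *ᵥ ((S.symB x.1 x.2).toBlocks₂₂⁻¹ *ᵥ (B₀ *ᵥ y)))) := by
  simp [layerField, Matrix.mulVec_mulVec, Matrix.mul_assoc]

theorem IsProfile.hasDerivWithinAt {q : State n₁ n₂} {v : ℝ → State n₁ n₂} (hv : S.IsProfile ν q v)
    {z : ℝ} (hz : 0 ≤ z) : HasDerivWithinAt v (dz v z) (Ici 0) z :=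
  (hv.smooth.differentiableOn (by simp) z hz).hasDerivWithinAt

/-- A profile solves the first order system. -/
theorem IsProfile.layerField (hS : S.Hypotheses) {q : State n₁ n₂} {v : ℝ → State n₁ n₂}
    (hv : S.IsProfile ν q v) (hreg : ∀ z, 0 ≤ z → (ν, v z) ∈ S.regularSet)
    {B₀ : Matrix (Fin n₂) (Fin n₂) ℝ} (hB₀ : B₀.det ≠ 0) {z : ℝ} (hz : 0 ≤ z) :
    HasDerivWithinAt
      (fun z => (v z, B₀⁻¹ *ᵥ ((S.symB ν (v z)).toBlocks₂₂ *ᵥ sndPart (dz v z))))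
      (S.layerField B₀ (ν, v z) (B₀⁻¹ *ᵥ ((S.symB ν (v z)).toBlocks₂₂ *ᵥ sndPart (dz v z))))
      (Ici 0) z := by
  have hu := uniqueDiffOn_Ici (0 : ℝ)
  have hdv : ContDiffOn ℝ ∞ (dz v) (Ici 0) := hv.smooth.derivWithin hu (by simp)
  have hsB : SmoothEntriesOn (fun s => S.symB ν (v s)) (Ici 0) := fun i j =>
    (smoothEntriesOn_symB hS i j).comp (contDiffOn_const.prodMk hv.smooth)
      fun s hs => ⟨mem_univ _, hv.mem s hs⟩
  have hflux : ContDiffOn ℝ ∞ (fun s => S.symB ν (v s) *ᵥ dz v s) (Ici 0) :=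
    hsB.mulVecL.clm_apply hdv
  have h1 := (hflux.differentiableOn (by simp) z hz).hasDerivWithinAt
  have h2 : derivWithin (fun s => S.symB ν (v s) *ᵥ dz v s) (Ici 0) z = S.symA ν (v z) *ᵥ dz v z :=
    (sub_eq_zero.mp (hv.eqn z hz)).symm
  rw [h2] at h1
  -- The first block row of the flux `B_ν(v) v'` vanishes identically, hence so does its derivative,
  -- which is that row of `A_ν(v) v'`.
  have hfst : fstPart (S.symA ν (v z) *ᵥ dz v z) = 0 := by
    have h3 := (fstPartL ℝ n₁ n₂).hasFDerivAt.comp_hasDerivWithinAt z h1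
    have h4 : HasDerivWithinAt (fun _ : ℝ => (0 : Fin n₁ → ℝ)) 0 (Ici 0) z :=
      hasDerivWithinAt_const _ _ _
    refine (hu z hz).eq_deriv _ (h3.congr (fun s hs => ?_) ?_) h4
    · simp [symB_mulVec hS (hv.mem s hs)]
    · simp [symB_mulVec hS (hv.mem z hz)]
  have hslope := eq_slopeMat_mulVec (hreg z hz).2.1 hfst
  have hsnd : HasDerivWithinAt (fun s => (S.symB ν (v s)).toBlocks₂₂ *ᵥ sndPart (dz v s))
      (S.schurMat ν (v z) *ᵥ sndPart (dz v z)) (Ici 0) z := by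
    have h3 := (sndPartL ℝ n₁ n₂).hasFDerivAt.comp_hasDerivWithinAt z h1
    refine (h3.congr (fun s hs => ?_) ?_).congr_deriv ?_
    · simp [symB_mulVec hS (hv.mem s hs)]
    · simp [symB_mulVec hS (hv.mem z hz)]
    · rw [hslope, symA_mulVec_slopeMat (hreg z hz).2.1]
      simp
  have hB : (S.symB ν (v z)).toBlocks₂₂⁻¹ *ᵥ
      (B₀ *ᵥ (B₀⁻¹ *ᵥ ((S.symB ν (v z)).toBlocks₂₂ *ᵥ sndPart (dz v z)))) = sndPart (dz v z) := by
    rw [Matrix.mulVec_mulVec _ B₀, Matrix.mul_nonsing_inv _ (isUnit_iff_ne_zero.mpr hB₀),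
      Matrix.one_mulVec, Matrix.mulVec_mulVec,
      Matrix.nonsing_inv_mul _ (isUnit_iff_ne_zero.mpr (hreg z hz).2.2), Matrix.one_mulVec]
  rw [layerField_apply]
  simp only [hB]
  rw [← hslope]
  exact (hv.hasDerivWithinAt hz).prodMk
    ((mulVecL B₀⁻¹).hasFDerivAt.comp_hasDerivWithinAt z hsnd)

variable {w : ℝ → State n₁ n₂} {y : ℝ → Fin n₂ → ℝ} {B₀ : Matrix (Fin n₂) (Fin n₂) ℝ}

theorem dz_eq_of_layerField
    (h : ∀ z, 0 ≤ z → HasDerivWithinAt (fun z => (w z, y z)) (S.layerField B₀ (ν, w z) (y z)) (Ici 0) z)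
    {z : ℝ} (hz : 0 ≤ z) :
    dz w z = S.slopeMat ν (w z) *ᵥ ((S.symB ν (w z)).toBlocks₂₂⁻¹ *ᵥ (B₀ *ᵥ y z)) := by
  have h1 := (ContinuousLinearMap.fst ℝ _ _).hasFDerivAt.comp_hasDerivWithinAt z (h z hz)
  rw [layerField_apply] at h1
  exact h1.derivWithin (uniqueDiffOn_Ici (0 : ℝ) z hz)

/-- Solutions of the first order system are profiles. -/
theorem isProfile_of_layerField (hS : S.Hypotheses) {q : State n₁ n₂} (hB₀ : B₀.det ≠ 0)
    (h : ∀ z, 0 ≤ z → HasDerivWithinAt (fun z => (w z, y z)) (S.layerField B₀ (ν, w z) (y z)) (Ici 0) z)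
    (hreg : ∀ z, 0 ≤ z → (ν, w z) ∈ S.regularSet) (hw : ContDiffOn ℝ ∞ w (Ici 0))
    (hlim : Tendsto w atTop (𝓝 q)) : S.IsProfile ν q w := by
  have hmem : ∀ z, 0 ≤ z → w z ∈ S.layerStates := fun z hz =>
    bdryStates_subset_layerStates hS (hreg z hz).1
  refine ⟨hw, hmem, fun z hz => ?_, hlim⟩
  have hflux : ∀ s, 0 ≤ s → S.symB ν (w s) *ᵥ dz w s =
      mulVecL (Matrix.fromRows (0 : Matrix (Fin n₁) (Fin n₂) ℝ) B₀) (y s) := by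
    intro s hs
    rw [symB_mulVec hS (hmem s hs), dz_eq_of_layerField h hs, sndPart_slopeMat_mulVec,
      Matrix.mulVec_mulVec, Matrix.mul_nonsing_inv _ (isUnit_iff_ne_zero.mpr (hreg s hs).2.2),
      Matrix.one_mulVec, mulVecL_apply, Matrix.fromRows_mulVec, Matrix.zero_mulVec]
  have h1 := (ContinuousLinearMap.snd ℝ _ _).hasFDerivAt.comp_hasDerivWithinAt z (h z hz)
  have h2 := (mulVecL (Matrix.fromRows (0 : Matrix (Fin n₁) (Fin n₂) ℝ)
    B₀)).hasFDerivAt.comp_hasDerivWithinAt z h1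
  have h3 := (h2.congr (fun s hs => hflux s hs) (hflux z hz)).derivWithin
    (uniqueDiffOn_Ici (0 : ℝ) z hz)
  have h4 : dz (fun s => S.symB ν (w s) *ᵥ dz w s) z =
      Sum.elim (0 : Fin n₁ → ℝ) (S.schurMat ν (w z) *ᵥ ((S.symB ν (w z)).toBlocks₂₂⁻¹ *ᵥ (B₀ *ᵥ y z))) := by
    refine h3.trans ?_
    rw [layerField_apply, mulVecL_apply, Matrix.fromRows_mulVec, Matrix.zero_mulVec,
      ContinuousLinearMap.coe_snd', Matrix.mulVec_mulVec _ B₀,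
      Matrix.mul_nonsing_inv _ (isUnit_iff_ne_zero.mpr hB₀), Matrix.one_mulVec]
  rw [h4, dz_eq_of_layerField h hz, symA_mulVec_slopeMat (hreg z hz).2.1, sub_self]

end System

end

section

/-! ### The linearized equation at a base point -/

theorem stableSubspace_le_decaySubspace {n : Type*} [Fintype n] [DecidableEq n] (M : Matrix n n ℝ) :
    stableSubspace M ≤ decaySubspace (mulVecL M) := by
  intro v hv
  obtain ⟨c, hc0, hc, C, β, hβ, hC⟩ := exists_decaying_of_mem_stableSubspace hv
  refine ⟨C, β, hβ, fun t ht => ?_⟩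
  rw [← hc0, ← eq_expFlow_of_hasDerivAt (A := mulVecL M) hc t]
  exact hC t ht

/-- `𝔼₋(M)` and `𝔼₋(-M)` consist of forward and backward decaying vectors and together span the
space, so the projection exists, fixes the first and annihilates the second. -/
theorem exists_dichotomy_mulVecL {n : Type*} [Fintype n] [DecidableEq n] {M : Matrix n n ℝ}
    (h : ∀ μ ∈ spectrum ℂ (cplx M), μ.re ≠ 0) :
    ∃ P C β, Dichotomy (mulVecL M) P C β ∧ (∀ v ∈ stableSubspace M, P v = v) ∧
      ∀ v, P v ∈ stableSubspace M := by
  have h1 := stableSubspace_le_decaySubspace M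
  have h2 : stableSubspace (-M) ≤ decaySubspace (-mulVecL M) := by
    have e : mulVecL (-M) = -mulVecL M := by ext v; simp [Matrix.neg_mulVec]
    rw [← e]
    exact stableSubspace_le_decaySubspace (-M)
  have hsup := stableSubspace_sup_neg h
  obtain ⟨P, C, β, hP, hfix, hker, -⟩ := exists_dichotomy (A := mulVecL M)
    (eq_top_iff.mpr (hsup ▸ sup_le_sup h1 h2))
  refine ⟨P, C, β, hP, fun v hv => hfix v (h1 hv), fun v => ?_⟩
  obtain ⟨a, ha, b, hb, rfl⟩ := Submodule.mem_sup.mp (hsup ▸ Submodule.mem_top (x := v))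
  rw [map_add, hfix a (h1 ha), hker b (h2 hb), add_zero]
  exact ha

theorem det_ne_zero_of_forall_mem_spectrum {n : Type*} [Fintype n] [DecidableEq n]
    {M : Matrix n n ℝ} (h : ∀ μ ∈ spectrum ℂ (cplx M), μ ≠ 0) : M.det ≠ 0 := by
  intro h0
  obtain ⟨v, hv, hMv⟩ := Matrix.exists_mulVec_eq_zero_iff.mpr h0
  refine h 0 (mem_spectrum_of_mulVec_eq (v := fun i => (v i : ℂ)) ?_ ?_) rfl
  · intro h1
    exact hv (funext fun i => Complex.ofReal_eq_zero.mp (congrFun h1 i))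
  · ext i
    have := congrFun hMv i
    simp only [Matrix.mulVec, dotProduct, cplx, Matrix.map_apply, zero_smul, Pi.zero_apply] at this ⊢
    exact_mod_cast this

theorem ne_zero_of_mem_spectrum_of_det_ne_zero {n : Type*} [Fintype n] [DecidableEq n]
    {M : Matrix n n ℝ} (h : M.det ≠ 0) {μ : ℂ} (hμ : μ ∈ spectrum ℂ (cplx M)) : μ ≠ 0 := by
  rintro rfl
  obtain ⟨v, hv, hMv⟩ := exists_cplx_eigenvector hμ
  refine hv ?_
  have h1 : (cplx M).det ≠ 0 := by
    have : (cplx M).det = (M.det : ℂ) := (RingHom.map_det Complex.ofRealHom M).symm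
    rw [this]; exact_mod_cast h
  rw [zero_smul] at hMv
  exact Matrix.eq_zero_of_mulVec_eq_zero h1 hMv

theorem norm_eq_one_of_isInwardUnitNormal {d : ℕ} {Ω : Set (EuclideanSpace ℝ (Fin d))}
    {x n : EuclideanSpace ℝ (Fin d)} (h : IsInwardUnitNormal Ω x n) : ‖n‖ = 1 := by
  obtain ⟨ρ, -, h0, -, rfl⟩ := h
  rw [norm_smul, norm_inv, norm_norm, inv_mul_cancel₀ (norm_ne_zero_iff.mpr h0)]

namespace System

variable {d n₁ n₂ : ℕ} {S : System d n₁ n₂}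

/-- The properties of a base point which are used below. -/
structure IsHyperbolicPoint (S : System d n₁ n₂) (ν : EuclideanSpace ℝ (Fin d))
    (p : State n₁ n₂) : Prop where
  norm_eq : ‖ν‖ = 1
  regular : (ν, p) ∈ S.regularSet
  re_ne_zero : ∀ μ ∈ spectrum ℂ (cplx (S.G ν p)), μ.re ≠ 0
  finrank_add : Module.finrank ℝ (stableSubspace (S.G ν p)) + S.Nplus = S.N1plus + n₂

theorem symA_smul (ξ : ℝ) (ν : EuclideanSpace ℝ (Fin d)) (u : State n₁ n₂) :
    S.symA (ξ • ν) u = ξ • S.symA ν u := by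
  simp [symA, Finset.smul_sum, smul_smul]

theorem symB_smul (ξ : ℝ) (ν : EuclideanSpace ℝ (Fin d)) (u : State n₁ n₂) :
    S.symB (ξ • ν) u = ξ ^ 2 • S.symB ν u := by
  simp only [symB, Finset.smul_sum, smul_smul]
  refine Finset.sum_congr rfl fun j _ => Finset.sum_congr rfl fun k _ => ?_
  congr 1
  simp only [PiLp.smul_apply, smul_eq_mul]
  ring

theorem cplx_smul {m n : Type*} (c : ℝ) (M : Matrix m n ℝ) : cplx (c • M) = (c : ℂ) • cplx M := by
  ext i j; simp [cplx]

/-- This is where the hypotheses on the spectra are used. Invertibility of `A¹¹_ν` and `B²²_ν` comes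
from the signs of the eigenvalues of their barred versions, which are products of diagonal blocks
because `A₀` is block triangular. -/
theorem isHyperbolicPoint (hS : S.Hypotheses) {t : ℝ} (ht : t ∈ Icc (-S.T) S.T)
    {x : EuclideanSpace ℝ (Fin d)} (hx : x ∈ frontier S.Ω) {p : State n₁ n₂} (hp : p ∈ S.O t x) :
    S.IsHyperbolicPoint (S.normal x) p := by
  set ν := S.normal x with hν
  have hν1 : ‖ν‖ = 1 := norm_eq_one_of_isInwardUnitNormal (hS.normal_spec x hx)
  have hν0 : ν ≠ 0 := fun h => by simp [h] at hν1
  have hpb : p ∈ S.bdryStates := ⟨t, ht, x, hx, hp⟩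
  have hpl := bdryStates_subset_layerStates hS hpb
  have hph := bdryStates_subset_hypStates hpb
  have hpu : p ∈ S.hypStates ∪ S.layerStates := Or.inl hph
  have hps : p ∈ S.Ostar t x := hS.O_subset_Ostar t ht x hx hp
  -- block forms
  set E₁₁ := (S.A₀ p).toBlocks₁₁
  set E₂₁ := (S.A₀ p).toBlocks₂₁
  set E₂₂ := (S.A₀ p).toBlocks₂₂
  set a := (S.symA ν p).toBlocks₁₁ with ha_def
  set b := (S.symA ν p).toBlocks₁₂ with hb_def
  set c := (S.symA ν p).toBlocks₂₁ with hc_def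
  set d' := (S.symA ν p).toBlocks₂₂ with hd_def
  set B := (S.symB ν p).toBlocks₂₂ with hB_def
  have hA₀ : S.A₀ p = Matrix.fromBlocks E₁₁ 0 E₂₁ E₂₂ := by
    rw [← hS.A₀_block p hpu]; exact (Matrix.fromBlocks_toBlocks _).symm
  have hA : S.symA ν p = Matrix.fromBlocks a b c d' := (Matrix.fromBlocks_toBlocks _).symm
  have hB : S.symB ν p = Matrix.fromBlocks 0 0 0 B := by
    obtain ⟨h1, h2, h3⟩ := toBlocks_symB (ν := ν) hS hpl
    rw [← Matrix.fromBlocks_toBlocks (S.symB ν p), h1, h2, h3]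
  have hdet := hS.det_A₀ p hpu
  have hE := hdet
  rw [hA₀, Matrix.det_fromBlocks_zero₁₂] at hE
  have hE₁ : IsUnit E₁₁.det := isUnit_iff_ne_zero.mpr (left_ne_zero_of_mul hE)
  have hE₂ : IsUnit E₂₂.det := isUnit_iff_ne_zero.mpr (right_ne_zero_of_mul hE)
  have hA₀inv : (S.A₀ p)⁻¹ = Matrix.fromBlocks E₁₁⁻¹ 0 (-(E₂₂⁻¹ * E₂₁ * E₁₁⁻¹)) E₂₂⁻¹ := by
    rw [hA₀]
    refine Matrix.inv_eq_right_inv ?_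
    rw [Matrix.fromBlocks_multiply]
    simp [Matrix.mul_nonsing_inv _ hE₁, Matrix.mul_nonsing_inv _ hE₂, ← Matrix.mul_assoc]
  have hAb : (S.Abar ν p).toBlocks₁₁ = E₁₁⁻¹ * a := by
    rw [Abar, hA₀inv, hA, Matrix.fromBlocks_multiply, Matrix.toBlocks_fromBlocks₁₁]
    simp
  have hBb : (S.Bbar ν p).toBlocks₂₂ = E₂₂⁻¹ * B := by
    rw [Bbar, hA₀inv, hB, Matrix.fromBlocks_multiply, Matrix.toBlocks_fromBlocks₂₂]
    simp
  -- spectral facts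
  have hA11 : ∀ μ ∈ spectrum ℂ (cplx (E₁₁⁻¹ * a)), μ.re ≠ 0 := by
    rw [← hAb]
    intro μ hμ
    rcases hS.sign_A11 t ht x hx p hps with h | h
    · exact (h μ hμ).ne'
    · exact (h μ hμ).ne
  have hB22 : ∀ μ ∈ spectrum ℂ (cplx (E₂₂⁻¹ * B)), 0 < μ.re := by
    rw [← hBb]
    obtain ⟨k, hk, h⟩ := hS.parabolic
    intro μ hμ
    have := h p hpu ν μ hμ
    rw [hν1] at this
    linarith
  have ha : a.det ≠ 0 := by
    have := det_ne_zero_of_forall_mem_spectrum fun μ hμ => ne_zero_of_re_ne_zero (hA11 μ hμ)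
    rw [Matrix.det_mul] at this
    exact right_ne_zero_of_mul this
  have hBdet : B.det ≠ 0 := by
    have := det_ne_zero_of_forall_mem_spectrum fun μ hμ => ne_zero_of_re_ne_zero (hB22 μ hμ).ne'
    rw [Matrix.det_mul] at this
    exact right_ne_zero_of_mul this
  have hAdet := hS.det_A t ht x hx p hp
  have hAre : ∀ μ ∈ spectrum ℂ (cplx (S.Abar ν p)), μ.re ≠ 0 := by
    intro μ hμ h0
    exact ne_zero_of_mem_spectrum_of_det_ne_zero hAdet hμ
      (Complex.ext h0 (hS.real_A p hph ν hν0 μ hμ))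
  obtain ⟨k, hk, hdiss⟩ := hS.dissipative
  have hdiss' : ∀ ξ : ℝ, ∀ μ ∈ spectrum ℂ ((ξ * Complex.I) • cplx (S.Abar ν p) +
      (ξ : ℂ) ^ 2 • cplx (S.Bbar ν p)), k * (ξ ^ 2 / (1 + ξ ^ 2)) ≤ μ.re := by
    intro ξ μ hμ
    have h1 := hdiss p hph (ξ • ν) μ
    rw [norm_smul, hν1, mul_one, Real.norm_eq_abs, sq_abs] at h1
    refine h1 ?_
    have e1 : S.Abar (ξ • ν) p = ξ • S.Abar ν p := by
      rw [Abar, symA_smul, Matrix.mul_smul]; rfl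
    have e2 : S.Bbar (ξ • ν) p = ξ ^ 2 • S.Bbar ν p := by
      rw [Bbar, symB_smul, Matrix.mul_smul]; rfl
    rw [e1, e2, cplx_smul, cplx_smul, smul_smul, mul_comm Complex.I]
    simpa using hμ
  have hG : S.G ν p = B⁻¹ * (d' - c * a⁻¹ * b) := rfl
  -- An eigenvector `y` of `G` lifts to `v = (-a⁻¹ b y, y)` with `A_ν v = μ B_ν v`.
  have hGre : ∀ μ ∈ spectrum ℂ (cplx (S.G ν p)), μ.re ≠ 0 := by
    intro μ hμ h0
    obtain ⟨y, hy, hGy⟩ := exists_cplx_eigenvector hμ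
    have hschur : cplx (d' - c * a⁻¹ * b) *ᵥ y = μ • (cplx B *ᵥ y) := by
      have h1 : cplx B * cplx (S.G ν p) = cplx (d' - c * a⁻¹ * b) := by
        rw [← cplx_mul, hG, ← Matrix.mul_assoc,
          Matrix.mul_nonsing_inv _ (isUnit_iff_ne_zero.mpr hBdet), Matrix.one_mul]
      rw [← h1, ← Matrix.mulVec_mulVec, hGy, Matrix.mulVec_smul]
    set v : Fin n₁ ⊕ Fin n₂ → ℂ := Sum.elim (-(cplx (a⁻¹ * b) *ᵥ y)) y with hv
    have hv0 : v ≠ 0 := by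
      intro h1
      exact hy (congrArg sndPart h1)
    have hblk : ∀ M : Matrix (Fin n₁ ⊕ Fin n₂) (Fin n₁ ⊕ Fin n₂) ℝ,
        (cplx M).toBlocks₁₁ = cplx M.toBlocks₁₁ ∧ (cplx M).toBlocks₁₂ = cplx M.toBlocks₁₂ ∧
        (cplx M).toBlocks₂₁ = cplx M.toBlocks₂₁ ∧ (cplx M).toBlocks₂₂ = cplx M.toBlocks₂₂ :=
      fun M => ⟨rfl, rfl, rfl, rfl⟩
    have hBv : cplx (S.symB ν p) *ᵥ v = Sum.elim (0 : Fin n₁ → ℂ) (cplx B *ᵥ y) := by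
      obtain ⟨h1, h2, h3⟩ := toBlocks_symB (ν := ν) hS hpl
      obtain ⟨e1, e2, e3, e4⟩ := hblk (S.symB ν p)
      have hz : ∀ {m n : Type} [Fintype n] (w : n → ℂ), cplx (0 : Matrix m n ℝ) *ᵥ w = 0 := by
        intro m n _ w; ext i; simp [cplx, Matrix.mulVec, dotProduct]
      refine parts_ext ?_ ?_
      · rw [fstPart_mulVec, e1, e2, h1, h2, hz, hz, add_zero]; rfl
      · rw [sndPart_mulVec, e3, e4, h3, hz, zero_add]; rfl
    have hAv : cplx (S.symA ν p) *ᵥ v = μ • (cplx (S.symB ν p) *ᵥ v) := by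
      obtain ⟨e1, e2, e3, e4⟩ := hblk (S.symA ν p)
      rw [hBv]
      refine parts_ext ?_ ?_
      · rw [fstPart_mulVec, e1, e2, hv, fstPart_elim, sndPart_elim, Matrix.mulVec_neg,
          Matrix.mulVec_mulVec, ← cplx_mul, ← Matrix.mul_assoc,
          Matrix.mul_nonsing_inv _ (isUnit_iff_ne_zero.mpr ha), Matrix.one_mul, neg_add_cancel]
        ext i; simp [fstPart]
      · rw [sndPart_mulVec, e3, e4, hv, fstPart_elim, sndPart_elim, Matrix.mulVec_neg,
          Matrix.mulVec_mulVec, ← cplx_mul, ← Matrix.mul_assoc]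
        have h1 : cplx (d' - c * a⁻¹ * b) = cplx d' - cplx (c * a⁻¹ * b) := by
          ext i j; simp [cplx]
        rw [h1, Matrix.sub_mulVec] at hschur
        rw [neg_add_eq_sub, hschur]
        rfl
    have hAbv : cplx (S.Abar ν p) *ᵥ v = μ • (cplx (S.Bbar ν p) *ᵥ v) := by
      rw [Abar, Bbar, cplx_mul, cplx_mul, ← Matrix.mulVec_mulVec, hAv, Matrix.mulVec_smul,
        Matrix.mulVec_mulVec]
    by_cases hτ : μ = 0
    · rw [hτ, zero_smul] at hAbv
      refine ne_zero_of_mem_spectrum_of_det_ne_zero hAdet (μ := 0)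
        (mem_spectrum_of_mulVec_eq hv0 ?_) rfl
      rw [hAbv, zero_smul]
    · have hμ' : μ = μ.im * Complex.I := Complex.ext (by simp [h0]) (by simp)
      have him : μ.im ≠ 0 := fun h => hτ (by rw [hμ', h]; simp)
      -- For `μ = is`, at frequency `ξ = s` the sum `iξĀ + ξ²B̄` maps `v` to `(is · is + s²) B̄ v =
      -- 0`; dissipativity excludes the eigenvalue `0` when `s ≠ 0`.
      have h1 := hdiss' μ.im 0 (mem_spectrum_of_mulVec_eq hv0 ?_)
      · have : 0 < k * (μ.im ^ 2 / (1 + μ.im ^ 2)) := by positivity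
        simp at h1
        linarith
      · rw [Matrix.add_mulVec, Matrix.smul_mulVec, Matrix.smul_mulVec, hAbv, smul_smul, ← add_smul]
        nth_rewrite 2 [hμ']
        rw [show (μ.im : ℂ) * Complex.I * (μ.im * Complex.I) + (μ.im : ℂ) ^ 2 = 0 by
          linear_combination (μ.im : ℂ) ^ 2 * Complex.I_sq]
        simp
  refine ⟨hν1, ⟨hpb, ha, hBdet⟩, hGre, ?_⟩
  have hcount := stableCount_reduced_add (E₂₁ := E₂₁) (b := b) (c := c) (d := d') hE₁ hE₂
    (isUnit_iff_ne_zero.mpr ha) (isUnit_iff_ne_zero.mpr hBdet)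
    (by rw [← hA₀, ← hA]; exact hAre) hA11 hGre hB22
    (by
      rw [← hA₀, ← hA, ← hB]
      intro ξ μ hμ
      exact le_trans (by positivity) (hdiss' ξ μ hμ))
  rw [← hA₀, ← hA, ← hAb, ← hG, Fintype.card_fin] at hcount
  rw [finrank_stableSubspace, ← hS.Nplus_spec t ht x hx p hp, ← hS.N1plus_spec t ht x hx p hps]
  exact hcount

end System

end

section

/-! ### Transversality of constant layers -/

/-- The complex vector with given real and imaginary parts. -/
def ofParts (ι : Type*) [Fintype ι] : (ι → ℝ) × (ι → ℝ) →L[ℝ] (ι → ℂ) :=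
  LinearMap.toContinuousLinearMap
    { toFun := fun x i => ⟨x.1 i, x.2 i⟩
      map_add' := fun x y => by ext i; apply Complex.ext <;> simp
      map_smul' := fun c x => by ext i; apply Complex.ext <;> simp }

/-- The real part of a complex vector. -/
def rePart (ι : Type*) [Fintype ι] : (ι → ℂ) →L[ℝ] (ι → ℝ) :=
  ContinuousLinearMap.pi fun i => Complex.reCLM.comp (ContinuousLinearMap.proj i)

/-- The imaginary part of a complex vector. -/
def imPart (ι : Type*) [Fintype ι] : (ι → ℂ) →L[ℝ] (ι → ℝ) :=
  ContinuousLinearMap.pi fun i => Complex.imCLM.comp (ContinuousLinearMap.proj i)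

section Parts

variable {ι κ : Type*} [Fintype ι] [Fintype κ]

@[simp] theorem ofParts_apply (x : (ι → ℝ) × (ι → ℝ)) (i : ι) :
    ofParts ι x i = ⟨x.1 i, x.2 i⟩ := rfl

@[simp] theorem rePart_apply (x : ι → ℂ) (i : ι) : rePart ι x i = (x i).re := rfl

@[simp] theorem imPart_apply (x : ι → ℂ) (i : ι) : imPart ι x i = (x i).im := rfl

theorem ofParts_rePart_imPart (x : ι → ℂ) : ofParts ι (rePart ι x, imPart ι x) = x := rfl

theorem cplx_mulVec_ofParts (M : Matrix κ ι ℝ) (x : (ι → ℝ) × (ι → ℝ)) :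
    cplx M *ᵥ ofParts ι x = ofParts κ (M *ᵥ x.1, M *ᵥ x.2) := by
  ext i
  apply Complex.ext <;> simp [Matrix.mulVec, dotProduct, cplx]

end Parts

theorem mulVec_surjective_of_rank {m n : ℕ} {M : Matrix (Fin m) (Fin n) ℝ} (h : M.rank = m) :
    Function.Surjective (M *ᵥ ·) := by
  have h1 : LinearMap.range M.mulVecLin = ⊤ :=
    Submodule.eq_top_of_finrank_eq (by rw [← Matrix.rank, h]; simp)
  exact LinearMap.range_eq_top.mp h1

namespace System

variable {d n₁ n₂ : ℕ} {S : System d n₁ n₂} {ν : EuclideanSpace ℝ (Fin d)} {p : State n₁ n₂}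

/-- Real solutions of the profile equation linearized about the constant `p`. -/
def IsConstLinearized (S : System d n₁ n₂) (ν : EuclideanSpace ℝ (Fin d)) (p : State n₁ n₂)
    (g : ℝ → State n₁ n₂) : Prop :=
  ContDiffOn ℝ ∞ g (Ici 0) ∧ ∀ z, 0 ≤ z →
    S.symA ν p *ᵥ dz g z - dz (fun s => S.symB ν p *ᵥ dz g s) z = 0

/-- The linearized boundary operator on real functions. -/
def constΓ (S : System d n₁ n₂) (p : State n₁ n₂) (g : ℝ → State n₁ n₂) : S.BIndex → ℝ :=
  Sum.elim (jacobian S.Υ₁ (fstPart p) *ᵥ fstPart (g 0))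
    (Sum.elim (jacobian S.Υ₂ (sndPart p) *ᵥ sndPart (g 0)) (S.K *ᵥ sndPart (dz g 0)))

theorem dz_ofParts {ι : Type*} [Fintype ι] {g₁ g₂ : ℝ → ι → ℝ} (h₁ : DifferentiableOn ℝ g₁ (Ici 0))
    (h₂ : DifferentiableOn ℝ g₂ (Ici 0)) {z : ℝ} (hz : 0 ≤ z) :
    dz (fun s => ofParts ι (g₁ s, g₂ s)) z = ofParts ι (dz g₁ z, dz g₂ z) :=
  ((ofParts ι).hasFDerivAt.comp_hasDerivWithinAt z
    ((h₁ z hz).hasDerivWithinAt.prodMk (h₂ z hz).hasDerivWithinAt)).derivWithin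
    (uniqueDiffOn_Ici (0 : ℝ) z hz)

theorem differentiableOn_dz {ι : Type*} [Fintype ι] {g : ℝ → ι → ℝ} (h : ContDiffOn ℝ ∞ g (Ici 0)) :
    DifferentiableOn ℝ (dz g) (Ici 0) :=
  (h.derivWithin (m := ∞) (uniqueDiffOn_Ici 0) (by simp)).differentiableOn (by simp)

/-- The terms with derivatives of the coefficients carry the factor `∂_z p = 0`; what is left is a
real linear equation, satisfied by real and imaginary parts separately. -/
theorem isLinearizedSolution_ofParts {g₁ g₂ : ℝ → State n₁ n₂} :
    S.IsLinearizedSolution ν (fun _ => p) (fun z => ofParts _ (g₁ z, g₂ z)) ↔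
      S.IsConstLinearized ν p g₁ ∧ S.IsConstLinearized ν p g₂ := by
  have hzero : ∀ z, dz (fun _ : ℝ => p) z = 0 := fun z => by simp [dz]
  have hC : ContDiffOn ℝ ∞ (fun z => ofParts _ (g₁ z, g₂ z)) (Ici 0) ↔
      ContDiffOn ℝ ∞ g₁ (Ici 0) ∧ ContDiffOn ℝ ∞ g₂ (Ici 0) := by
    refine ⟨fun h => ⟨(rePart (Fin n₁ ⊕ Fin n₂)).contDiff.comp_contDiffOn h,
      (imPart (Fin n₁ ⊕ Fin n₂)).contDiff.comp_contDiffOn h⟩,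
      fun h => (ofParts (Fin n₁ ⊕ Fin n₂)).contDiff.comp_contDiffOn (h.1.prodMk h.2)⟩
  have key : ContDiffOn ℝ ∞ g₁ (Ici 0) → ContDiffOn ℝ ∞ g₂ (Ici 0) → ∀ z, 0 ≤ z →
      (cplx (S.symA ν p) *ᵥ dz (fun z => ofParts _ (g₁ z, g₂ z)) z
        + dMat (S.symA ν) p (ofParts _ (g₁ z, g₂ z)) *ᵥ (fun k => (dz (fun _ => p) z k : ℂ))
      - dz (fun s => cplx (S.symB ν p) *ᵥ dz (fun z => ofParts _ (g₁ z, g₂ z)) s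
            + dMat (S.symB ν) p (ofParts _ (g₁ s, g₂ s)) *ᵥ
              (fun k => (dz (fun _ => p) s k : ℂ))) z) =
      ofParts _ (S.symA ν p *ᵥ dz g₁ z - dz (fun s => S.symB ν p *ᵥ dz g₁ s) z,
        S.symA ν p *ᵥ dz g₂ z - dz (fun s => S.symB ν p *ᵥ dz g₂ s) z) := by
    intro h1 h2 z hz
    have hd1 := h1.differentiableOn (by simp)
    have hd2 := h2.differentiableOn (by simp)
    have hv : ∀ z, (fun k => (dz (fun _ => p) z k : ℂ)) = 0 := fun z => by ext k; simp [hzero]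
    have e : ∀ g : ℝ → State n₁ n₂, ContDiffOn ℝ ∞ g (Ici 0) →
        DifferentiableOn ℝ (fun s => S.symB ν p *ᵥ dz g s) (Ici 0) := fun g hg =>
      (mulVecL (S.symB ν p)).differentiable.comp_differentiableOn (differentiableOn_dz hg)
    have hcongr : dz (fun s => cplx (S.symB ν p) *ᵥ dz (fun z => ofParts _ (g₁ z, g₂ z)) s
            + dMat (S.symB ν) p (ofParts _ (g₁ s, g₂ s)) *ᵥ
              (fun k => (dz (fun _ => p) s k : ℂ))) z =
        dz (fun s => ofParts _ (S.symB ν p *ᵥ dz g₁ s, S.symB ν p *ᵥ dz g₂ s)) z := by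
      have e1 : ∀ s, 0 ≤ s → cplx (S.symB ν p) *ᵥ dz (fun z => ofParts _ (g₁ z, g₂ z)) s
            + dMat (S.symB ν) p (ofParts _ (g₁ s, g₂ s)) *ᵥ
              (fun k => (dz (fun _ => p) s k : ℂ)) =
          ofParts _ (S.symB ν p *ᵥ dz g₁ s, S.symB ν p *ᵥ dz g₂ s) := by
        intro s hs
        rw [hv, Matrix.mulVec_zero, add_zero, dz_ofParts hd1 hd2 hs, cplx_mulVec_ofParts]
      exact derivWithin_congr (fun s hs => e1 s hs) (e1 z hz)
    rw [hcongr, dz_ofParts (e g₁ h1) (e g₂ h2) hz, hv, Matrix.mulVec_zero, add_zero,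
      dz_ofParts hd1 hd2 hz, cplx_mulVec_ofParts, ← map_sub]
    rfl
  constructor
  · rintro ⟨h1, h2⟩
    obtain ⟨hc1, hc2⟩ := hC.mp h1
    have h3 := fun z hz => (key hc1 hc2 z hz).symm.trans (h2 z hz)
    refine ⟨⟨hc1, fun z hz => ?_⟩, ⟨hc2, fun z hz => ?_⟩⟩
    · exact congrArg (rePart _) (h3 z hz)
    · exact congrArg (imPart _) (h3 z hz)
  · rintro ⟨⟨h1, h1'⟩, ⟨h2, h2'⟩⟩
    refine ⟨hC.mpr ⟨h1, h2⟩, fun z hz => ?_⟩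
    refine (key h1 h2 z hz).trans ?_
    rw [h1' z hz, h2' z hz]
    exact map_zero _

theorem Γ_ofParts {g₁ g₂ : ℝ → State n₁ n₂} (h₁ : DifferentiableOn ℝ g₁ (Ici 0))
    (h₂ : DifferentiableOn ℝ g₂ (Ici 0)) :
    S.Γ (fun _ => p) (fun z => ofParts _ (g₁ z, g₂ z)) =
      ofParts _ (S.constΓ p g₁, S.constΓ p g₂) := by
  have e1 : ∀ x : State n₁ n₂ × State n₁ n₂, fstPart (ofParts _ x) =
    ofParts (Fin n₁) (fstPart x.1, fstPart x.2) := fun x => rfl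
  have e2 : ∀ x : State n₁ n₂ × State n₁ n₂, sndPart (ofParts _ x) =
    ofParts (Fin n₂) (sndPart x.1, sndPart x.2) := fun x => rfl
  rw [Γ, dz_ofParts h₁ h₂ le_rfl, e1, e2, e2, cplx_mulVec_ofParts, cplx_mulVec_ofParts,
    cplx_mulVec_ofParts]
  ext (i | i | i) <;> rfl

/-- Transversality of a constant layer, for real functions. -/
def IsConstTransversal (S : System d n₁ n₂) (ν : EuclideanSpace ℝ (Fin d)) (p : State n₁ n₂) :
    Prop :=
  (∀ g, S.IsConstLinearized ν p g → Tendsto (fun z => (g z, sndPart (dz g z))) atTop (𝓝 0) →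
      S.constΓ p g = 0 → ∀ z, 0 ≤ z → g z = 0) ∧
  (∀ y : S.BIndex → ℝ, ∃ g, S.IsConstLinearized ν p g ∧
      (∃ l, Tendsto (fun z => (g z, sndPart (dz g z))) atTop (𝓝 l)) ∧ S.constΓ p g = y)

theorem tendsto_ofParts_iff {g₁ g₂ : ℝ → State n₁ n₂} (h₁ : DifferentiableOn ℝ g₁ (Ici 0))
    (h₂ : DifferentiableOn ℝ g₂ (Ici 0)) {l₁ l₂ : State n₁ n₂ × (Fin n₂ → ℝ)} :
    Tendsto (fun z => (ofParts _ (g₁ z, g₂ z),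
        sndPart (dz (fun z => ofParts _ (g₁ z, g₂ z)) z))) atTop
        (𝓝 (ofParts _ (l₁.1, l₂.1), ofParts _ (l₁.2, l₂.2))) ↔
      Tendsto (fun z => (g₁ z, sndPart (dz g₁ z))) atTop (𝓝 l₁) ∧
      Tendsto (fun z => (g₂ z, sndPart (dz g₂ z))) atTop (𝓝 l₂) := by
  have e : (fun z => (ofParts _ (g₁ z, g₂ z), sndPart (dz (fun z => ofParts _ (g₁ z, g₂ z)) z)))
      =ᶠ[atTop] fun z => (ofParts _ (g₁ z, g₂ z),
        ofParts (Fin n₂) (sndPart (dz g₁ z), sndPart (dz g₂ z))) := by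
    filter_upwards [eventually_ge_atTop 0] with z hz
    rw [dz_ofParts h₁ h₂ hz]
    rfl
  rw [tendsto_congr' e]
  constructor
  · intro h
    refine ⟨?_, ?_⟩
    · exact (((rePart _).continuous.tendsto _).comp (continuous_fst.tendsto _ |>.comp h)).prodMk_nhds
        (((rePart _).continuous.tendsto _).comp (continuous_snd.tendsto _ |>.comp h))
    · exact (((imPart _).continuous.tendsto _).comp (continuous_fst.tendsto _ |>.comp h)).prodMk_nhds
        (((imPart _).continuous.tendsto _).comp (continuous_snd.tendsto _ |>.comp h))
  · rintro ⟨h1, h2⟩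
    have a1 := (continuous_fst.tendsto _).comp h1
    have a2 := (continuous_snd.tendsto _).comp h1
    have b1 := (continuous_fst.tendsto _).comp h2
    have b2 := (continuous_snd.tendsto _).comp h2
    exact (((ofParts _).continuous.tendsto _).comp (a1.prodMk_nhds b1)).prodMk_nhds
      (((ofParts _).continuous.tendsto _).comp (a2.prodMk_nhds b2))

theorem isTransversal_const_iff :
    S.IsTransversal ν (fun _ => p) ↔ S.IsConstTransversal ν p := by
  have hd : ∀ {g}, S.IsConstLinearized ν p g → DifferentiableOn ℝ g (Ici 0) :=
    fun h => h.1.differentiableOn (by simp)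
  have hzero : S.IsConstLinearized ν p fun _ => 0 := by
    refine ⟨contDiffOn_const, fun z _ => ?_⟩
    have : dz (fun _ : ℝ => (0 : State n₁ n₂)) = 0 := by ext1 z; simp [dz]
    simp only [this, Pi.zero_apply, Matrix.mulVec_zero]
    simp
  have hΓ0 : S.constΓ p (fun _ => 0) = 0 := by
    have : dz (fun _ : ℝ => (0 : State n₁ n₂)) 0 = 0 := by simp [dz]
    have e1 : fstPart (0 : State n₁ n₂) = 0 := rfl
    have e2 : sndPart (0 : State n₁ n₂) = 0 := rfl
    ext (i | i | i) <;> simp [constΓ, this, e1, e2]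
  have hlim0 : Tendsto (fun z : ℝ => ((0 : State n₁ n₂),
      sndPart (dz (fun _ : ℝ => (0 : State n₁ n₂)) z))) atTop (𝓝 0) := by
    have : ∀ z, dz (fun _ : ℝ => (0 : State n₁ n₂)) z = 0 := fun z => by simp [dz]
    simp only [this]
    exact tendsto_const_nhds
  constructor
  · rintro ⟨hi, hii⟩
    refine ⟨fun g hg hlim hΓ z hz => ?_, fun y => ?_⟩
    · have h1 := hi (fun z => ofParts _ (g z, 0)) (isLinearizedSolution_ofParts.mpr ⟨hg, hzero⟩)
        ((tendsto_ofParts_iff (hd hg) (hd hzero)).mpr ⟨hlim, hlim0⟩)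
        (by rw [Γ_ofParts (hd hg) (hd hzero), hΓ, hΓ0]; exact map_zero _) z hz
      exact congrArg (rePart _) h1
    · obtain ⟨h, hh, ⟨l, hl⟩, hΓ⟩ := hii (ofParts _ (y, 0))
      obtain ⟨h1, h2⟩ := isLinearizedSolution_ofParts (g₁ := fun z => rePart _ (h z))
        (g₂ := fun z => imPart _ (h z)) |>.mp hh
      refine ⟨_, h1, ⟨(rePart _ l.1, rePart _ l.2), ?_⟩, ?_⟩
      · exact ((tendsto_ofParts_iff (l₁ := (rePart _ l.1, rePart _ l.2))
          (l₂ := (imPart _ l.1, imPart _ l.2)) (hd h1) (hd h2)).mp hl).1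
      · have := (Γ_ofParts (S := S) (p := p) (hd h1) (hd h2)).symm.trans hΓ
        exact congrArg (rePart _) this
  · rintro ⟨hi, hii⟩
    refine ⟨fun h hh hlim hΓ z hz => ?_, fun y => ?_⟩
    · obtain ⟨h1, h2⟩ := isLinearizedSolution_ofParts (g₁ := fun z => rePart _ (h z))
        (g₂ := fun z => imPart _ (h z)) |>.mp hh
      obtain ⟨l1, l2⟩ := (tendsto_ofParts_iff (l₁ := 0) (l₂ := 0) (hd h1) (hd h2)).mp hlim
      have h3 := (Γ_ofParts (S := S) (p := p) (hd h1) (hd h2)).symm.trans hΓ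
      have e1 := hi _ h1 l1 (congrArg (rePart _) h3) z hz
      have e2 := hi _ h2 l2 (congrArg (imPart _) h3) z hz
      rw [← ofParts_rePart_imPart (h z), e1, e2]
      exact map_zero _
    · obtain ⟨g₁, h1, ⟨l₁, hl₁⟩, hΓ₁⟩ := hii (rePart _ y)
      obtain ⟨g₂, h2, ⟨l₂, hl₂⟩, hΓ₂⟩ := hii (imPart _ y)
      refine ⟨fun z => ofParts _ (g₁ z, g₂ z), isLinearizedSolution_ofParts.mpr ⟨h1, h2⟩,
        ⟨_, (tendsto_ofParts_iff (hd h1) (hd h2)).mpr ⟨hl₁, hl₂⟩⟩, ?_⟩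
      rw [Γ_ofParts (hd h1) (hd h2), hΓ₁, hΓ₂]
      rfl

end System

end

section

/-! ### Explicit linearized solutions at a constant state and the algebraic transversality condition
-/

namespace System

variable {d n₁ n₂ : ℕ} {S : System d n₁ n₂} {ν : EuclideanSpace ℝ (Fin d)} {p : State n₁ n₂}

theorem symB_mul_G (hb : S.IsHyperbolicPoint ν p) :
    (S.symB ν p).toBlocks₂₂ * S.G ν p = S.schurMat ν p := by
  rw [G, schurMat, ← Matrix.mul_assoc,
    Matrix.mul_nonsing_inv _ (isUnit_iff_ne_zero.mpr hb.regular.2.2), Matrix.one_mul]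

theorem IsHyperbolicPoint.det_G_ne_zero (hb : S.IsHyperbolicPoint ν p) : (S.G ν p).det ≠ 0 :=
  det_ne_zero_of_forall_mem_spectrum fun μ hμ => ne_zero_of_re_ne_zero (hb.re_ne_zero μ hμ)

theorem IsHyperbolicPoint.mem_layerStates (hS : S.Hypotheses) (hb : S.IsHyperbolicPoint ν p) :
    p ∈ S.layerStates := bdryStates_subset_layerStates hS hb.regular.1

/-- The solutions of the linearized equation at a base point. -/
def constSol (S : System d n₁ n₂) (ν : EuclideanSpace ℝ (Fin d)) (p : State n₁ n₂)
    (l : State n₁ n₂) (a : Fin n₂ → ℝ) (z : ℝ) : State n₁ n₂ :=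
  l + (S.slopeMat ν p * (S.G ν p)⁻¹) *ᵥ expFlow (mulVecL (S.G ν p)) z a

theorem hasDerivAt_constSol (hb : S.IsHyperbolicPoint ν p) (l : State n₁ n₂) (a : Fin n₂ → ℝ)
    (z : ℝ) : HasDerivAt (S.constSol ν p l a)
      (S.slopeMat ν p *ᵥ expFlow (mulVecL (S.G ν p)) z a) z := by
  have h1 := (mulVecL (S.slopeMat ν p * (S.G ν p)⁻¹)).hasFDerivAt.comp_hasDerivAt z
    (hasDerivAt_expFlow_apply (mulVecL (S.G ν p)) a z)
  refine (h1.const_add l).congr_deriv ?_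
  rw [mulVecL_apply, mulVecL_apply, Matrix.mulVec_mulVec, Matrix.mul_assoc,
    Matrix.nonsing_inv_mul _ (isUnit_iff_ne_zero.mpr hb.det_G_ne_zero), Matrix.mul_one]

theorem contDiff_expFlow {Z : Type*} [NormedAddCommGroup Z] [NormedSpace ℝ Z] [CompleteSpace Z]
    (A : Z →L[ℝ] Z) (v : Z) : ContDiff ℝ ∞ fun t => expFlow A t v := by
  refine contDiff_infty.mpr fun k => ?_
  induction k generalizing v with
  | zero => exact contDiff_zero.mpr ((continuous_expFlow A).clm_apply continuous_const)
  | succ k ih =>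
    rw [Nat.cast_add, Nat.cast_one, contDiff_succ_iff_deriv]
    refine ⟨fun t => (hasDerivAt_expFlow_apply A v t).differentiableAt, by simp, ?_⟩
    rw [show deriv (fun t => expFlow A t v) = fun t => A (expFlow A t v) from
      funext fun t => (hasDerivAt_expFlow_apply A v t).deriv]
    exact A.contDiff.comp (ih v)

theorem dz_constSol (hb : S.IsHyperbolicPoint ν p) (l : State n₁ n₂) (a : Fin n₂ → ℝ) {z : ℝ}
    (hz : 0 ≤ z) : dz (S.constSol ν p l a) z =
      S.slopeMat ν p *ᵥ expFlow (mulVecL (S.G ν p)) z a :=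
  (hasDerivAt_constSol hb l a z).hasDerivWithinAt.derivWithin (uniqueDiffOn_Ici 0 z hz)

theorem isConstLinearized_constSol (hS : S.Hypotheses) (hb : S.IsHyperbolicPoint ν p)
    (l : State n₁ n₂) (a : Fin n₂ → ℝ) : S.IsConstLinearized ν p (S.constSol ν p l a) := by
  refine ⟨?_, fun z hz => ?_⟩
  · exact (contDiff_const.add ((mulVecL (S.slopeMat ν p * (S.G ν p)⁻¹)).contDiff.comp
      (contDiff_expFlow (mulVecL (S.G ν p)) a))).contDiffOn
  · have h1 : ∀ s, 0 ≤ s → S.symB ν p *ᵥ dz (S.constSol ν p l a) s =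
        mulVecL (Matrix.fromRows (0 : Matrix (Fin n₁) (Fin n₂) ℝ) (S.symB ν p).toBlocks₂₂)
          (expFlow (mulVecL (S.G ν p)) s a) := by
      intro s hs
      rw [dz_constSol hb l a hs, symB_mulVec hS (hb.mem_layerStates hS), sndPart_slopeMat_mulVec,
        mulVecL_apply, Matrix.fromRows_mulVec, Matrix.zero_mulVec]
    have h2 := (mulVecL (Matrix.fromRows (0 : Matrix (Fin n₁) (Fin n₂) ℝ)
      (S.symB ν p).toBlocks₂₂)).hasFDerivAt.comp_hasDerivAt z
      (hasDerivAt_expFlow_apply (mulVecL (S.G ν p)) a z)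
    have h3 := (h2.hasDerivWithinAt.congr (fun s hs => h1 s hs) (h1 z hz)).derivWithin
      (uniqueDiffOn_Ici (0 : ℝ) z hz)
    rw [dz_constSol hb l a hz, symA_mulVec_slopeMat hb.regular.2.1]
    rw [sub_eq_zero]
    refine Eq.trans ?_ h3.symm
    rw [mulVecL_apply, mulVecL_apply, Matrix.fromRows_mulVec, Matrix.zero_mulVec,
      Matrix.mulVec_mulVec, symB_mul_G hb]

/-- Every solution of the linearized equation is a `constSol`. -/
theorem IsConstLinearized.eq_constSol (hS : S.Hypotheses) (hb : S.IsHyperbolicPoint ν p)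
    {g : ℝ → State n₁ n₂} (hg : S.IsConstLinearized ν p g) :
    ∃ l a, EqOn g (S.constSol ν p l a) (Ici 0) := by
  have hu := uniqueDiffOn_Ici (0 : ℝ)
  have hdg := differentiableOn_dz hg.1
  have hslope : ∀ z, 0 ≤ z → dz g z = S.slopeMat ν p *ᵥ sndPart (dz g z) ∧
      HasDerivWithinAt (fun s => sndPart (dz g s)) (S.G ν p *ᵥ sndPart (dz g z)) (Ici 0) z := by
    intro z hz
    have h1 : HasDerivWithinAt (fun s => S.symB ν p *ᵥ dz g s) (S.symA ν p *ᵥ dz g z) (Ici 0) z := by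
      rw [sub_eq_zero.mp (hg.2 z hz)]
      exact ((mulVecL (S.symB ν p)).differentiable.comp_differentiableOn hdg z hz).hasDerivWithinAt
    have hfst : fstPart (S.symA ν p *ᵥ dz g z) = 0 := by
      have h3 := (fstPartL ℝ n₁ n₂).hasFDerivAt.comp_hasDerivWithinAt z h1
      have h4 : HasDerivWithinAt (fun _ : ℝ => (0 : Fin n₁ → ℝ)) 0 (Ici 0) z :=
        hasDerivWithinAt_const _ _ _
      refine (hu z hz).eq_deriv _ (h3.congr (fun s hs => ?_) ?_) h4 <;>
      simp [symB_mulVec hS (hb.mem_layerStates hS)]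
    have hs := eq_slopeMat_mulVec hb.regular.2.1 hfst
    refine ⟨hs, ?_⟩
    have h3 := (sndPartL ℝ n₁ n₂).hasFDerivAt.comp_hasDerivWithinAt z h1
    have h4 := (mulVecL (S.symB ν p).toBlocks₂₂⁻¹).hasFDerivAt.comp_hasDerivWithinAt z h3
    have hinv : ∀ v, (S.symB ν p).toBlocks₂₂⁻¹ *ᵥ ((S.symB ν p).toBlocks₂₂ *ᵥ v) = v := fun v => by
      rw [Matrix.mulVec_mulVec,
        Matrix.nonsing_inv_mul _ (isUnit_iff_ne_zero.mpr hb.regular.2.2), Matrix.one_mulVec]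
    refine (h4.congr (fun s hs => ?_) ?_).congr_deriv ?_
    · simp [symB_mulVec hS (hb.mem_layerStates hS), hinv]
    · simp [symB_mulVec hS (hb.mem_layerStates hS), hinv]
    · rw [hs, symA_mulVec_slopeMat hb.regular.2.1, ← symB_mul_G hb]
      simp [← Matrix.mulVec_mulVec, hinv]
  set a := sndPart (dz g 0) with ha
  have hy : ∀ z, 0 ≤ z → sndPart (dz g z) = expFlow (mulVecL (S.G ν p)) z a := fun z hz =>
    eq_expFlow_of_hasDerivWithinAt (A := mulVecL (S.G ν p)) (fun s hs => (hslope s hs).2) hz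
  refine ⟨g 0 - (S.slopeMat ν p * (S.G ν p)⁻¹) *ᵥ a, a, fun z hz => ?_⟩
  have h0 : S.constSol ν p (g 0 - (S.slopeMat ν p * (S.G ν p)⁻¹) *ᵥ a) a 0 = g 0 := by
    simp [constSol]
  have hdiff : ∀ s ∈ Ici (0 : ℝ), HasDerivWithinAt
      (fun z => g z - S.constSol ν p (g 0 - (S.slopeMat ν p * (S.G ν p)⁻¹) *ᵥ a) a z) 0 (Ici 0) s := by
    intro s hs
    refine (((hg.1.differentiableOn (by simp) s hs).hasDerivWithinAt).sub
      (hasDerivAt_constSol hb _ a s).hasDerivWithinAt).congr_deriv ?_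
    rw [← hy s hs, ← (hslope s hs).1]
    exact sub_self _
  have h3 := (convex_Ici (0 : ℝ)).is_const_of_fderivWithin_eq_zero (𝕜 := ℝ)
      (fun s hs => (hdiff s hs).differentiableWithinAt) (fun s hs => by
        rw [(hdiff s hs).hasFDerivWithinAt.fderivWithin (hu s hs)]; ext; simp) hz
        (Set.mem_Ici.mpr (le_refl (0 : ℝ)))
  rw [h0, sub_self] at h3
  exact sub_eq_zero.mp h3

/-- The parameter `a` is the initial value of `∂_z w²`. Integration from there produces the factors
`G⁻¹` in the first two block rows, while `K` acts on `a` directly and does not see `l`. -/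
theorem constΓ_constSol (hb : S.IsHyperbolicPoint ν p) (l : State n₁ n₂) (a : Fin n₂ → ℝ) :
    S.constΓ p (S.constSol ν p l a) =
      Sum.elim (jacobian S.Υ₁ (fstPart p) *ᵥ fstPart l)
        (Sum.elim (jacobian S.Υ₂ (sndPart p) *ᵥ sndPart l) 0) + S.thirdColumn ν p *ᵥ a := by
  have h0 : S.constSol ν p l a 0 = l + S.slopeMat ν p *ᵥ ((S.G ν p)⁻¹ *ᵥ a) := by
    simp [constSol, Matrix.mulVec_mulVec]
  have h1 : fstPart (l + S.slopeMat ν p *ᵥ ((S.G ν p)⁻¹ *ᵥ a)) =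
      fstPart l + fstPart (S.slopeMat ν p *ᵥ ((S.G ν p)⁻¹ *ᵥ a)) := rfl
  have h2 : sndPart (l + S.slopeMat ν p *ᵥ ((S.G ν p)⁻¹ *ᵥ a)) =
      sndPart l + sndPart (S.slopeMat ν p *ᵥ ((S.G ν p)⁻¹ *ᵥ a)) := rfl
  rw [constΓ, dz_constSol hb l a le_rfl, h0, h1, h2, sndPart_slopeMat_mulVec,
    sndPart_slopeMat_mulVec, fstPart_slopeMat_mulVec, Matrix.mulVec_add, Matrix.mulVec_add,
    thirdColumn, Matrix.fromRows_mulVec, Matrix.fromRows_mulVec]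
  ext (i | i | i) <;> simp [Matrix.mulVec_mulVec, ← Matrix.mul_assoc, Matrix.mulVec_neg,
    Matrix.neg_mulVec]

theorem constSol_zero_mulVec (hb : S.IsHyperbolicPoint ν p) (a : Fin n₂ → ℝ) :
    S.G ν p *ᵥ sndPart (S.constSol ν p 0 a 0) = a := by
  have h0 : S.constSol ν p 0 a 0 = S.slopeMat ν p *ᵥ ((S.G ν p)⁻¹ *ᵥ a) := by
    simp [constSol, Matrix.mulVec_mulVec]
  rw [h0, sndPart_slopeMat_mulVec, Matrix.mulVec_mulVec,
    Matrix.mul_nonsing_inv _ (isUnit_iff_ne_zero.mpr hb.det_G_ne_zero), Matrix.one_mulVec]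

theorem tendsto_expFlow_zero {Z : Type*} [NormedAddCommGroup Z] [NormedSpace ℝ Z] [CompleteSpace Z]
    {A : Z →L[ℝ] Z} {v : Z} (hv : v ∈ decaySubspace A) :
    Tendsto (fun t => expFlow A t v) atTop (𝓝 0) := by
  obtain ⟨C, β, hβ, hC⟩ := hv
  refine squeeze_zero_norm' ((eventually_ge_atTop 0).mono hC) ?_
  have h1 : Tendsto (fun t : ℝ => -β * t) atTop atBot :=
    tendsto_id.const_mul_atTop_of_neg (by linarith)
  simpa using (Real.tendsto_exp_atBot.comp h1).const_mul C

/-- The bounded orbits of `y' = G y` start in the stable subspace. -/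
theorem mem_stableSubspace_of_tendsto {n : Type*} [Fintype n] [DecidableEq n] {M : Matrix n n ℝ}
    (h : ∀ μ ∈ spectrum ℂ (cplx M), μ.re ≠ 0) {a l : n → ℝ}
    (hl : Tendsto (fun t => expFlow (mulVecL M) t a) atTop (𝓝 l)) : a ∈ stableSubspace M := by
  obtain ⟨P, C, β, hP, hfix, hmem⟩ := exists_dichotomy_mulVecL h
  have hb : ∀ t, 0 ≤ t → ‖a - P a‖ ≤ C * Real.exp (-β * t) * ‖expFlow (mulVecL M) t a‖ := by
    intro t ht
    have h1 := hP.unstable t ht (expFlow (mulVecL M) t a)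
    rw [hP.comm, ← map_sub, expFlow_neg_apply] at h1
    exact h1
  have h2 : Tendsto (fun t : ℝ => C * Real.exp (-β * t) * ‖expFlow (mulVecL M) t a‖) atTop (𝓝 0) := by
    have h3 : Tendsto (fun t : ℝ => -β * t) atTop atBot :=
      tendsto_id.const_mul_atTop_of_neg (by linarith [hP.pos])
    simpa using ((Real.tendsto_exp_atBot.comp h3).const_mul C).mul hl.norm
  have h3 := ge_of_tendsto h2 ((eventually_ge_atTop 0).mono hb)
  have h4 : a = P a := sub_eq_zero.mp (norm_le_zero_iff.mp h3)
  rw [h4]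
  exact hmem a

/-- For `N'' = 0` the rank condition is void and the target space is trivial, so one statement of
surjectivity covers both cases. -/
theorem finrank_map_K_iff (F : Submodule ℝ (Fin n₂ → ℝ)) :
    (0 < S.N'' → Module.finrank ℝ (F.map (Matrix.toLin' S.K)) = S.N'') ↔
      ∀ y, ∃ a ∈ F, S.K *ᵥ a = y := by
  constructor
  · intro h y
    rcases Nat.eq_zero_or_pos S.N'' with h0 | h0
    · have : IsEmpty (Fin S.N'') := by rw [h0]; infer_instance
      exact ⟨0, zero_mem _, funext fun i => isEmptyElim i⟩
    · have h1 := Submodule.eq_top_of_finrank_eq ((h h0).trans (by simp))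
      have h2 : y ∈ F.map (Matrix.toLin' S.K) := h1 ▸ trivial
      obtain ⟨a, ha, hay⟩ := h2
      exact ⟨a, ha, hay⟩
  · intro h _
    have h1 : F.map (Matrix.toLin' S.K) = ⊤ := eq_top_iff.mpr fun y _ => by
      obtain ⟨a, ha, hay⟩ := h y
      exact ⟨a, ha, hay⟩
    rw [h1]
    simp

/-- A constant layer is transversal if and only if the layer condition holds. -/
theorem isTransversal_const_iff_layerCondition (hS : S.Hypotheses)
    (hb : S.IsHyperbolicPoint ν p) :
    S.IsTransversal ν (fun _ => p) ↔ S.LayerCondition ν p := by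
  rw [isTransversal_const_iff]
  have hpl := hb.mem_layerStates hS
  have hΥ₁ := mulVec_surjective_of_rank (hS.rank_Υ₁ p hpl)
  have hΥ₂ := mulVec_surjective_of_rank (hS.rank_Υ₂ p hpl)
  have hlim : ∀ l, ∀ a ∈ stableSubspace (S.G ν p), Tendsto (fun z => (S.constSol ν p l a z,
      sndPart (dz (S.constSol ν p l a) z))) atTop (𝓝 (l, 0)) := by
    intro l a ha
    have h1 := tendsto_expFlow_zero (stableSubspace_le_decaySubspace _ ha)
    refine Tendsto.prodMk_nhds ?_ ?_
    · have h2 := ((mulVecL (S.slopeMat ν p * (S.G ν p)⁻¹)).continuous.tendsto 0).comp h1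
      have h3 := h2.const_add l
      rw [map_zero, add_zero] at h3
      exact h3
    · refine h1.congr' ((eventually_ge_atTop 0).mono fun z hz => ?_)
      change _ = sndPart (dz (S.constSol ν p l a) z)
      rw [dz_constSol hb l a hz, sndPart_slopeMat_mulVec]
  have hdz : ∀ {g g' : ℝ → State n₁ n₂}, EqOn g g' (Ici 0) → ∀ z, 0 ≤ z → dz g z = dz g' z :=
    fun h z hz => derivWithin_congr h (h hz)
  have hstable : ∀ {g l a}, S.IsConstLinearized ν p g → EqOn g (S.constSol ν p l a) (Ici 0) →
      ∀ {y}, Tendsto (fun z => (g z, sndPart (dz g z))) atTop (𝓝 y) →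
      a ∈ stableSubspace (S.G ν p) := by
    intro g l a _ he y hy
    refine mem_stableSubspace_of_tendsto hb.re_ne_zero (l := y.2) ?_
    refine ((continuous_snd.tendsto _).comp hy).congr'
      ((eventually_ge_atTop 0).mono fun z hz => ?_)
    change sndPart (dz g z) = _
    rw [hdz he z hz, dz_constSol hb l a hz, sndPart_slopeMat_mulVec]
  have hΓ : ∀ {g l a}, EqOn g (S.constSol ν p l a) (Ici 0) →
      S.constΓ p g = S.constΓ p (S.constSol ν p l a) := by
    intro g l a he
    rw [constΓ, constΓ, he (Set.mem_Ici.mpr le_rfl), hdz he 0 le_rfl]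
  rw [LayerCondition, finrank_map_K_iff]
  constructor
  · rintro ⟨hi, hii⟩
    refine ⟨fun a ha a' ha' haa => ?_, fun y => ?_⟩
    · have hm : a - a' ∈ stableSubspace (S.G ν p) := sub_mem ha ha'
      have h1 := hi (S.constSol ν p 0 (a - a')) (isConstLinearized_constSol hS hb _ _)
        (hlim 0 _ hm) ?_ 0 le_rfl
      · have h2 := constSol_zero_mulVec hb (a - a')
        rw [h1] at h2
        have h3 : sndPart (0 : State n₁ n₂) = 0 := rfl
        rw [h3, Matrix.mulVec_zero] at h2
        exact sub_eq_zero.mp h2.symm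
      · have e1 : fstPart (0 : State n₁ n₂) = 0 := rfl
        have e2 : sndPart (0 : State n₁ n₂) = 0 := rfl
        have haa : S.thirdColumn ν p *ᵥ a = S.thirdColumn ν p *ᵥ a' := haa
        rw [constΓ_constSol hb, Matrix.mulVec_sub, haa, sub_self, e1, e2]
        ext (i | i | i) <;> simp
    -- Only the Neumann row is prescribed to be nonzero. It depends on `a` alone, and `a` is stable
    -- because `∂_z g²` converges.
    · obtain ⟨g, hg, ⟨l', hl'⟩, hgΓ⟩ := hii (Sum.elim 0 (Sum.elim 0 y))
      obtain ⟨l, a, he⟩ := hg.eq_constSol hS hb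
      refine ⟨a, hstable hg he hl', ?_⟩
      rw [hΓ he, constΓ_constSol hb, thirdColumn, Matrix.fromRows_mulVec,
        Matrix.fromRows_mulVec] at hgΓ
      ext i
      simpa using congrFun hgΓ (Sum.inr (Sum.inr i))
  · rintro ⟨hi, hii⟩
    refine ⟨fun g hg hg0 hgΓ z hz => ?_, fun y => ?_⟩
    · obtain ⟨l, a, he⟩ := hg.eq_constSol hS hb
      have ha := hstable hg he hg0
      have hl : l = 0 := by
        have h1 : Tendsto g atTop (𝓝 l) :=
          ((continuous_fst.tendsto _).comp (hlim l a ha)).congr'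
            ((eventually_ge_atTop 0).mono fun z hz => (he hz).symm)
        exact tendsto_nhds_unique h1 ((continuous_fst.tendsto _).comp hg0)
      subst hl
      have e1 : fstPart (0 : State n₁ n₂) = 0 := rfl
      have e2 : sndPart (0 : State n₁ n₂) = 0 := rfl
      rw [hΓ he, constΓ_constSol hb, e1, e2] at hgΓ
      have h2 : S.thirdColumn ν p *ᵥ a = 0 := by
        rw [← hgΓ]
        ext (i | i | i) <;> simp
      have h3 : a = 0 := hi ha (zero_mem _) (by simpa using h2)
      rw [he hz, h3]
      simp [constSol]
    -- `a` is spent on the Neumann row; the constant part `l` then corrects the other two rows,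
    -- whose Jacobians are onto.
    · obtain ⟨a, ha, hKa⟩ := hii fun i => y (Sum.inr (Sum.inr i))
      obtain ⟨l₁, hl₁⟩ := hΥ₁ fun i => y (Sum.inl i) - (S.thirdColumn ν p *ᵥ a) (Sum.inl i)
      obtain ⟨l₂, hl₂⟩ := hΥ₂ fun i =>
        y (Sum.inr (Sum.inl i)) - (S.thirdColumn ν p *ᵥ a) (Sum.inr (Sum.inl i))
      refine ⟨S.constSol ν p (Sum.elim l₁ l₂) a, isConstLinearized_constSol hS hb _ _,
        ⟨_, hlim _ a ha⟩, ?_⟩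
      rw [constΓ_constSol hb, fstPart_elim, sndPart_elim]
      simp only at hl₁ hl₂
      rw [hl₁, hl₂]
      ext (i | i | i)
      · simp
      · simp
      · have : (S.thirdColumn ν p *ᵥ a) (Sum.inr (Sum.inr i)) = (S.K *ᵥ a) i := by
          rw [thirdColumn, Matrix.fromRows_mulVec, Matrix.fromRows_mulVec]; rfl
        simp [this, hKa]

end System

end

section

/-! ### Small profiles near a base point -/

namespace System

variable {d n₁ n₂ : ℕ} {S : System d n₁ n₂} {ν₀ : EuclideanSpace ℝ (Fin d)} {p₀ : State n₁ n₂}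

/-- The parameters `(ν, q, a)` of small profiles: `q` is the endstate. -/
abbrev Param (S : System d n₁ n₂) (ν₀ : EuclideanSpace ℝ (Fin d)) (p₀ : State n₁ n₂) : Type :=
  EuclideanSpace ℝ (Fin d) × State n₁ n₂ × stableSubspace (S.G ν₀ p₀)

/-- The linearization at the base point of `(ν, q, a) ↦ (w(0), ∂_z w²(0))`. -/
def paramTangent (S : System d n₁ n₂) (ν₀ : EuclideanSpace ℝ (Fin d)) (p₀ : State n₁ n₂) :
    S.Param ν₀ p₀ →L[ℝ] State n₁ n₂ × (Fin n₂ → ℝ) :=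
  stableTangent _ (mulVecL (S.slopeMat ν₀ p₀ * (S.G ν₀ p₀)⁻¹)) (mulVecL (S.G ν₀ p₀)) _

/-- `w · (ν, q, a)` is the smooth family of the small profiles near `p₀`, with
`∂_z w² (0) = κ (ν, q, a)`. -/
structure IsLayerFamily (S : System d n₁ n₂) (ν₀ : EuclideanSpace ℝ (Fin d)) (p₀ : State n₁ n₂)
    (O : Set (S.Param ν₀ p₀)) (w : ℝ → S.Param ν₀ p₀ → State n₁ n₂)
    (κ : S.Param ν₀ p₀ → Fin n₂ → ℝ) (δ : ℝ) (m : S.Param ν₀ p₀ → ℝ) : Prop where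
  pos : 0 < δ
  isOpen : IsOpen O
  base_mem : (ν₀, p₀, 0) ∈ O
  smooth : ContDiffOn ℝ ∞ (fun x : ℝ × S.Param ν₀ p₀ => w x.1 x.2) (Ioi (-1) ×ˢ O)
  smooth_slope : ContDiffOn ℝ ∞ κ O
  values : ∀ o ∈ O, ∀ z, 0 ≤ z → w z o ∈ S.bdryStates
  profile : ∀ o ∈ O, S.IsProfile o.1 o.2.1 fun z => w z o
  slope : ∀ o ∈ O, sndPart (dz (fun z => w z o) 0) = κ o
  continuousOn_bound : ContinuousOn m O
  bound_zero : ∀ ν q, (ν, q, 0) ∈ O → m (ν, q, 0) = 0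
  decay : ∀ o ∈ O, ∀ z, 0 ≤ z →
    ‖w z o - o.2.1‖ + ‖sndPart (dz (fun z => w z o) z)‖ ≤ m o * Real.exp (-δ * z)
  hasFDerivAt : HasFDerivAt (fun o => (w 0 o, κ o)) (S.paramTangent ν₀ p₀) (ν₀, p₀, 0)
  unique : ∀ N ∈ 𝓝 ((ν₀, p₀, 0) : S.Param ν₀ p₀), ∃ ε > 0, ∀ ν q (v : ℝ → State n₁ n₂),
    ‖ν - ν₀‖ < ε → ‖q - p₀‖ < ε → S.IsProfile ν q v →
    (∀ z, 0 ≤ z → ‖v z - q‖ < ε ∧ ‖sndPart (dz v z)‖ < ε) →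
    ∃ a, (ν, q, a) ∈ N ∧ (ν, q, a) ∈ O ∧ ∀ z, 0 ≤ z → v z = w z (ν, q, a)

theorem smoothEntriesOn_symB₂₂ (hS : S.Hypotheses) :
    SmoothEntriesOn (fun x : EuclideanSpace ℝ (Fin d) × State n₁ n₂ =>
      (S.symB x.1 x.2).toBlocks₂₂) S.regularSet :=
  fun i j => (smoothEntriesOn_symB hS (.inr i) (.inr j)).mono
    fun _ hx => ⟨mem_univ _, bdryStates_subset_layerStates hS hx.1⟩

theorem exists_bound_mulVec {X : Type*} [NormedAddCommGroup X] [NormedSpace ℝ X] {U : Set X} {x₀ : X}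
    (hU : U ∈ 𝓝 x₀) {n : ℕ} {M : X → Matrix (Fin n) (Fin n) ℝ} (hM : SmoothEntriesOn M U) :
    ∃ K, 0 ≤ K ∧ ∀ᶠ x in 𝓝 x₀, ∀ y, ‖M x *ᵥ y‖ ≤ K * ‖y‖ := by
  have h1 : ContinuousAt (fun x => mulVecL (M x)) x₀ := hM.mulVecL.continuousOn.continuousAt hU
  refine ⟨‖mulVecL (M x₀)‖ + 1, by positivity, ?_⟩
  filter_upwards [h1.norm.eventually_lt continuousAt_const
    (lt_add_one ‖mulVecL (M x₀)‖)] with x hx y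
  exact (mulVecL (M x)).le_of_opNorm_le hx.le y

/-- A global field which agrees with the layer field near the base point. -/
theorem IsHyperbolicPoint.exists_field (hS : S.Hypotheses) (hb : S.IsHyperbolicPoint ν₀ p₀) :
    ∃ (f : EuclideanSpace ℝ (Fin d) × State n₁ n₂ × (Fin n₂ → ℝ) →
        (Fin n₂ → ℝ) →L[ℝ] State n₁ n₂ × (Fin n₂ → ℝ)) (R K : ℝ),
      ContDiff ℝ ∞ f ∧ 0 < R ∧ 0 ≤ K ∧ ∀ ν w, ‖ν - ν₀‖ < R → ‖w - p₀‖ < R →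
        (ν, w) ∈ S.regularSet ∧
        (∀ y, f (ν, w, y) = S.layerField (S.symB ν₀ p₀).toBlocks₂₂ (ν, w)) ∧
        (∀ y, ‖(S.symB ν w).toBlocks₂₂⁻¹ *ᵥ ((S.symB ν₀ p₀).toBlocks₂₂ *ᵥ y)‖ ≤ K * ‖y‖) ∧
        ∀ y, ‖(S.symB ν₀ p₀).toBlocks₂₂⁻¹ *ᵥ ((S.symB ν w).toBlocks₂₂ *ᵥ y)‖ ≤ K * ‖y‖ := by
  set B₀ := (S.symB ν₀ p₀).toBlocks₂₂
  have hreg : S.regularSet ∈ 𝓝 (ν₀, p₀) := (isOpen_regularSet hS).mem_nhds hb.regular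
  obtain ⟨g, hg, hge⟩ := exists_contDiff_eventuallyEq (isOpen_regularSet hS) hb.regular
    (contDiffOn_layerField hS B₀)
  obtain ⟨K₁, hK₁, h₁⟩ := exists_bound_mulVec hreg
    ((smoothEntriesOn_inv_symB hS).mul (SmoothEntriesOn.const B₀))
  obtain ⟨K₂, hK₂, h₂⟩ := exists_bound_mulVec hreg
    ((SmoothEntriesOn.const B₀⁻¹).mul (smoothEntriesOn_symB₂₂ hS))
  obtain ⟨R, hR, h⟩ := Metric.eventually_nhds_iff.mp
    (((hge.and h₁).and h₂).and (eventually_mem_nhds_iff.mpr hreg))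
  refine ⟨fun x => g (x.1, x.2.1), R, max K₁ K₂, hg.comp (by fun_prop), hR, le_max_of_le_left hK₁,
    fun ν w hν hw => ?_⟩
  obtain ⟨⟨⟨h3, h4⟩, h5⟩, h6⟩ := h (y := (ν, w)) (by
    rw [dist_eq_norm]; exact max_lt hν hw)
  refine ⟨mem_of_mem_nhds h6, fun y => h3, fun y => ?_, fun y => ?_⟩
  · rw [Matrix.mulVec_mulVec]
    exact (h4 y).trans (by gcongr; exact le_max_left _ _)
  · rw [Matrix.mulVec_mulVec]
    exact (h5 y).trans (by gcongr; exact le_max_right _ _)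

/-- The small profiles near a base point form a smooth family. -/
theorem IsHyperbolicPoint.exists_layerFamily (hS : S.Hypotheses) (hb : S.IsHyperbolicPoint ν₀ p₀) :
    ∃ O w κ δ m, S.IsLayerFamily ν₀ p₀ O w κ δ m := by
  obtain ⟨f, R, K, hf, hR, hK, hfR⟩ := hb.exists_field hS
  set B₀ := (S.symB ν₀ p₀).toBlocks₂₂ with hB₀def
  have hB₀ : B₀.det ≠ 0 := hb.regular.2.2
  have hBu : IsUnit B₀.det := isUnit_iff_ne_zero.mpr hB₀
  obtain ⟨P, C, β, hP, hPF, hFP⟩ := exists_dichotomy_mulVecL hb.re_ne_zero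
  -- The factor `B₀` in the second unknown cancels here, so the linearization is exactly `G` and not
  -- merely conjugate to it.
  have hf0 : ∀ y, f (ν₀, p₀, 0) y = (S.slopeMat ν₀ p₀ *ᵥ y, S.G ν₀ p₀ *ᵥ y) := by
    intro y
    rw [(hfR ν₀ p₀ (by simpa) (by simpa)).2.1 0, layerField_apply]
    simp only [← hB₀def]
    rw [Matrix.mulVec_mulVec _ B₀⁻¹, Matrix.nonsing_inv_mul _ hBu, Matrix.one_mulVec, ← symB_mul_G hb,
      Matrix.mulVec_mulVec, ← Matrix.mul_assoc, Matrix.nonsing_inv_mul _ hBu, Matrix.one_mul]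
  have hG : (ContinuousLinearMap.snd ℝ (State n₁ n₂) (Fin n₂ → ℝ)).comp (f (ν₀, p₀, 0)) =
      mulVecL (S.G ν₀ p₀) := by
    refine ContinuousLinearMap.ext fun y => ?_
    simp [hf0]
  obtain ⟨O, u, δ, m, hu⟩ := exists_stableFamily
    (J := mulVecL (S.slopeMat ν₀ p₀ * (S.G ν₀ p₀)⁻¹)) (F := stableSubspace (S.G ν₀ p₀)) hf
    (hG ▸ hP) (fun y => by
      rw [hf0, mulVecL_apply, Matrix.mulVec_mulVec, Matrix.mul_assoc,
        Matrix.nonsing_inv_mul _ (isUnit_iff_ne_zero.mpr hb.det_G_ne_zero), Matrix.mul_one])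
    hPF hFP
  have hu' := hu.hasFDerivAt
  rw [hG] at hu'
  -- the restricted domain
  set O' : Set (S.Param ν₀ p₀) :=
    (O ∩ m ⁻¹' Iio (R / 2)) ∩ ({o | ‖o.1 - ν₀‖ < R} ∩ {o | ‖o.2.1 - p₀‖ < R / 2}) with hO'
  have hO'o : IsOpen O' := by
    refine (hu.continuousOn_bound.isOpen_inter_preimage hu.isOpen isOpen_Iio).inter
      (IsOpen.inter ?_ ?_)
    · exact isOpen_lt (by fun_prop) continuous_const
    · exact isOpen_lt (by fun_prop) continuous_const
  have hsub : O' ⊆ O := fun o ho => ho.1.1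
  have hbase : (ν₀, p₀, 0) ∈ O' := by
    refine ⟨⟨hu.base_mem, ?_⟩, ?_, ?_⟩
    · change m _ < _
      rw [hu.bound_zero _ _ hu.base_mem]; positivity
    · simpa using hR
    · simpa using hR
  have hm0 : ∀ o ∈ O, 0 ≤ m o := fun o ho => by
    simpa using (norm_nonneg _).trans (hu.decay o ho 0 le_rfl)
  have hexp : ∀ z, 0 ≤ z → Real.exp (-δ * z) ≤ 1 := fun z hz =>
    Real.exp_le_one_iff.mpr (by nlinarith [hu.pos])
  -- Endstate within `R / 2` of the base state and amplitude below `R / 2`: the whole orbit stays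
  -- where the extended field is the true one.
  have hnear : ∀ o ∈ O', ∀ z, 0 ≤ z → ‖(u z o).1 - p₀‖ < R := by
    intro o ho z hz
    have h1 := (norm_fst_le _).trans (hu.decay o (hsub ho) z hz)
    have h2 : m o * Real.exp (-δ * z) ≤ m o :=
      mul_le_of_le_one_right (hm0 o (hsub ho)) (hexp z hz)
    have h3 : m o < R / 2 := ho.1.2
    have h4 : ‖o.2.1 - p₀‖ < R / 2 := ho.2.2
    calc ‖(u z o).1 - p₀‖ = ‖((u z o).1 - o.2.1) + (o.2.1 - p₀)‖ := by rw [sub_add_sub_cancel]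
      _ ≤ ‖(u z o).1 - o.2.1‖ + ‖o.2.1 - p₀‖ := norm_add_le _ _
      _ < R := by
        have h5 : ‖(u z o).1 - o.2.1‖ ≤ m o * Real.exp (-δ * z) := h1
        linarith
  have hfo : ∀ o ∈ O', ∀ z : ℝ, 0 ≤ z → _ := fun o ho z hz =>
    hfR o.1 (u z o).1 ho.2.1 (hnear o ho z hz)
  have hode : ∀ o ∈ O', ∀ z, 0 ≤ z → HasDerivWithinAt (fun z => ((u z o).1, (u z o).2))
      (S.layerField B₀ (o.1, (u z o).1) (u z o).2) (Ici 0) z := by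
    intro o ho z hz
    rw [← (hfo o ho z hz).2.1 (u z o).2]
    exact (hu.ode o (hsub ho) z (by linarith)).hasDerivWithinAt
  have hlim : ∀ o ∈ O', Tendsto (fun z => (u z o).1) atTop (𝓝 o.2.1) := by
    intro o ho
    rw [tendsto_iff_norm_sub_tendsto_zero]
    have h1 : Tendsto (fun z : ℝ => m o * Real.exp (-δ * z)) atTop (𝓝 0) := by
      have h3 : Tendsto (fun t : ℝ => -δ * t) atTop atBot :=
        tendsto_id.const_mul_atTop_of_neg (by linarith [hu.pos])
      simpa using (Real.tendsto_exp_atBot.comp h3).const_mul (m o)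
    refine squeeze_zero' (Eventually.of_forall fun z => norm_nonneg _) ?_ h1
    filter_upwards [eventually_ge_atTop 0] with z hz
    exact (norm_fst_le (u z o - (o.2.1, 0))).trans (hu.decay o (hsub ho) z hz)
  have hw : ContDiffOn ℝ ∞ (fun x : ℝ × S.Param ν₀ p₀ => (u x.1 x.2).1) (Ioi (-1) ×ˢ O') :=
    contDiff_fst.comp_contDiffOn (hu.smooth.mono (prod_mono_right hsub))
  have hw0 : ContDiffOn ℝ ∞ (u 0) O' :=
    hu.smooth.comp (f := fun o => ((0 : ℝ), o)) (by fun_prop)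
      fun o ho => ⟨by norm_num, hsub ho⟩
  have hinv : ContDiffOn ℝ ∞ (fun o : S.Param ν₀ p₀ =>
      mulVecL ((S.symB o.1 (u 0 o).1).toBlocks₂₂⁻¹ * B₀)) O' :=
    (((smoothEntriesOn_inv_symB hS).mul (SmoothEntriesOn.const B₀)).mulVecL).comp
      (f := fun o : S.Param ν₀ p₀ => (o.1, (u 0 o).1))
      (contDiffOn_fst.prodMk (contDiff_fst.comp_contDiffOn hw0))
      fun o ho => (hfo o ho 0 le_rfl).1
  have hdz : ∀ o ∈ O', ∀ z, 0 ≤ z → sndPart (dz (fun z => (u z o).1) z) =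
      (S.symB o.1 (u z o).1).toBlocks₂₂⁻¹ *ᵥ (B₀ *ᵥ (u z o).2) := fun o ho z hz => by
    rw [dz_eq_of_layerField (hode o ho) hz, sndPart_slopeMat_mulVec]
  have hu0 : u 0 (ν₀, p₀, 0) = (p₀, 0) := by
    have h := hu.decay _ hu.base_mem 0 le_rfl
    rw [hu.bound_zero _ _ hu.base_mem, zero_mul] at h
    exact sub_eq_zero.mp (norm_le_zero_iff.mp h)
  refine ⟨O', fun z o => (u z o).1,
    fun o => mulVecL ((S.symB o.1 (u 0 o).1).toBlocks₂₂⁻¹ * B₀) (u 0 o).2, δ,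
    fun o => (1 + K) * m o, hu.pos, hO'o, hbase, hw, ?_, ?_, ?_, ?_, ?_, ?_, ?_, ?_, ?_⟩
  · exact hinv.clm_apply (contDiff_snd.comp_contDiffOn hw0)
  · exact fun o ho z hz => (hfo o ho z hz).1.1
  · intro o ho
    refine isProfile_of_layerField hS hB₀ (hode o ho) (fun z hz => (hfo o ho z hz).1) ?_ (hlim o ho)
    exact hw.comp (f := fun z : ℝ => (z, o)) (by fun_prop)
      fun z hz => ⟨lt_of_lt_of_le (by norm_num : (-1 : ℝ) < 0) hz, ho⟩
  · intro o ho
    rw [hdz o ho 0 le_rfl, mulVecL_apply, Matrix.mulVec_mulVec]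
  · exact (continuousOn_const.mul (hu.continuousOn_bound.mono hsub))
  · intro ν q h
    change (1 + K) * m (ν, q, 0) = 0
    rw [hu.bound_zero ν q (hsub h), mul_zero]
  · intro o ho z hz
    have h1 := hu.decay o (hsub ho) z hz
    have h2 : ‖(u z o).1 - o.2.1‖ ≤ m o * Real.exp (-δ * z) := (norm_fst_le _).trans h1
    have h3 : ‖(u z o).2 - 0‖ ≤ m o * Real.exp (-δ * z) := (norm_snd_le _).trans h1
    rw [sub_zero] at h3
    have h4 := (hfo o ho z hz).2.2.1 (u z o).2
    rw [hdz o ho z hz]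
    calc _ ≤ m o * Real.exp (-δ * z) + K * (m o * Real.exp (-δ * z)) :=
          add_le_add h2 (h4.trans (by gcongr))
      _ = _ := by ring
  · have h3 := ((hinv.contDiffAt (hO'o.mem_nhds hbase)).differentiableAt (by simp)).hasFDerivAt
    have h4 := hu'.fst.prodMk (h3.clm_apply hu'.snd)
    refine h4.congr_fderiv ?_
    refine ContinuousLinearMap.ext fun x => ?_
    simp [paramTangent, hu0, ← hB₀def, Matrix.nonsing_inv_mul _ hBu]
  · intro N hN
    obtain ⟨ε, hε, h⟩ := hu.unique (N ∩ O') (inter_mem hN (hO'o.mem_nhds hbase))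
    -- The division by `K + 1` converts smallness of `∂_z v²` into smallness of the flux variable;
    -- `R / 2` keeps `v` in the region where the extended field is the true one.
    refine ⟨min (ε / (K + 1)) (R / 2), by positivity, fun ν q v hν hq hv hvs => ?_⟩
    have hεK : ε / (K + 1) ≤ ε := div_le_self hε.le (by linarith)
    have hν' : ‖ν - ν₀‖ < R := hν.trans_le ((min_le_right _ _).trans (by linarith))
    have hvR : ∀ z, 0 ≤ z → ‖v z - p₀‖ < R := fun z hz => by
      have h1 := (hvs z hz).1.trans_le (min_le_right _ _)
      have h2 := hq.trans_le (min_le_right _ _)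
      calc ‖v z - p₀‖ = ‖(v z - q) + (q - p₀)‖ := by rw [sub_add_sub_cancel]
        _ ≤ ‖v z - q‖ + ‖q - p₀‖ := norm_add_le _ _
        _ < R := by linarith
    have hfv := fun z hz => hfR ν (v z) hν' (hvR z hz)
    obtain ⟨a, ha, -, hva⟩ := h ν q
      (fun z => (v z, B₀⁻¹ *ᵥ ((S.symB ν (v z)).toBlocks₂₂ *ᵥ sndPart (dz v z))))
      (hν.trans_le ((min_le_left _ _).trans hεK)) (hq.trans_le ((min_le_left _ _).trans hεK))
      (fun z hz => by
        change HasDerivWithinAt _ (f (ν, v z, _) _) _ _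
        rw [(hfv z hz).2.1]
        exact hv.layerField hS (fun z hz => (hfv z hz).1) hB₀ hz)
      (fun z hz => by
        have h1 := (hvs z hz).1.trans_le ((min_le_left _ _).trans hεK)
        have h2 := (hvs z hz).2.trans_le (min_le_left _ _)
        refine max_lt h1 ?_
        change ‖B₀⁻¹ *ᵥ ((S.symB ν (v z)).toBlocks₂₂ *ᵥ sndPart (dz v z)) - 0‖ < ε
        rw [sub_zero]
        refine ((hfv z hz).2.2.2 _).trans_lt ?_
        rw [lt_div_iff₀ (by positivity)] at h2
        nlinarith [norm_nonneg (sndPart (dz v z))])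
      hv.limit
    exact ⟨a, ha.1, ha.2, fun z hz => congrArg Prod.fst (hva z hz)⟩

end System

end

section

/-! ### Families of submanifolds given implicitly -/

section Implicit

variable {P E F W : Type*} [NormedAddCommGroup P] [NormedSpace ℝ P] [FiniteDimensional ℝ P]
  [NormedAddCommGroup E] [NormedSpace ℝ E] [FiniteDimensional ℝ E]
  [NormedAddCommGroup F] [NormedSpace ℝ F] [FiniteDimensional ℝ F]
  [NormedAddCommGroup W] [NormedSpace ℝ W] [FiniteDimensional ℝ W]

/-- Coordinates on the projection to `E` of the kernel of a surjective map on `E × F` which is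
injective on `F`. -/
theorem exists_kernel_coordinates {m : ℕ} (T : E × F →ₗ[ℝ] W) (hsurj : Function.Surjective T)
    (hinj : ∀ a, T (0, a) = 0 → a = 0)
    (hm : Module.finrank ℝ E + Module.finrank ℝ F = Module.finrank ℝ W + m) :
    ∃ L : E →ₗ[ℝ] (Fin m → ℝ), ∀ x, T x = 0 → L x.1 = 0 → x = 0 := by
  have hK : Module.finrank ℝ (LinearMap.ker T) = m := by
    have h1 := T.finrank_range_add_finrank_ker
    rw [LinearMap.range_eq_top.mpr hsurj, finrank_top, Module.finrank_prod] at h1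
    omega
  let ι : LinearMap.ker T ≃ₗ[ℝ] (Fin m → ℝ) := LinearEquiv.ofFinrankEq _ _ (by rw [hK]; simp)
  let π : LinearMap.ker T →ₗ[ℝ] E := (LinearMap.fst ℝ E F).comp (LinearMap.ker T).subtype
  have hπ : LinearMap.ker π = ⊥ := by
    rw [LinearMap.ker_eq_bot']
    rintro ⟨⟨q, a⟩, h⟩ (hq : q = 0)
    subst hq
    have : a = 0 := hinj a h
    subst this
    rfl
  obtain ⟨g, hg⟩ := LinearMap.exists_leftInverse_of_injective π hπ
  refine ⟨ι.toLinearMap.comp g, fun x hx hL => ?_⟩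
  have h1 : g x.1 = ⟨x, hx⟩ := LinearMap.congr_fun hg (⟨x, hx⟩ : LinearMap.ker T)
  have h2 : ι (g x.1) = 0 := hL
  rw [h1] at h2
  exact congrArg Subtype.val (ι.map_eq_zero_iff.mp h2)

/-- The zero set of `H`, where the derivative of `H` in `(q, a)` is surjective and its derivative
in `a` is injective, is the graph of a function `q ↦ a` over a family of submanifolds. -/
theorem exists_implicit_family {m : ℕ} {H : P × E × F → W} {b₀ : P} {q₀ : E} {H' : P × E × F →L[ℝ] W}
    (hH : ∀ᶠ x in 𝓝 (b₀, q₀, 0), ContDiffAt ℝ ∞ H x) (hH' : HasFDerivAt H H' (b₀, q₀, 0))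
    (h0 : H (b₀, q₀, 0) = 0) (hsurj : ∀ y, ∃ q a, H' (0, q, a) = y)
    (hinj : ∀ a, H' (0, 0, a) = 0 → a = 0)
    (hm : Module.finrank ℝ E + Module.finrank ℝ F = Module.finrank ℝ W + m) :
    ∃ L : E →L[ℝ] (Fin m → ℝ),
      (∃ N ∈ 𝓝 ((b₀, q₀, 0) : P × E × F), ∀ b q a a', (b, q, a) ∈ N → (b, q, a') ∈ N →
        H (b, q, a) = 0 → H (b, q, a') = 0 → a = a') ∧
      ∀ N ∈ 𝓝 ((b₀, q₀, 0) : P × E × F), ∃ (U : Set P) (V : Set (Fin m → ℝ))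
        (Q : P → (Fin m → ℝ) → E) (α : P → (Fin m → ℝ) → F), IsOpen U ∧ b₀ ∈ U ∧ IsOpen V ∧
        ContDiffOn ℝ ∞ (fun x : P × (Fin m → ℝ) => Q x.1 x.2) (U ×ˢ V) ∧
        ContDiffOn ℝ ∞ (fun x : P × (Fin m → ℝ) => α x.1 x.2) (U ×ˢ V) ∧
        (∀ b ∈ U, ∀ y ∈ V, (b, Q b y, α b y) ∈ N ∧ H (b, Q b y, α b y) = 0 ∧ L (Q b y - q₀) = y) ∧
        ∀ᶠ x in 𝓝 (b₀, q₀, 0), H x = 0 → L (x.2.1 - q₀) ∈ V ∧ x.2.1 = Q x.1 (L (x.2.1 - q₀)) ∧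
          x.2.2 = α x.1 (L (x.2.1 - q₀)) := by
  obtain ⟨L₀, hL₀⟩ := exists_kernel_coordinates
    (T := H'.toLinearMap.comp (LinearMap.inr ℝ P (E × F))) (m := m)
    (fun y => by obtain ⟨q, a, h⟩ := hsurj y; exact ⟨(q, a), h⟩) hinj hm
  set L : E →L[ℝ] (Fin m → ℝ) := LinearMap.toContinuousLinearMap L₀ with hLdef
  -- The equations are completed by the `m` coordinates `L (q - q₀)` on the projected kernel to a
  -- map between spaces of equal dimension, which is a local diffeomorphism once its derivative is
  -- injective.
  let D : P × E × F →L[ℝ] P × W × (Fin m → ℝ) := (ContinuousLinearMap.fst ℝ P (E × F)).prod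
    (H'.prod (L.comp ((ContinuousLinearMap.fst ℝ E F).comp (ContinuousLinearMap.snd ℝ P (E × F)))))
  have hDinj : Function.Injective D.toLinearMap := by
    rw [← LinearMap.ker_eq_bot, LinearMap.ker_eq_bot']
    rintro ⟨b, x⟩ h
    obtain ⟨hb, h1, h2⟩ : b = 0 ∧ H' (b, x) = 0 ∧ L₀ x.1 = 0 := by
      simpa [D, Prod.ext_iff, hLdef] using h
    subst hb
    rw [hL₀ x h1 h2]
    rfl
  have hdim : Module.finrank ℝ (P × E × F) = Module.finrank ℝ (P × W × (Fin m → ℝ)) := by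
    simp only [Module.finrank_prod, Module.finrank_fin_fun]
    omega
  let D' : (P × E × F) ≃L[ℝ] (P × W × (Fin m → ℝ)) :=
    (LinearMap.linearEquivOfInjective D.toLinearMap hDinj hdim).toContinuousLinearEquiv
  have hD' : (D' : P × E × F →L[ℝ] P × W × (Fin m → ℝ)) = D := by
    refine ContinuousLinearMap.ext fun x => ?_
    exact LinearMap.linearEquivOfInjective_apply hDinj hdim x
  have := FiniteDimensional.complete ℝ (P × E × F)
  have hLd : ContDiff ℝ ∞ fun x : P × E × F => L (x.2.1 - q₀) := by fun_prop
  obtain ⟨e, he0, he, hesymm⟩ := exists_smooth_inverse (x₀ := (b₀, q₀, (0 : F))) (F' := D')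
    (F := fun x : P × E × F => (x.1, H x, L (x.2.1 - q₀)))
    (hH.mono fun x hx => contDiffAt_fst.prodMk (hx.prodMk hLd.contDiffAt)) (by
      rw [hD']
      refine hasFDerivAt_fst.prodMk (hH'.prodMk ?_)
      have h1 : HasFDerivAt (fun x : P × E × F => x.2.1 - q₀)
          ((ContinuousLinearMap.fst ℝ E F).comp (ContinuousLinearMap.snd ℝ P (E × F)))
          (b₀, q₀, 0) :=
        ((ContinuousLinearMap.fst ℝ E F).comp
          (ContinuousLinearMap.snd ℝ P (E × F))).hasFDerivAt.sub_const q₀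
      exact L.hasFDerivAt.comp _ h1)
  -- Two zeros with the same `b` and `q` have the same image under `e`. This neighbourhood is fixed
  -- before `N`, so that the solution set can be shrunk later, depending on scales derived from it.
  refine ⟨L, ⟨e.source, e.open_source.mem_nhds he0, fun b q a a' h1 h2 h3 h4 => ?_⟩,
    fun N hN => ?_⟩
  · have h5 : e (b, q, a) = e (b, q, a') := by rw [he, he]; simp only [h3, h4]
    have h6 := e.injOn h1 h2 h5
    simpa using h6
  have he00 : e (b₀, q₀, 0) = (b₀, 0, 0) := by rw [he]; simp [h0]
  have htgt : (b₀, (0 : W), (0 : Fin m → ℝ)) ∈ e.target := he00 ▸ e.map_source he0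
  have hsymm0 : e.symm (b₀, 0, 0) = (b₀, q₀, 0) := by rw [← he00, e.left_inv he0]
  have hpre : ∀ᶠ x in 𝓝 (b₀, (0 : W), (0 : Fin m → ℝ)), x ∈ e.target ∧ e.symm x ∈ N := by
    have h1 := e.continuousAt_symm htgt
    exact Filter.Eventually.and (e.open_target.mem_nhds htgt) (h1.eventually_mem (hsymm0 ▸ hN))
  have hi : Continuous fun x : P × (Fin m → ℝ) => (x.1, (0 : W), x.2) := by fun_prop
  have hpre' : ∀ᶠ x in 𝓝 (b₀, (0 : Fin m → ℝ)),
      (x.1, (0 : W), x.2) ∈ e.target ∧ e.symm (x.1, 0, x.2) ∈ N :=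
    (hi.tendsto (b₀, 0)).eventually hpre
  obtain ⟨U, V, hUo, hbU, hVo, h0V, hUV⟩ := mem_nhds_prod_iff'.mp hpre'
  have hUV' : ∀ b ∈ U, ∀ y ∈ V, (b, (0 : W), y) ∈ e.target ∧ e.symm (b, 0, y) ∈ N :=
    fun b hb y hy => hUV (mk_mem_prod hb hy)
  have hform : ∀ b ∈ U, ∀ y ∈ V,
      (b, (e.symm (b, 0, y)).2.1, (e.symm (b, 0, y)).2.2) = e.symm (b, 0, y) ∧
      H (e.symm (b, 0, y)) = 0 ∧ L ((e.symm (b, 0, y)).2.1 - q₀) = y := by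
    intro b hb y hy
    have h1 := e.right_inv (hUV' b hb y hy).1
    rw [he] at h1
    obtain ⟨h2, h3, h4⟩ : (e.symm (b, 0, y)).1 = b ∧ H (e.symm (b, 0, y)) = 0 ∧
        L ((e.symm (b, 0, y)).2.1 - q₀) = y := by simpa [Prod.ext_iff] using h1
    refine ⟨?_, h3, h4⟩
    ext1
    · exact h2.symm
    · rfl
  have hsm : ContDiffOn ℝ ∞ (fun x : P × (Fin m → ℝ) => e.symm (x.1, 0, x.2)) (U ×ˢ V) :=
    hesymm.comp (f := fun x : P × (Fin m → ℝ) => (x.1, (0 : W), x.2)) (by fun_prop)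
      fun x hx => (hUV' x.1 hx.1 x.2 hx.2).1
  refine ⟨U, V, fun b y => (e.symm (b, 0, y)).2.1, fun b y => (e.symm (b, 0, y)).2.2, hUo, hbU, hVo,
    ?_, ?_, fun b hb y hy => ?_, ?_⟩
  · exact contDiff_fst.comp_contDiffOn (contDiff_snd.comp_contDiffOn hsm)
  · exact contDiff_snd.comp_contDiffOn (contDiff_snd.comp_contDiffOn hsm)
  · obtain ⟨h1, h2, h3⟩ := hform b hb y hy
    simp only
    rw [h1]
    exact ⟨(hUV' b hb y hy).2, h2, h3⟩
  · have hV : ∀ᶠ x in 𝓝 ((b₀, q₀, 0) : P × E × F), L (x.2.1 - q₀) ∈ V :=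
      hLd.continuous.continuousAt.eventually_mem (hVo.mem_nhds (by simpa using h0V))
    filter_upwards [hV, e.open_source.mem_nhds he0] with x hxV hxs hx
    have h1 : e x = (x.1, 0, L (x.2.1 - q₀)) := by rw [he]; simp only [hx]
    have h2 : e.symm (x.1, 0, L (x.2.1 - q₀)) = x := by rw [← h1, e.left_inv hxs]
    refine ⟨hxV, ?_, ?_⟩ <;> simp only [h2]

end Implicit

end

section

/-! ### The boundary conditions for small profiles -/

theorem jacobian_mulVec {m n : ℕ} (f : (Fin m → ℝ) → (Fin n → ℝ)) (x v : Fin m → ℝ) :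
    jacobian f x *ᵥ v = fderiv ℝ f x v := by
  rw [jacobian, ← Matrix.toLin'_apply, Matrix.toLin'_toMatrix']
  rfl

theorem isOpenMap_fstPart (n₁ n₂ : ℕ) : IsOpenMap (fstPart : State n₁ n₂ → Fin n₁ → ℝ) :=
  (fstPartL ℝ n₁ n₂).isOpenMap fun x => ⟨Sum.elim x 0, rfl⟩

theorem isOpenMap_sndPart (n₁ n₂ : ℕ) : IsOpenMap (sndPart : State n₁ n₂ → Fin n₂ → ℝ) :=
  (sndPartL ℝ n₁ n₂).isOpenMap fun x => ⟨Sum.elim 0 x, rfl⟩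

namespace System

variable {d n₁ n₂ : ℕ} {S : System d n₁ n₂} {ν₀ : EuclideanSpace ℝ (Fin d)} {p₀ : State n₁ n₂}

theorem contDiffAt_Υ₁ (hS : S.Hypotheses) {u : State n₁ n₂} (hu : u ∈ S.layerStates) :
    ContDiffAt ℝ ∞ S.Υ₁ (fstPart u) :=
  hS.smooth_Υ₁.contDiffAt ((isOpenMap_fstPart n₁ n₂ _ (isOpen_layerStates hS)).mem_nhds
    (mem_image_of_mem _ hu))

theorem contDiffAt_Υ₂ (hS : S.Hypotheses) {u : State n₁ n₂} (hu : u ∈ S.layerStates) :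
    ContDiffAt ℝ ∞ S.Υ₂ (sndPart u) :=
  hS.smooth_Υ₂.contDiffAt ((isOpenMap_sndPart n₁ n₂ _ (isOpen_layerStates hS)).mem_nhds
    (mem_image_of_mem _ hu))

/-- The values of the boundary operators. -/
abbrev BValues (S : System d n₁ n₂) : Type :=
  (Fin S.N1plus → ℝ) × (Fin (n₂ - S.N'') → ℝ) × (Fin S.N'' → ℝ)

/-- The base points and parameters `((ν, p), q, a)`. -/
abbrev BParam (S : System d n₁ n₂) (ν₀ : EuclideanSpace ℝ (Fin d)) (p₀ : State n₁ n₂) : Type :=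
  (EuclideanSpace ℝ (Fin d) × State n₁ n₂) × State n₁ n₂ × stableSubspace (S.G ν₀ p₀)

/-- The projection `((ν, p), q, a) ↦ (ν, q, a)`. -/
def toParam (S : System d n₁ n₂) (ν₀ : EuclideanSpace ℝ (Fin d)) (p₀ : State n₁ n₂) :
    S.BParam ν₀ p₀ →L[ℝ] S.Param ν₀ p₀ :=
  ((ContinuousLinearMap.fst ℝ _ _).comp (ContinuousLinearMap.fst ℝ _ _)).prod
    (ContinuousLinearMap.snd ℝ _ _)

@[simp] theorem toParam_apply (x : S.BParam ν₀ p₀) : S.toParam ν₀ p₀ x = (x.1.1, x.2) := rfl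

/-- The defect in the boundary conditions. -/
def residual (S : System d n₁ n₂) {ν₀ : EuclideanSpace ℝ (Fin d)} {p₀ : State n₁ n₂}
    (w₀ : S.Param ν₀ p₀ → State n₁ n₂) (κ : S.Param ν₀ p₀ → Fin n₂ → ℝ) (x : S.BParam ν₀ p₀) :
    S.BValues :=
  (S.Υ₁ (fstPart (w₀ (S.toParam ν₀ p₀ x))) - S.Υ₁ (fstPart x.1.2),
    S.Υ₂ (sndPart (w₀ (S.toParam ν₀ p₀ x))) - S.Υ₂ (sndPart x.1.2),
    S.K *ᵥ κ (S.toParam ν₀ p₀ x))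

/-- The derivative of the defect at the base point. -/
def residualTangent (S : System d n₁ n₂) (ν₀ : EuclideanSpace ℝ (Fin d)) (p₀ : State n₁ n₂) :
    S.BParam ν₀ p₀ →L[ℝ] S.BValues :=
  let w' : S.BParam ν₀ p₀ →L[ℝ] State n₁ n₂ × (Fin n₂ → ℝ) :=
    (S.paramTangent ν₀ p₀).comp (S.toParam ν₀ p₀)
  let p' : S.BParam ν₀ p₀ →L[ℝ] State n₁ n₂ :=
    (ContinuousLinearMap.snd ℝ _ _).comp (ContinuousLinearMap.fst ℝ _ _)
  ((fderiv ℝ S.Υ₁ (fstPart p₀)).comp ((fstPartL ℝ n₁ n₂).comp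
      ((ContinuousLinearMap.fst ℝ _ _).comp w')) -
    (fderiv ℝ S.Υ₁ (fstPart p₀)).comp ((fstPartL ℝ n₁ n₂).comp p')).prod
  (((fderiv ℝ S.Υ₂ (sndPart p₀)).comp ((sndPartL ℝ n₁ n₂).comp
      ((ContinuousLinearMap.fst ℝ _ _).comp w')) -
    (fderiv ℝ S.Υ₂ (sndPart p₀)).comp ((sndPartL ℝ n₁ n₂).comp p')).prod
  ((mulVecL S.K).comp ((ContinuousLinearMap.snd ℝ _ _).comp w')))

/-- Apart from the invertible map `e^{G}` of the stable space, due to the time shift, the dependence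
on `a` is that of `thirdColumn`. -/
theorem residualTangent_apply (ν : EuclideanSpace ℝ (Fin d)) (q : State n₁ n₂)
    (a : stableSubspace (S.G ν₀ p₀)) :
    S.residualTangent ν₀ p₀ ((ν, 0), q, a) =
      (jacobian S.Υ₁ (fstPart p₀) *ᵥ fstPart q +
          (jacobian S.Υ₁ (fstPart p₀) * (-((S.symA ν₀ p₀).toBlocks₁₁⁻¹ *
            (S.symA ν₀ p₀).toBlocks₁₂ * (S.G ν₀ p₀)⁻¹))) *ᵥ expFlow (mulVecL (S.G ν₀ p₀)) 1 a,
        jacobian S.Υ₂ (sndPart p₀) *ᵥ sndPart q +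
          (jacobian S.Υ₂ (sndPart p₀) * (S.G ν₀ p₀)⁻¹) *ᵥ expFlow (mulVecL (S.G ν₀ p₀)) 1 a,
        S.K *ᵥ expFlow (mulVecL (S.G ν₀ p₀)) 1 a) := by
  set y := expFlow (mulVecL (S.G ν₀ p₀)) 1 a with hy
  have h1 : fstPart (q + S.slopeMat ν₀ p₀ *ᵥ ((S.G ν₀ p₀)⁻¹ *ᵥ y)) =
      fstPart q + fstPart (S.slopeMat ν₀ p₀ *ᵥ ((S.G ν₀ p₀)⁻¹ *ᵥ y)) := rfl
  have h2 : sndPart (q + S.slopeMat ν₀ p₀ *ᵥ ((S.G ν₀ p₀)⁻¹ *ᵥ y)) =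
      sndPart q + sndPart (S.slopeMat ν₀ p₀ *ᵥ ((S.G ν₀ p₀)⁻¹ *ᵥ y)) := rfl
  have h3 : S.residualTangent ν₀ p₀ ((ν, 0), q, a) =
      (fderiv ℝ S.Υ₁ (fstPart p₀) (fstPart (q + S.slopeMat ν₀ p₀ *ᵥ ((S.G ν₀ p₀)⁻¹ *ᵥ y))),
        fderiv ℝ S.Υ₂ (sndPart p₀) (sndPart (q + S.slopeMat ν₀ p₀ *ᵥ ((S.G ν₀ p₀)⁻¹ *ᵥ y))),
        S.K *ᵥ y) := by
    have e1 : fstPart (0 : State n₁ n₂) = 0 := rfl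
    have e2 : sndPart (0 : State n₁ n₂) = 0 := rfl
    simp [residualTangent, paramTangent, ← hy, Matrix.mulVec_mulVec, e1, e2]
  rw [h3, h1, h2, fstPart_slopeMat_mulVec, sndPart_slopeMat_mulVec, map_add, map_add,
    ← jacobian_mulVec, ← jacobian_mulVec, ← jacobian_mulVec, ← jacobian_mulVec]
  simp [Matrix.mulVec_mulVec, Matrix.mul_assoc, Matrix.mulVec_neg, Matrix.neg_mulVec]

/-- The stable subspace is invariant under the flow. -/
theorem expFlow_mem_stableSubspace {n : Type*} [Fintype n] [DecidableEq n] {M : Matrix n n ℝ}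
    (h : ∀ μ ∈ spectrum ℂ (cplx M), μ.re ≠ 0) {a : n → ℝ} (ha : a ∈ stableSubspace M) (t : ℝ) :
    expFlow (mulVecL M) t a ∈ stableSubspace M := by
  obtain ⟨P, C, β, hP, hfix, hmem⟩ := exists_dichotomy_mulVecL h
  rw [← hfix a ha, ← hP.comm]
  exact hmem _

/-- As for transversality: condition (ii) reaches the Neumann row through `a`, and the endstate `q`
reaches the others. The flow is undone by `e^{-G}`, which preserves the stable space. -/
theorem residualTangent_surjective (hS : S.Hypotheses) (hb : S.IsHyperbolicPoint ν₀ p₀)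
    (hc : S.LayerCondition ν₀ p₀) (y : S.BValues) :
    ∃ q a, S.residualTangent ν₀ p₀ (0, q, a) = y := by
  have hpl := hb.mem_layerStates hS
  obtain ⟨a, ha, hKa⟩ := (finrank_map_K_iff _).mp hc.2 y.2.2
  set a' : stableSubspace (S.G ν₀ p₀) := ⟨_, expFlow_mem_stableSubspace hb.re_ne_zero ha (-1)⟩
  have ha' : expFlow (mulVecL (S.G ν₀ p₀)) 1 a' = a := expFlow_apply_neg _ _ _
  obtain ⟨q₁, hq₁⟩ := mulVec_surjective_of_rank (hS.rank_Υ₁ p₀ hpl) (y.1 -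
    (jacobian S.Υ₁ (fstPart p₀) * (-((S.symA ν₀ p₀).toBlocks₁₁⁻¹ *
            (S.symA ν₀ p₀).toBlocks₁₂ * (S.G ν₀ p₀)⁻¹))) *ᵥ a)
  obtain ⟨q₂, hq₂⟩ := mulVec_surjective_of_rank (hS.rank_Υ₂ p₀ hpl) (y.2.1 -
    (jacobian S.Υ₂ (sndPart p₀) * (S.G ν₀ p₀)⁻¹) *ᵥ a)
  refine ⟨Sum.elim q₁ q₂, a', ?_⟩
  simp only at hq₁ hq₂
  refine (residualTangent_apply 0 _ _).trans ?_
  rw [ha', fstPart_elim, sndPart_elim, hq₁, hq₂, sub_add_cancel, sub_add_cancel, hKa]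

/-- With `q` fixed, the derivative in `a` is `thirdColumn` on the stable space, so this is condition
(i). -/
theorem residualTangent_injective (hb : S.IsHyperbolicPoint ν₀ p₀)
    (hc : S.LayerCondition ν₀ p₀) (a : stableSubspace (S.G ν₀ p₀))
    (ha : S.residualTangent ν₀ p₀ (0, 0, a) = 0) : a = 0 := by
  have h := (residualTangent_apply 0 0 a).symm.trans ha
  have e1 : fstPart (0 : State n₁ n₂) = 0 := rfl
  have e2 : sndPart (0 : State n₁ n₂) = 0 := rfl
  rw [e1, e2, Matrix.mulVec_zero, Matrix.mulVec_zero, zero_add, zero_add, Prod.ext_iff,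
    Prod.ext_iff] at h
  obtain ⟨h1, h2, h3⟩ := h
  have h4 : expFlow (mulVecL (S.G ν₀ p₀)) 1 a = 0 := by
    refine hc.1 (expFlow_mem_stableSubspace hb.re_ne_zero a.2 1) (zero_mem _) ?_
    simp only at h1 h2 h3
    simp only [thirdColumn, Matrix.fromRows_mulVec, Matrix.mulVec_zero, h1, h2, h3]
    ext (i | i | i) <;> rfl
  have h5 := expFlow_neg_apply (mulVecL (S.G ν₀ p₀)) 1 (a : Fin n₂ → ℝ)
  rw [h4, map_zero] at h5
  exact Subtype.ext h5.symm

theorem finrank_endstates (hS : S.Hypotheses) (hb : S.IsHyperbolicPoint ν₀ p₀) :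
    Module.finrank ℝ (State n₁ n₂) + Module.finrank ℝ (stableSubspace (S.G ν₀ p₀)) =
      Module.finrank ℝ S.BValues + (n₁ + n₂ - S.Nplus) := by
  have h1 := hb.finrank_add
  -- With the dimension formula this gives `N₊ ≤ N`, so the natural number subtraction in the
  -- dimension of the manifold is not truncated.
  have h2 : S.N1plus ≤ n₁ := by
    have := Matrix.rank_le_width (jacobian S.Υ₁ (fstPart p₀))
    rwa [hS.rank_Υ₁ p₀ (hb.mem_layerStates hS)] at this
  have h3 := hS.N''_le
  simp only [Module.finrank_prod, Module.finrank_fintype_fun_eq_card, Fintype.card_sum,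
    Fintype.card_fin]
  omega

namespace IsLayerFamily

variable {O : Set (S.Param ν₀ p₀)} {w : ℝ → S.Param ν₀ p₀ → State n₁ n₂}
  {κ : S.Param ν₀ p₀ → Fin n₂ → ℝ} {δ : ℝ} {m : S.Param ν₀ p₀ → ℝ}

theorem bound_nonneg (h : S.IsLayerFamily ν₀ p₀ O w κ δ m) {o : S.Param ν₀ p₀} (ho : o ∈ O) :
    0 ≤ m o := by
  simpa using (add_nonneg (norm_nonneg _) (norm_nonneg _)).trans (h.decay o ho 0 le_rfl)

theorem amplitude (h : S.IsLayerFamily ν₀ p₀ O w κ δ m) {o : S.Param ν₀ p₀} (ho : o ∈ O) {z : ℝ}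
    (hz : 0 ≤ z) : ‖w z o - o.2.1‖ ≤ m o ∧ ‖sndPart (dz (fun z => w z o) z)‖ ≤ m o := by
  have h1 : Real.exp (-δ * z) ≤ 1 := Real.exp_le_one_iff.mpr (by nlinarith [h.pos])
  have h2 := (h.decay o ho z hz).trans (mul_le_of_le_one_right (h.bound_nonneg ho) h1)
  constructor <;> linarith [norm_nonneg (w z o - o.2.1),
    norm_nonneg (sndPart (dz (fun z => w z o) z))]

theorem apply_zero (h : S.IsLayerFamily ν₀ p₀ O w κ δ m) {ν : EuclideanSpace ℝ (Fin d)}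
    {q : State n₁ n₂} (ho : (ν, q, 0) ∈ O) : w 0 (ν, q, 0) = q ∧ κ (ν, q, 0) = 0 := by
  have h1 := h.amplitude ho le_rfl
  rw [h.bound_zero _ _ ho, h.slope _ ho] at h1
  exact ⟨sub_eq_zero.mp (norm_le_zero_iff.mp h1.1), norm_le_zero_iff.mp h1.2⟩

theorem satisfiesBC_iff (h : S.IsLayerFamily ν₀ p₀ O w κ δ m) {ν : EuclideanSpace ℝ (Fin d)}
    {p q : State n₁ n₂} {a : stableSubspace (S.G ν₀ p₀)} (ho : (ν, q, a) ∈ O) :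
    S.SatisfiesBC p (fun z => w z (ν, q, a)) ↔ S.residual (w 0) κ ((ν, p), q, a) = 0 := by
  simp only [SatisfiesBC, Υ, h.slope _ ho, residual, toParam_apply, Prod.ext_iff, Pi.zero_apply,
    Matrix.mulVec_zero, Finset.sum_const_zero, add_zero, Prod.fst_zero, Prod.snd_zero, sub_eq_zero]
  constructor
  · intro h1
    exact ⟨funext fun i => congrFun h1 (.inl i), funext fun i => congrFun h1 (.inr (.inl i)),
      funext fun i => congrFun h1 (.inr (.inr i))⟩
  · rintro ⟨h1, h2, h3⟩
    rw [h1, h2, h3]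

theorem residual_diag (h : S.IsLayerFamily ν₀ p₀ O w κ δ m) {ν : EuclideanSpace ℝ (Fin d)}
    {p : State n₁ n₂} (ho : (ν, p, 0) ∈ O) : S.residual (w 0) κ ((ν, p), p, 0) = 0 := by
  simp [residual, (h.apply_zero ho).1, (h.apply_zero ho).2]

theorem eventually_contDiffAt_residual (hS : S.Hypotheses) (hb : S.IsHyperbolicPoint ν₀ p₀)
    (h : S.IsLayerFamily ν₀ p₀ O w κ δ m) :
    ∀ᶠ x in 𝓝 ((ν₀, p₀), p₀, 0), ContDiffAt ℝ ∞ (S.residual (w 0) κ) x := by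
  have h1 : ∀ᶠ x in 𝓝 (((ν₀, p₀), p₀, 0) : S.BParam ν₀ p₀), S.toParam ν₀ p₀ x ∈ O :=
    (S.toParam ν₀ p₀).continuous.continuousAt.eventually_mem (h.isOpen.mem_nhds h.base_mem)
  have h2 : ∀ᶠ x in 𝓝 (((ν₀, p₀), p₀, 0) : S.BParam ν₀ p₀), x.1.2 ∈ S.layerStates :=
    (by fun_prop : Continuous fun x : S.BParam ν₀ p₀ => x.1.2).continuousAt.eventually_mem
      ((isOpen_layerStates hS).mem_nhds (hb.mem_layerStates hS))
  filter_upwards [h1, h2] with x hx hx2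
  have hw : ContDiffAt ℝ ∞ (fun x : S.BParam ν₀ p₀ => w 0 (S.toParam ν₀ p₀ x)) x := by
    have h3 : ContDiffOn ℝ ∞ (w 0) O := h.smooth.comp (f := fun o => ((0 : ℝ), o)) (by fun_prop)
      fun o ho => ⟨by norm_num, ho⟩
    exact (h3.contDiffAt (h.isOpen.mem_nhds hx)).comp x (S.toParam ν₀ p₀).contDiff.contDiffAt
  have hκ : ContDiffAt ℝ ∞ (fun x : S.BParam ν₀ p₀ => κ (S.toParam ν₀ p₀ x)) x :=
    (h.smooth_slope.contDiffAt (h.isOpen.mem_nhds hx)).comp x (S.toParam ν₀ p₀).contDiff.contDiffAt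
  have hp : ContDiffAt ℝ ∞ (fun x : S.BParam ν₀ p₀ => x.1.2) x := by fun_prop
  have hwl := bdryStates_subset_layerStates hS (h.values _ hx 0 le_rfl)
  exact (((contDiffAt_Υ₁ hS hwl).comp x ((fstPartL ℝ n₁ n₂).contDiff.contDiffAt.comp x hw)).sub
      ((contDiffAt_Υ₁ hS hx2).comp x ((fstPartL ℝ n₁ n₂).contDiff.contDiffAt.comp x hp))).prodMk
    ((((contDiffAt_Υ₂ hS hwl).comp x ((sndPartL ℝ n₁ n₂).contDiff.contDiffAt.comp x hw)).sub
      ((contDiffAt_Υ₂ hS hx2).comp x ((sndPartL ℝ n₁ n₂).contDiff.contDiffAt.comp x hp))).prodMk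
    ((mulVecL S.K).contDiff.contDiffAt.comp x hκ))

theorem hasFDerivAt_residual (hS : S.Hypotheses) (hb : S.IsHyperbolicPoint ν₀ p₀)
    (h : S.IsLayerFamily ν₀ p₀ O w κ δ m) :
    HasFDerivAt (S.residual (w 0) κ) (S.residualTangent ν₀ p₀) ((ν₀, p₀), p₀, 0) := by
  have h0 := (h.apply_zero h.base_mem).1
  have h1 : HasFDerivAt (fun x : S.BParam ν₀ p₀ =>
      (w 0 (S.toParam ν₀ p₀ x), κ (S.toParam ν₀ p₀ x)))
      ((S.paramTangent ν₀ p₀).comp (S.toParam ν₀ p₀)) ((ν₀, p₀), p₀, 0) :=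
    h.hasFDerivAt.comp (((ν₀, p₀), p₀, 0) : S.BParam ν₀ p₀) (S.toParam ν₀ p₀).hasFDerivAt
  have hp : HasFDerivAt (fun x : S.BParam ν₀ p₀ => x.1.2)
      ((ContinuousLinearMap.snd ℝ _ _).comp (ContinuousLinearMap.fst ℝ _ _)) ((ν₀, p₀), p₀, 0) :=
    hasFDerivAt_fst.snd
  have hpl := hb.mem_layerStates hS
  have hΥ₁ := ((contDiffAt_Υ₁ hS hpl).differentiableAt (by simp)).hasFDerivAt
  have hΥ₂ := ((contDiffAt_Υ₂ hS hpl).differentiableAt (by simp)).hasFDerivAt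
  have hf1 := (fstPartL ℝ n₁ n₂).hasFDerivAt.comp _ h1.fst
  have hf2 := (sndPartL ℝ n₁ n₂).hasFDerivAt.comp _ h1.fst
  refine HasFDerivAt.prodMk (HasFDerivAt.sub ?_ ?_) (HasFDerivAt.prodMk (HasFDerivAt.sub ?_ ?_) ?_)
  · refine HasFDerivAt.comp (g := S.Υ₁) _ ?_ hf1
    change HasFDerivAt S.Υ₁ _ (fstPart (w 0 (ν₀, p₀, 0)))
    rw [h0]
    exact hΥ₁
  · exact HasFDerivAt.comp (g := S.Υ₁) (((ν₀, p₀), p₀, 0) : S.BParam ν₀ p₀) hΥ₁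
      ((fstPartL ℝ n₁ n₂).hasFDerivAt.comp _ hp)
  · refine HasFDerivAt.comp (g := S.Υ₂) _ ?_ hf2
    change HasFDerivAt S.Υ₂ _ (sndPart (w 0 (ν₀, p₀, 0)))
    rw [h0]
    exact hΥ₂
  · exact HasFDerivAt.comp (g := S.Υ₂) (((ν₀, p₀), p₀, 0) : S.BParam ν₀ p₀) hΥ₂
      ((sndPartL ℝ n₁ n₂).hasFDerivAt.comp _ hp)
  · exact (mulVecL S.K).hasFDerivAt.comp _ h1.snd

end IsLayerFamily

end System

end

section

/-! ### Charts of endstate manifolds -/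

/-- `q ↦ L (q - q₀)` is a left inverse of the parametrization. Its derivative shows that the
parametrization is immersive, and its continuity that it is an embedding. -/
theorem isSmoothFamily_of_retraction {P F : Type*} [NormedAddCommGroup P] [NormedSpace ℝ P]
    [NormedAddCommGroup F] [NormedSpace ℝ F] {m : ℕ} {U Om : Set P} {V : Set (Fin m → ℝ)}
    {Q : P → (Fin m → ℝ) → F} {L : F →L[ℝ] (Fin m → ℝ)} {q₀ : F} (hU : IsOpen U) (hV : IsOpen V)
    (hOm : Om ⊆ U) (hQ : ContDiffOn ℝ ∞ (fun x : P × (Fin m → ℝ) => Q x.1 x.2) (U ×ˢ V))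
    (hL : ∀ b ∈ Om, ∀ y ∈ V, L (Q b y - q₀) = y) :
    IsSmoothFamily m Om fun b => Q b '' V := by
  have hsub : Om ×ˢ V ⊆ U ×ˢ V := prod_mono_left hOm
  refine ⟨V, Q, hV, hQ.mono hsub, fun b hb y hy => ?_, ?_, fun _ _ => rfl⟩
  · have h1 : ContDiffAt ℝ ∞ (Q b) y :=
      (hQ.contDiffAt ((hU.prod hV).mem_nhds (mk_mem_prod (hOm hb) hy))).comp y
        (f := fun y => (b, y)) (by fun_prop)
    have h2 := (h1.differentiableAt (by simp)).hasFDerivAt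
    have h3 : HasFDerivAt (fun y => L (Q b y - q₀)) (L.comp (fderiv ℝ (Q b) y)) y :=
      L.hasFDerivAt.comp y (h2.sub_const q₀)
    have h4 : HasFDerivAt (fun y => L (Q b y - q₀)) (ContinuousLinearMap.id ℝ _) y :=
      (hasFDerivAt_id y).congr_of_eventuallyEq
        (Filter.eventuallyEq_of_mem (hV.mem_nhds hy) fun y' hy' => hL b hb y' hy')
    have h5 := h3.unique h4
    refine Function.LeftInverse.injective (g := L) fun v => ?_
    exact DFunLike.congr_fun h5 v
  · have hc : Continuous ((Om ×ˢ V).domRestrict fun x : P × (Fin m → ℝ) => (x.1, Q x.1 x.2)) :=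
      (continuousOn_fst.prodMk (hQ.continuousOn.mono hsub)).domRestrict
    refine IsEmbedding.of_comp hc (g := fun x : P × F => (x.1, L (x.2 - q₀))) (by fun_prop) ?_
    convert! IsEmbedding.subtypeVal (p := (· ∈ Om ×ˢ V)) using 1
    ext1 x
    exact Prod.ext rfl (hL _ x.2.1 _ x.2.2)

/-- A chart with uniform control of the profiles: `r` bounds the amplitude of its profiles and is a
scale on which they are unique, `ε` is a scale on which the chart contains all profiles. -/
structure IsControlledChart {d n₁ n₂ : ℕ} (S : System d n₁ n₂)
    (b₀ : EuclideanSpace ℝ (Fin d) × State n₁ n₂)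
    (Om : Set (EuclideanSpace ℝ (Fin d) × State n₁ n₂))
    (C : EuclideanSpace ℝ (Fin d) × State n₁ n₂ → Set (State n₁ n₂))
    (w : EuclideanSpace ℝ (Fin d) × State n₁ n₂ → ℝ → State n₁ n₂ → State n₁ n₂)
    (ε r : ℝ) : Prop where
  chart : IsEndstateChart S b₀ Om C w
  pos : 0 < ε
  near : ∀ b ∈ Om, ‖b.2 - b₀.2‖ < ε
  unique_of_small : ∀ b ∈ Om, ∀ (q : State n₁ n₂) (v : ℝ → State n₁ n₂),
    S.IsProfile b.1 q v → S.SatisfiesBC b.2 v → ‖q - b₀.2‖ < ε →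
    (∀ z, 0 ≤ z → ‖v z - q‖ < ε ∧ ‖sndPart (System.dz v z)‖ < ε) →
    q ∈ C b ∧ ∀ z, 0 ≤ z → v z = w b z q
  amplitude : ∀ b ∈ Om, ∀ q ∈ C b, ∀ z, 0 ≤ z →
    ‖w b z q - q‖ < r ∧ ‖sndPart (System.dz (fun s => w b s q) z)‖ < r
  unique_of_mem : ∀ b ∈ Om, ∀ q ∈ C b, ∀ v : ℝ → State n₁ n₂,
    S.IsProfile b.1 q v → S.SatisfiesBC b.2 v →
    (∀ z, 0 ≤ z → ‖v z - q‖ < r ∧ ‖sndPart (System.dz v z)‖ < r) →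
    ∀ z, 0 ≤ z → v z = w b z q
  small : ∀ b ∈ Om, ∀ η > 0, ∀ᶠ q in 𝓝 b.2, q ∈ C b → ∀ z, 0 ≤ z →
    ‖w b z q - q‖ < η ∧ ‖sndPart (System.dz (fun s => w b s q) z)‖ < η

namespace IsControlledChart

variable {d n₁ n₂ : ℕ} {S : System d n₁ n₂}
  {b b₁ b₂ : EuclideanSpace ℝ (Fin d) × State n₁ n₂}
  {Om₁ Om₂ : Set (EuclideanSpace ℝ (Fin d) × State n₁ n₂)}
  {C₁ C₂ : EuclideanSpace ℝ (Fin d) × State n₁ n₂ → Set (State n₁ n₂)}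
  {w₁ w₂ : EuclideanSpace ℝ (Fin d) × State n₁ n₂ → ℝ → State n₁ n₂ → State n₁ n₂}
  {ε₁ r₁ ε₂ r₂ : ℝ}

/-- Near `p` the profiles of the first chart are as small as desired, hence within the scale `ε₂` on
which the second chart contains all profiles. -/
theorem eventually_mem_of_mem (h₁ : IsControlledChart S b₁ Om₁ C₁ w₁ ε₁ r₁)
    (h₂ : IsControlledChart S b₂ Om₂ C₂ w₂ ε₂ r₂) (hb₁ : b ∈ Om₁) (hb₂ : b ∈ Om₂) :
    ∀ᶠ q in 𝓝 b.2, q ∈ C₁ b → q ∈ C₂ b := by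
  have hn : ∀ᶠ q in 𝓝 b.2, ‖q - b₂.2‖ < ε₂ :=
    ContinuousAt.eventually_lt (by fun_prop) continuousAt_const (h₂.near b hb₂)
  filter_upwards [h₁.small b hb₁ ε₂ h₂.pos, hn] with q hq hqn hqC
  exact (h₂.unique_of_small b hb₂ q _ (h₁.chart.profile b hb₁ q hqC) (h₁.chart.bc b hb₁ q hqC) hqn
    (hq hqC)).1

theorem exists_nhds_inter_eq (h₁ : IsControlledChart S b₁ Om₁ C₁ w₁ ε₁ r₁)
    (h₂ : IsControlledChart S b₂ Om₂ C₂ w₂ ε₂ r₂) (hb₁ : b ∈ Om₁) (hb₂ : b ∈ Om₂) :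
    ∃ U ∈ 𝓝 b.2, C₁ b ∩ U = C₂ b ∩ U :=
  ⟨_, (h₁.eventually_mem_of_mem h₂ hb₁ hb₂).and (h₂.eventually_mem_of_mem h₁ hb₂ hb₁), by
    ext q
    exact ⟨fun h => ⟨h.2.1 h.1, h.2⟩, fun h => ⟨h.2.2 h.1, h.2⟩⟩⟩

/-- A profile of the chart with the smaller amplitude bound is within the uniqueness scale of the
other chart. No closeness of `q` to `p` is needed. -/
theorem eq_of_le (h₁ : IsControlledChart S b₁ Om₁ C₁ w₁ ε₁ r₁)
    (h₂ : IsControlledChart S b₂ Om₂ C₂ w₂ ε₂ r₂) (hb₁ : b ∈ Om₁) (hb₂ : b ∈ Om₂) (hr : r₁ ≤ r₂)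
    {q : State n₁ n₂} (hq₁ : q ∈ C₁ b) (hq₂ : q ∈ C₂ b) {z : ℝ} (hz : 0 ≤ z) :
    w₁ b z q = w₂ b z q :=
  h₂.unique_of_mem b hb₂ q hq₂ _ (h₁.chart.profile b hb₁ q hq₁) (h₁.chart.bc b hb₁ q hq₁)
    (fun z hz => ⟨(h₁.amplitude b hb₁ q hq₁ z hz).1.trans_le hr,
      (h₁.amplitude b hb₁ q hq₁ z hz).2.trans_le hr⟩) z hz

theorem profile_eq (h₁ : IsControlledChart S b₁ Om₁ C₁ w₁ ε₁ r₁)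
    (h₂ : IsControlledChart S b₂ Om₂ C₂ w₂ ε₂ r₂) (hb₁ : b ∈ Om₁) (hb₂ : b ∈ Om₂)
    {q : State n₁ n₂} (hq₁ : q ∈ C₁ b) (hq₂ : q ∈ C₂ b) {z : ℝ} (hz : 0 ≤ z) :
    w₁ b z q = w₂ b z q := by
  rcases le_total r₁ r₂ with hr | hr
  · exact h₁.eq_of_le h₂ hb₁ hb₂ hr hq₁ hq₂ hz
  · exact (h₂.eq_of_le h₁ hb₂ hb₁ hr hq₂ hq₁ hz).symm

end IsControlledChart

namespace System

variable {d n₁ n₂ : ℕ} {S : System d n₁ n₂} {ν₀ : EuclideanSpace ℝ (Fin d)} {p₀ : State n₁ n₂}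

theorem exists_prod_nhds {N : Set (S.BParam ν₀ p₀)} (hN : N ∈ 𝓝 (((ν₀, p₀), p₀, 0) : S.BParam ν₀ p₀)) :
    ∃ N₁ ∈ 𝓝 ((ν₀, p₀, 0) : S.Param ν₀ p₀), ∃ N₂ ∈ 𝓝 p₀, ∀ o ∈ N₁, ∀ p ∈ N₂,
      ((o.1, p), o.2) ∈ N := by
  have hc : Continuous fun x : S.Param ν₀ p₀ × State n₁ n₂ => (((x.1.1, x.2), x.1.2) : S.BParam ν₀ p₀) := by
    fun_prop
  have h1 := (hc.tendsto ((ν₀, p₀, 0), p₀)) hN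
  obtain ⟨N₁, hN₁, N₂, hN₂, h⟩ := mem_nhds_prod_iff.mp h1
  exact ⟨N₁, hN₁, N₂, hN₂, fun o ho p hp => h (mk_mem_prod ho hp)⟩

/-- Near a base point satisfying the layer condition there is a chart. -/
theorem IsHyperbolicPoint.exists_controlledChart (hS : S.Hypotheses)
    (hb : S.IsHyperbolicPoint ν₀ p₀) (hc : S.LayerCondition ν₀ p₀) :
    ∃ Om C w ε r, IsControlledChart S (ν₀, p₀) Om C w ε r := by
  obtain ⟨O, w, κ, δ, m, h⟩ := hb.exists_layerFamily hS
  obtain ⟨L, ⟨N₀, hN₀, hinj⟩, himp⟩ := exists_implicit_family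
    (h.eventually_contDiffAt_residual hS hb) (h.hasFDerivAt_residual hS hb)
    (h.residual_diag h.base_mem) (residualTangent_surjective hS hb hc)
    (residualTangent_injective hb hc) (finrank_endstates hS hb)
  obtain ⟨N₁, hN₁, N₂, hN₂, hN₁₂⟩ := exists_prod_nhds hN₀
  -- Profiles below the scale `r` have parameters in `N₁`, where the boundary conditions determine
  -- `a` from the endstate.
  obtain ⟨r, hr, hur⟩ := h.unique N₁ hN₁
  have hT : Continuous (S.toParam ν₀ p₀) := (S.toParam ν₀ p₀).continuous
  have hO : O ∈ 𝓝 ((ν₀, p₀, 0) : S.Param ν₀ p₀) := h.isOpen.mem_nhds h.base_mem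
  have hsmall : ∀ η > 0, ∀ᶠ o in 𝓝 ((ν₀, p₀, 0) : S.Param ν₀ p₀), m o < η := fun η hη =>
    (h.continuousOn_bound.continuousAt hO).eventually_lt continuousAt_const
      (by rwa [h.bound_zero _ _ h.base_mem])
  -- The chart is cut down after `r` is chosen, so that all its amplitudes are below `r`; the bound
  -- `1` makes the constant in the decay estimate uniform.
  have hNev : ∀ᶠ x in 𝓝 (((ν₀, p₀), p₀, 0) : S.BParam ν₀ p₀),
      (S.toParam ν₀ p₀ x ∈ O ∧ m (S.toParam ν₀ p₀ x) < min r 1) ∧ x ∈ N₀ ∧ ‖x.2.1 - p₀‖ < r := by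
    refine ((hT.tendsto ((ν₀, p₀), p₀, 0)).eventually
      (Filter.Eventually.and hO (hsmall (min r 1) (by positivity)))).and
      (Filter.Eventually.and hN₀ ?_)
    exact ContinuousAt.eventually_lt (by fun_prop) continuousAt_const (by simpa using hr)
  obtain ⟨U, V, Q, α, hUo, hbU, hVo, hQ, hα, hsol, huniq⟩ := himp _ hNev
  -- On `N₃` every solution of the boundary conditions lies on the chart, and `ε` is the scale below
  -- which profiles have parameters in `N₃`.
  obtain ⟨N₃, hN₃, N₄, hN₄, hN₃₄⟩ := exists_prod_nhds huniq
  obtain ⟨ε, hε, huε⟩ := h.unique N₃ hN₃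
  -- the domain of the chart
  have hOm : ∀ᶠ b in 𝓝 (ν₀, p₀), (b ∈ U ∧ ‖b.1 - ν₀‖ < min r ε ∧ ‖b.2 - p₀‖ < ε) ∧
      (b.2 ∈ N₂ ∧ b.2 ∈ N₄ ∧ b.2 ∈ S.bdryStates) ∧ (b.1, b.2, 0) ∈ N₃ ∩ O := by
    have hfst : Tendsto Prod.fst (𝓝 (ν₀, p₀)) (𝓝 ν₀) := continuous_fst.tendsto (ν₀, p₀)
    have hsnd : Tendsto Prod.snd (𝓝 (ν₀, p₀)) (𝓝 p₀) := continuous_snd.tendsto (ν₀, p₀)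
    have hdiag : Tendsto (fun b : EuclideanSpace ℝ (Fin d) × State n₁ n₂ =>
        ((b.1, b.2, 0) : S.Param ν₀ p₀)) (𝓝 (ν₀, p₀)) (𝓝 (ν₀, p₀, 0)) :=
      (by fun_prop : Continuous fun b : EuclideanSpace ℝ (Fin d) × State n₁ n₂ =>
        ((b.1, b.2, 0) : S.Param ν₀ p₀)).tendsto (ν₀, p₀)
    refine ((hUo.eventually_mem hbU).and (Filter.Eventually.and ?_ ?_)).and
      (((hsnd.eventually_mem hN₂).and ((hsnd.eventually_mem hN₄).and
      (hsnd.eventually_mem ((isOpen_bdryStates hS).mem_nhds hb.regular.1)))).and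
      (hdiag.eventually_mem (inter_mem hN₃ hO)))
    · exact ContinuousAt.eventually_lt (by fun_prop) continuousAt_const (by simp [hr, hε])
    · exact ContinuousAt.eventually_lt (by fun_prop) continuousAt_const (by simpa using hε)
  obtain ⟨U', hU', hU'o, hbU'⟩ := eventually_nhds_iff.mp hOm
  set Om : Set (EuclideanSpace ℝ (Fin d) × State n₁ n₂) := U' ∩ (Metric.sphere 0 1 ×ˢ univ) with hOmdef
  set C : EuclideanSpace ℝ (Fin d) × State n₁ n₂ → Set (State n₁ n₂) := fun b => Q b '' V with hCdef
  set par : EuclideanSpace ℝ (Fin d) × State n₁ n₂ → State n₁ n₂ → S.Param ν₀ p₀ :=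
    fun b q => (b.1, q, α b (L (q - p₀))) with hpar
  have hOmU : Om ⊆ U := fun b hb => (hU' b hb.1).1.1
  have hC : ∀ b ∈ Om, ∀ q ∈ C b, (par b q ∈ O ∧ m (par b q) < min r 1) ∧
      (b, (par b q).2) ∈ N₀ ∧ ‖q - p₀‖ < r ∧ S.residual (w 0) κ (b, (par b q).2) = 0 ∧
      L (q - p₀) ∈ V := by
    rintro b hb _ ⟨y, hy, rfl⟩
    obtain ⟨⟨h1, h2, h3⟩, h4, h5⟩ := hsol b (hOmU hb) y hy
    simp only [hpar, h5]
    exact ⟨h1, h2, h3, h4, hy⟩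
  -- The constant layer, with parameters `q = p` and `a = 0`, satisfies the boundary conditions;
  -- hence `p` is an endstate of the chart and `α` vanishes there.
  have hp : ∀ b ∈ Om, L (b.2 - p₀) ∈ V ∧ b.2 = Q b (L (b.2 - p₀)) ∧ 0 = α b (L (b.2 - p₀)) := by
    intro b hb
    obtain ⟨-, ⟨-, h4, -⟩, h5⟩ := hU' b hb.1
    exact hN₃₄ (b.1, b.2, 0) h5.1 b.2 h4 (h.residual_diag h5.2)
  have hunique : ∀ b ∈ Om, ∀ (q : State n₁ n₂) (v : ℝ → State n₁ n₂),
      S.IsProfile b.1 q v → S.SatisfiesBC b.2 v → ‖q - p₀‖ < ε →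
      (∀ z, 0 ≤ z → ‖v z - q‖ < ε ∧ ‖sndPart (dz v z)‖ < ε) →
      q ∈ C b ∧ ∀ z, 0 ≤ z → v z = w z (par b q) := by
    intro b hb q v hv hbc hq hvs
    obtain ⟨⟨-, h1, -⟩, ⟨-, h2, -⟩, -⟩ := hU' b hb.1
    obtain ⟨a, haN, haO, hva⟩ := huε b.1 q v (h1.trans_le (min_le_right _ _)) hq hv hvs
    have hbc' : S.SatisfiesBC b.2 (fun z => w z (b.1, q, a)) := by
      rw [SatisfiesBC, ← hva 0 le_rfl]
      have : dz (fun z => w z (b.1, q, a)) 0 = dz v 0 :=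
        derivWithin_congr (fun z hz => (hva z hz).symm) (hva 0 le_rfl).symm
      rw [this]
      exact hbc
    obtain ⟨h3, h4, h5⟩ := hN₃₄ _ haN b.2 h2 ((h.satisfiesBC_iff haO).mp hbc')
    have h5 : a = α b (L (q - p₀)) := h5
    refine ⟨⟨_, h3, h4.symm⟩, fun z hz => ?_⟩
    rw [hva z hz, h5]
  refine ⟨Om, C, fun b z q => w z (par b q), ε, r, ?_, hε, fun b hb => (hU' b hb.1).1.2.2, hunique,
    fun b hb q hq z hz => ?_, fun b hb q hq v hv hbc hvs => ?_, fun b hb η hη => ?_⟩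
  · refine ⟨⟨hbU', by simp [hb.norm_eq], trivial⟩, fun b hb => ⟨hb.2.1, (hU' b hb.1).2.1.2.2⟩,
      ⟨U', hU'o, rfl⟩, isSmoothFamily_of_retraction hUo hVo hOmU hQ
        fun b hb y hy => (hsol b (hOmU hb) y hy).2.2,
      fun b hb => ⟨_, (hp b hb).1, (hp b hb).2.1.symm⟩, ?_,
      fun b hb q hq => h.values _ (hC b hb q hq).1.1, fun b hb q hq => h.profile _ (hC b hb q hq).1.1,
      fun b hb q hq => (h.satisfiesBC_iff (hC b hb q hq).1.1).mpr (hC b hb q hq).2.2.2.1,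
      ⟨1, δ, h.pos, fun b hb q hq z hz => ?_⟩, ⟨ε, hε, hunique⟩⟩
    · have hαs : ContDiffOn ℝ ∞
          (fun x : ℝ × (EuclideanSpace ℝ (Fin d) × State n₁ n₂) × State n₁ n₂ =>
            α x.2.1 (L (x.2.2 - p₀))) {x | 0 ≤ x.1 ∧ x.2.1 ∈ Om ∧ x.2.2 ∈ C x.2.1} :=
        hα.comp (f := fun x : ℝ × (EuclideanSpace ℝ (Fin d) × State n₁ n₂) × State n₁ n₂ =>
          (x.2.1, L (x.2.2 - p₀))) (by fun_prop)
          fun x hx => ⟨hOmU hx.2.1, (hC _ hx.2.1 _ hx.2.2).2.2.2.2⟩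
      exact h.smooth.comp
        (f := fun x : ℝ × (EuclideanSpace ℝ (Fin d) × State n₁ n₂) × State n₁ n₂ =>
          (x.1, par x.2.1 x.2.2))
        (contDiff_fst.contDiffOn.prodMk
          (ContDiffOn.prodMk (by fun_prop) (ContDiffOn.prodMk (by fun_prop) hαs)))
        fun x hx => ⟨lt_of_lt_of_le (by norm_num : (-1 : ℝ) < 0) hx.1,
          (hC _ hx.2.1 _ hx.2.2).1.1⟩
    · refine (h.decay _ (hC b hb q hq).1.1 z hz).trans ?_
      have := ((hC b hb q hq).1.2.trans_le (min_le_right _ _)).le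
      gcongr
  · have h1 := h.amplitude (hC b hb q hq).1.1 hz
    have h2 := (hC b hb q hq).1.2.trans_le (min_le_left _ _)
    exact ⟨h1.1.trans_lt h2, h1.2.trans_lt h2⟩
  · obtain ⟨⟨-, h1, -⟩, ⟨h2, -, -⟩, -⟩ := hU' b hb.1
    obtain ⟨⟨h3, -⟩, h4, h5, h6, -⟩ := hC b hb q hq
    obtain ⟨a, haN, haO, hva⟩ := hur b.1 q v (h1.trans_le (min_le_left _ _)) h5 hv hvs
    have hbc' : S.SatisfiesBC b.2 (fun z => w z (b.1, q, a)) := by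
      rw [SatisfiesBC, ← hva 0 le_rfl]
      have : dz (fun z => w z (b.1, q, a)) 0 = dz v 0 :=
        derivWithin_congr (fun z hz => (hva z hz).symm) (hva 0 le_rfl).symm
      rw [this]
      exact hbc
    -- The parameter of `v` and that of the chart profile over the same `q` both lie in the region
    -- of injectivity.
    have ha := hinj b q a _ (hN₁₂ _ haN b.2 h2) h4 ((h.satisfiesBC_iff haO).mp hbc') h6
    intro z hz
    rw [hva z hz, ha]
  · obtain ⟨h1, h2, h3⟩ := hp b hb
    have hO' := (hU' b hb.1).2.2.2
    have hparb : par b b.2 = (b.1, b.2, 0) := by rw [hpar, h3]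
    have hcα : ContinuousAt (fun q => α b (L (q - p₀))) b.2 :=
      (hα.continuousOn.continuousAt ((hUo.prod hVo).mem_nhds (mk_mem_prod (hOmU hb) h1))).comp
        (f := fun q => (b, L (q - p₀))) (by fun_prop)
    have hcp : ContinuousAt (par b) b.2 := continuousAt_const.prodMk (continuousAt_id.prodMk hcα)
    have hcm : ContinuousAt (fun q => m (par b q)) b.2 := by
      refine ContinuousAt.comp (g := m) ?_ hcp
      rw [hparb]
      exact h.continuousOn_bound.continuousAt (h.isOpen.mem_nhds hO')
    -- The amplitude bound vanishes at `q = p`, where the profile is constant, and it is continuous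
    -- in `q`.
    have hm0 : m (par b b.2) < η := by rwa [hparb, h.bound_zero _ _ hO']
    filter_upwards [hcm.eventually_lt continuousAt_const hm0] with q hq hqC z hz
    have h4 := h.amplitude (hC b hb q hqC).1.1 hz
    exact ⟨h4.1.trans_lt hq, h4.2.trans_lt hq⟩

end System

end

end BoundaryLayer

end

theorem mainTheorem8 {d n₁ n₂ : ℕ} (S : BoundaryLayer.System d n₁ n₂) (hS : S.Hypotheses)
    (p : ℝ → EuclideanSpace ℝ (Fin d) → BoundaryLayer.State n₁ n₂)
    (hp_cont : ContinuousOn (fun x : ℝ × EuclideanSpace ℝ (Fin d) => p x.1 x.2)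
      (Set.Icc (-S.T) S.T ×ˢ frontier S.Ω))
    (hp_mem : ∀ t ∈ Set.Icc (-S.T) S.T, ∀ x ∈ frontier S.Ω, p t x ∈ S.O t x) :
    (∀ b ∈ S.basePoints p,
      (S.IsTransversal b.1 (fun _ => b.2) ↔ S.LayerCondition b.1 b.2)) ∧
    ∃ (Om : EuclideanSpace ℝ (Fin d) × BoundaryLayer.State n₁ n₂ →
          Set (EuclideanSpace ℝ (Fin d) × BoundaryLayer.State n₁ n₂))
      (C : EuclideanSpace ℝ (Fin d) × BoundaryLayer.State n₁ n₂ →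
          EuclideanSpace ℝ (Fin d) × BoundaryLayer.State n₁ n₂ →
          Set (BoundaryLayer.State n₁ n₂))
      (w : EuclideanSpace ℝ (Fin d) × BoundaryLayer.State n₁ n₂ →
          EuclideanSpace ℝ (Fin d) × BoundaryLayer.State n₁ n₂ →
          ℝ → BoundaryLayer.State n₁ n₂ → BoundaryLayer.State n₁ n₂),
      (∀ b₀ ∈ S.basePoints p, S.LayerCondition b₀.1 b₀.2 →
        BoundaryLayer.IsEndstateChart S b₀ (Om b₀) (C b₀) (w b₀)) ∧
      (∀ b₁ ∈ S.basePoints p, ∀ b₂ ∈ S.basePoints p,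
        S.LayerCondition b₁.1 b₁.2 → S.LayerCondition b₂.1 b₂.2 →
        ∀ b ∈ Om b₁ ∩ Om b₂,
          (∃ U ∈ 𝓝 b.2, C b₁ b ∩ U = C b₂ b ∩ U) ∧
          ∀ q ∈ C b₁ b ∩ C b₂ b, ∀ z, 0 ≤ z → w b₁ b z q = w b₂ b z q) := by
  have hb : ∀ b ∈ S.basePoints p, S.IsHyperbolicPoint b.1 b.2 := by
    rintro _ ⟨t, ht, x, hx, rfl⟩
    exact BoundaryLayer.System.isHyperbolicPoint hS ht hx (hp_mem t ht x hx)
  refine ⟨fun b h => BoundaryLayer.System.isTransversal_const_iff_layerCondition hS (hb b h), ?_⟩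
  have hex : ∀ b₀, ∃ Om C w ε r, b₀ ∈ S.basePoints p → S.LayerCondition b₀.1 b₀.2 →
      BoundaryLayer.IsControlledChart S b₀ Om C w ε r := by
    intro b₀
    by_cases h : b₀ ∈ S.basePoints p ∧ S.LayerCondition b₀.1 b₀.2
    · obtain ⟨Om, C, w, ε, r, hc⟩ := (hb b₀ h.1).exists_controlledChart hS h.2
      exact ⟨Om, C, w, ε, r, fun _ _ => hc⟩
    -- Irrelevant values where the conditions fail, so that the charts can be chosen as functions of
    -- an arbitrary `b₀`.
    · exact ⟨∅, fun _ => ∅, fun _ _ => id, 0, 0, fun h₁ h₂ => absurd ⟨h₁, h₂⟩ h⟩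
  choose Om C w ε r hc using hex
  refine ⟨Om, C, w, fun b₀ h₀ hL => (hc b₀ h₀ hL).chart, fun b₁ h₁ b₂ h₂ hL₁ hL₂ b hb => ⟨?_, ?_⟩⟩
  · exact (hc b₁ h₁ hL₁).exists_nhds_inter_eq (hc b₂ h₂ hL₂) hb.1 hb.2
  · exact fun q hq z hz => (hc b₁ h₁ hL₁).profile_eq (hc b₂ h₂ hL₂) hb.1 hb.2 hq.1 hq.2 hz
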